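/- A *signed tree model* of a finite simple graph $G$ is a triple $(T,A,B)$ where $T$ is a rooted full binary tree whose leaves are the vertices of $G$, and $A$ (transversal anti-edges) and $B$ (transversal edges) are disjoint sets of transversal pairs, i.e. unordered pairs of nodes of $T$ neither of which is an ancestor of the other, such that no two pairs of $A\cup B$ cross (one end of the first is a strict ancestor of an end of the second, and vice versa). Two vertices $u,v$ are adjacent in $G$ iff there is $u'v'\in B$ with $u'$ an ancestor of $u$ and $v'$ an ancestor of $v$ such that no other pair $u''v''\in A\cup B$ satisfies that $u''$ lies on the path of $T$ from $u'$ to $u$ and $v''$ on the path from $v'$ to $v$. The model is *positive* if $A=\varnothing$. An *interval biclique partition* of $G$ is a linear order on $V(G)$ with a partition of $E(G)$ into bicliques whose two sides are disjoint intervals of the order. A *DAG compression* of $G$ is a directed acyclic graph $D$ whose sinks are exactly the vertices of $G$, together with a set $F$ of unordered pairs $xy$ of (possibly equal) nodes of $D$, such that $uv\in E(G)$ iff there are $xy\in F$ and directed paths $x\to u$, $y\to v$ in $D$; its size is $|V(D)|+|E(D)|+|F|$. **Theorem.** On a word RAM with words of $\Theta(\log n)$ bits there are algorithms which, given a signed tree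 model with $p=|A|+|B|$ transversal pairs of an $n$-vertex graph $G$ (the tree as a parent array, the leaf of each vertex, and the lists of pairs of $A$ and of $B$), compute respectively 1. in time $O(n+p\log n)$, an interval biclique partition of $G$ with $O(p)$ bicliques; 2. in time $O(n+p\log n)$, a DAG compression of $G$ of size $O(n+p\log n)$; 3. in time $O(n+p\log n+p\log^2 n)$, a positive tree model of $G$ with $O(p\log^2 n)$ transversal edges. The constants are absolute; in particular, the bounds of items 1 and 2 are $O(p\log n)$ as soon as $p\log n\ge n$. -/

import Mathlib

namespace TreeModels

/-! ### A word RAM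

A machine has registers and arrays of words, all indexed by natural numbers. A program is a fixed
finite command, so it names finitely many registers and arrays; array cells are addressed by
computed words. Words have `w` bits, arithmetic is modulo `2 ^ w`, and every elementary
operation (constant, register access, array access, arithmetic operation, comparison, branch,
assignment) costs one step. -/

/-- The contents of all registers and of all arrays. -/
structure State where
  reg : ℕ → ℕ
  arr : ℕ → ℕ → ℕ

/-- Binary operations on words. -/
inductive Op where
  | add | sub | mul | div | mod | lt | eq

/-- The value of an operation before reduction to word length. Subtraction is truncated at `0`;
comparisons return `1` (true) or `0` (false). -/
def Op.apply : Op → ℕ → ℕ → ℕ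
  | .add, a, b => a + b
  | .sub, a, b => a - b
  | .mul, a, b => a * b
  | .div, a, b => a / b
  | .mod, a, b => a % b
  | .lt, a, b => if a < b then 1 else 0
  | .eq, a, b => if a = b then 1 else 0

inductive Expr where
  | const (k : ℕ)
  | reg (i : ℕ)
  | arr (k : ℕ) (idx : Expr)
  | op (o : Op) (a b : Expr)

/-- The value of an expression in a state, for word length `w`. -/
def Expr.eval (w : ℕ) (s : State) : Expr → ℕ
  | .const k => k % 2 ^ w
  | .reg i => s.reg i
  | .arr k idx => s.arr k (idx.eval w s)
  | .op o a b => o.apply (a.eval w s) (b.eval w s) % 2 ^ w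

/-- The number of steps needed to evaluate an expression. -/
def Expr.cost : Expr → ℕ
  | .const _ => 1
  | .reg _ => 1
  | .arr _ idx => idx.cost + 1
  | .op _ a b => a.cost + b.cost + 1

inductive Prog where
  | skip
  | assign (i : ℕ) (e : Expr)
  | store (k : ℕ) (idx e : Expr)
  | seq (P Q : Prog)
  | ite (e : Expr) (P Q : Prog)
  | loop (e : Expr) (P : Prog)

/-- Write the word `x` to register `i`. -/
def State.setReg (s : State) (i x : ℕ) : State where
  reg := Function.update s.reg i x
  arr := s.arr

/-- Write the word `x` to cell `j` of array `k`. -/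
def State.setArr (s : State) (k j x : ℕ) : State where
  reg := s.reg
  arr := Function.update s.arr k (Function.update (s.arr k) j x)

/-- `Exec w P s s' t`: started in state `s`, with word length `w`, the program `P` halts in state
`s'` after exactly `t` steps. A condition holds if its value is nonzero; `loop e P` repeats `P`
while `e` holds. -/
inductive Exec (w : ℕ) : Prog → State → State → ℕ → Prop where
  | skip (s : State) : Exec w .skip s s 1
  | assign (s : State) (i : ℕ) (e : Expr) :
      Exec w (.assign i e) s (s.setReg i (e.eval w s)) (e.cost + 1)
  | store (s : State) (k : ℕ) (idx e : Expr) :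
      Exec w (.store k idx e) s (s.setArr k (idx.eval w s) (e.eval w s)) (idx.cost + e.cost + 1)
  | seq {P Q : Prog} {s₁ s₂ s₃ : State} {t₁ t₂ : ℕ} :
      Exec w P s₁ s₂ t₁ → Exec w Q s₂ s₃ t₂ → Exec w (.seq P Q) s₁ s₃ (t₁ + t₂)
  | ite_true {e : Expr} {P Q : Prog} {s s' : State} {t : ℕ} :
      e.eval w s ≠ 0 → Exec w P s s' t → Exec w (.ite e P Q) s s' (e.cost + 1 + t)
  | ite_false {e : Expr} {P Q : Prog} {s s' : State} {t : ℕ} :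
      e.eval w s = 0 → Exec w Q s s' t → Exec w (.ite e P Q) s s' (e.cost + 1 + t)
  | loop_false {e : Expr} {P : Prog} {s : State} :
      e.eval w s = 0 → Exec w (.loop e P) s s (e.cost + 1)
  | loop_true {e : Expr} {P : Prog} {s₁ s₂ s₃ : State} {t₁ t₂ : ℕ} :
      e.eval w s₁ ≠ 0 → Exec w P s₁ s₂ t₁ → Exec w (.loop e P) s₂ s₃ t₂ →
      Exec w (.loop e P) s₁ s₃ (e.cost + 1 + t₁ + t₂)

/-- The initial state on input `X`, a finite list of lists of words: array `k` holds the `k`-th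
list, register `k` holds its length, everything else is zero. -/
def State.init (X : List (List ℕ)) : State where
  reg k := (X.getD k []).length
  arr k j := (X.getD k []).getD j 0

/-- The state contains the lists `Y` as output: array `k` starts with the `k`-th list and register
`k` holds its length. -/
def State.Holds (s : State) (Y : List (List ℕ)) : Prop :=
  ∀ (k : ℕ) (hk : k < Y.length), s.reg k = Y[k].length ∧
    ∀ (j : ℕ) (hj : j < Y[k].length), s.arr k j = Y[k][j]

/-- On input `X`, with word length `w`, the program `P` halts after exactly `t` steps with
output `Y`. -/
def Prog.Outputs (P : Prog) (w : ℕ) (X Y : List (List ℕ)) (t : ℕ) : Prop :=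
  ∃ s : State, Exec w P (State.init X) s t ∧ s.Holds Y

/-! ### Lists of edges -/

/-- `L` lists each element of the set `E` of unordered pairs exactly once, each of them in one of
its two orientations. -/
def ListsPairs {α : Type*} (L : List (α × α)) (E : Finset (Sym2 α)) : Prop :=
  (L.map fun q => s(q.1, q.2)).Nodup ∧ ∀ e, e ∈ L.map (fun q => s(q.1, q.2)) ↔ e ∈ E

/-- The first coordinates of a list of pairs of indices, as words. -/
def fsts {k : ℕ} (L : List (Fin k × Fin k)) : List ℕ := L.map fun q => (q.1 : ℕ)

/-- The second coordinates of a list of pairs of indices, as words. -/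
def snds {k : ℕ} (L : List (Fin k × Fin k)) : List ℕ := L.map fun q => (q.2 : ℕ)

/-! ### Rooted trees -/

/-- A rooted tree on the node set `N`, given by parent pointers; the root points to itself. -/
structure ParentTree (N : Type*) where
  root : N
  parent : N → N
  parent_root : parent root = root
  reach : ∀ v, ∃ k, parent^[k] v = root

namespace ParentTree

variable {N : Type*} (T : ParentTree N)

/-- `u` is an ancestor of `v` (possibly `v` itself). -/
def Anc (u v : N) : Prop := ∃ k, T.parent^[k] v = u

/-- `u` is a strict ancestor of `v`. -/
def SAnc (u v : N) : Prop := T.Anc u v ∧ u ≠ v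

def children (u : N) : Set N := {v | v ≠ T.root ∧ T.parent v = u}

def IsLeaf (u : N) : Prop := T.children u = ∅

/-- Every node that is not a leaf has exactly two children. -/
def IsFullBinary : Prop := ∀ u, T.IsLeaf u ∨ ∃ a b, a ≠ b ∧ T.children u = {a, b}

/-- An unordered pair of nodes neither of which is an ancestor of the other. -/
def IsTransversal (e : Sym2 N) : Prop := ∃ u v, e = s(u, v) ∧ ¬ T.Anc u v ∧ ¬ T.Anc v u

/-- One node of `e` is a strict ancestor of one node of `f`, and vice versa. -/
def Cross (e f : Sym2 N) : Prop :=
  (∃ a ∈ e, ∃ b ∈ f, T.SAnc a b) ∧ (∃ b ∈ f, ∃ a ∈ e, T.SAnc b a)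

theorem anc_total {u v x : N} (hu : T.Anc u x) (hv : T.Anc v x) : T.Anc u v ∨ T.Anc v u := by
  obtain ⟨i, rfl⟩ := hu
  obtain ⟨j, rfl⟩ := hv
  rcases le_total i j with h | h
  · right
    exact ⟨j - i, by rw [← Function.iterate_add_apply, Nat.sub_add_cancel h]⟩
  · left
    exact ⟨i - j, by rw [← Function.iterate_add_apply, Nat.sub_add_cancel h]⟩

end ParentTree

/-! ### Signed tree models -/

/-- A signed tree model with vertex set `V` (the leaves of the tree) and node set `N`. -/
structure SignedTreeModel (V N : Type*) where
  tree : ParentTree N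
  full : tree.IsFullBinary
  /-- The vertices are identified with the leaves. -/
  leaf : V → N
  leaf_injective : Function.Injective leaf
  range_leaf : Set.range leaf = {x | tree.IsLeaf x}
  /-- The transversal anti-edges. -/
  neg : Finset (Sym2 N)
  /-- The transversal edges. -/
  pos : Finset (Sym2 N)
  disj : Disjoint neg pos
  transversal : ∀ e, e ∈ neg ∨ e ∈ pos → tree.IsTransversal e
  noncrossing : ∀ e f, e ∈ neg ∨ e ∈ pos → f ∈ neg ∨ f ∈ pos → ¬ tree.Cross e f

namespace SignedTreeModel

variable {V N : Type*} (M : SignedTreeModel V N)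

/-- The number of transversal pairs. -/
def numPairs : ℕ := M.neg.card + M.pos.card

/-- The pair `e` lies above `u, v`, and no other transversal pair of the model lies in between. -/
def Covers (e : Sym2 N) (u v : N) : Prop :=
  ∃ u' v', e = s(u', v') ∧ M.tree.Anc u' u ∧ M.tree.Anc v' v ∧
    ¬ ∃ u'' v'', (s(u'', v'') ∈ M.neg ∨ s(u'', v'') ∈ M.pos) ∧ s(u'', v'') ≠ e ∧
      M.tree.Anc u' u'' ∧ M.tree.Anc u'' u ∧ M.tree.Anc v' v'' ∧ M.tree.Anc v'' v

/-- The graph of a signed tree model: two vertices are adjacent iff they are covered by a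
transversal edge. -/
def graph : SimpleGraph V where
  Adj u v := ∃ e ∈ M.pos, M.Covers e (M.leaf u) (M.leaf v)
  symm := ⟨by
    rintro u v ⟨e, he, u', v', rfl, hu, hv, h⟩
    refine ⟨_, he, v', u', Sym2.eq_swap, hv, hu, ?_⟩
    rintro ⟨a, b, hab, hne, h1, h2, h3, h4⟩
    exact h ⟨b, a, by rwa [Sym2.eq_swap], by rwa [Sym2.eq_swap], h3, h4, h1, h2⟩⟩
  loopless := ⟨by
    rintro u ⟨e, he, u', v', rfl, hu, hv, -⟩
    obtain ⟨a, b, hab, h1, h2⟩ := M.transversal _ (Or.inr he)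
    rcases Sym2.eq_iff.1 hab with ⟨rfl, rfl⟩ | ⟨rfl, rfl⟩ <;>
      rcases M.tree.anc_total hu hv with h | h <;> contradiction⟩

/-- A positive tree model has no transversal anti-edges. -/
def IsPositive : Prop := M.neg = ∅

/-- `X` represents the model: the parent array, the array giving the leaf of each vertex, and the
lists of anti-edges and of edges (each as two arrays of endpoints). The numbering of the nodes and
of the vertices and the order of the lists are arbitrary. -/
def IsCode {n m : ℕ} (M : SignedTreeModel (Fin n) (Fin m)) (X : List (List ℕ)) : Prop :=
  ∃ LA LB : List (Fin m × Fin m), ListsPairs LA M.neg ∧ ListsPairs LB M.pos ∧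
    X = [List.ofFn fun v => (M.tree.parent v : ℕ), List.ofFn fun i => (M.leaf i : ℕ),
      fsts LA, snds LA, fsts LB, snds LB]

end SignedTreeModel

/-! ### Interval biclique partitions -/

/-- The tuple `(a, b, c, d)` standing for the biclique with sides `[a, b]` and `[c, d]`. -/
structure Biclique (n : ℕ) where
  (a b c d : Fin n)

/-- The edges of the biclique, where `ord i` is the `i`-th vertex in the linear order. -/
def Biclique.edges {V : Type*} {n : ℕ} (ord : Fin n ≃ V) (q : Biclique n) : Set (Sym2 V) :=
  {e | ∃ i ∈ Set.Icc q.a q.b, ∃ j ∈ Set.Icc q.c q.d, e = s(ord i, ord j)}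

/-- A linear order on the vertices of `G`, and a partition of the edges of `G` into bicliques whose
sides are disjoint nonempty intervals of the order. -/
structure IntervalBicliquePartition {V : Type*} {n : ℕ} (G : SimpleGraph V) where
  /-- The vertices in increasing order. -/
  ord : Fin n ≃ V
  bicliques : List (Biclique n)
  nonempty : ∀ q ∈ bicliques, q.a ≤ q.b ∧ q.c ≤ q.d
  disj : ∀ q ∈ bicliques, Disjoint (Set.Icc q.a q.b) (Set.Icc q.c q.d)
  edge_disj : bicliques.Pairwise fun q r => Disjoint (q.edges ord) (r.edges ord)
  edge_cover : {e | ∃ q ∈ bicliques, e ∈ q.edges ord} = G.edgeSet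

/-- `Y` represents the partition: the vertices in increasing order, and the list of the tuples of
the bicliques as four arrays. -/
def IntervalBicliquePartition.IsCode {n : ℕ} {G : SimpleGraph (Fin n)}
    (I : IntervalBicliquePartition (n := n) G) (Y : List (List ℕ)) : Prop :=
  Y = [List.ofFn fun i => (I.ord i : ℕ), I.bicliques.map fun q => (q.a : ℕ),
    I.bicliques.map fun q => (q.b : ℕ), I.bicliques.map fun q => (q.c : ℕ),
    I.bicliques.map fun q => (q.d : ℕ)]

/-! ### DAG compressions -/

/-- A DAG compression of `G` whose directed acyclic graph has node set `Q`. -/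
structure DAGCompression {V : Type*} (G : SimpleGraph V) (Q : Type*) where
  /-- The arcs of the digraph. -/
  arcs : Finset (Q × Q)
  acyclic : ∀ x, ¬ Relation.TransGen (fun x y => (x, y) ∈ arcs) x x
  /-- The vertices of `G` are identified with the sinks. -/
  sink : V → Q
  sink_injective : Function.Injective sink
  range_sink : Set.range sink = {x | ∀ y, (x, y) ∉ arcs}
  /-- The compressed edges. -/
  edges : Finset (Sym2 Q)
  adj_iff : ∀ u v, G.Adj u v ↔ ∃ x y, s(x, y) ∈ edges ∧
    Relation.ReflTransGen (fun x y => (x, y) ∈ arcs) x (sink u) ∧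
    Relation.ReflTransGen (fun x y => (x, y) ∈ arcs) y (sink v)

namespace DAGCompression

/-- The number of nodes, arcs and compressed edges. -/
def size {V : Type*} {G : SimpleGraph V} {k : ℕ} (D : DAGCompression G (Fin k)) : ℕ :=
  k + D.arcs.card + D.edges.card

/-- `Y` represents the compression: the number of nodes, the sink of each vertex, the list of arcs
and the list of compressed edges (each as two arrays of endpoints). -/
def IsCode {n k : ℕ} {G : SimpleGraph (Fin n)} (D : DAGCompression G (Fin k))
    (Y : List (List ℕ)) : Prop :=
  ∃ LE LB : List (Fin k × Fin k), (LE.Nodup ∧ ∀ a, a ∈ LE ↔ a ∈ D.arcs) ∧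
    ListsPairs LB D.edges ∧
    Y = [[k], List.ofFn fun i => (D.sink i : ℕ), fsts LE, snds LE, fsts LB, snds LB]

end DAGCompression

end TreeModels

/-! Number the leaves of the tree from left to right, so that nodes become intervals of positions,
and two nodes are comparable exactly if their intervals are nested. A transversal pair becomes a
rectangle above the diagonal, with the interval of its left node as the x-side. Noncrossing says
that two rectangles which meet are nested (`pairRects_laminar`), and for x < y the vertices at
positions x and y are adjacent iff the smallest rectangle containing (x, y) comes from a transversal
edge (`pairRects_positive`).

An interval biclique partition is therefore a partition of the positive points above the diagonal
into rectangles (`exists_partition`). It is found by a sweep over the columns x. The rectangles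
meeting the current column form a stack, because their x-sides are laminar, and they divide the
y-axis into coloured segments. Inserting a rectangle cuts one segment into at most three; removing
it glues these pieces together again. A segment is written, over all columns since it was last
brought up to date, only when it is cut or glued: at most once per insertion and at most three times
per removal, which gives at most 4p bicliques. The invariant is `RectFamily.Sweep`, preserved by
`advance`, `flush`, `push` and `pop`, and evaluated by `Sweep.final`. Sorting the rectangles and
finding the segment to cut both use maximum trees, at logarithmic cost per operation; log p = O(log
n) because p ≤ 4n².

For the other two items, take the complete binary tree on the n positions. Each side of a biclique
is the disjoint union of the leaf sets of O(log n) nodes (`IsDecomposition`, `decompose_runs`). In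
the DAG compression every biclique gets two new nodes with arcs to the tree nodes of its sides, and
one compressed edge between them (`exists_dagCompression`). In the positive model the tree is the
complete binary tree, and every biclique contributes all pairs of nodes from its two decompositions,
O(log² n) many. Since the bicliques partition the edges, each edge of the graph lies below exactly
one such pair; hence the pairs do not cross and none is overruled by another (`Decomposed.unique`,
`exists_positiveTreeModel`).

Programs are verified by a Hoare logic for total correctness with step bounds (`Runs`).
Straight-line code is evaluated in exact arithmetic under the proviso that nothing overflows, and
`word_bound` provides the room for this. -/

namespace TreeModels

/-! ### Exact semantics of expressions and straight-line programs -/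

instance : Add Expr := ⟨.op .add⟩
instance : Sub Expr := ⟨.op .sub⟩
instance : Mul Expr := ⟨.op .mul⟩
instance : Div Expr := ⟨.op .div⟩
instance : Mod Expr := ⟨.op .mod⟩
instance (k : ℕ) : OfNat Expr k := ⟨.const k⟩

namespace Expr

/-- The value of an expression without reduction to word length. -/
def val (s : State) : Expr → ℕ
  | .const k => k
  | .reg i => s.reg i
  | .arr k idx => s.arr k (idx.val s)
  | .op o a b => o.apply (a.val s) (b.val s)

/-- No reduction to word length happens during the evaluation. -/
def Safe (W : ℕ) (s : State) : Expr → Prop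
  | .const k => k < W
  | .reg _ => True
  | .arr _ idx => idx.Safe W s
  | .op o a b => a.Safe W s ∧ b.Safe W s ∧ o.apply (a.val s) (b.val s) < W

theorem eval_eq {w : ℕ} {s : State} : ∀ {e : Expr}, e.Safe (2 ^ w) s → e.eval w s = e.val s
  | .const _, h => Nat.mod_eq_of_lt h
  | .reg _, _ => rfl
  | .arr k idx, h => by
    have h' : idx.Safe (2 ^ w) s := h
    simp only [eval, val, eval_eq h']
  | .op o a b, h => by
    obtain ⟨ha, hb, hab⟩ := h
    simp only [eval, val, eval_eq ha, eval_eq hb, Nat.mod_eq_of_lt hab]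

/-- The comparison `a < b`. -/
def lt (a b : Expr) : Expr := .op .lt a b

/-- The comparison `a = b`. -/
def eq (a b : Expr) : Expr := .op .eq a b

section simps
variable (s : State) (W : ℕ) (a b : Expr) (i k : ℕ)

theorem val_add : (a + b).val s = a.val s + b.val s := id rfl
theorem val_sub : (a - b).val s = a.val s - b.val s := id rfl
theorem val_mul : (a * b).val s = a.val s * b.val s := id rfl
theorem val_div : (a / b).val s = a.val s / b.val s := id rfl
theorem val_mod : (a % b).val s = a.val s % b.val s := id rfl
theorem val_lt : (lt a b).val s = if a.val s < b.val s then 1 else 0 := id rfl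
theorem val_eq : (eq a b).val s = if a.val s = b.val s then 1 else 0 := id rfl
theorem val_lit : (ofNat(k) : Expr).val s = OfNat.ofNat k := id rfl
theorem val_reg : (Expr.reg i).val s = s.reg i := id rfl
theorem val_arr : (Expr.arr k a).val s = s.arr k (a.val s) := id rfl
theorem safe_add : (a + b).Safe W s ↔ a.Safe W s ∧ b.Safe W s ∧ a.val s + b.val s < W := Iff.rfl
theorem safe_sub : (a - b).Safe W s ↔ a.Safe W s ∧ b.Safe W s ∧ a.val s - b.val s < W := Iff.rfl
theorem safe_mul : (a * b).Safe W s ↔ a.Safe W s ∧ b.Safe W s ∧ a.val s * b.val s < W := Iff.rfl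
theorem safe_div : (a / b).Safe W s ↔ a.Safe W s ∧ b.Safe W s ∧ a.val s / b.val s < W := Iff.rfl
theorem safe_mod : (a % b).Safe W s ↔ a.Safe W s ∧ b.Safe W s ∧ a.val s % b.val s < W := Iff.rfl
theorem safe_lt (hW : 1 < W) : (lt a b).Safe W s ↔ a.Safe W s ∧ b.Safe W s := by
  have : (if a.val s < b.val s then 1 else 0) < W := by split_ifs <;> omega
  exact ⟨fun h => ⟨h.1, h.2.1⟩, fun h => ⟨h.1, h.2, this⟩⟩
theorem safe_eq (hW : 1 < W) : (eq a b).Safe W s ↔ a.Safe W s ∧ b.Safe W s := by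
  have : (if a.val s = b.val s then 1 else 0) < W := by split_ifs <;> omega
  exact ⟨fun h => ⟨h.1, h.2.1⟩, fun h => ⟨h.1, h.2, this⟩⟩
theorem safe_lit : (ofNat(k) : Expr).Safe W s ↔ OfNat.ofNat k < W := Iff.rfl
theorem safe_reg : (Expr.reg i).Safe W s ↔ True := Iff.rfl
theorem safe_arr : (Expr.arr k a).Safe W s ↔ a.Safe W s := Iff.rfl

end simps

end Expr

section
variable (s : State) (i j x : ℕ)

@[simp] theorem State.setReg_reg : (s.setReg i x).reg = Function.update s.reg i x := id rfl

@[simp] theorem State.setReg_arr : (s.setReg i x).arr = s.arr := id rfl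

@[simp] theorem State.setArr_reg : (s.setArr i j x).reg = s.reg := id rfl

@[simp] theorem State.setArr_arr :
    (s.setArr i j x).arr = Function.update s.arr i (Function.update (s.arr i) j x) := id rfl

end

/-- Sequential composition of a list of programs. -/
def blk : List Prog → Prog
  | [] => .skip
  | [P] => P
  | P :: Q :: L => .seq P (blk (Q :: L))

namespace Prog

/-- The final state of a loop-free program, without reduction to word length. -/
def sl : Prog → State → State
  | .skip, s => s
  | .assign i e, s => s.setReg i (e.val s)
  | .store k idx e, s => s.setArr k (idx.val s) (e.val s)
  | .seq P Q, s => Q.sl (P.sl s)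
  | .ite e P Q, s => if e.val s = 0 then Q.sl s else P.sl s
  | .loop _ _, s => s

/-- The program is loop-free and no reduction to word length happens. -/
def Safe (W : ℕ) : Prog → State → Prop
  | .skip, _ => True
  | .assign _ e, s => e.Safe W s
  | .store _ idx e, s => idx.Safe W s ∧ e.Safe W s
  | .seq P Q, s => P.Safe W s ∧ Q.Safe W (P.sl s)
  | .ite e P Q, s => e.Safe W s ∧ (e.val s ≠ 0 → P.Safe W s) ∧ (e.val s = 0 → Q.Safe W s)
  | .loop _ _, _ => False

/-- An upper bound for the cost of a loop-free program. -/
def cost : Prog → ℕ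
  | .skip => 1
  | .assign _ e => e.cost + 1
  | .store _ idx e => idx.cost + e.cost + 1
  | .seq P Q => P.cost + Q.cost
  | .ite e P Q => e.cost + 1 + (P.cost + Q.cost)
  | .loop _ _ => 0

/-- The program contains an assignment to register `i`. -/
def writesReg : Prog → ℕ → Bool
  | .skip, _ => false
  | .assign j _, i => j == i
  | .store _ _ _, _ => false
  | .seq P Q, i => P.writesReg i || Q.writesReg i
  | .ite _ P Q, i => P.writesReg i || Q.writesReg i
  | .loop _ P, i => P.writesReg i

/-- The program contains a store to array `k`. -/
def writesArr : Prog → ℕ → Bool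
  | .skip, _ => false
  | .assign _ _, _ => false
  | .store j _ _, k => j == k
  | .seq P Q, k => P.writesArr k || Q.writesArr k
  | .ite _ P Q, k => P.writesArr k || Q.writesArr k
  | .loop _ P, k => P.writesArr k

end Prog

/-- The states agree on all registers and arrays that the program does not write. -/
structure Frame (P : Prog) (s s' : State) : Prop where
  reg : ∀ i, P.writesReg i = false → s'.reg i = s.reg i
  arr : ∀ k, P.writesArr k = false → s'.arr k = s.arr k

theorem Frame.refl (P : Prog) (s : State) : Frame P s s := ⟨fun _ _ => rfl, fun _ _ => rfl⟩

theorem Frame.trans {P : Prog} {s₁ s₂ s₃ : State} (h : Frame P s₁ s₂) (h' : Frame P s₂ s₃) :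
    Frame P s₁ s₃ :=
  ⟨fun i hi => (h'.reg i hi).trans (h.reg i hi), fun k hk => (h'.arr k hk).trans (h.arr k hk)⟩

/-- `writesReg` and `writesArr` are Boolean functions of the program text, so `rfl` proves that a
cell is not written. The rules for `Runs` pass this frame on, and specifications need to mention
only what changes. -/
theorem Exec.frame {w : ℕ} {P : Prog} {s s' : State} {t : ℕ} (h : Exec w P s s' t) :
    Frame P s s' := by
  induction h with
  | skip s => exact .refl _ _
  | assign s i e =>
    refine ⟨fun j hj => ?_, fun _ _ => rfl⟩
    have : j ≠ i := by rintro rfl; simp [Prog.writesReg] at hj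
    simp [State.setReg, this]
  | store s k idx e =>
    refine ⟨fun _ _ => rfl, fun j hj => ?_⟩
    have : j ≠ k := by rintro rfl; simp [Prog.writesArr] at hj
    simp [State.setArr, this]
  | seq _ _ h1 h2 =>
    constructor <;> intro j hj <;> simp [Prog.writesReg, Prog.writesArr] at hj
    · rw [h2.reg j hj.2, h1.reg j hj.1]
    · rw [h2.arr j hj.2, h1.arr j hj.1]
  | ite_true _ _ h =>
    constructor <;> intro j hj <;> simp [Prog.writesReg, Prog.writesArr] at hj
    · exact h.reg j hj.1
    · exact h.arr j hj.1
  | ite_false _ _ h =>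
    constructor <;> intro j hj <;> simp [Prog.writesReg, Prog.writesArr] at hj
    · exact h.reg j hj.2
    · exact h.arr j hj.2
  | loop_false _ => exact .refl _ _
  | loop_true _ _ _ h1 h2 => exact Frame.trans ⟨h1.reg, h1.arr⟩ h2

/-! ### Total correctness with time bounds -/

/-- Started in `s`, the program halts after at most `T` steps in a state satisfying `Q`. -/
def Runs (w : ℕ) (P : Prog) (s : State) (T : ℕ) (Q : State → Prop) : Prop :=
  ∃ s' t, Exec w P s s' t ∧ t ≤ T ∧ Q s'

namespace Runs

variable {w : ℕ} {P P' : Prog} {s : State} {T T' T'' : ℕ} {Q Q' : State → Prop}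

theorem mono (h : Runs w P s T Q) (hT : T ≤ T') (hQ : ∀ s', Frame P s s' → Q s' → Q' s') :
    Runs w P s T' Q' := by
  obtain ⟨s', t, h1, h2, h3⟩ := h
  exact ⟨s', t, h1, h2.trans hT, hQ _ h1.frame h3⟩

theorem exact_sl : ∀ {P : Prog} {s : State}, P.Safe (2 ^ w) s →
    ∃ t, Exec w P s (P.sl s) t ∧ t ≤ P.cost
  | .skip, s, _ => ⟨_, .skip s, le_rfl⟩
  | .assign i e, s, h => by
    have := Exec.assign (w := w) s i e
    rw [Expr.eval_eq h] at this
    exact ⟨_, this, le_rfl⟩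
  | .store k idx e, s, h => by
    have := Exec.store (w := w) s k idx e
    rw [Expr.eval_eq h.1, Expr.eval_eq h.2] at this
    exact ⟨_, this, le_rfl⟩
  | .seq P Q, s, h => by
    obtain ⟨t1, h1, h1'⟩ := exact_sl h.1
    obtain ⟨t2, h2, h2'⟩ := exact_sl h.2
    exact ⟨_, .seq h1 h2, by simp only [Prog.cost]; omega⟩
  | .ite e P Q, s, h => by
    by_cases he : e.val s = 0
    · obtain ⟨t, ht, ht'⟩ := exact_sl (h.2.2 he)
      refine ⟨_, .ite_false (by rwa [Expr.eval_eq h.1]) (s' := (Prog.ite e P Q).sl s) (t := t) ?_,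
        by simp only [Prog.cost]; omega⟩
      simpa only [Prog.sl, if_pos he] using ht
    · obtain ⟨t, ht, ht'⟩ := exact_sl (h.2.1 he)
      refine ⟨_, .ite_true (by rwa [Expr.eval_eq h.1]) (s' := (Prog.ite e P Q).sl s) (t := t) ?_,
        by simp only [Prog.cost]; omega⟩
      simpa only [Prog.sl, if_neg he] using ht

/-- Loop-free code needs no intermediate assertions: the postcondition is checked on the symbolic
result `Prog.sl`. The time bound is a Boolean comparison, so that numerical bounds hold by `rfl`. -/
theorem straight (h : P.Safe (2 ^ w) s ∧ Q (P.sl s)) (hT : P.cost.ble T = true) :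
    Runs w P s T Q := by
  obtain ⟨t, ht, ht'⟩ := exact_sl h.1
  exact ⟨_, t, ht, ht'.trans (Nat.le_of_ble_eq_true hT), h.2⟩

theorem seq {R : State → Prop} (h1 : Runs w P s T R)
    (h2 : ∀ s', Frame P s s' → R s' → Runs w P' s' T' Q) (hT : T + T' ≤ T'') :
    Runs w (.seq P P') s T'' Q := by
  obtain ⟨s', t, e1, ht, hR⟩ := h1
  obtain ⟨s'', t', e2, ht', hQ⟩ := h2 s' e1.frame hR
  exact ⟨s'', _, .seq e1 e2, by omega, hQ⟩

theorem ite {e : Expr} (he : e.Safe (2 ^ w) s) (h1 : e.val s ≠ 0 → Runs w P s T Q)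
    (h2 : e.val s = 0 → Runs w P' s T Q) (hT : e.cost + 1 + T ≤ T') :
    Runs w (.ite e P P') s T' Q := by
  by_cases h : e.val s = 0
  · obtain ⟨s', t, e1, ht, hQ⟩ := h2 h
    exact ⟨s', _, .ite_false (by rwa [Expr.eval_eq he]) e1, by omega, hQ⟩
  · obtain ⟨s', t, e1, ht, hQ⟩ := h1 h
    exact ⟨s', _, .ite_true (by rwa [Expr.eval_eq he]) e1, by omega, hQ⟩

/-- The rule for loops: `I k` is the invariant if at most `k` iterations remain. -/
theorem loop {e : Expr} (I : ℕ → State → Prop) (c N : ℕ) (s : State) (hI : I N s)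
    (hsafe : ∀ k s', Frame P s s' → I k s' → e.Safe (2 ^ w) s')
    (hstep : ∀ k s', Frame P s s' → I k s' → e.val s' ≠ 0 →
      ∃ k', k = k' + 1 ∧ Runs w P s' c (I k'))
    (hT : N * (c + e.cost + 1) + e.cost + 1 ≤ T)
    (hQ : ∀ k s', Frame P s s' → I k s' → e.val s' = 0 → Q s') :
    Runs w (.loop e P) s T Q := by
  have key : ∀ N s', Frame P s s' → I N s' → ∃ s'' t, Exec w (.loop e P) s' s'' t ∧
      t ≤ N * (c + e.cost + 1) + e.cost + 1 ∧ Q s'' := by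
    intro N
    induction N with
    | zero =>
      intro s' hf hI
      -- With no iterations left the guard is false, because `hstep` would write 0 as a successor.
      have h0 : e.val s' = 0 := by
        by_contra h
        obtain ⟨k', hk, -⟩ := hstep _ _ hf hI h
        omega
      exact ⟨s', _, .loop_false (by rwa [Expr.eval_eq (hsafe _ _ hf hI)]), by omega,
        hQ _ _ hf hI h0⟩
    | succ N ih =>
      intro s' hf hI
      by_cases h0 : e.val s' = 0
      · exact ⟨s', _, .loop_false (by rwa [Expr.eval_eq (hsafe _ _ hf hI)]), by
          have := Nat.zero_le ((N + 1) * (c + e.cost + 1)); omega, hQ _ _ hf hI h0⟩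
      · obtain ⟨k', hk, s1, t1, e1, ht1, hI1⟩ := hstep _ _ hf hI h0
        obtain rfl : k' = N := by omega
        obtain ⟨s2, t2, e2, ht2, hQ2⟩ := ih s1 (hf.trans e1.frame) hI1
        refine ⟨s2, _, .loop_true (by rwa [Expr.eval_eq (hsafe _ _ hf hI)]) e1 e2, ?_, hQ2⟩
        have : (k' + 1) * (c + e.cost + 1) = k' * (c + e.cost + 1) + (c + e.cost + 1) := by ring
        omega
  obtain ⟨s'', t, h1, h2, h3⟩ := key N s (.refl _ _) hI
  exact ⟨s'', t, h1, h2.trans hT, h3⟩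

/-- The rule for loops of the form `for i = a, …, b - 1`: `I i` is the invariant at the start of
iteration `i`. -/
theorem forLoop {e : Expr} (I : ℕ → State → Prop) (c a b : ℕ) (s : State) (hab : a ≤ b)
    (hI : I a s)
    (he : ∀ i s', Frame P s s' → I i s' → e.Safe (2 ^ w) s' ∧ (e.val s' ≠ 0 ↔ i < b))
    (hstep : ∀ i s', a ≤ i → i < b → Frame P s s' → I i s' → Runs w P s' c (I (i + 1)))
    (hT : (b - a) * (c + e.cost + 1) + e.cost + 1 ≤ T)
    (hQ : ∀ s', Frame P s s' → I b s' → Q s') :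
    Runs w (.loop e P) s T Q := by
  -- The counter `k` is the number of remaining iterations, so the loop variable is `b - k`.
  refine loop (fun k s' => k ≤ b - a ∧ I (b - k) s') c (b - a) s
    ⟨le_rfl, by rwa [Nat.sub_sub_self hab]⟩
    (fun k s' hf hI => (he _ _ hf hI.2).1) ?_ hT ?_
  · rintro k s' hf ⟨hk, hI⟩ hne
    have hlt := (he _ _ hf hI).2.1 hne
    obtain ⟨k', rfl⟩ : ∃ k', k = k' + 1 := ⟨k - 1, by omega⟩
    refine ⟨k', rfl, (hstep _ _ (by omega) hlt hf hI).mono le_rfl fun s'' _ h => ⟨by omega, ?_⟩⟩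
    rwa [show b - k' = b - (k' + 1) + 1 by omega]
  · rintro k s' hf ⟨hk, hI⟩ h0
    have : ¬ (b - k < b) := fun h => (he _ _ hf hI).2.2 h h0
    have hk0 : b - k = b := by omega
    exact hQ _ hf (by rwa [hk0] at hI)

end Runs

attribute [simp] Expr.val_add Expr.val_sub Expr.val_mul Expr.val_div Expr.val_mod Expr.val_lt
  Expr.val_eq Expr.val_lit Expr.val_reg Expr.val_arr Expr.safe_add Expr.safe_sub Expr.safe_mul
  Expr.safe_div Expr.safe_mod Expr.safe_lt Expr.safe_eq Expr.safe_lit Expr.safe_reg Expr.safe_arr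
  Prog.sl Prog.Safe blk

notation "ℛ" => Expr.reg
notation "𝒜" => Expr.arr

/-- The array `f` starts with the list `L`. -/
def Stores (f : ℕ → ℕ) (L : List ℕ) : Prop := ∀ j x, L[j]? = some x → f j = x

theorem Stores.nil (f : ℕ → ℕ) : Stores f [] := fun j x h => by simp at h

theorem Stores.append {f : ℕ → ℕ} {L : List ℕ} (h : Stores f L) (x : ℕ) :
    Stores (Function.update f L.length x) (L ++ [x]) := by
  intro j y hj
  rcases lt_trichotomy j L.length with h' | rfl | h'
  · rw [Function.update_of_ne h'.ne]
    rw [List.getElem?_append_left h'] at hj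
    exact h _ _ hj
  · simpa using hj
  · rw [List.getElem?_eq_none (by simp; omega)] at hj
    cases hj

theorem Stores.get {f : ℕ → ℕ} {L : List ℕ} (h : Stores f L) (j : ℕ) (hj : j < L.length) :
    f j = L[j] := h _ _ (List.getElem?_eq_getElem hj)

/-! ### Maximum trees

An array with `2 * N` cells is viewed as a binary tree: the children of `i` are `2 * i` and
`2 * i + 1`, the root is `1`, the leaves are `N, …, 2 * N - 1`. -/

/-- Every inner node holds the maximum of its children. -/
def IsMaxTree (N : ℕ) (T : ℕ → ℕ) : Prop :=
  ∀ i, 1 ≤ i → i < N → T i = max (T (2 * i)) (T (2 * i + 1))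

/-- `x` lies below `y` in the binary tree on the positive integers. -/
def Below (x y : ℕ) : Prop := ∃ j, x / 2 ^ j = y

theorem Below.refl (x : ℕ) : Below x x := ⟨0, by simp⟩

theorem Below.up {x y : ℕ} (h : Below x y) : Below x (y / 2) := by
  obtain ⟨j, rfl⟩ := h
  exact ⟨j + 1, by rw [pow_succ, Nat.div_div_eq_div_mul]⟩

theorem IsMaxTree.le {N : ℕ} {T : ℕ → ℕ} (h : IsMaxTree N T) {x y : ℕ} (hx : x < 2 * N)
    (hy : 1 ≤ y) (hxy : Below x y) : T x ≤ T y := by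
  obtain ⟨j, rfl⟩ := hxy
  induction j with
  | zero => simp
  | succ j ih =>
    rw [pow_succ, ← Nat.div_div_eq_div_mul] at hy ⊢
    have hle : x / 2 ^ j ≤ x := Nat.div_le_self _ _
    refine (ih (by omega)).trans ?_
    generalize x / 2 ^ j = z at *
    rw [h (z / 2) hy (by omega)]
    rcases Nat.mod_two_eq_zero_or_one z with h0 | h0
    · rw [show 2 * (z / 2) = z by omega]; exact le_max_left _ _
    · rw [show 2 * (z / 2) + 1 = z by omega]; exact le_max_right _ _

/-- Descend from `y`, always to a child that attains the maximum. -/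
theorem exists_leaf_below {N : ℕ} {T : ℕ → ℕ} (h : IsMaxTree N T) (y : ℕ) (hy : 1 ≤ y)
    (hy' : y < 2 * N) : ∃ x, N ≤ x ∧ x < 2 * N ∧ Below x y ∧ T x = T y := by
  by_cases hN : N ≤ y
  · exact ⟨y, hN, hy', .refl _, rfl⟩
  · have h1 := h y hy (by omega)
    rcases max_choice (T (2 * y)) (T (2 * y + 1)) with h2 | h2
    · obtain ⟨x, h3, h4, h5, h6⟩ := exists_leaf_below h (2 * y) (by omega) (by omega)
      have := h5.up
      rw [show 2 * y / 2 = y by omega] at this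
      exact ⟨x, h3, h4, this, by rw [h6, h1, h2]⟩
    · obtain ⟨x, h3, h4, h5, h6⟩ := exists_leaf_below h (2 * y + 1) (by omega) (by omega)
      have := h5.up
      rw [show (2 * y + 1) / 2 = y by omega] at this
      exact ⟨x, h3, h4, this, by rw [h6, h1, h2]⟩
termination_by 2 * N - y

/-- Set leaf number `reg 51` of the maximum tree in array `k` with `reg 50` leaves to `reg 52`. -/
def setLeaf (k : ℕ) : Prog := blk [
  .assign 53 (ℛ 50 + ℛ 51),
  .store k (ℛ 53) (ℛ 52),
  .assign 53 (ℛ 53 / 2),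
  .loop (ℛ 53) (blk [
    .ite (.lt (𝒜 k (2 * ℛ 53)) (𝒜 k (2 * ℛ 53 + 1)))
      (.store k (ℛ 53) (𝒜 k (2 * ℛ 53 + 1))) (.store k (ℛ 53) (𝒜 k (2 * ℛ 53))),
    .assign 53 (ℛ 53 / 2)])]

theorem setLeaf_runs {w k N : ℕ} {s : State} (hN : s.reg 50 = N) (hpos : s.reg 51 < N)
    (hW : 4 * N + 4 < 2 ^ w) (hT : IsMaxTree N (s.arr k)) :
    Runs w (setLeaf k) s (60 * (Nat.log 2 N + 1)) fun s' => IsMaxTree N (s'.arr k) ∧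
      ∀ j < N, s'.arr k (N + j) = if j = s.reg 51 then s.reg 52 else s.arr k (N + j) := by
  have hlog : N < 2 ^ (Nat.log 2 N + 1) := Nat.lt_pow_succ_log_self (by norm_num) N
  have hW1 : 1 < 2 ^ w := by omega
  have hw0 : w ≠ 0 := by rintro rfl; simp at hW1
  refine Runs.seq (T := 4) (T' := 60 * (Nat.log 2 N + 1) - 4)
    (R := fun s' => s' = (s.setReg 53 (N + s.reg 51))) (.straight (by simp [hN]; omega) rfl)
    ?_ (by omega)
  rintro _ - rfl
  refine Runs.seq (T := 3) (T' := 60 * (Nat.log 2 N + 1) - 7)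
    (R := fun s' => s' = ((s.setReg 53 (N + s.reg 51)).setArr k (N + s.reg 51) (s.reg 52)))
    (.straight (by simp) rfl) ?_ (by omega)
  rintro _ - rfl
  refine Runs.seq (T := 4) (T' := 60 * (Nat.log 2 N + 1) - 11)
    (R := fun s' => s'.reg 53 = (N + s.reg 51) / 2 ∧
      s'.arr k = Function.update (s.arr k) (N + s.reg 51) (s.reg 52))
    (.straight (by simp; omega) rfl) ?_ (by omega)
  rintro s1 - ⟨h53, harr⟩
  -- Only the node in register 53 may violate the maximum condition. Repairing it moves the possible
  -- defect to its parent, and the number of the node halves, which bounds the rounds.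
  refine Runs.loop (fun i s' => s'.reg 53 < 2 ^ i ∧ s'.reg 53 < N ∧
      (∀ j < N, s'.arr k (N + j) = if j = s.reg 51 then s.reg 52 else s.arr k (N + j)) ∧
      ∀ i, 1 ≤ i → i < N → i ≠ s'.reg 53 →
        s'.arr k i = max (s'.arr k (2 * i)) (s'.arr k (2 * i + 1)))
    40 (Nat.log 2 N + 1) s1 ?_ ?_ ?_ ?_ ?_
  · refine ⟨by omega, by omega, fun j hj => ?_, fun i hi hi' hne => ?_⟩
    · rw [harr, Function.update_apply]; simp
    · rw [h53] at hne
      rw [harr, Function.update_of_ne (by omega), Function.update_of_ne (by omega),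
        Function.update_of_ne (by omega)]
      exact hT i hi hi'
  · intro i s' _ _; trivial
  · rintro i s' - ⟨hi, hlt, hleaf, hinv⟩ hne
    simp only [Expr.val_reg] at hne
    obtain ⟨i', rfl⟩ : ∃ i', i = i' + 1 := by
      rcases i with _ | i
      · simp at hi; omega
      · exact ⟨i, rfl⟩
    refine ⟨i', rfl, Runs.seq (T := 30) (T' := 10) (R := fun t => t.reg 53 = s'.reg 53 ∧
      t.arr k = Function.update (s'.arr k) (s'.reg 53)
        (max (s'.arr k (2 * s'.reg 53)) (s'.arr k (2 * s'.reg 53 + 1)))) ?_ ?_ (by omega)⟩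
    · refine .straight ?_ rfl
      simp [hW1]
      refine ⟨by omega, ?_⟩
      split_ifs with hlt' <;> simp
      · rw [max_eq_left hlt']
      · rw [max_eq_right (not_le.1 hlt').le]
    · rintro t - ⟨h1, h2⟩
      refine .straight ?_ rfl
      simp [h1, h2]
      refine ⟨by omega, ?_, by omega, fun j hj => ?_, fun i hi1 hi2 hi3 => ?_⟩
      · rw [pow_succ] at hi; omega
      · rw [Function.update_of_ne (by omega)]; exact hleaf j hj
      · rcases eq_or_ne i (s'.reg 53) with rfl | hne'
        · simp
          rw [Function.update_of_ne (by omega), Function.update_of_ne (by omega)]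
        · rw [Function.update_of_ne hne', Function.update_of_ne (by omega),
            Function.update_of_ne (by omega)]
          exact hinv i hi1 hi2 hne'
  · simp only [Expr.cost]; omega
  · rintro i s' - ⟨-, -, hleaf, hinv⟩ h0
    simp only [Expr.val_reg] at h0
    exact ⟨fun i hi hi' => hinv i hi hi' (by omega), hleaf⟩

/-! ### Decomposition of intervals into subtrees -/

/-- The leaves below the nodes of `D` are the leaves with numbers `a, …, b - 1`, each of them below
exactly one node of `D`. -/
structure IsDecomposition (N a b : ℕ) (D : List ℕ) : Prop where
  pos : ∀ y ∈ D, 1 ≤ y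
  lt : ∀ y ∈ D, y < 2 * N
  nodup : D.Nodup
  length_le : D.length ≤ 2 * (Nat.log 2 N + 2)
  mem_iff : ∀ x, N ≤ x → x < 2 * N → ((N + a ≤ x ∧ x < N + b) ↔ ∃ y ∈ D, Below x y)
  unique : ∀ x, N ≤ x → x < 2 * N → ∀ y ∈ D, ∀ y' ∈ D, Below x y → Below x y' → y = y'

/-- `x` lies below `y`, and all numbers below `y` on the level of `x` lie between `a` and `b`. -/
def BelowIn (a b x y : ℕ) : Prop := ∃ j, x / 2 ^ j = y ∧ a ≤ y * 2 ^ j ∧ (y + 1) * 2 ^ j ≤ b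

theorem BelowIn.mem {a b x y : ℕ} (h : BelowIn a b x y) : a ≤ x ∧ x < b := by
  obtain ⟨j, rfl, h1, h2⟩ := h
  have := Nat.div_mul_le_self x (2 ^ j)
  have := Nat.lt_div_mul_add (a := x) (b := 2 ^ j) (by positivity)
  rw [add_mul] at h2
  omega

/-- If j > i, then (y + 1)·2^j ≥ 2(y + 1)·2^i > 2a ≥ b. So an interval [a, b) with b ≤ 2a can
contain the descendants of `y` on one level only. -/
theorem level_le {a b y i j : ℕ} (hb : b ≤ 2 * a) (h1 : a ≤ y * 2 ^ i)
    (h2 : (y + 1) * 2 ^ j ≤ b) : j ≤ i := by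
  by_contra h
  obtain ⟨d, rfl⟩ := Nat.exists_eq_add_of_lt (not_le.1 h)
  have h5 : 2 * 2 ^ i ≤ 2 ^ (i + d + 1) := by
    rw [← pow_succ']; exact Nat.pow_le_pow_right (by norm_num) (by omega)
  have := Nat.mul_le_mul_left (y + 1) h5
  have : (y + 1) * (2 * 2 ^ i) = 2 * (y * 2 ^ i) + 2 * 2 ^ i := by ring
  have : 0 < 2 ^ i := by positivity
  omega

/-- The number of leaves need not be a power of two, so leaves may lie on two levels. But all leaf
numbers are in [N, 2N), within a factor two: if one full level below `y` lies in [a, b), no leaf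
lies below `y` on another level. -/
theorem belowIn_iff {N a b x y z : ℕ} (ha : N ≤ a) (hb : b ≤ 2 * N) (hz : BelowIn a b z y)
    (hx : N ≤ x) (hx' : x < 2 * N) : BelowIn a b x y ↔ Below x y := by
  refine ⟨fun ⟨j, h, _⟩ => ⟨j, h⟩, ?_⟩
  rintro ⟨i, hi⟩
  obtain ⟨j, hj, h1, h2⟩ := hz
  suffices i = j by subst this; exact ⟨i, hi, h1, h2⟩
  subst hi
  have h3 := Nat.div_mul_le_self x (2 ^ i)
  have h4 := Nat.lt_div_mul_add (a := x) (b := 2 ^ i) (by positivity)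
  set y := x / 2 ^ i
  rcases lt_trichotomy i j with h | h | h
  · obtain ⟨d, rfl⟩ := Nat.exists_eq_add_of_lt h
    have h5 : 2 * 2 ^ i ≤ 2 ^ (i + d + 1) := by
      rw [← pow_succ']; exact Nat.pow_le_pow_right (by norm_num) (by omega)
    have := Nat.mul_le_mul_left (y + 1) h5
    have : (y + 1) * (2 * 2 ^ i) = 2 * (y * 2 ^ i + 2 ^ i) := by ring
    omega
  · exact h
  · obtain ⟨d, rfl⟩ := Nat.exists_eq_add_of_lt h
    have h5 : 2 * 2 ^ j ≤ 2 ^ (j + d + 1) := by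
      rw [← pow_succ']; exact Nat.pow_le_pow_right (by norm_num) (by omega)
    have := Nat.mul_le_mul_left y h5
    have : y * (2 * 2 ^ j) = 2 * (y * 2 ^ j) := by ring
    omega

/-- Invariant of the decomposition: the interval `[a, b)` consists of the numbers below nodes of
`D` and of the numbers which lie below `[l, r)` on level `h`. -/
structure DecompInv (a b h l r : ℕ) (D : List ℕ) : Prop where
  nodup : D.Nodup
  ne : ∀ y ∈ D, ∃ z, BelowIn a b z y
  unique : ∀ x, ∀ y ∈ D, ∀ y' ∈ D, BelowIn a b x y → BelowIn a b x y' → y = y'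
  disj : ∀ x, ∀ y ∈ D, BelowIn a b x y → ¬ (l ≤ x / 2 ^ h ∧ x / 2 ^ h < r)
  cover : ∀ x, (a ≤ x ∧ x < b) ↔ (∃ y ∈ D, BelowIn a b x y) ∨ (l ≤ x / 2 ^ h ∧ x / 2 ^ h < r)

theorem DecompInv.add {a b h l r y l' r' : ℕ} {D : List ℕ} (hab : b ≤ 2 * a)
    (H : DecompInv a b h l r D)
    (hy : ∀ z, (l ≤ z ∧ z < r) ↔ z = y ∨ (l' ≤ z ∧ z < r')) (hy' : ¬ (l' ≤ y ∧ y < r')) :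
    DecompInv a b h l' r' (D ++ [y]) := by
  have hyy : l ≤ y ∧ y < r := (hy y).2 (Or.inl rfl)
  have hin : ∀ x, x / 2 ^ h = y → a ≤ x ∧ x < b := fun x hx =>
    (H.cover x).2 (Or.inr (by rwa [hx]))
  have hpos : 0 < 2 ^ h := by positivity
  have h1 := hin (y * 2 ^ h) (Nat.mul_div_cancel _ hpos)
  have h2 := hin ((y + 1) * 2 ^ h - 1) (by
    rw [Nat.div_eq_iff hpos, add_mul]; constructor <;> omega)
  have h3 : (y + 1) * 2 ^ h ≤ b := by omega
  -- The level in `BelowIn` must be `h`, by `level_le` in both directions.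
  have hb : ∀ x, BelowIn a b x y ↔ x / 2 ^ h = y := by
    refine fun x => ⟨?_, fun hx => ⟨h, hx, h1.1, h3⟩⟩
    rintro ⟨j, hj, hj1, hj2⟩
    rwa [le_antisymm (level_le hab h1.1 hj2) (level_le hab hj1 h3)] at hj
  have hz := (hb (y * 2 ^ h)).2 (Nat.mul_div_cancel _ hpos)
  have hne : ∀ x, ∀ y' ∈ D, BelowIn a b x y' → ¬ BelowIn a b x y := fun x y' hy' hx hx' =>
    H.disj x y' hy' hx (by rw [(hb x).1 hx']; exact hyy)
  refine ⟨?_, ?_, ?_, ?_, ?_⟩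
  · refine List.nodup_append.2 ⟨H.nodup, List.nodup_singleton y, ?_⟩
    rintro y' hy' _ hm rfl
    rw [List.mem_singleton.1 hm] at hy'
    exact hne _ _ hy' hz hz
  · intro y' hm
    rcases List.mem_append.1 hm with hm | hm
    · exact H.ne y' hm
    · rw [List.mem_singleton.1 hm]; exact ⟨_, hz⟩
  · intro x y1 hm1 y2 hm2 hx1 hx2
    simp only [List.mem_append, List.mem_singleton] at hm1 hm2
    rcases hm1 with hm1 | rfl <;> rcases hm2 with hm2 | rfl
    · exact H.unique x y1 hm1 y2 hm2 hx1 hx2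
    · exact (hne _ _ hm1 hx1 hx2).elim
    · exact (hne _ _ hm2 hx2 hx1).elim
    · rfl
  · intro x y1 hm1 hx1 hmem
    simp only [List.mem_append, List.mem_singleton] at hm1
    rcases hm1 with hm1 | rfl
    · exact H.disj x y1 hm1 hx1 ((hy _).2 (Or.inr hmem))
    · rw [(hb x).1 hx1] at hmem; exact hy' hmem
  · intro x
    rw [H.cover x, hy]
    simp only [List.mem_append, List.mem_singleton, or_and_right, exists_or, exists_eq_left, hb, or_assoc]

/-- Once both ends are even, [l, r) consists of complete pairs of siblings, so it can be replaced by
the parents [l / 2, r / 2). -/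
theorem DecompInv.half {a b h l r : ℕ} {D : List ℕ} (H : DecompInv a b h l r D) (hl : l % 2 = 0)
    (hr : r % 2 = 0) : DecompInv a b (h + 1) (l / 2) (r / 2) D := by
  have key : ∀ x, (l / 2 ≤ x / 2 ^ (h + 1) ∧ x / 2 ^ (h + 1) < r / 2) ↔
      (l ≤ x / 2 ^ h ∧ x / 2 ^ h < r) := by
    intro x
    rw [pow_succ, ← Nat.div_div_eq_div_mul]
    omega
  exact ⟨H.nodup, H.ne, H.unique, fun x y hy hx => by rw [key]; exact H.disj x y hy hx,
    fun x => by rw [key]; exact H.cover x⟩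

theorem DecompInv.isDecomposition {N a b h l r : ℕ} {D : List ℕ} (hb : b ≤ N)
    (H : DecompInv (N + a) (N + b) h l r D) (hlr : r ≤ l)
    (hD : D.length ≤ 2 * (Nat.log 2 N + 2)) : IsDecomposition N a b D := by
  have key : ∀ x, N ≤ x → x < 2 * N → ∀ y ∈ D, (BelowIn (N + a) (N + b) x y ↔ Below x y) := by
    intro x hx hx' y hy
    obtain ⟨z, hz⟩ := H.ne y hy
    exact belowIn_iff (by omega) (by omega) hz hx hx'
  have hle : ∀ y ∈ D, 1 ≤ y ∧ y < 2 * N := by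
    intro y hy
    obtain ⟨z, hz⟩ := H.ne y hy
    have hm := hz.mem
    obtain ⟨j, h1, h2, h3⟩ := hz
    subst h1
    refine ⟨Nat.pos_of_ne_zero ?_, (Nat.div_le_self _ _).trans_lt (by omega)⟩
    intro h0
    rw [h0] at h2
    omega
  refine ⟨fun y hy => (hle y hy).1, fun y hy => (hle y hy).2, H.nodup, hD, ?_, ?_⟩
  · intro x hx hx'
    rw [H.cover x]
    constructor
    · rintro (⟨y, hy, h⟩ | h)
      · exact ⟨y, hy, (key x hx hx' y hy).1 h⟩
      · omega
    · rintro ⟨y, hy, h⟩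
      exact Or.inl ⟨y, hy, (key x hx hx' y hy).2 h⟩
  · intro x hx hx' y hy y' hy' h h'
    exact H.unique x y hy y' hy' ((key x hx hx' y hy).2 h) ((key x hx hx' y' hy').2 h')

/-- Write to array `k` a list of nodes, and to `reg 56` its length, whose subtrees decompose the
interval of leaves from number `reg 54` to number `reg 55 - 1` in the tree with `reg 50` leaves. -/
def decompose (k : ℕ) : Prog := blk [
  .assign 54 (ℛ 54 + ℛ 50),
  .assign 55 (ℛ 55 + ℛ 50),
  .assign 56 0,
  .loop (.lt (ℛ 54) (ℛ 55)) (blk [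
    .ite (ℛ 54 % 2)
      (blk [.store k (ℛ 56) (ℛ 54), .assign 56 (ℛ 56 + 1), .assign 54 (ℛ 54 + 1)]) .skip,
    .ite (ℛ 55 % 2)
      (blk [.assign 55 (ℛ 55 - 1), .store k (ℛ 56) (ℛ 55), .assign 56 (ℛ 56 + 1)]) .skip,
    .assign 54 (ℛ 54 / 2),
    .assign 55 (ℛ 55 / 2)])]

theorem decompose_runs {w k N a b : ℕ} {s : State} (hN : s.reg 50 = N) (ha : s.reg 54 = a)
    (hb : s.reg 55 = b) (hab : a ≤ b) (hbN : b ≤ N) (hN0 : 0 < N) (hW : 4 * N + 8 < 2 ^ w) :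
    Runs w (decompose k) s (120 * (Nat.log 2 N + 2)) fun s' =>
      ∃ D, IsDecomposition N a b D ∧ s'.reg 56 = D.length ∧ Stores (s'.arr k) D := by
  have hlog : N < 2 ^ (Nat.log 2 N + 1) := Nat.lt_pow_succ_log_self (by norm_num) N
  have hlogN : Nat.log 2 N < N := Nat.log_lt_self 2 (by omega)
  have hW1 : 1 < 2 ^ w := by omega
  have hw0 : w ≠ 0 := by rintro rfl; simp at hW1
  refine Runs.seq (T := 4) (T' := 120 * (Nat.log 2 N + 2) - 4)
    (R := fun s' => s' = (s.setReg 54 (a + N))) (.straight (by simp [hN, ha]; omega) rfl)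
    ?_ (by omega)
  rintro _ - rfl
  refine Runs.seq (T := 4) (T' := 120 * (Nat.log 2 N + 2) - 8)
    (R := fun s' => s' = ((s.setReg 54 (a + N)).setReg 55 (b + N)))
    (.straight (by simp [hN, hb]; omega) rfl) ?_ (by omega)
  rintro _ - rfl
  refine Runs.seq (T := 2) (T' := 120 * (Nat.log 2 N + 2) - 10)
    (R := fun s' => s'.reg 54 = a + N ∧ s'.reg 55 = b + N ∧ s'.reg 56 = 0)
    (.straight (by simp) rfl) ?_ (by omega)
  rintro s1 - ⟨h54, h55, h56⟩
  -- A round halves register 55, initially at most 2N < 2^(log N + 2), and adds at most one node at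
  -- each end. Hence the length of `D` plus twice the number of remaining rounds never grows.
  refine Runs.loop (fun i s' => s'.reg 55 < 2 ^ i ∧ s'.reg 55 ≤ 2 * N ∧ i ≤ Nat.log 2 N + 2 ∧
      ∃ h D, DecompInv (N + a) (N + b) h (s'.reg 54) (s'.reg 55) D ∧ s'.reg 56 = D.length ∧
        Stores (s'.arr k) D ∧ D.length + 2 * i ≤ 2 * (Nat.log 2 N + 2))
    100 (Nat.log 2 N + 2) s1 ?_ ?_ ?_ ?_ ?_
  · refine ⟨by rw [pow_succ]; omega, by omega, le_rfl, 0, [], ⟨List.nodup_nil, ?_, ?_, ?_, ?_⟩,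
      by simpa using h56, Stores.nil _, by simp⟩
    · simp
    · simp
    · simp
    · simp [h54, h55, add_comm]
  · intro i s' _ _; simp [hW1]
  · rintro i s' - ⟨hi, hle, hi', h, D, hinv, hlen, hst, hD⟩ hne
    have hlt : s'.reg 54 < s'.reg 55 := by simpa using hne
    obtain ⟨i', rfl⟩ : ∃ i', i = i' + 1 := by
      rcases i with _ | i
      · simp at hi; omega
      · exact ⟨i, rfl⟩
    rw [pow_succ] at hi
    refine ⟨i', rfl, ?_⟩
    refine Runs.seq (T := 25) (T' := 60) (R := fun t => t.reg 55 = s'.reg 55 ∧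
      t.reg 54 ≤ t.reg 55 ∧ t.reg 54 % 2 = 0 ∧ ∃ D', DecompInv (N + a) (N + b) h (t.reg 54)
        (t.reg 55) D' ∧ t.reg 56 = D'.length ∧ Stores (t.arr k) D' ∧ D'.length ≤ D.length + 1)
      ?_ ?_ (by omega)
    · refine .ite (T := 20) (by simp; omega) ?_ ?_ (by decide)
      · intro hodd
        have hodd' : s'.reg 54 % 2 = 1 := by simpa using hodd
        refine .straight ?_ rfl
        simp [hlen, hw0]
        refine ⟨by omega, by omega, by omega, D ++ [s'.reg 54], ?_, by simp, hst.append _, by simp⟩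
        exact hinv.add (by omega) (fun z => by omega) (by omega)
      · intro heven
        have heven' : s'.reg 54 % 2 = 0 := by simpa using heven
        refine .straight ?_ rfl
        simp
        exact ⟨by omega, heven', D, hinv, hlen, hst, by omega⟩
    · rintro t1 - ⟨h1, h2, h3, D1, hinv1, hlen1, hst1, hD1⟩
      refine Runs.seq (T := 25) (T' := 20) (R := fun t => t.reg 55 ≤ s'.reg 55 ∧
        t.reg 54 % 2 = 0 ∧ t.reg 55 % 2 = 0 ∧ t.reg 54 ≤ t.reg 55 ∧ ∃ D',
          DecompInv (N + a) (N + b) h (t.reg 54)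
          (t.reg 55) D' ∧ t.reg 56 = D'.length ∧ Stores (t.arr k) D' ∧ D'.length ≤ D.length + 2)
        ?_ ?_ (by omega)
      · refine .ite (T := 20) (by simp; omega) ?_ ?_ (by decide)
        · intro hodd
          have hodd' : t1.reg 55 % 2 = 1 := by simpa using hodd
          refine .straight ?_ rfl
          simp [hlen1, hw0]
          refine ⟨by omega, by omega, h3, by omega, by omega, D1 ++ [t1.reg 55 - 1], ?_, by simp,
            hst1.append _, by simp; omega⟩
          exact hinv1.add (by omega) (fun z => by omega) (by omega)
        · intro heven
          have heven' : t1.reg 55 % 2 = 0 := by simpa using heven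
          refine .straight ?_ rfl
          simp
          exact ⟨by omega, h3, heven', h2, D1, hinv1, hlen1, hst1, by omega⟩
      · rintro t2 - ⟨h1', h2', h3', h4', D2, hinv2, hlen2, hst2, hD2⟩
        refine .straight ?_ rfl
        simp
        exact ⟨by omega, by omega, by omega, by omega, h + 1, D2,
          hinv2.half h2' h3', hlen2, hst2, by omega⟩
  · simp only [Expr.cost, Expr.lt]; omega
  · rintro i s' - ⟨hi, hle, hi', h, D, hinv, hlen, hst, hD⟩ h0
    have hge : s'.reg 55 ≤ s'.reg 54 := by simpa using h0
    exact ⟨D, hinv.isDecomposition hbN hge (by omega), hlen, hst⟩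

/-! ### Laminar families of rectangles -/

/-- The rectangles `[x1 i, x2 i) × [y1 i, y2 i)`, `i < p`, with a colour for each of them. -/
structure RectFamily where
  (n p : ℕ)
  (x1 x2 y1 y2 col : ℕ → ℕ)

namespace RectFamily

variable (R : RectFamily)

def Mem (i x y : ℕ) : Prop := R.x1 i ≤ x ∧ x < R.x2 i ∧ R.y1 i ≤ y ∧ y < R.y2 i

def Sub (j i : ℕ) : Prop :=
  R.x1 i ≤ R.x1 j ∧ R.x2 j ≤ R.x2 i ∧ R.y1 i ≤ R.y1 j ∧ R.y2 j ≤ R.y2 i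

/-- That the x-sides alone are laminar, even for rectangles disjoint in the y-direction, is what
makes the rectangles meeting a column a stack. The field `lam` carries the noncrossing condition,
`x_le_y` puts the rectangles above the diagonal, and `eq_of_sub` excludes repetitions. -/
structure Laminar : Prop where
  x_lt : ∀ i < R.p, R.x1 i < R.x2 i
  x_le_y : ∀ i < R.p, R.x2 i ≤ R.y1 i
  y_lt : ∀ i < R.p, R.y1 i < R.y2 i
  y_le : ∀ i < R.p, R.y2 i ≤ R.n
  lam_x : ∀ i < R.p, ∀ j < R.p, R.x2 i ≤ R.x1 j ∨ R.x2 j ≤ R.x1 i ∨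
    (R.x1 i ≤ R.x1 j ∧ R.x2 j ≤ R.x2 i) ∨ (R.x1 j ≤ R.x1 i ∧ R.x2 i ≤ R.x2 j)
  lam : ∀ i < R.p, ∀ j < R.p, i ≠ j → R.x2 i ≤ R.x1 j ∨ R.x2 j ≤ R.x1 i ∨
    R.y2 i ≤ R.y1 j ∨ R.y2 j ≤ R.y1 i ∨ R.Sub i j ∨ R.Sub j i
  eq_of_sub : ∀ i < R.p, ∀ j < R.p, R.Sub i j → R.Sub j i → i = j

/-- The smallest rectangle containing the point has a nonzero colour. -/
def Positive (x y : ℕ) : Prop :=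
  ∃ i < R.p, R.col i ≠ 0 ∧ R.Mem i x y ∧ ∀ j < R.p, R.Mem j x y → R.Sub j i → j = i

/-- The segment of `[0, n)` which contains `y`, as start, end and colour, after inserting the
intervals `[y1 r, y2 r)` for `r` in the list, the last entry first. -/
def seg : List ℕ → ℕ → ℕ × ℕ × ℕ
  | [], _ => (0, R.n, 0)
  | r :: S, y =>
    -- Only the segment containing `y1 r` is cut. For stacks over a laminar family it contains the
    -- whole interval of `r`, by `Laminar.le_finish_of_cons`.
    if (seg S (R.y1 r)).1 ≤ y ∧ y < (seg S (R.y1 r)).2.1 then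
      if y < R.y1 r then ((seg S (R.y1 r)).1, R.y1 r, (seg S (R.y1 r)).2.2)
      else if y < R.y2 r then (R.y1 r, R.y2 r, R.col r)
      else (R.y2 r, (seg S (R.y1 r)).2.1, (seg S (R.y1 r)).2.2)
    else seg S y

/-- The `x`-interval of `r` lies in the one of `q`, and the `y`-intervals are disjoint or nested in
the same direction. -/
def Nested (r q : ℕ) : Prop := R.x1 q ≤ R.x1 r ∧ R.x2 r ≤ R.x2 q ∧
  (R.y2 r ≤ R.y1 q ∨ R.y2 q ≤ R.y1 r ∨ (R.y1 q ≤ R.y1 r ∧ R.y2 r ≤ R.y2 q))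

/-- The head of the list is the top of the stack: `nested` compares every item with all items below
it. -/
structure IsStack (S : List ℕ) : Prop where
  nested : S.Pairwise R.Nested
  lt : ∀ r ∈ S, r < R.p
  nodup : S.Nodup

variable {R}

theorem IsStack.tail {r : ℕ} {S : List ℕ} (h : R.IsStack (r :: S)) : R.IsStack S :=
  ⟨(List.pairwise_cons.1 h.1).2, fun q hq => h.2 q (List.mem_cons_of_mem _ hq),
    (List.nodup_cons.1 h.nodup).2⟩

namespace Laminar

variable (L : R.Laminar)
include L

/-- The claims are proved in one induction. The last one says that an interval disjoint from or
contained in each listed interval fits into one segment; applied to the tail it shows that `r` cuts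
just one segment, which is what the first claim needs for the enlarged stack. -/
theorem seg_spec : ∀ {S : List ℕ}, R.IsStack S →
    (∀ y < R.n, (R.seg S y).1 ≤ y ∧ y < (R.seg S y).2.1 ∧ (R.seg S y).2.1 ≤ R.n) ∧
    (∀ z < R.n, ∀ y, (R.seg S z).1 ≤ y → y < (R.seg S z).2.1 → R.seg S y = R.seg S z) ∧
    (∀ a b, a < b → b ≤ R.n →
      (∀ q ∈ S, b ≤ R.y1 q ∨ R.y2 q ≤ a ∨ (R.y1 q ≤ a ∧ b ≤ R.y2 q)) →
      b ≤ (R.seg S a).2.1)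
  | [], _ => by
    refine ⟨fun y hy => ⟨Nat.zero_le _, hy, le_rfl⟩, fun _ _ _ _ _ => rfl, fun a b _ hb _ => hb⟩
  | r :: S, h => by
    obtain ⟨h1, h2, h3⟩ := seg_spec h.tail
    have hr := h.lt r (by simp)
    have hy := L.y_lt r hr
    have hn := L.y_le r hr
    obtain ⟨t1, t2, t3⟩ := h1 (R.y1 r) (by omega)
    have hfit : R.y2 r ≤ (R.seg S (R.y1 r)).2.1 := h3 _ _ hy hn fun q hq =>
      ((List.pairwise_cons.1 h.nested).1 q hq).2.2
    have hconst := h2 (R.y1 r) (by omega)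
    refine ⟨fun y hyn => ?_, fun z hz y => ?_, fun a b hab hb hq => ?_⟩
    · have := h1 y hyn
      simp only [seg]
      split_ifs <;> (try simp only) <;> omega
    · have := h1 z hz
      by_cases hin : (R.seg S (R.y1 r)).1 ≤ z ∧ z < (R.seg S (R.y1 r)).2.1
      · intro hy1 hy2
        simp only [seg, if_pos hin] at hy1 hy2
        have hy' : (R.seg S (R.y1 r)).1 ≤ y ∧ y < (R.seg S (R.y1 r)).2.1 := by
          split_ifs at hy1 hy2 <;> simp only at hy1 hy2 <;> omega
        simp only [seg, if_pos hin, if_pos hy']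
        split_ifs at hy1 hy2 ⊢ <;> simp only at hy1 hy2 <;> first | rfl | (exfalso; omega)
      · have hz' : R.seg (r :: S) z = R.seg S z := by simp only [seg, if_neg hin]
        rw [hz']
        intro hy1 hy2
        have heq := h2 z hz y hy1 hy2
        have hny : ¬ ((R.seg S (R.y1 r)).1 ≤ y ∧ y < (R.seg S (R.y1 r)).2.1) := by
          intro hc
          rw [← hconst y hc.1 hc.2, heq] at hin
          exact hin ⟨this.1, this.2.1⟩
        simp only [seg, if_neg hny, heq]
    · have h3' := h3 a b hab hb fun q hq' => hq q (List.mem_cons_of_mem _ hq')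
      have hq' := hq r (by simp)
      by_cases hin : (R.seg S (R.y1 r)).1 ≤ a ∧ a < (R.seg S (R.y1 r)).2.1
      · rw [hconst a hin.1 hin.2] at h3'
        simp only [seg, if_pos hin]
        split_ifs <;> simp only <;> omega
      · simpa only [seg, if_neg hin] using h3'

variable {S : List ℕ}

theorem start_le (h : R.IsStack S) {y : ℕ} (hy : y < R.n) : (R.seg S y).1 ≤ y :=
  ((L.seg_spec h).1 y hy).1

theorem lt_finish (h : R.IsStack S) {y : ℕ} (hy : y < R.n) : y < (R.seg S y).2.1 :=
  ((L.seg_spec h).1 y hy).2.1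

theorem finish_le (h : R.IsStack S) {y : ℕ} (hy : y < R.n) : (R.seg S y).2.1 ≤ R.n :=
  ((L.seg_spec h).1 y hy).2.2

theorem seg_eq (h : R.IsStack S) {y z : ℕ} (hz : z < R.n) (h1 : (R.seg S z).1 ≤ y)
    (h2 : y < (R.seg S z).2.1) : R.seg S y = R.seg S z :=
  (L.seg_spec h).2.1 z hz y h1 h2

theorem le_finish_of_cons {r : ℕ} (h : R.IsStack (r :: S)) :
    R.y2 r ≤ (R.seg S (R.y1 r)).2.1 :=
  (L.seg_spec h.tail).2.2 _ _ (L.y_lt r (h.lt r (by simp))) (L.y_le r (h.lt r (by simp)))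
    fun q hq => ((List.pairwise_cons.1 h.nested).1 q hq).2.2

theorem seg_start (h : R.IsStack S) {y : ℕ} (hy : y < R.n) :
    R.seg S (R.seg S y).1 = R.seg S y :=
  L.seg_eq h hy le_rfl ((L.start_le h hy).trans_lt (L.lt_finish h hy))

theorem start_eq_of_start_eq (h : R.IsStack S) {y z : ℕ} (hy : y < R.n) (hz : z < R.n)
    (hyz : (R.seg S y).1 = (R.seg S z).1) : R.seg S y = R.seg S z := by
  rw [← L.seg_start h hy, hyz, L.seg_start h hz]

/-- The start of the segment of `y` is the greatest start below `y`. -/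
theorem le_start (h : R.IsStack S) {y z : ℕ} (hy : y < R.n) (hz : z ≤ y)
    (hz' : (R.seg S z).1 = z) : z ≤ (R.seg S y).1 := by
  by_contra hlt
  have := L.seg_eq h hy (not_le.1 hlt).le (hz.trans_lt (L.lt_finish h hy))
  rw [this] at hz'
  omega

/-- The colour of the segment of `y` is the one of the first listed interval containing `y`. -/
theorem color_eq : ∀ {S : List ℕ}, R.IsStack S → ∀ y < R.n, (R.seg S y).2.2 ≠ 0 ↔
    ∃ S₁ r S₂, S = S₁ ++ r :: S₂ ∧ (R.y1 r ≤ y ∧ y < R.y2 r) ∧ R.col r ≠ 0 ∧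
      ∀ q ∈ S₁, ¬ (R.y1 q ≤ y ∧ y < R.y2 q)
  | [], _, y, _ => by simp [seg]
  | r :: S, h, y, hy => by
    have ih := color_eq h.tail y hy
    have hr := h.lt r (by simp)
    have hyr := L.y_lt r hr
    have hn := L.y_le r hr
    have hfit := L.le_finish_of_cons h
    have hst := L.start_le h.tail (y := R.y1 r) (by omega)
    by_cases hin : R.y1 r ≤ y ∧ y < R.y2 r
    · have : (R.seg (r :: S) y).2.2 = R.col r := by
        simp only [seg]
        rw [if_pos ⟨by omega, by omega⟩, if_neg (by omega), if_pos hin.2]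
      rw [this]
      constructor
      · intro hc
        exact ⟨[], r, S, rfl, hin, hc, by simp⟩
      · rintro ⟨S₁, r', S₂, hS, hr', hc, hq⟩
        rcases S₁ with _ | ⟨q, S₁⟩
        · simp only [List.nil_append, List.cons.injEq] at hS
          rw [hS.1]; exact hc
        · simp only [List.cons_append, List.cons.injEq] at hS
          exact absurd hin (hS.1 ▸ hq q (by simp))
    -- The pieces left and right of the new interval inherit the old colour.
    · have : (R.seg (r :: S) y).2.2 = (R.seg S y).2.2 := by
        simp only [seg]
        split_ifs with h1 h2 h3
        · rw [L.seg_eq h.tail (by omega) h1.1 h1.2]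
        · omega
        · rw [L.seg_eq h.tail (by omega) h1.1 h1.2]
        · rfl
      rw [this, ih]
      constructor
      · rintro ⟨S₁, r', S₂, hS, hr', hc, hq⟩
        refine ⟨r :: S₁, r', S₂, by rw [hS]; rfl, hr', hc, ?_⟩
        intro q hq'
        rcases List.mem_cons.1 hq' with rfl | hq'
        · exact hin
        · exact hq q hq'
      · rintro ⟨S₁, r', S₂, hS, hr', hc, hq⟩
        rcases S₁ with _ | ⟨q, S₁⟩
        · simp only [List.nil_append, List.cons.injEq] at hS
          rw [← hS.1] at hr'; exact absurd hr' hin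
        · simp only [List.cons_append, List.cons.injEq] at hS
          exact ⟨S₁, r', S₂, hS.2, hr', hc, fun q hq' => hq q (List.mem_cons_of_mem _ hq')⟩

/-- If the list contains exactly the rectangles which meet the column `x`, then the colours of the
segments are the colours in that column. -/
theorem positive_iff (h : R.IsStack S) {x y : ℕ} (hy : y < R.n)
    (hx : ∀ i < R.p, i ∈ S ↔ R.x1 i ≤ x ∧ x < R.x2 i) :
    R.Positive x y ↔ (R.seg S y).2.2 ≠ 0 := by
  rw [L.color_eq h y hy]
  -- Of two listed rectangles whose y-intervals contain `y`, the one higher on the stack lies inside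
  -- the other. So the first listed interval containing `y` belongs to the smallest rectangle.
  have hsub : ∀ {S₁ r S₂ q}, S = S₁ ++ r :: S₂ → q ∈ S₂ → R.y1 r ≤ y ∧ y < R.y2 r →
      R.y1 q ≤ y ∧ y < R.y2 q → R.Sub r q := by
    intro S₁ r S₂ q hS hq h1 h2
    have := h.nested
    rw [hS, List.pairwise_append] at this
    have := (List.pairwise_cons.1 this.2.1).1 q hq
    unfold Nested at this
    unfold Sub
    omega
  constructor
  · rintro ⟨i, hi, hc, ⟨hm1, hm2, hm3, hm4⟩, hmin⟩
    have hiS := (hx i hi).2 ⟨hm1, hm2⟩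
    obtain ⟨S₁, S₂, hS⟩ := List.append_of_mem hiS
    refine ⟨S₁, i, S₂, hS, ⟨hm3, hm4⟩, hc, fun q hq hqy => ?_⟩
    have hqS : q ∈ S := by rw [hS]; simp [hq]
    have hqp := h.lt q hqS
    have hqx := (hx q hqp).1 hqS
    obtain ⟨T₁, T₂, rfl⟩ := List.append_of_mem hq
    have hsq : R.Sub q i := hsub (S₁ := T₁) (S₂ := T₂ ++ i :: S₂) (by rw [hS]; simp) (by simp)
      hqy ⟨hm3, hm4⟩
    obtain rfl := hmin q hqp ⟨hqx.1, hqx.2, hqy.1, hqy.2⟩ hsq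
    have := h.nodup
    rw [hS] at this
    simp [List.nodup_append] at this
  · rintro ⟨S₁, r, S₂, hS, hr, hc, hq⟩
    have hrS : r ∈ S := by rw [hS]; simp
    have hrp := h.lt r hrS
    have hrx := (hx r hrp).1 hrS
    refine ⟨r, hrp, hc, ⟨hrx.1, hrx.2, hr.1, hr.2⟩, ?_⟩
    rintro j hj ⟨hj1, hj2, hj3, hj4⟩ hjr
    have hjS := (hx j hj).2 ⟨hj1, hj2⟩
    rw [hS, List.mem_append, List.mem_cons] at hjS
    rcases hjS with hjS | rfl | hjS
    · exact absurd ⟨hj3, hj4⟩ (hq j hjS)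
    · rfl
    · exact L.eq_of_sub j hj r hrp hjr (hsub hS hjS hr ⟨hj3, hj4⟩)

variable {r : ℕ}

/-- Either `y` lies in the segment that is cut, or its segment is untouched and starts outside of
it. Read forwards this serves insertion, read backwards removal. -/
theorem start_cons (h : R.IsStack (r :: S)) {y : ℕ} (hy : y < R.n) :
    ((R.seg S (R.y1 r)).1 ≤ y ∧ y < (R.seg S (R.y1 r)).2.1 ∧
      R.seg S y = R.seg S (R.y1 r) ∧
      R.seg (r :: S) y = if y < R.y1 r then
        ((R.seg S (R.y1 r)).1, R.y1 r, (R.seg S (R.y1 r)).2.2)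
      else if y < R.y2 r then (R.y1 r, R.y2 r, R.col r)
      else (R.y2 r, (R.seg S (R.y1 r)).2.1, (R.seg S (R.y1 r)).2.2)) ∨
    (¬ ((R.seg S (R.y1 r)).1 ≤ y ∧ y < (R.seg S (R.y1 r)).2.1) ∧
      R.seg (r :: S) y = R.seg S y ∧
      ¬ ((R.seg S (R.y1 r)).1 ≤ (R.seg S y).1 ∧ (R.seg S y).1 < (R.seg S (R.y1 r)).2.1)) := by
  have hyr := L.y_lt r (h.lt r (by simp))
  have hyn := L.y_le r (h.lt r (by simp))
  by_cases hin : (R.seg S (R.y1 r)).1 ≤ y ∧ y < (R.seg S (R.y1 r)).2.1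
  · exact Or.inl ⟨hin.1, hin.2, L.seg_eq h.tail (by omega) hin.1 hin.2,
      by simp only [seg, if_pos hin]⟩
  · refine Or.inr ⟨hin, by simp only [seg, if_neg hin], fun hc => hin ?_⟩
    have h1 := L.seg_eq h.tail (by omega) hc.1 hc.2
    rw [L.seg_start h.tail hy] at h1
    rw [← h1]
    exact ⟨L.start_le h.tail hy, L.lt_finish h.tail hy⟩

theorem stack_bounds (h : R.IsStack (r :: S)) :
    (R.seg S (R.y1 r)).1 ≤ R.y1 r ∧ R.y1 r < R.y2 r ∧ R.y2 r ≤ (R.seg S (R.y1 r)).2.1 ∧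
      (R.seg S (R.y1 r)).2.1 ≤ R.n := by
  have hyr := L.y_lt r (h.lt r (by simp))
  have hyn := L.y_le r (h.lt r (by simp))
  exact ⟨L.start_le h.tail (by omega), hyr, L.le_finish_of_cons h, L.finish_le h.tail (by omega)⟩

/-- Needed to keep the marks of the starts up to date: at most two of them change, and `y2 r`
becomes a start only if the right piece is nonempty. -/
theorem isStart_cons (h : R.IsStack (r :: S)) {y : ℕ} (hy : y < R.n) :
    (R.seg (r :: S) y).1 = y ↔ y = R.y1 r ∨ (y = R.y2 r ∧ R.y2 r < (R.seg S (R.y1 r)).2.1) ∨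
      (R.seg S y).1 = y := by
  have hb := L.stack_bounds h
  rcases L.start_cons h hy with ⟨h1, h2, h3, h4⟩ | ⟨h1, h2, h3⟩
  · rw [h4, h3]
    split_ifs <;> simp only <;> omega
  · rw [h2]
    omega

end Laminar

/-! ### The sweep -/

/-- Outer rectangles come first. -/
def Before (i j : ℕ) : Prop := R.x1 i < R.x1 j ∨ (R.x1 i = R.x1 j ∧ (R.x2 j < R.x2 i ∨
  (R.x2 i = R.x2 j ∧ R.y2 j - R.y1 j ≤ R.y2 i - R.y1 i)))

variable (R) in
/-- `Z` enumerates the rectangles, outer rectangles first. -/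
structure IsOrder (Z : ℕ → ℕ) : Prop where
  lt : ∀ k < R.p, Z k < R.p
  inj : ∀ k < R.p, ∀ l < R.p, Z k = Z l → k = l
  before : ∀ k l, k < l → l < R.p → R.Before (Z k) (Z l)

theorem IsOrder.surj {Z : ℕ → ℕ} (h : R.IsOrder Z) {i : ℕ} (hi : i < R.p) :
    ∃ k < R.p, Z k = i := by
  have := Finset.surj_on_of_inj_on_of_card_le (s := Finset.range R.p) (t := Finset.range R.p)
    (fun k _ => Z k) (fun k hk => by simpa using h.lt k (by simpa using hk))
    (fun k l hk hl hkl => h.inj k (by simpa using hk) l (by simpa using hl) hkl) le_rfl i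
    (by simpa using hi)
  obtain ⟨k, hk, rfl⟩ := this
  exact ⟨k, by simpa using hk, rfl⟩

/-- The tuple `(a, b, c, d)` stands for the rectangle `[a, b] × [c, d]`. -/
def Covers (q : ℕ × ℕ × ℕ × ℕ) (x y : ℕ) : Prop :=
  q.1 ≤ x ∧ x ≤ q.2.1 ∧ q.2.2.1 ≤ y ∧ y ≤ q.2.2.2

variable (R) in
/-- The state of the sweep: the first `k` rectangles have been inserted, those in `S` have not been
removed, the columns left of `X` have been swept, `xs` contains the column up to which the segment
with a given start has been written to the output `E`. -/
structure Sweep (Z : ℕ → ℕ) (k : ℕ) (S : List ℕ) (X : ℕ) (xs : ℕ → ℕ)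
    (E : List (ℕ × ℕ × ℕ × ℕ)) : Prop where
  stack : R.IsStack S
  X_le : X ≤ R.n
  mem : ∀ r ∈ S, (∃ l < k, Z l = r) ∧ R.x1 r ≤ X ∧ X ≤ R.x2 r
  old : ∀ l < k, Z l ∉ S → R.x2 (Z l) ≤ X
  new : ∀ l, k ≤ l → l < R.p → X ≤ R.x1 (Z l)
  xs_le : ∀ y < R.n, xs (R.seg S y).1 ≤ X
  wf : ∀ q ∈ E, q.1 ≤ q.2.1 ∧ q.2.1 < R.n ∧ q.2.2.1 ≤ q.2.2.2 ∧ q.2.2.2 < R.n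
  disj : E.Pairwise fun q q' => ∀ x y, Covers q x y → ¬ Covers q' x y
  cover : ∀ x y, y < R.n → ((∃ q ∈ E, Covers q x y) ↔ x < xs (R.seg S y).1 ∧ R.Positive x y)
  -- In the columns swept but not yet written, the colour of the current segment is already the
  -- correct one, so the pending part of a segment is a single rectangle.
  pending : ∀ x y, y < R.n → xs (R.seg S y).1 ≤ x → x < X →
    (R.Positive x y ↔ (R.seg S y).2.2 ≠ 0)

theorem Sweep.init (Z : ℕ → ℕ) (xs : ℕ → ℕ) (hxs : xs 0 = 0) : R.Sweep Z 0 [] 0 xs [] where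
  stack := ⟨List.Pairwise.nil, by simp, List.nodup_nil⟩
  X_le := Nat.zero_le _
  mem := by simp
  old := by simp
  new := by simp
  xs_le := by simp [seg, hxs]
  wf := by simp
  disj := List.Pairwise.nil
  cover := by simp [seg, hxs]
  pending := by simp

namespace Sweep

variable {Z : ℕ → ℕ} {k X X' : ℕ} {S : List ℕ} {xs : ℕ → ℕ} {E : List (ℕ × ℕ × ℕ × ℕ)}
  (L : R.Laminar)
include L

/-- Between `X` and `X'` no rectangle begins or ends, so in these columns the stack consists of
exactly the rectangles meeting the column, and `positive_iff` applies. -/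
theorem advance (hZ : R.IsOrder Z) (H : R.Sweep Z k S X xs E) (hXX : X ≤ X') (hX' : X' ≤ R.n)
    (h1 : ∀ r ∈ S, X' ≤ R.x2 r) (h2 : ∀ l, k ≤ l → l < R.p → X' ≤ R.x1 (Z l)) :
    R.Sweep Z k S X' xs E where
  stack := H.stack
  X_le := hX'
  mem r hr := ⟨(H.mem r hr).1, (H.mem r hr).2.1.trans hXX, h1 r hr⟩
  old l hl hm := (H.old l hl hm).trans hXX
  new := h2
  xs_le y hy := (H.xs_le y hy).trans hXX
  wf := H.wf
  disj := H.disj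
  cover := H.cover
  pending x y hy hx hx' := by
    rcases lt_or_ge x X with h | h
    · exact H.pending x y hy hx h
    · refine L.positive_iff H.stack hy fun i hi => ⟨fun hiS => ?_, fun hix => ?_⟩
      · have := H.mem i hiS
        have := h1 i hiS
        omega
      · obtain ⟨l, hl, rfl⟩ := hZ.surj hi
        by_contra hn
        rcases lt_or_ge l k with hlk | hlk
        · have := H.old l hlk hn
          omega
        · have := h2 l hlk hl
          omega

/-- Write the rectangle of the segment with start `s` up to the column `X`. -/
theorem flush (H : R.Sweep Z k S X xs E) {s : ℕ} (hs : s < R.n) (hss : (R.seg S s).1 = s) :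
    R.Sweep Z k S X (Function.update xs s X)
      -- Tuples describe closed intervals, whence the two subtractions of 1. The test `xs s < X`
      -- avoids empty tuples.
      (if (R.seg S s).2.2 ≠ 0 ∧ xs s < X then
        E ++ [(xs s, X - 1, s, (R.seg S s).2.1 - 1)] else E) := by
  have hX := H.X_le
  have hlt := L.lt_finish H.stack hs
  have hle := L.finish_le H.stack hs
  have hxs := H.xs_le s hs
  rw [hss] at hxs
  have hmem : ∀ y < R.n, (R.seg S y).1 = s ↔ s ≤ y ∧ y < (R.seg S s).2.1 := by
    intro y hy
    constructor
    · intro h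
      rw [← L.start_eq_of_start_eq H.stack hy hs (h.trans hss.symm)]
      exact ⟨h ▸ L.start_le H.stack hy, L.lt_finish H.stack hy⟩
    · rintro ⟨h1, h2⟩
      rw [L.seg_eq H.stack hs (by omega) h2, hss]
  have hseg : ∀ y < R.n, (R.seg S y).1 = s → R.seg S y = R.seg S s := fun y hy h =>
    L.start_eq_of_start_eq H.stack hy hs (h.trans hss.symm)
  refine ⟨H.stack, H.X_le, H.mem, H.old, H.new, ?_, ?_, ?_, ?_, ?_⟩
  · intro y hy
    have := H.xs_le y hy
    rw [Function.update_apply]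
    split_ifs <;> omega
  · intro q hq
    split_ifs at hq with hc
    · rcases List.mem_append.1 hq with hq | hq
      · exact H.wf q hq
      · rw [List.mem_singleton.1 hq]
        simp only
        omega
    · exact H.wf q hq
  · split_ifs with hc
    · rw [List.pairwise_append]
      refine ⟨H.disj, List.pairwise_singleton _ _, ?_⟩
      intro q hq q' hq' x y h1 h2
      rw [List.mem_singleton.1 hq'] at h2
      simp only [Covers] at h2
      have hy : y < R.n := by omega
      have h3 := (H.cover x y hy).1 ⟨q, hq, h1⟩
      rw [(hmem y hy).2 (by omega)] at h3
      omega
    · exact H.disj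
  · intro x y hy
    have hc := H.cover x y hy
    have hp := H.pending x y hy
    have hm := hmem y hy
    have hsg := hseg y hy
    rw [Function.update_apply]
    split_ifs with h1 h2 h2
    · rw [h2] at hc hp
      rw [hsg h2] at hp
      simp only [List.mem_append, List.mem_singleton, or_and_right, exists_or, exists_eq_left, hc]
      simp only [Covers]
      constructor
      · rintro (⟨h3, h4⟩ | h3)
        · exact ⟨by omega, h4⟩
        · exact ⟨by omega, (hp h3.1 (by omega)).2 h1.1⟩
      · rintro ⟨h3, h4⟩
        by_cases h5 : x < xs s
        · exact Or.inl ⟨h5, h4⟩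
        · right
          have := hm.1 h2
          omega
    · simp only [List.mem_append, List.mem_singleton, or_and_right, exists_or, exists_eq_left, hc]
      refine or_iff_left fun hcov => h2 (hm.2 ?_)
      simp only [Covers] at hcov
      omega
    · rw [hc, h2]
      rw [h2, hsg h2] at hp
      constructor
      · rintro ⟨h3, h4⟩
        exact ⟨by omega, h4⟩
      · rintro ⟨h3, h4⟩
        refine ⟨?_, h4⟩
        by_contra h5
        exact h1 ⟨(hp (by omega) h3).1 h4, by omega⟩
    · exact hc
  · intro x y hy hx hx'
    rw [Function.update_apply] at hx
    split_ifs at hx with h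
    · omega
    · exact H.pending x y hy hx hx'

/-- The segment to be cut has been flushed (`hxs`) and its pieces are registered at the current
column, so nothing is pending there. All other segments stay the same. -/
theorem push (hZ : R.IsOrder Z) (hk : k < R.p) {xs' : ℕ → ℕ}
    (H : R.Sweep Z k S (R.x1 (Z k)) xs E) (hS : ∀ q ∈ S, R.x1 (Z k) < R.x2 q)
    (hxs : xs (R.seg S (R.y1 (Z k))).1 = R.x1 (Z k))
    (h0 : R.IsStack (Z k :: S))
    (h1 : xs' (R.y1 (Z k)) = R.x1 (Z k))
    (h2 : R.y2 (Z k) < (R.seg S (R.y1 (Z k))).2.1 → xs' (R.y2 (Z k)) = R.x1 (Z k))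
    (h3 : ∀ s, s ≠ R.y1 (Z k) → ¬ (s = R.y2 (Z k) ∧ R.y2 (Z k) < (R.seg S (R.y1 (Z k))).2.1) →
      xs' s = xs s) :
    R.Sweep Z (k + 1) (Z k :: S) (R.x1 (Z k)) xs' E := by
  have hb := L.stack_bounds h0
  have hxlt := L.x_lt (Z k) (hZ.lt k hk)
  have key : ∀ y < R.n, xs' (R.seg (Z k :: S) y).1 = xs (R.seg S y).1 ∧
      (xs (R.seg S y).1 = R.x1 (Z k) ∨ R.seg (Z k :: S) y = R.seg S y) := by
    intro y hy
    rcases L.start_cons h0 hy with ⟨h4, h5, h6, h7⟩ | ⟨h4, h5, h6⟩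
    · rw [h6, h7, hxs]
      refine ⟨?_, Or.inl rfl⟩
      split_ifs with h8 h9
      · simp only
        rw [h3 _ (by omega) (by omega), hxs]
      · exact h1
      · exact h2 (by omega)
    · rw [h5]
      exact ⟨h3 _ (by omega) (by omega), Or.inr rfl⟩
  refine ⟨h0, H.X_le, ?_, ?_, ?_, ?_, H.wf, H.disj, ?_, ?_⟩
  · intro r hr
    rcases List.mem_cons.1 hr with rfl | hr
    · exact ⟨⟨k, by omega, rfl⟩, le_rfl, hxlt.le⟩
    · obtain ⟨⟨l, hl, rfl⟩, h5, h6⟩ := H.mem r hr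
      exact ⟨⟨l, by omega, rfl⟩, h5, h6⟩
  · intro l hl hm
    simp only [List.mem_cons, not_or] at hm
    rcases Nat.lt_succ_iff_lt_or_eq.1 hl with h | rfl
    · exact H.old l h hm.2
    · exact absurd rfl hm.1
  · intro l hl hl'
    exact H.new l (by omega) hl'
  · intro y hy
    rw [(key y hy).1]
    exact H.xs_le y hy
  · intro x y hy
    rw [(key y hy).1]
    exact H.cover x y hy
  · intro x y hy hx hx'
    rw [(key y hy).1] at hx
    rcases (key y hy).2 with h | h
    · omega
    · rw [h]; exact H.pending x y hy hx hx'

/-- An item `q` on the stack comes earlier in the order and still reaches beyond the column `x1 (Z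
k)`, so its x-interval meets that of `Z k` and contains it by laminarity and the order. If the
y-intervals meet too, the rectangles are nested, and the tie-breaking by height leaves only the
inclusion of the new one in `q`. -/
theorem isStack_push (hZ : R.IsOrder Z) (hk : k < R.p) (H : R.Sweep Z k S X xs E)
    (hS : ∀ q ∈ S, R.x1 (Z k) < R.x2 q) : R.IsStack (Z k :: S) := by
  refine ⟨List.pairwise_cons.2 ⟨fun q hq => ?_, H.stack.nested⟩, ?_, ?_⟩
  · obtain ⟨⟨l, hl, rfl⟩, h1, h2⟩ := H.mem q hq
    have h3 := hZ.before l k hl hk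
    have hk' := hZ.lt k hk
    have hl' := hZ.lt l (hl.trans hk)
    have h4 := hS _ hq
    have h5 := L.lam_x _ hk' _ hl'
    have h6 := L.lam _ hk' _ hl' fun h => by
      have := hZ.inj k hk l (hl.trans hk) h
      omega
    have := H.new k le_rfl hk
    have := L.x_lt _ hk'
    have := L.y_lt _ hk'
    have := L.y_lt _ hl'
    unfold Before at h3
    unfold Sub at h6
    unfold Nested
    omega
  · intro q hq
    rcases List.mem_cons.1 hq with rfl | hq
    · exact hZ.lt k hk
    · exact H.stack.lt q hq
  · refine List.nodup_cons.2 ⟨fun hm => ?_, H.stack.nodup⟩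
    obtain ⟨⟨l, hl, h⟩, -⟩ := H.mem _ hm
    have := hZ.inj l (hl.trans hk) k hk h
    omega

/-- When all pieces have been flushed up to the column `x2 r`, nothing is pending in them, so gluing
them does not affect the claims about swept columns. -/
theorem pop {r : ℕ} (H : R.Sweep Z k (r :: S) (R.x2 r) xs E)
    (hxs : ∀ y, (R.seg S (R.y1 r)).1 ≤ y → y < (R.seg S (R.y1 r)).2.1 →
      xs (R.seg (r :: S) y).1 = R.x2 r) (hs : xs (R.seg S (R.y1 r)).1 = R.x2 r) :
    R.Sweep Z k S (R.x2 r) xs E := by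
  have key : ∀ y < R.n, xs (R.seg (r :: S) y).1 = xs (R.seg S y).1 ∧
      (xs (R.seg S y).1 = R.x2 r ∨ R.seg (r :: S) y = R.seg S y) := by
    intro y hy
    rcases L.start_cons H.stack hy with ⟨h4, h5, h6, -⟩ | ⟨h4, h5, -⟩
    · rw [hxs y h4 h5, h6, hs]
      exact ⟨rfl, Or.inl rfl⟩
    · rw [h5]
      exact ⟨rfl, Or.inr rfl⟩
  refine ⟨H.stack.tail, H.X_le, fun q hq => H.mem q (List.mem_cons_of_mem _ hq), ?_, H.new, ?_,
    H.wf, H.disj, ?_, ?_⟩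
  · intro l hl hm
    by_cases hr : Z l = r
    · rw [hr]
    · exact H.old l hl (by simp [hr, hm])
  · intro y hy
    rw [← (key y hy).1]
    exact H.xs_le y hy
  · intro x y hy
    rw [← (key y hy).1]
    exact H.cover x y hy
  · intro x y hy hx hx'
    rcases (key y hy).2 with h | h
    · omega
    · rw [← h]
      rw [← (key y hy).1] at hx
      exact H.pending x y hy hx hx'

end Sweep

/-- At the end the only segment has colour 0. A positive point lies in a rectangle that ends by
column `X`; if it had not been written it would be pending in a segment of colour 0. -/
theorem Sweep.final {Z : ℕ → ℕ} {X : ℕ} {xs : ℕ → ℕ} {E : List (ℕ × ℕ × ℕ × ℕ)}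
    (hZ : R.IsOrder Z) (H : R.Sweep Z R.p [] X xs E) (x y : ℕ) (hy : y < R.n) :
    (∃ q ∈ E, Covers q x y) ↔ R.Positive x y := by
  rw [H.cover x y hy]
  refine ⟨fun h => h.2, fun h => ⟨?_, h⟩⟩
  by_contra hx
  obtain ⟨i, hi, -, hm, -⟩ := id h
  obtain ⟨l, hl, rfl⟩ := hZ.surj hi
  have := H.old l hl (by simp)
  have h1 := (H.pending x y hy (not_lt.1 hx) (by unfold Mem at hm; omega)).1 h
  simp [seg] at h1

end RectFamily

/-! ### Intervals of leaves -/

namespace ParentTree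

variable {N : Type*} (T : ParentTree N)

theorem Anc.refl (u : N) : T.Anc u u := ⟨0, rfl⟩

variable {T}

theorem Anc.trans {u v x : N} (h : T.Anc u v) (h' : T.Anc v x) : T.Anc u x := by
  obtain ⟨i, rfl⟩ := h
  obtain ⟨j, rfl⟩ := h'
  exact ⟨i + j, by rw [Function.iterate_add_apply]⟩

theorem anc_parent (v : N) : T.Anc (T.parent v) v := ⟨1, rfl⟩

theorem anc_root (v : N) : T.Anc T.root v := T.reach v

theorem parent_iterate_root (k : ℕ) : T.parent^[k] T.root = T.root := by
  induction k with
  | zero => rfl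
  | succ k ih => rw [Function.iterate_succ_apply, T.parent_root, ih]

theorem anc_iff {u v : N} : T.Anc u v ↔ u = v ∨ T.Anc u (T.parent v) := by
  constructor
  · rintro ⟨k, rfl⟩
    rcases k with _ | k
    · exact Or.inl rfl
    · exact Or.inr ⟨k, rfl⟩
  · rintro (rfl | h)
    · exact .refl T u
    · exact h.trans (anc_parent v)

/-- Repeating the period often enough climbs past the root, which is a fixed point; so `v` is the
root. -/
theorem eq_root_of_periodic {v : N} {k : ℕ} (hk : 0 < k) (h : T.parent^[k] v = v) :
    v = T.root := by
  obtain ⟨j, hj⟩ := T.reach v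
  have h1 : T.parent^[k * j] v = v := by
    have : Function.IsPeriodicPt T.parent k v := h
    exact this.mul_const j
  rw [← h1, show k * j = (k * j - j) + j by
    have := Nat.le_mul_of_pos_left j hk; omega, Function.iterate_add_apply, hj,
    parent_iterate_root]

theorem Anc.antisymm {u v : N} (h : T.Anc u v) (h' : T.Anc v u) : u = v := by
  obtain ⟨i, rfl⟩ := h
  obtain ⟨j, hj⟩ := h'
  rcases Nat.eq_zero_or_pos i with rfl | hi
  · rfl
  rw [← Function.iterate_add_apply] at hj
  have := eq_root_of_periodic (by omega) hj
  rw [this, parent_iterate_root]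

theorem parent_ne {v : N} (hv : v ≠ T.root) : T.parent v ≠ v := fun h =>
  hv (eq_root_of_periodic (k := 1) one_pos h)

/-- A property of nodes which passes from all children of a node to the node holds everywhere. -/
theorem induction_up [Finite N] {p : N → Prop} (h : ∀ u, (∀ v ∈ T.children u, p v) → p u)
    (u : N) : p u := by
  have hwf : WellFounded fun v u => T.SAnc u v := by
    have : IsTrans N fun v u => T.SAnc u v := ⟨fun a b c hab hbc =>
      ⟨hbc.1.trans hab.1, fun hca => hab.2 (hab.1.antisymm (hca ▸ hbc.1))⟩⟩
    have : Std.Irrefl fun v u => T.SAnc u v := ⟨fun a ha => ha.2 rfl⟩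
    exact Finite.wellFounded_of_trans_of_irrefl _
  induction u using hwf.induction with
  | h u ih =>
    refine h u fun v hv => ih v ⟨?_, ?_⟩
    · rw [← hv.2]; exact anc_parent v
    · rw [← hv.2]; exact parent_ne hv.1

/-- A property of the root which passes from each node to its children holds everywhere. -/
theorem induction_down {p : N → Prop} (h0 : p T.root)
    (h : ∀ u, p u → ∀ v ∈ T.children u, p v) (u : N) : p u := by
  obtain ⟨k, hk⟩ := T.reach u
  induction k generalizing u with
  | zero => rw [show u = T.root from hk]; exact h0
  | succ k ih =>
    by_cases hu : u = T.root
    · rw [hu]; exact h0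
    · exact h _ (ih _ hk) u ⟨hu, rfl⟩

/-- A strict descendant lies below a child. -/
theorem Anc.exists_child {u v : N} (h : T.Anc u v) (hne : u ≠ v) :
    ∃ c ∈ T.children u, T.Anc c v := by
  obtain ⟨k, hk⟩ := h
  induction k generalizing v with
  | zero => exact absurd hk.symm hne
  | succ k ih =>
    by_cases hu : u = T.parent v
    · refine ⟨v, ⟨fun hv => hne ?_, hu.symm⟩, .refl T v⟩
      rw [hu, hv, T.parent_root]
    · obtain ⟨c, hc, hcv⟩ := ih hu hk
      exact ⟨c, hc, hcv.trans (anc_parent v)⟩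

/-- `lo u` is the number of leaves to the left of `u`, and `sz u` the number of leaves below `u`,
for one of the orders of the children. -/
structure Labelling (T : ParentTree N) (lo sz : N → ℕ) : Prop where
  root : lo T.root = 0
  leaf : ∀ u, T.IsLeaf u → sz u = 1
  node : ∀ u, ¬ T.IsLeaf u → ∃ a b, a ≠ b ∧ T.children u = {a, b} ∧ lo a = lo u ∧
    lo b = lo u + sz a ∧ sz u = sz a + sz b

namespace Labelling

variable [Finite N] {lo sz : N → ℕ} (H : T.Labelling lo sz)
include H

theorem pos (u : N) : 0 < sz u := by
  induction u using T.induction_up with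
  | h u ih =>
    by_cases hu : T.IsLeaf u
    · rw [H.leaf u hu]; exact one_pos
    · obtain ⟨a, b, -, hab, -, -, hs⟩ := H.node u hu
      have := ih a (by rw [hab]; simp)
      omega

theorem child {u v : N} (h : v ∈ T.children u) :
    lo u ≤ lo v ∧ lo v + sz v ≤ lo u + sz u ∧ sz v < sz u := by
  have hu : ¬ T.IsLeaf u := fun hu => by
    have : T.children u = ∅ := hu
    rw [this] at h; exact h
  obtain ⟨a, b, -, hab, h1, h2, h3⟩ := H.node u hu
  have := H.pos a
  have := H.pos b
  rw [hab] at h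
  rcases h with rfl | rfl <;> omega

theorem sub {u v : N} (h : T.Anc u v) :
    lo u ≤ lo v ∧ lo v + sz v ≤ lo u + sz u ∧ (u ≠ v → sz v < sz u) := by
  obtain ⟨k, hk⟩ := h
  induction k generalizing v with
  | zero => rw [show v = u from hk]; simp
  | succ k ih =>
    by_cases hv : v = T.root
    · rw [hv, parent_iterate_root] at hk
      rw [hv, hk]; simp
    · have h1 := ih hk
      have h2 := H.child (u := T.parent v) (v := v) ⟨hv, rfl⟩
      refine ⟨by omega, by omega, fun _ => ?_⟩
      by_cases h3 : u = T.parent v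
      · rw [h3]; exact h2.2.2
      · exact h2.2.2.trans (h1.2.2 h3)

/-- Nodes whose intervals meet are comparable. -/
theorem comparable {u v : N} {x : ℕ} (h1 : lo u ≤ x) (h2 : x < lo u + sz u) (h3 : lo v ≤ x)
    (h4 : x < lo v + sz v) : T.Anc u v ∨ T.Anc v u := by
  induction u using T.induction_down with
  | h0 => exact Or.inl (anc_root v)
  | h u ih c hc =>
    have hcu := H.child hc
    rcases ih (by omega) (by omega) with h | h
    · by_cases huv : u = v
      · right
        rw [← huv, ← hc.2]; exact anc_parent c
      · obtain ⟨d, hd, hdv⟩ := h.exists_child huv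
        have hdv' := H.sub hdv
        by_cases hcd : c = d
        · exact Or.inl (hcd ▸ hdv)
        -- The point would lie in the intervals of two different children of `u`, but these are
        -- consecutive and disjoint.
        · have hu : ¬ T.IsLeaf u := fun hu => by
            have : T.children u = ∅ := hu
            rw [this] at hc; exact hc
          obtain ⟨a, b, -, hab, h5, h6, h7⟩ := H.node u hu
          rw [hab] at hc hd
          rcases hc with rfl | rfl <;> rcases hd with rfl | rfl
          · exact absurd rfl hcd
          · omega
          · omega
          · exact absurd rfl hcd
    · right
      refine h.trans ?_
      rw [← hc.2]; exact anc_parent c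

/-- Nested intervals meet, so the nodes are comparable; the wrong direction is excluded because a
strict descendant has strictly fewer leaves. -/
theorem anc_iff {u v : N} : T.Anc u v ↔ lo u ≤ lo v ∧ lo v + sz v ≤ lo u + sz u := by
  refine ⟨fun h => ⟨(H.sub h).1, (H.sub h).2.1⟩, fun ⟨h1, h2⟩ => ?_⟩
  have hv := H.pos v
  rcases H.comparable (u := u) (v := v) (x := lo v) h1 (by omega) le_rfl (by omega) with h | h
  · exact h
  · have h3 := H.sub h
    by_cases huv : v = u
    · rw [huv]; exact .refl T u
    · have := h3.2.2 huv
      omega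

theorem eq_of_eq {u v : N} (h1 : lo u = lo v) (h2 : sz u = sz v) : u = v :=
  Anc.antisymm (T := T) (H.anc_iff.2 (by omega)) (H.anc_iff.2 (by omega))

theorem disjoint_or (u v : N) :
    lo u + sz u ≤ lo v ∨ lo v + sz v ≤ lo u ∨ T.Anc u v ∨ T.Anc v u := by
  have := H.pos u
  have := H.pos v
  by_contra h
  simp only [not_or, not_le] at h
  obtain ⟨h1, h2, h3, h4⟩ := h
  rcases H.comparable (u := u) (v := v) (x := max (lo u) (lo v)) (by omega) (by omega) (by omega)
    (by omega) with h | h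
  · exact h3 h
  · exact h4 h

theorem exists_leaf {u : N} {x : ℕ} (h1 : lo u ≤ x) (h2 : x < lo u + sz u) :
    ∃ v, T.IsLeaf v ∧ lo v = x := by
  induction u using T.induction_up with
  | h u ih =>
    by_cases hu : T.IsLeaf u
    · have := H.leaf u hu
      exact ⟨u, hu, by omega⟩
    · obtain ⟨a, b, -, hab, h5, h6, h7⟩ := H.node u hu
      rcases lt_or_ge x (lo a + sz a) with h | h
      · exact ih a (by rw [hab]; simp) (by omega) h
      · exact ih b (by rw [hab]; simp) (by omega) (by omega)

theorem le_root (u : N) : lo u + sz u ≤ sz T.root := by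
  have := (H.sub (anc_root u)).2.1
  rw [H.root] at this
  omega

end Labelling

/-- A full binary tree with `n` leaves has `2 * n - 1` nodes. -/
theorem card_nodes {m n : ℕ} {T : ParentTree (Fin m)} (hT : T.IsFullBinary) {leaf : Fin n → Fin m}
    (hinj : Function.Injective leaf) (hleaf : Set.range leaf = {x | T.IsLeaf x}) :
    m + 1 = 2 * n := by
  classical
  have h1 : (Finset.univ.erase T.root).card = m - 1 := by
    rw [Finset.card_erase_of_mem (Finset.mem_univ _), Finset.card_univ, Fintype.card_fin]
  -- Counting the non-root nodes by their parents gives m − 1 = 2(m − n).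
  have h2 := Finset.card_eq_sum_card_fiberwise (s := Finset.univ.erase T.root)
    (t := Finset.univ) (f := T.parent) (fun x _ => by simp)
  have h3 : ∀ u, (Finset.filter (fun v => T.parent v = u) (Finset.univ.erase T.root)).card =
      if T.IsLeaf u then 0 else 2 := by
    intro u
    have hset : ((Finset.filter (fun v => T.parent v = u) (Finset.univ.erase T.root) :
        Finset (Fin m)) : Set (Fin m)) = T.children u := by
      ext v; simp [children]
    split_ifs with hu
    · rw [Finset.card_eq_zero, ← Finset.coe_eq_empty, hset]; exact hu
    · rcases hT u with h | ⟨a, b, hab, h⟩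
      · exact absurd h hu
      · rw [h] at hset
        have : Finset.filter (fun v => T.parent v = u) (Finset.univ.erase T.root) = {a, b} := by
          apply Finset.coe_injective; rw [hset]; simp
        rw [this, Finset.card_pair hab]
  simp only [h3] at h2
  rw [h1, Finset.sum_ite, Finset.sum_const_zero, zero_add, Finset.sum_const, smul_eq_mul] at h2
  have h4 : (Finset.filter (fun u => T.IsLeaf u) Finset.univ).card = n := by
    have : Finset.filter (fun u => T.IsLeaf u) Finset.univ = Finset.univ.image leaf := by
      ext u
      have := Set.ext_iff.1 hleaf u
      simp only [Set.mem_range, Set.mem_ofPred_eq] at this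
      simp [this]
    rw [this, Finset.card_image_of_injective _ hinj, Finset.card_univ, Fintype.card_fin]
  have h5 := Finset.card_filter_add_card_filter_not (s := (Finset.univ : Finset (Fin m)))
    (fun u => T.IsLeaf u)
  rw [Finset.card_univ, Fintype.card_fin] at h5
  have : 0 < m := Fin.pos T.root
  omega

end ParentTree

/-! ### The rectangles of a signed tree model -/

/-- The pair ordered from left to right. -/
def orient {m : ℕ} (lo : Fin m → ℕ) (q : Fin m × Fin m) : Fin m × Fin m :=
  if lo q.2 < lo q.1 then (q.2, q.1) else q

theorem mk_orient {m : ℕ} (lo : Fin m → ℕ) (q : Fin m × Fin m) :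
    s((orient lo q).1, (orient lo q).2) = s(q.1, q.2) := by
  unfold orient
  split_ifs
  · exact Sym2.eq_swap
  · rfl

theorem orient_eq {m : ℕ} {lo : Fin m → ℕ} {q : Fin m × Fin m} {u v : Fin m}
    (h : s(q.1, q.2) = s(u, v)) (huv : lo u < lo v) : orient lo q = (u, v) := by
  unfold orient
  rcases Sym2.eq_iff.1 h with ⟨h1, h2⟩ | ⟨h1, h2⟩
  · rw [if_neg (by rw [h1, h2]; omega), ← h1, ← h2]
  · rw [if_pos (by rw [h1, h2]; omega), ← h1, ← h2]

/-- The rectangles of the pairs in a list, of which the first `a` ones have colour `0`. -/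
def pairRects {m : ℕ} (n a : ℕ) (lo sz : Fin m → ℕ) (L : List (Fin m × Fin m)) (r : Fin m) :
    RectFamily where
  n := n
  p := L.length
  x1 i := lo (orient lo (L.getD i (r, r))).1
  x2 i := lo (orient lo (L.getD i (r, r))).1 + sz (orient lo (L.getD i (r, r))).1
  y1 i := lo (orient lo (L.getD i (r, r))).2
  y2 i := lo (orient lo (L.getD i (r, r))).2 + sz (orient lo (L.getD i (r, r))).2
  col i := if i < a then 0 else 1

section

variable {n m : ℕ} {M : SignedTreeModel (Fin n) (Fin m)} {LA LB : List (Fin m × Fin m)}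
  (hA : ListsPairs LA M.neg) (hB : ListsPairs LB M.pos) {lo sz : Fin m → ℕ}
  (H : M.tree.Labelling lo sz)

theorem ListsPairs.length_eq {α : Type*} [DecidableEq α] {L : List (α × α)} {E : Finset (Sym2 α)}
    (h : ListsPairs L E) : L.length = E.card := by
  have : (L.map fun q => s(q.1, q.2)).toFinset = E := by
    ext e; rw [List.mem_toFinset, h.2 e]
  rw [← this, List.toFinset_card_of_nodup h.1, List.length_map]

theorem SignedTreeModel.pos_iff (M : SignedTreeModel (Fin n) (Fin m)) (H : M.tree.Labelling lo sz)
    {u : Fin m} {a : Fin n} :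
    M.tree.Anc u (M.leaf a) ↔ lo u ≤ lo (M.leaf a) ∧ lo (M.leaf a) < lo u + sz u := by
  have h : sz (M.leaf a) = 1 := H.leaf _ (by
    have : M.leaf a ∈ Set.range M.leaf := ⟨a, rfl⟩
    rw [M.range_leaf] at this; exact this)
  rw [H.anc_iff, h]
  omega

/-- The starts of the leaf intervals are distinct and fill up the interval of the root, so its
length is the number of vertices. -/
theorem SignedTreeModel.sz_root (M : SignedTreeModel (Fin n) (Fin m))
    (H : M.tree.Labelling lo sz) : sz M.tree.root = n := by
  have hlt : ∀ a, lo (M.leaf a) < sz M.tree.root := fun a => by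
    have := H.le_root (M.leaf a)
    have := H.pos (M.leaf a)
    omega
  have hbij : Function.Bijective fun a => (⟨lo (M.leaf a), hlt a⟩ : Fin (sz M.tree.root)) := by
    constructor
    · intro a b hab
      have hab' : lo (M.leaf a) = lo (M.leaf b) := by simpa using hab
      have h1 := (M.pos_iff H (a := a) (u := M.leaf a)).1 (.refl _ _)
      have h2 := (M.pos_iff H (a := b) (u := M.leaf b)).1 (.refl _ _)
      have h3 := (M.pos_iff H (a := a) (u := M.leaf b)).2 (by omega)
      have h4 := (M.pos_iff H (a := b) (u := M.leaf a)).2 (by omega)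
      exact M.leaf_injective (h4.antisymm h3)
    · rintro ⟨x, hx⟩
      obtain ⟨v, hv, hvx⟩ := H.exists_leaf (u := M.tree.root) (x := x) (by rw [H.root]; omega)
        (by rw [H.root]; omega)
      have : v ∈ Set.range M.leaf := by rw [M.range_leaf]; exact hv
      obtain ⟨a, rfl⟩ := this
      exact ⟨a, Fin.ext hvx⟩
  simpa using (Fintype.card_of_bijective hbij).symm

include hA hB

/-- The rectangles are indexed by positions in `LA ++ LB`, anti-edges first, so comparing the index
with the length of `LA` tells the sign. The node `r` is merely the default value of `getD`. -/
theorem item_mem {i : ℕ} (hi : i < (LA ++ LB).length) (r : Fin m) :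
    (s(((LA ++ LB).getD i (r, r)).1, ((LA ++ LB).getD i (r, r)).2) ∈ M.neg ∨
      s(((LA ++ LB).getD i (r, r)).1, ((LA ++ LB).getD i (r, r)).2) ∈ M.pos) ∧
    (LA.length ≤ i → s(((LA ++ LB).getD i (r, r)).1, ((LA ++ LB).getD i (r, r)).2) ∈ M.pos) := by
  rw [List.getD_eq_getElem _ _ hi]
  by_cases h : i < LA.length
  · rw [List.getElem_append_left h]
    refine ⟨Or.inl ((hA.2 _).1 ?_), fun h' => by omega⟩
    exact List.mem_map_of_mem (List.getElem_mem h)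
  · rw [List.getElem_append_right (not_lt.1 h)]
    have : _ ∈ M.pos := (hB.2 _).1 (List.mem_map_of_mem (f := fun q => s(q.1, q.2))
      (List.getElem_mem (l := LB) (n := i - LA.length) (by simp at hi; omega)))
    exact ⟨Or.inr this, fun _ => this⟩

theorem items_nodup : ((LA ++ LB).map fun q => s(q.1, q.2)).Nodup := by
  rw [List.map_append, List.nodup_append]
  refine ⟨hA.1, hB.1, ?_⟩
  rintro e he _ he' rfl
  exact Finset.disjoint_left.1 M.disj ((hA.2 e).1 he) ((hB.2 e).1 he')

theorem item_inj {i j : ℕ} (hi : i < (LA ++ LB).length) (hj : j < (LA ++ LB).length) (r : Fin m)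
    (h : s(((LA ++ LB).getD i (r, r)).1, ((LA ++ LB).getD i (r, r)).2) =
      s(((LA ++ LB).getD j (r, r)).1, ((LA ++ LB).getD j (r, r)).2)) : i = j := by
  rw [List.getD_eq_getElem _ _ hi, List.getD_eq_getElem _ _ hj] at h
  have := (items_nodup hA hB).getElem_inj_iff (i := i) (hi := by simpa using hi) (j := j)
    (hj := by simpa using hj)
  simp only [List.getElem_map] at this
  exact this.1 h

theorem exists_item {e : Sym2 (Fin m)} (he : e ∈ M.neg ∨ e ∈ M.pos) (r : Fin m) :
    ∃ i < (LA ++ LB).length, (e ∈ M.pos → LA.length ≤ i) ∧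
      s(((LA ++ LB).getD i (r, r)).1, ((LA ++ LB).getD i (r, r)).2) = e := by
  rcases he with he | he
  · obtain ⟨q, hq, rfl⟩ := List.mem_map.1 ((hA.2 e).2 he)
    obtain ⟨i, hi, rfl⟩ := List.getElem_of_mem hq
    refine ⟨i, by simp; omega, fun h => absurd h (Finset.disjoint_left.1 M.disj he), ?_⟩
    rw [List.getD_eq_getElem _ _ (by simp; omega), List.getElem_append_left hi]
  · obtain ⟨q, hq, rfl⟩ := List.mem_map.1 ((hB.2 e).2 he)
    obtain ⟨i, hi, rfl⟩ := List.getElem_of_mem hq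
    refine ⟨LA.length + i, by simp; omega, fun _ => by omega, ?_⟩
    rw [List.getD_eq_getElem _ _ (by simp; omega), List.getElem_append_right (by omega)]
    simp

include H

/-- The ends of a transversal pair are incomparable, so their intervals are disjoint, and `orient`
puts the left one first. -/
theorem orient_spec {i : ℕ} (hi : i < (LA ++ LB).length) (r : Fin m) {u v : Fin m}
    (h : orient lo ((LA ++ LB).getD i (r, r)) = (u, v)) :
    (s(u, v) ∈ M.neg ∨ s(u, v) ∈ M.pos) ∧ lo u + sz u ≤ lo v := by
  have h1 := (item_mem hA hB hi r).1
  rw [← mk_orient lo, h] at h1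
  refine ⟨h1, ?_⟩
  obtain ⟨a, b, hab, h2, h3⟩ := M.transversal _ h1
  have huv : ¬ M.tree.Anc u v ∧ ¬ M.tree.Anc v u := by
    rcases Sym2.eq_iff.1 hab with ⟨rfl, rfl⟩ | ⟨rfl, rfl⟩
    · exact ⟨h2, h3⟩
    · exact ⟨h3, h2⟩
  have hle : lo u ≤ lo v := by
    unfold orient at h
    split_ifs at h with hc
    · rw [Prod.mk.injEq] at h
      rw [← h.1, ← h.2]; exact hc.le
    · rw [h] at hc; exact not_lt.1 hc
  have := H.pos u
  have := H.pos v
  rcases H.disjoint_or u v with h | h | h | h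
  · exact h
  · omega
  · exact absurd h huv.1
  · exact absurd h huv.2

/-- If the ends on one side are incomparable, the rectangles are disjoint in that coordinate. If
they are comparable on both sides, strict inclusions in opposite directions would be a crossing;
hence the rectangles are nested. -/
theorem pairRects_laminar (r : Fin m) :
    (pairRects n LA.length lo sz (LA ++ LB) r).Laminar := by
  refine ⟨?_, ?_, ?_, ?_, ?_, ?_, ?_⟩
  · intro i _
    have := H.pos (orient lo ((LA ++ LB).getD i (r, r))).1
    simp only [pairRects]
    omega
  · intro i hi
    exact (orient_spec hA hB H hi r (u := _) (v := _) rfl).2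
  · intro i _
    have := H.pos (orient lo ((LA ++ LB).getD i (r, r))).2
    simp only [pairRects]
    omega
  · intro i _
    have := H.le_root (orient lo ((LA ++ LB).getD i (r, r))).2
    rw [M.sz_root H] at this
    exact this
  · intro i _ j _
    have := H.disjoint_or (orient lo ((LA ++ LB).getD i (r, r))).1
      (orient lo ((LA ++ LB).getD j (r, r))).1
    rw [H.anc_iff, H.anc_iff] at this
    simp only [pairRects]
    omega
  · intro i hi j hj hij
    obtain ⟨⟨u, v⟩, hu⟩ : ∃ q, orient lo ((LA ++ LB).getD i (r, r)) = q := ⟨_, rfl⟩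
    obtain ⟨⟨u', v'⟩, hu'⟩ : ∃ q, orient lo ((LA ++ LB).getD j (r, r)) = q := ⟨_, rfl⟩
    have h1 := orient_spec hA hB H hi r hu
    have h2 := orient_spec hA hB H hj r hu'
    simp only [pairRects, RectFamily.Sub, hu, hu']
    have hcross := M.noncrossing _ _ h1.1 h2.1
    have hcross' := M.noncrossing _ _ h2.1 h1.1
    -- Only crossings that compare left ends with left ends and right ends with right ends are
    -- needed.
    have hc1 : ¬ (M.tree.SAnc u u' ∧ M.tree.SAnc v' v) := fun h =>
      hcross ⟨⟨u, by simp, u', by simp, h.1⟩, ⟨v', by simp, v, by simp, h.2⟩⟩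
    have hc2 : ¬ (M.tree.SAnc u' u ∧ M.tree.SAnc v v') := fun h =>
      hcross' ⟨⟨u', by simp, u, by simp, h.1⟩, ⟨v, by simp, v', by simp, h.2⟩⟩
    have hx := H.disjoint_or u u'
    have hy := H.disjoint_or v v'
    simp only [ParentTree.SAnc, not_and, not_not] at hc1 hc2
    by_cases hu0 : u = u'
    · subst hu0
      rw [H.anc_iff, H.anc_iff] at hy
      omega
    · by_cases hv0 : v = v'
      · subst hv0
        rw [H.anc_iff, H.anc_iff] at hx
        omega
      · have hc1' : M.tree.Anc u u' → ¬ M.tree.Anc v' v := fun h h' =>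
          hv0 (hc1 ⟨h, hu0⟩ h').symm
        have hc2' : M.tree.Anc u' u → ¬ M.tree.Anc v v' := fun h h' =>
          hv0 (hc2 ⟨h, Ne.symm hu0⟩ h')
        rw [H.anc_iff, H.anc_iff] at hx hy hc1' hc2'
        omega
  · intro i hi j hj h1 h2
    refine item_inj hA hB hi hj r ?_
    rw [← mk_orient lo, ← mk_orient lo ((LA ++ LB).getD j (r, r))]
    simp only [pairRects, RectFamily.Sub] at h1 h2
    rw [H.eq_of_eq (u := (orient lo ((LA ++ LB).getD i (r, r))).1)
      (v := (orient lo ((LA ++ LB).getD j (r, r))).1) (by omega) (by omega),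
      H.eq_of_eq (u := (orient lo ((LA ++ LB).getD i (r, r))).2)
      (v := (orient lo ((LA ++ LB).getD j (r, r))).2) (by omega) (by omega)]

/-- A pair in between in the sense of `Covers` is the same as another rectangle that contains the
point and lies inside the given one. So being covered by an edge means that the smallest rectangle
around the point has colour 1. -/
theorem pairRects_positive (r : Fin m) {a b : Fin n} (hab : lo (M.leaf a) < lo (M.leaf b)) :
    (pairRects n LA.length lo sz (LA ++ LB) r).Positive (lo (M.leaf a)) (lo (M.leaf b)) ↔
      M.graph.Adj a b := by
  -- A pair above the leaves of `a` and `b` has its left end above the left leaf, so its orientation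
  -- agrees with that of the point.
  have hor : ∀ {u v : Fin m}, (s(u, v) ∈ M.neg ∨ s(u, v) ∈ M.pos) → M.tree.Anc u (M.leaf a) →
      M.tree.Anc v (M.leaf b) → ∃ i < (LA ++ LB).length, (s(u, v) ∈ M.pos → LA.length ≤ i) ∧
      orient lo ((LA ++ LB).getD i (r, r)) = (u, v) := by
    intro u v huv hu hv
    obtain ⟨i, hi, hp, hi'⟩ := exists_item hA hB huv r
    refine ⟨i, hi, hp, orient_eq hi' ?_⟩
    obtain ⟨⟨u', v'⟩, h3⟩ : ∃ q, orient lo ((LA ++ LB).getD i (r, r)) = q := ⟨_, rfl⟩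
    have h4 := (orient_spec hA hB H hi r h3).2
    have h5 := mk_orient lo ((LA ++ LB).getD i (r, r))
    rw [h3, hi'] at h5
    change s(u', v') = s(u, v) at h5
    rw [M.pos_iff H] at hu hv
    have := H.pos u'
    rcases Sym2.eq_iff.1 h5 with ⟨rfl, rfl⟩ | ⟨rfl, rfl⟩ <;> omega
  constructor
  · rintro ⟨i, hi, hc, ⟨h1, h2, h3, h4⟩, hmin⟩
    have hi' : LA.length ≤ i := by
      by_contra h
      exact hc (by simp only [pairRects]; rw [if_pos (by omega)])
    obtain ⟨⟨u, v⟩, hu⟩ : ∃ q, orient lo ((LA ++ LB).getD i (r, r)) = q := ⟨_, rfl⟩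
    simp only [pairRects, hu] at h1 h2 h3 h4
    have he := (item_mem hA hB hi r).2 hi'
    rw [← mk_orient lo, hu] at he
    refine ⟨s(u, v), he, u, v, rfl, (M.pos_iff H).2 ⟨h1, h2⟩, (M.pos_iff H).2 ⟨h3, h4⟩, ?_⟩
    rintro ⟨u', v', he', hne, h5, h6, h7, h8⟩
    obtain ⟨j, hj, -, hj'⟩ := hor he' h6 h8
    rw [M.pos_iff H] at h6 h8
    rw [H.anc_iff] at h5 h7
    have := hmin j hj (by simp only [pairRects, RectFamily.Mem, hj']; omega)
      (by simp only [pairRects, RectFamily.Sub, hj', hu]; omega)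
    subst this
    rw [hj'] at hu
    rw [Prod.mk.injEq] at hu
    exact hne (by rw [hu.1, hu.2])
  · rintro ⟨e, he, u, v, rfl, hu, hv, hno⟩
    obtain ⟨i, hi, hp, hi'⟩ := hor (Or.inr he) hu hv
    have hu' := (M.pos_iff H).1 hu
    have hv' := (M.pos_iff H).1 hv
    refine ⟨i, hi, ?_, ?_, ?_⟩
    · have := hp he
      simp only [pairRects]; rw [if_neg (by omega)]; exact one_ne_zero
    · simp only [pairRects, RectFamily.Mem, hi']; omega
    · intro j hj hm hs
      obtain ⟨⟨u', v'⟩, hj'⟩ : ∃ q, orient lo ((LA ++ LB).getD j (r, r)) = q := ⟨_, rfl⟩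
      simp only [pairRects, RectFamily.Sub, RectFamily.Mem, hj', hi'] at hm hs
      by_contra hji
      refine hno ⟨u', v', (orient_spec hA hB H hj r hj').1, fun heq => hji ?_,
        H.anc_iff.2 (by omega), (M.pos_iff H).2 (by omega), H.anc_iff.2 (by omega),
        (M.pos_iff H).2 (by omega)⟩
      refine item_inj hA hB hj hi r ?_
      rw [← mk_orient lo, ← mk_orient lo ((LA ++ LB).getD i (r, r)), hj', hi']
      exact heq

end

/-! ### From rectangles to bicliques -/

/-- The biclique of a tuple of numbers. -/
def toBiclique {n : ℕ} (hn : 0 < n) (q : ℕ × ℕ × ℕ × ℕ) : Biclique n where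
  a := ⟨q.1 % n, Nat.mod_lt _ hn⟩
  b := ⟨q.2.1 % n, Nat.mod_lt _ hn⟩
  c := ⟨q.2.2.1 % n, Nat.mod_lt _ hn⟩
  d := ⟨q.2.2.2 % n, Nat.mod_lt _ hn⟩

/-- All rectangles lie strictly above the diagonal. Hence the two sides are disjoint, and every edge
corresponds to exactly one point (i, j) with i < j, so disjoint rectangles have disjoint edge sets.
-/
theorem exists_partition {n : ℕ} (hn : 0 < n) {G : SimpleGraph (Fin n)} (ord : Fin n ≃ Fin n)
    {E : List (ℕ × ℕ × ℕ × ℕ)}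
    (hwf : ∀ q ∈ E, q.1 ≤ q.2.1 ∧ q.2.1 < n ∧ q.2.2.1 ≤ q.2.2.2 ∧ q.2.2.2 < n)
    (hdisj : E.Pairwise fun q q' => ∀ x y, RectFamily.Covers q x y → ¬ RectFamily.Covers q' x y)
    (hlt : ∀ q ∈ E, ∀ x y, RectFamily.Covers q x y → x < y)
    (hcover : ∀ i j : Fin n, i < j →
      ((∃ q ∈ E, RectFamily.Covers q i j) ↔ G.Adj (ord i) (ord j))) :
    ∃ I : IntervalBicliquePartition (n := n) G, I.IsCode [List.ofFn fun i => (ord i : ℕ),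
      E.map fun q => q.1, E.map fun q => q.2.1, E.map fun q => q.2.2.1,
      E.map fun q => q.2.2.2] ∧ I.bicliques.length = E.length := by
  have hval : ∀ q ∈ E, ((toBiclique hn q).a : ℕ) = q.1 ∧ ((toBiclique hn q).b : ℕ) = q.2.1 ∧
      ((toBiclique hn q).c : ℕ) = q.2.2.1 ∧ ((toBiclique hn q).d : ℕ) = q.2.2.2 := by
    intro q hq
    have := hwf q hq
    exact ⟨Nat.mod_eq_of_lt (by omega), Nat.mod_eq_of_lt (by omega), Nat.mod_eq_of_lt (by omega),
      Nat.mod_eq_of_lt (by omega)⟩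
  have hedge : ∀ q ∈ E, ∀ e, e ∈ (toBiclique hn q).edges ord ↔
      ∃ i j : Fin n, RectFamily.Covers q i j ∧ e = s(ord i, ord j) := by
    intro q hq e
    obtain ⟨h1, h2, h3, h4⟩ := hval q hq
    simp only [Biclique.edges, Set.mem_ofPred_eq, Set.mem_Icc, RectFamily.Covers, Fin.le_def, h1,
      h2, h3, h4]
    constructor
    · rintro ⟨i, hi, j, hj, rfl⟩
      exact ⟨i, j, ⟨hi.1, hi.2, hj.1, hj.2⟩, rfl⟩
    · rintro ⟨i, j, hij, rfl⟩
      exact ⟨i, ⟨hij.1, hij.2.1⟩, j, hij.2.2, rfl⟩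
  refine ⟨⟨ord, E.map (toBiclique hn), ?_, ?_, ?_, ?_⟩, ?_, by simp⟩
  · intro b hb
    obtain ⟨q, hq, rfl⟩ := List.mem_map.1 hb
    have := hwf q hq
    obtain ⟨h1, h2, h3, h4⟩ := hval q hq
    rw [Fin.le_def, Fin.le_def, h1, h2, h3, h4]
    omega
  · intro b hb
    obtain ⟨q, hq, rfl⟩ := List.mem_map.1 hb
    obtain ⟨h1, h2, h3, h4⟩ := hval q hq
    rw [Set.disjoint_left]
    intro z hz hz'
    rw [Set.mem_Icc, Fin.le_def, Fin.le_def] at hz hz'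
    exact lt_irrefl _ (hlt q hq z z ⟨by omega, by omega, by omega, by omega⟩)
  · rw [List.pairwise_map]
    refine hdisj.imp_of_mem fun {q q'} hq hq' h => ?_
    rw [Set.disjoint_left]
    intro e he he'
    rw [hedge q hq] at he
    rw [hedge q' hq'] at he'
    obtain ⟨i, j, hij, rfl⟩ := he
    obtain ⟨i', j', hij', heq⟩ := he'
    have h1 := hlt q hq _ _ hij
    have h2 := hlt q' hq' _ _ hij'
    rcases Sym2.eq_iff.1 heq with ⟨h3, h4⟩ | ⟨h3, h4⟩
    · rw [← ord.injective h3, ← ord.injective h4] at hij'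
      exact h _ _ hij hij'
    · rw [ord.injective h3, ord.injective h4] at h1
      omega
  · ext e
    simp only [Set.mem_ofPred_eq, List.mem_map]
    constructor
    · rintro ⟨_, ⟨q, hq, rfl⟩, he⟩
      rw [hedge q hq] at he
      obtain ⟨i, j, hij, rfl⟩ := he
      rw [SimpleGraph.mem_edgeSet]
      exact (hcover i j (hlt q hq _ _ hij)).1 ⟨q, hq, hij⟩
    · induction e using Sym2.ind with
      | h a b =>
        rw [SimpleGraph.mem_edgeSet]
        intro hadj
        obtain ⟨i, rfl⟩ := ord.surjective a
        obtain ⟨j, rfl⟩ := ord.surjective b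
        rcases lt_trichotomy i j with h | rfl | h
        · obtain ⟨q, hq, hc⟩ := (hcover i j h).2 hadj
          exact ⟨_, ⟨q, hq, rfl⟩, (hedge q hq _).2 ⟨i, j, hc, rfl⟩⟩
        · exact absurd hadj (SimpleGraph.irrefl _)
        · obtain ⟨q, hq, hc⟩ := (hcover j i h).2 hadj.symm
          exact ⟨_, ⟨q, hq, rfl⟩, (hedge q hq _).2 ⟨j, i, hc, Sym2.eq_swap⟩⟩
  · simp only [IntervalBicliquePartition.IsCode, List.map_map]
    congr 2
    · exact List.map_congr_left fun q hq => (hval q hq).1.symm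
    congr 1
    · exact List.map_congr_left fun q hq => (hval q hq).2.1.symm
    congr 1
    · exact List.map_congr_left fun q hq => (hval q hq).2.2.1.symm
    congr 1
    · exact List.map_congr_left fun q hq => (hval q hq).2.2.2.symm

/-! ### Computing the intervals of the nodes

Registers: `10`, `11` number of vertices and of nodes, `12` number of anti-edges, `13` number of
pairs, `14` root, `15` – `19` scratch. Arrays: `10`, `11` first and second child plus one, `12` nodes
in breadth-first order, `13` numbers of leaves, `14` starts of the intervals. -/

section

variable {m n w : ℕ} {T : ParentTree (Fin m)}

/-- `L u` and `R u` are the children of `u` plus one, and `L u = 0` if `u` is a leaf. -/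
def ChildArrays (T : ParentTree (Fin m)) (L R : ℕ → ℕ) : Prop :=
  ∀ u : Fin m, (T.IsLeaf u ∧ L u = 0) ∨
    ∃ a b : Fin m, a ≠ b ∧ T.children u = {a, b} ∧ L u = a + 1 ∧ R u = b + 1

def findChildren : Prog := blk [
  .assign 15 0,
  .loop (.lt (ℛ 15) (ℛ 11)) (blk [
    .assign 16 (𝒜 0 (ℛ 15)),
    .ite (.eq (ℛ 16) (ℛ 15)) (.assign 14 (ℛ 15))
      (.ite (𝒜 10 (ℛ 16)) (.store 11 (ℛ 16) (ℛ 15 + 1)) (.store 10 (ℛ 16) (ℛ 15 + 1))),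
    .assign 15 (ℛ 15 + 1)])]

/-- The children with number less than `i` have been entered for the node `u`. -/
def ChildInv (T : ParentTree (Fin m)) (L R : ℕ → ℕ) (i : ℕ) (u : Fin m) : Prop :=
  ((∀ v ∈ T.children u, i ≤ v.1) ∧ L u = 0) ∨
  (∃ a ∈ T.children u, a.1 < i ∧ (∀ v ∈ T.children u, v.1 < i → v = a) ∧ L u = a + 1) ∨
  ∃ a ∈ T.children u, ∃ b ∈ T.children u, a ≠ b ∧ a.1 < i ∧ b.1 < i ∧ L u = a + 1 ∧ R u = b + 1

theorem ChildInv.finish {L R : ℕ → ℕ} (hT : T.IsFullBinary) (h : ∀ u, ChildInv T L R m u) :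
    ChildArrays T L R := by
  intro u
  rcases h u with ⟨h1, h2⟩ | ⟨a, ha, -, h1, -⟩ | ⟨a, ha, b, hb, hab, -, -, h1, h2⟩
  · refine Or.inl ⟨Set.eq_empty_of_forall_notMem fun v hv => ?_, h2⟩
    have := h1 v hv
    omega
  · exfalso
    rcases hT u with h | ⟨c, d, hcd, h⟩
    · have h' : T.children u = ∅ := h
      rw [h'] at ha; exact ha
    · have h2 := h1 c (by rw [h]; simp) c.2
      have h3 := h1 d (by rw [h]; simp) d.2
      exact hcd (h2.trans h3.symm)
  · refine Or.inr ⟨a, b, hab, ?_, h1, h2⟩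
    rcases hT u with h | ⟨c, d, hcd, h⟩
    · have h' : T.children u = ∅ := h
      rw [h'] at ha; exact ha.elim
    · rw [h] at ha hb ⊢
      rcases ha with rfl | rfl <;> rcases hb with rfl | rfl
      · exact absurd rfl hab
      · rfl
      · exact Set.pair_comm _ _
      · exact absurd rfl hab

theorem findChildren_runs {s : State} (hT : T.IsFullBinary) (hW : 8 * m + 8 < 2 ^ w)
    (hm : s.reg 11 = m) (hpar : ∀ v : Fin m, s.arr 0 v = T.parent v)
    (h0 : ∀ j, s.arr 10 j = 0) :
    Runs w findChildren s (60 * m + 20) fun s' =>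
      ChildArrays T (s'.arr 10) (s'.arr 11) ∧ s'.reg 14 = T.root := by
  have hw0 : w ≠ 0 := by rintro rfl; simp at hW
  have hW1 : 1 < 2 ^ w := by omega
  refine Runs.seq (T := 2) (T' := 60 * m + 18)
    (R := fun t => t = s.setReg 15 0) (.straight (by simp) rfl) ?_ (by omega)
  rintro _ - rfl
  refine Runs.forLoop (fun i t => t.reg 15 = i ∧
    (∀ u, ChildInv T (t.arr 10) (t.arr 11) i u) ∧ (T.root.1 < i → t.reg 14 = T.root))
    50 0 m _ (Nat.zero_le _) ?_ ?_ ?_ ?_ ?_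
  · refine ⟨by simp, fun u => Or.inl ⟨by simp, by simp [h0]⟩, by simp⟩
  · rintro i t hf ⟨h1, -, -⟩
    have := hf.reg 11 rfl
    simp [hm] at this
    simp [this, h1, hW1]
  · rintro i t - hi hf ⟨h1, h2, h3⟩
    have hp : t.arr 0 i = T.parent ⟨i, hi⟩ := by
      rw [hf.arr 0 rfl]; exact hpar ⟨i, hi⟩
    refine Runs.seq (T := 3) (T' := 40) (R := fun t' => t'.reg 15 = i ∧
      t'.reg 16 = T.parent ⟨i, hi⟩ ∧ t'.arr = t.arr ∧ t'.reg 14 = t.reg 14)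
      (.straight (by simp [h1, hp]) rfl) ?_ (by omega)
    rintro t1 - ⟨h4, h5, h6, h7⟩
    refine Runs.seq (T := 30) (T' := 10) (R := fun t' => t'.reg 15 = i ∧
      (∀ u, ChildInv T (t'.arr 10) (t'.arr 11) (i + 1) u) ∧
        (T.root.1 < i + 1 → t'.reg 14 = T.root)) ?_ ?_ (by omega)
    -- Node `i` is a child of its parent only, and of no node if it is the root; all other nodes
    -- keep their entries.
    · have hother : ∀ u : Fin m, T.parent ⟨i, hi⟩ ≠ u ∨ (⟨i, hi⟩ : Fin m) = T.root →
          ChildInv T (t.arr 10) (t.arr 11) (i + 1) u := by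
        intro u hu
        have hnc : ∀ v ∈ T.children u, v.1 ≠ i := by
          rintro v hv rfl
          rcases hu with h | h
          · exact h hv.2
          · exact hv.1 h
        rcases h2 u with ⟨h8, h9⟩ | ⟨a, ha, h8, h9, h10⟩ | ⟨a, ha, b, hb, hab, h8, h9, h10⟩
        · refine Or.inl ⟨fun v hv => ?_, h9⟩
          have := h8 v hv
          have := hnc v hv
          omega
        · refine Or.inr (Or.inl ⟨a, ha, by omega, fun v hv hvi => h9 v hv ?_, h10⟩)
          have := hnc v hv
          omega
        · exact Or.inr (Or.inr ⟨a, ha, b, hb, hab, by omega, by omega, h10⟩)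
      by_cases hroot : (⟨i, hi⟩ : Fin m) = T.root
      · have hpi : T.parent ⟨i, hi⟩ = ⟨i, hi⟩ := by rw [hroot, T.parent_root]
        refine .straight ?_ rfl
        simp [hW1, h4, h5, h6, hpi]
        exact ⟨fun u => hother u (Or.inr hroot), fun _ => by rw [← hroot]⟩
      · have hpi : (T.parent ⟨i, hi⟩ : ℕ) ≠ i := fun h => T.parent_ne hroot (Fin.ext h)
        have hri : T.root.1 < i + 1 → T.root.1 < i := fun h => by
          have : T.root.1 ≠ i := fun h' => hroot (Fin.ext h'.symm)
          omega
        have hci : (⟨i, hi⟩ : Fin m) ∈ T.children (T.parent ⟨i, hi⟩) := ⟨hroot, rfl⟩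
        refine .straight ?_ rfl
        simp [hW1, h4, h5, h6, hpi]
        refine ⟨⟨fun _ => by omega, fun _ => by omega⟩, ?_⟩
        split_ifs with hL
        · refine ⟨by simp [h4], fun u => ?_, fun h => by simp [h7, h3 (hri (by omega))]⟩
          simp only [State.setArr_arr, h6, ne_eq, Nat.reduceEqDiff, not_false_eq_true,
            Function.update_of_ne, Function.update_self]
          by_cases hu : T.parent ⟨i, hi⟩ = u
          · subst hu
            refine Or.inr (Or.inl ⟨_, hci, Nat.lt_succ_self _, fun v hv hvi => ?_, by simp⟩)
            rcases h2 (T.parent ⟨i, hi⟩) with ⟨h8, h9⟩ | ⟨a, ha, h8, h9, h10⟩ |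
              ⟨a, ha, b, hb, hab, h8, h9, h10, h11⟩
            · have := h8 v hv
              exact Fin.ext (by simp; omega)
            · omega
            · omega
          · have hne : (u : ℕ) ≠ T.parent ⟨i, hi⟩ := fun h => hu (Fin.ext h.symm)
            have := hother u (Or.inl hu)
            simpa only [ChildInv, Function.update_of_ne hne] using this
        · refine ⟨by simp [h4], fun u => ?_, fun h => by simp [h7, h3 (hri (by omega))]⟩
          simp only [State.setArr_arr, h6, ne_eq, Nat.reduceEqDiff, not_false_eq_true,
            Function.update_of_ne, Function.update_self]
          by_cases hu : T.parent ⟨i, hi⟩ = u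
          · subst hu
            rcases h2 (T.parent ⟨i, hi⟩) with ⟨h8, h9⟩ | ⟨a, ha, h8, h9, h10⟩ |
              ⟨a, ha, b, hb, hab, h8, h9, h10, h11⟩
            · omega
            · refine Or.inr (Or.inr ⟨a, ha, _, hci, fun h => ?_, by omega, Nat.lt_succ_self _, h10,
                by simp⟩)
              rw [h] at h8
              simp at h8
            -- A third child contradicts that the tree is full binary.
            · exfalso
              rcases hT (T.parent ⟨i, hi⟩) with h | ⟨c, d, hcd, h⟩
              · have h' : T.children (T.parent ⟨i, hi⟩) = ∅ := h
                rw [h'] at ha; exact ha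
              · have hai : a ≠ ⟨i, hi⟩ := by rintro rfl; simp at h8
                have hbi : b ≠ ⟨i, hi⟩ := by rintro rfl; simp at h9
                rw [h] at ha hb hci
                simp only [Set.mem_insert_iff, Set.mem_singleton_iff] at ha hb hci
                grind
          · have hne : (u : ℕ) ≠ T.parent ⟨i, hi⟩ := fun h => hu (Fin.ext h.symm)
            have := hother u (Or.inl hu)
            simpa only [ChildInv, Function.update_of_ne hne] using this
    · rintro t2 - ⟨h8, h9, h10⟩
      exact .straight (by simp [h8, hw0]; exact ⟨by omega, h9, fun h => h10 (by omega)⟩) rfl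
  · simp only [Expr.cost, Expr.lt]; omega
  · rintro t - ⟨-, h2, h3⟩
    exact ⟨ChildInv.finish hT h2, h3 T.root.2⟩

/-- The list contains each node once, parents before children. -/
structure IsTopological (T : ParentTree (Fin m)) (q : List (Fin m)) : Prop where
  nodup : q.Nodup
  mem : ∀ v, v ∈ q
  before : ∀ j v, q[j]? = some v → v ≠ T.root → T.parent v ∈ q.take j

theorem IsTopological.length {q : List (Fin m)} (h : IsTopological T q) : q.length = m := by
  have := List.toFinset_card_of_nodup h.nodup
  rw [← this, Finset.eq_univ_of_forall (s := q.toFinset) (fun v => by simpa using h.mem v),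
    Finset.card_univ, Fintype.card_fin]

def traverse : Prog := blk [
  .store 12 0 (ℛ 14),
  .assign 15 0,
  .assign 16 1,
  .loop (.lt (ℛ 15) (ℛ 16)) (blk [
    .assign 17 (𝒜 12 (ℛ 15)),
    .ite (𝒜 10 (ℛ 17)) (blk [
      .store 12 (ℛ 16) (𝒜 10 (ℛ 17) - 1),
      .store 12 (ℛ 16 + 1) (𝒜 11 (ℛ 17) - 1),
      .assign 16 (ℛ 16 + 2)]) .skip,
    .assign 15 (ℛ 15 + 1)])]

/-- Invariant of the breadth-first traversal: the children of the first `h` nodes of the queue `q`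
have been appended. -/
structure QueueInv (T : ParentTree (Fin m)) (h : ℕ) (q : List (Fin m)) : Prop where
  le : h ≤ q.length
  nodup : q.Nodup
  root : T.root ∈ q
  mem_iff : ∀ v, v ≠ T.root → (v ∈ q ↔ T.parent v ∈ q.take h)
  before : ∀ j v, q[j]? = some v → v ≠ T.root → T.parent v ∈ q.take j

theorem QueueInv.step {h : ℕ} {q l : List (Fin m)} {u : Fin m} (H : QueueInv T h q)
    (hu : q[h]? = some u) (hl : l.Nodup) (hmem : ∀ v, v ∈ l ↔ v ∈ T.children u) :
    QueueInv T (h + 1) (q ++ l) := by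
  have hlt : h < q.length := (List.getElem?_eq_some_iff.1 hu).1
  have htake : (q ++ l).take (h + 1) = q.take h ++ [u] := by
    rw [List.take_append_of_le_length (by omega), List.take_add_one, hu]; rfl
  -- Since `u` has not been processed before, none of its children is in the queue, and appending
  -- them creates no repetition.
  have hu' : u ∉ q.take h := by
    have h1 := H.nodup
    rw [← List.take_append_drop h q, List.nodup_append] at h1
    intro hm
    refine h1.2.2 u hm u ?_ rfl
    rw [List.mem_iff_getElem?]
    exact ⟨0, by simpa using hu⟩
  refine ⟨by simp; omega, ?_, by simp [H.root], ?_, ?_⟩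
  · refine List.nodup_append.2 ⟨H.nodup, hl, ?_⟩
    rintro v hv _ hv' rfl
    have hc := (hmem v).1 hv'
    have := (H.mem_iff v hc.1).1 hv
    rw [hc.2] at this
    exact hu' this
  · intro v hv
    rw [htake, List.mem_append, List.mem_append, hmem, H.mem_iff v hv, List.mem_singleton]
    exact or_congr_right ⟨fun h => h.2, fun h => ⟨hv, h⟩⟩
  · intro j v hj hv
    rcases lt_or_ge j q.length with h1 | h1
    · rw [List.getElem?_append_left h1] at hj
      rw [List.take_append_of_le_length h1.le]
      exact H.before j v hj hv
    · rw [List.getElem?_append_right h1] at hj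
      have hvl := (hmem v).1 (List.mem_of_getElem? hj)
      rw [hvl.2, List.take_append, List.mem_append, List.take_of_length_le h1]
      exact Or.inl (List.mem_of_getElem? hu)

theorem QueueInv.finish {q : List (Fin m)} (H : QueueInv T q.length q) : IsTopological T q := by
  refine ⟨H.nodup, fun v => ?_, H.before⟩
  induction v using T.induction_down with
  | h0 => exact H.root
  | h u ih v hv => rw [H.mem_iff v hv.1, List.take_length, hv.2]; exact ih

theorem traverse_runs {s : State} (hW : 8 * m + 8 < 2 ^ w)
    (hch : ChildArrays T (s.arr 10) (s.arr 11)) (hroot : s.reg 14 = T.root) :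
    Runs w traverse s (80 * m + 20) fun s' =>
      ∃ q, IsTopological T q ∧ Stores (s'.arr 12) (q.map Fin.val) := by
  have hw0 : w ≠ 0 := by rintro rfl; simp at hW
  have hW1 : 1 < 2 ^ w := by omega
  refine Runs.seq (T := 3) (T' := 80 * m + 17) (R := fun t =>
    t.arr 12 = Function.update (s.arr 12) 0 T.root) (.straight (by simp [hroot]) rfl) ?_ (by omega)
  rintro t1 hf1 h12
  refine Runs.seq (T := 2) (T' := 80 * m + 15) (R := fun t => t = t1.setReg 15 0)
    (.straight (by simp) rfl) ?_ (by omega)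
  rintro _ - rfl
  refine Runs.seq (T := 2) (T' := 80 * m + 13) (R := fun t => t = (t1.setReg 15 0).setReg 16 1)
    (.straight (by simp; omega) rfl) ?_ (by omega)
  rintro _ - rfl
  -- A queue without repetitions has at most `m` entries, so at most `m` minus register 15 rounds
  -- remain.
  refine Runs.loop (fun k t => ∃ q, QueueInv T (t.reg 15) q ∧ t.reg 16 = q.length ∧
    Stores (t.arr 12) (q.map Fin.val) ∧ k + t.reg 15 = m) 70 m _ ?_ ?_ ?_ ?_ ?_
  · refine ⟨[T.root], ⟨by simp, by simp, by simp, ?_, ?_⟩, by simp, ?_, by simp⟩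
    · intro v hv; simp [hv]
    · intro j v hj hv
      rcases j with _ | j
      · simp at hj; exact absurd hj.symm hv
      · simp at hj
    · simp [h12]
      exact (Stores.nil (s.arr 12)).append _
  · intro k t _ _; simp [hW1]
  · rintro k t hf ⟨q, hq, h16, hst, hk⟩ hne
    have hlt : t.reg 15 < q.length := by rw [← h16]; simpa using hne
    have hqm : q.length ≤ m := by
      have := hq.nodup.length_le_card
      simpa using this
    obtain ⟨k', rfl⟩ : ∃ k', k = k' + 1 := ⟨k - 1, by omega⟩
    refine ⟨k', rfl, ?_⟩
    obtain ⟨u, hu⟩ : ∃ u, q[t.reg 15]? = some u := ⟨_, List.getElem?_eq_getElem hlt⟩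
    have h17 : t.arr 12 (t.reg 15) = u := hst _ _ (by rw [List.getElem?_map, hu]; rfl)
    have h10 : t.arr 10 = s.arr 10 := by
      rw [hf.arr 10 rfl]; simp [hf1.arr 10 rfl]
    have h11 : t.arr 11 = s.arr 11 := by
      rw [hf.arr 11 rfl]; simp [hf1.arr 11 rfl]
    refine Runs.seq (T := 3) (T' := 60) (R := fun t' => t'.reg 17 = u ∧ t'.reg 15 = t.reg 15 ∧
      t'.reg 16 = t.reg 16 ∧ t'.arr = t.arr) (.straight (by simp [h17]) rfl) ?_ (by omega)
    rintro t2 - ⟨h1, h2, h3, h4⟩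
    rcases hch u with ⟨hleaf, hL⟩ | ⟨a, b, hab, hch', hL, hR⟩
    · refine .straight ?_ rfl
      simp [h1, h2, h3, h4, h10, hL, hw0]
      refine ⟨by omega, q ++ [], hq.step hu List.nodup_nil fun v => ?_, by simp [h16], by
        simpa using hst, by omega⟩
      have h' : T.children u = ∅ := hleaf
      rw [h']; simp
    · have hnew : QueueInv T (t.reg 15 + 1) (q ++ [a, b]) :=
        hq.step hu (by simp [hab]) fun v => by rw [hch']; simp
      have hlen : (q ++ [a, b]).length ≤ m := by
        have := hnew.nodup.length_le_card
        simpa using this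
      have hst' := (hst.append a).append b
      simp only [List.length_append, List.length_map, List.length_singleton] at hst' hlen
      refine .straight ?_ rfl
      simp [h1, h2, h3, h4, h10, h11, hL, hR, hw0, h16]
      refine ⟨by have := a.2; have := b.2; simp at hlen; omega, q ++ [a, b], hnew, by simp, ?_,
        by omega⟩
      simpa using hst'
  · simp only [Expr.cost, Expr.lt]; omega
  · rintro k t hf ⟨q, hq, h16, hst, hk⟩ h0
    have hge : q.length ≤ t.reg 15 := by rw [← h16]; simpa using h0
    rw [le_antisymm hq.le hge] at hq
    exact ⟨q, hq.finish, hst⟩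

end

/-! ### Numbers of leaves below the nodes and starts of their intervals. -/

section

variable {m n w : ℕ} {T : ParentTree (Fin m)}

open Classical in
/-- The number of leaves below a node, for an enumeration of the leaves. -/
noncomputable def leafCount (T : ParentTree (Fin m)) (leaf : Fin n → Fin m) (u : Fin m) : ℕ :=
  (Finset.univ.filter fun i => T.Anc u (leaf i)).card

theorem leafCount_le (leaf : Fin n → Fin m) (u : Fin m) : leafCount T leaf u ≤ n := by
  unfold leafCount
  exact (Finset.card_le_univ _).trans_eq (Fintype.card_fin n)

theorem leafCount_leaf {leaf : Fin n → Fin m} (hinj : Function.Injective leaf)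
    (hleaf : Set.range leaf = {x | T.IsLeaf x}) {u : Fin m} (hu : T.IsLeaf u) :
    leafCount T leaf u = 1 := by
  have : u ∈ Set.range leaf := by rw [hleaf]; exact hu
  obtain ⟨i, rfl⟩ := this
  unfold leafCount
  rw [Finset.card_eq_one]
  refine ⟨i, ?_⟩
  ext j
  simp only [Finset.mem_filter, Finset.mem_univ, true_and, Finset.mem_singleton]
  constructor
  · intro h
    by_contra hne
    obtain ⟨c, hc, -⟩ := h.exists_child fun h' => hne (hinj h').symm
    have h' : T.children (leaf i) = ∅ := hu
    rw [h'] at hc; exact hc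
  · rintro rfl; exact .refl T _

theorem leafCount_node {leaf : Fin n → Fin m} (hleaf : Set.range leaf = {x | T.IsLeaf x})
    {u a b : Fin m} (hab : a ≠ b) (hu : T.children u = {a, b}) :
    leafCount T leaf u = leafCount T leaf a + leafCount T leaf b := by
  unfold leafCount
  have ha : a ∈ T.children u := by rw [hu]; simp
  have hb : b ∈ T.children u := by rw [hu]; simp
  have hsib : ∀ {c d : Fin m}, c ∈ T.children u → d ∈ T.children u → T.Anc c d → c = d := by
    intro c d hc hd h
    rcases ParentTree.anc_iff.1 h with h | h
    · exact h
    · rw [hd.2] at h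
      have : c = u := h.antisymm (by rw [← hc.2]; exact ParentTree.anc_parent c)
      exact absurd (this ▸ hc.2) (ParentTree.parent_ne hc.1)
  rw [← Finset.card_union_of_disjoint]
  · congr 1
    ext i
    simp only [Finset.mem_filter, Finset.mem_univ, true_and, Finset.mem_union]
    constructor
    · intro h
      have hne : u ≠ leaf i := by
        rintro rfl
        have h' : leaf i ∈ Set.range leaf := ⟨i, rfl⟩
        rw [hleaf] at h'
        have h'' : T.children (leaf i) = ∅ := h'
        rw [h''] at ha; exact ha
      obtain ⟨c, hc, hci⟩ := h.exists_child hne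
      rw [hu] at hc
      rcases hc with rfl | rfl
      · exact Or.inl hci
      · exact Or.inr hci
    · rintro (h | h)
      · refine ParentTree.Anc.trans ?_ h
        rw [← ha.2]; exact ParentTree.anc_parent a
      · refine ParentTree.Anc.trans ?_ h
        rw [← hb.2]; exact ParentTree.anc_parent b
  · rw [Finset.disjoint_left]
    intro i hi hi'
    simp only [Finset.mem_filter, Finset.mem_univ, true_and] at hi hi'
    rcases T.anc_total hi hi' with h | h
    · exact hab (hsib ha hb h)
    · exact hab (hsib hb ha h).symm

def countLeaves : Prog := blk [
  .assign 15 (ℛ 11),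
  .loop (ℛ 15) (blk [
    .assign 15 (ℛ 15 - 1),
    .assign 17 (𝒜 12 (ℛ 15)),
    .ite (𝒜 10 (ℛ 17))
      (.store 13 (ℛ 17) (𝒜 13 (𝒜 10 (ℛ 17) - 1) + 𝒜 13 (𝒜 11 (ℛ 17) - 1)))
      (.store 13 (ℛ 17) 1)])]

/-- Children come after their parent: a backward pass can sum up the leaf numbers of the children,
and a forward pass can distribute the starts. -/
theorem IsTopological.child_mem {q : List (Fin m)} (hq : IsTopological T q) {k : ℕ} {u v : Fin m}
    (hu : q[k]? = some u) (hv : v ∈ T.children u) : v ∈ q.drop (k + 1) := by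
  obtain ⟨j, hj⟩ := List.mem_iff_getElem?.1 (hq.mem v)
  have h1 := hq.before j v hj hv.1
  rw [hv.2] at h1
  obtain ⟨i, hi⟩ := List.mem_iff_getElem?.1 h1
  rw [List.getElem?_take] at hi
  split_ifs at hi with hij
  have := (List.nodup_iff_getElem?_ne_getElem?.1 hq.nodup)
  have hik : i = k := by
    obtain ⟨hi1, hi2⟩ := List.getElem?_eq_some_iff.1 hi
    obtain ⟨hk1, hk2⟩ := List.getElem?_eq_some_iff.1 hu
    exact (hq.nodup.getElem_inj_iff).1 (hi2.trans hk2.symm)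
  rw [List.mem_iff_getElem?]
  exact ⟨j - (k + 1), by rw [List.getElem?_drop, ← hj]; congr 1; omega⟩

theorem countLeaves_runs {s : State} {leaf : Fin n → Fin m} (hinj : Function.Injective leaf)
    (hleaf : Set.range leaf = {x | T.IsLeaf x}) (hW : 8 * m + 8 < 2 ^ w) (hn : n ≤ m)
    (hm : s.reg 11 = m) (hch : ChildArrays T (s.arr 10) (s.arr 11)) {q : List (Fin m)}
    (hq : IsTopological T q) (hst : Stores (s.arr 12) (q.map Fin.val)) :
    Runs w countLeaves s (60 * m + 20) fun s' => ∀ u : Fin m, s'.arr 13 u = leafCount T leaf u := by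
  have hw0 : w ≠ 0 := by rintro rfl; simp at hW
  have hW1 : 1 < 2 ^ w := by omega
  refine Runs.seq (T := 2) (T' := 60 * m + 18)
    (R := fun t => t = s.setReg 15 m) (.straight (by simp [hm]) rfl) ?_ (by omega)
  rintro _ - rfl
  refine Runs.loop (fun k t => t.reg 15 = k ∧ k ≤ m ∧
    ∀ u ∈ q.drop k, t.arr 13 (Fin.val u) = leafCount T leaf u) 50 m _ ?_ ?_ ?_ ?_ ?_
  · refine ⟨by simp, le_rfl, ?_⟩
    rw [List.drop_of_length_le (by rw [hq.length])]
    simp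
  · intro k t _ _; trivial
  · rintro k t hf ⟨h15, hk, hinv⟩ hne
    obtain ⟨k', rfl⟩ : ∃ k', k = k' + 1 := ⟨k - 1, by simp [h15] at hne; omega⟩
    refine ⟨k', rfl, ?_⟩
    obtain ⟨u, hu⟩ : ∃ u, q[k']? = some u :=
      ⟨_, List.getElem?_eq_getElem (by rw [hq.length]; omega)⟩
    have h17 : t.arr 12 k' = u := by
      rw [hf.arr 12 rfl]
      exact hst _ _ (by rw [List.getElem?_map, hu]; rfl)
    have h10 : t.arr 10 = s.arr 10 := by rw [hf.arr 10 rfl]; simp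
    have h11 : t.arr 11 = s.arr 11 := by rw [hf.arr 11 rfl]; simp
    have hdrop : ∀ v, v ∈ q.drop k' → v = u ∨ v ∈ q.drop (k' + 1) := by
      intro v hv
      rw [List.drop_eq_getElem_cons (by rw [hq.length]; omega), List.mem_cons] at hv
      obtain ⟨h1, h2⟩ := List.getElem?_eq_some_iff.1 hu
      rwa [h2] at hv
    have hfin : ∀ c, c = leafCount T leaf u → ∀ v ∈ q.drop k',
        Function.update (t.arr 13) u c (Fin.val v) = leafCount T leaf v := by
      rintro c rfl v hv
      rcases hdrop v hv with rfl | hv'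
      · simp
      · by_cases hvu : v = u
        · rw [hvu]; simp
        · rw [Function.update_of_ne (fun h => hvu (Fin.ext h))]
          exact hinv v hv'
    rcases hch u with ⟨hl, hL⟩ | ⟨a, b, hab, hch', hL, hR⟩
    · refine .straight ?_ rfl
      simp [h15, h17, h10, hL, hw0]
      exact ⟨by omega, by omega, hfin _ (leafCount_leaf hinj hleaf hl).symm⟩
    · have ha := hinv a (hq.child_mem hu (by rw [hch']; simp))
      have hb := hinv b (hq.child_mem hu (by rw [hch']; simp))
      have hsum := leafCount_node hleaf hab hch'
      have hle := leafCount_le (T := T) leaf u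
      refine .straight ?_ rfl
      simp [h15, h17, h10, h11, hL, hR, ha, hb, hw0]
      exact ⟨by have := a.2; have := b.2; omega, by omega, hfin _ hsum.symm⟩
  · simp only [Expr.cost]; omega
  · rintro k t hf ⟨h15, hk, hinv⟩ h0
    obtain rfl : k = 0 := by simpa [h15] using h0
    intro u
    exact hinv u (by simpa using hq.mem u)

def findStarts : Prog := blk [
  .assign 15 0,
  .loop (.lt (ℛ 15) (ℛ 11)) (blk [
    .assign 17 (𝒜 12 (ℛ 15)),
    .ite (𝒜 10 (ℛ 17)) (blk [
      .store 14 (𝒜 10 (ℛ 17) - 1) (𝒜 14 (ℛ 17)),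
      .store 14 (𝒜 11 (ℛ 17) - 1) (𝒜 14 (ℛ 17) + 𝒜 13 (𝒜 10 (ℛ 17) - 1))]) .skip,
    .assign 15 (ℛ 15 + 1)])]

theorem findStarts_runs {s : State} {leaf : Fin n → Fin m} (hinj : Function.Injective leaf)
    (hleaf : Set.range leaf = {x | T.IsLeaf x}) (hW : 8 * m + 8 < 2 ^ w) (hn : n ≤ m)
    (hm : s.reg 11 = m) (hch : ChildArrays T (s.arr 10) (s.arr 11)) {q : List (Fin m)}
    (hq : IsTopological T q) (hst : Stores (s.arr 12) (q.map Fin.val))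
    (hsz : ∀ u : Fin m, s.arr 13 u = leafCount T leaf u) (h0 : ∀ j, s.arr 14 j = 0) :
    Runs w findStarts s (80 * m + 20) fun s' =>
      T.Labelling (fun u => s'.arr 14 u) (leafCount T leaf) := by
  have hw0 : w ≠ 0 := by rintro rfl; simp at hW
  have hW1 : 1 < 2 ^ w := by omega
  refine Runs.seq (T := 2) (T' := 80 * m + 18)
    (R := fun t => t = s.setReg 15 0) (.straight (by simp) rfl) ?_ (by omega)
  rintro _ - rfl
  -- The third condition keeps the sums within a word. It holds at the beginning because unassigned
  -- starts are 0.
  refine Runs.forLoop (fun i t => t.reg 15 = i ∧ t.arr 14 T.root = 0 ∧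
    (∀ u : Fin m, t.arr 14 u + leafCount T leaf u ≤ n) ∧
    ∀ u ∈ q.take i, ∀ a b : Fin m, T.children u = {a, b} → t.arr 10 (Fin.val u) = a + 1 →
      t.arr 11 (Fin.val u) = b + 1 →
      t.arr 14 a = t.arr 14 (Fin.val u) ∧ t.arr 14 b = t.arr 14 (Fin.val u) + leafCount T leaf a)
    70 0 m _ (Nat.zero_le _) ?_ ?_ ?_ ?_ ?_
  · refine ⟨by simp, by simp [h0], fun u => ?_, by simp⟩
    simp [h0, leafCount_le]
  · rintro i t hf ⟨h1, -, -⟩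
    have := hf.reg 11 rfl
    simp [hm] at this
    simp [this, h1, hW1]
  · rintro i t - hi hf ⟨h15, hroot, hle, hinv⟩
    obtain ⟨u, hu⟩ : ∃ u, q[i]? = some u :=
      ⟨_, List.getElem?_eq_getElem (by rw [hq.length]; omega)⟩
    have h17 : t.arr 12 i = u := by
      rw [hf.arr 12 rfl]
      exact hst _ _ (by rw [List.getElem?_map, hu]; rfl)
    have h10 : t.arr 10 = s.arr 10 := by rw [hf.arr 10 rfl]; simp
    have h11 : t.arr 11 = s.arr 11 := by rw [hf.arr 11 rfl]; simp
    have h13 : t.arr 13 = s.arr 13 := by rw [hf.arr 13 rfl]; simp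
    have htake : q.take (i + 1) = q.take i ++ [u] := by rw [List.take_add_one, hu]; rfl
    have hlt := (List.getElem?_eq_some_iff.1 hu).1
    -- The children of `u` have not been processed yet, so writing their starts does not disturb the
    -- relations established earlier.
    have hnot : ∀ v, v ∈ q.drop (i + 1) → v ∉ q.take (i + 1) := by
      intro v hv hv'
      have h1 := hq.nodup
      rw [← List.take_append_drop (i + 1) q, List.nodup_append] at h1
      exact h1.2.2 v hv' v hv rfl
    rcases hch u with ⟨hl, hL⟩ | ⟨a, b, hab, hch', hL, hR⟩
    · refine .straight ?_ rfl
      simp [h15, h17, h10, hL, hw0]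
      refine ⟨by omega, hroot, hle, fun v hv c d hcd h1 h2 => ?_⟩
      rw [htake, List.mem_append, List.mem_singleton] at hv
      rcases hv with hv | rfl
      · exact hinv v hv c d hcd (by rw [h10]; exact h1) h2
      · have h' : T.children v = ∅ := hl
        rw [h'] at hcd
        have : c ∈ (∅ : Set (Fin m)) := by rw [hcd]; simp
        exact this.elim
    · have hac : a ∈ T.children u := by rw [hch']; simp
      have hbc : b ∈ T.children u := by rw [hch']; simp
      have ha := hnot _ (hq.child_mem hu hac)
      have hb := hnot _ (hq.child_mem hu hbc)
      have hsum := leafCount_node hleaf hab hch'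
      have hua : u ≠ a := by
        rintro rfl; exact ha (by rw [htake]; simp)
      have hub : u ≠ b := by
        rintro rfl; exact hb (by rw [htake]; simp)
      have hv : ∀ {c d : Fin m}, c ≠ d → (c : ℕ) ≠ d := fun h h' => h (Fin.ext h')
      have hleu := hle u
      refine .straight ?_ rfl
      simp [h15, h17, h10, h11, h13, hsz, hL, hR, hw0, hv hua]
      refine ⟨by have := a.2; have := b.2; omega, ?_, fun v => ?_, fun v hv' c d hcd h1 h2 => ?_⟩
      · rw [Function.update_of_ne (hv (fun h => hbc.1 h.symm)),
          Function.update_of_ne (hv (fun h => hac.1 h.symm))]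
        exact hroot
      · rw [Function.update_apply, Function.update_apply]
        split_ifs with h1 h2
        · rw [Fin.ext h1]; omega
        · rw [Fin.ext h2]; omega
        · exact hle v
      · rw [htake, List.mem_append, List.mem_singleton] at hv'
        rcases hv' with hv' | rfl
        · have hvt : v ∈ q.take (i + 1) := by rw [htake]; simp [hv']
          have hcc : c ∈ T.children v := by rw [hcd]; simp
          have hdc : d ∈ T.children v := by rw [hcd]; simp
          have hvu : v ≠ u := by
            rintro rfl
            have h1 := hq.nodup
            rw [← List.take_append_drop i q, List.nodup_append] at h1
            refine h1.2.2 v hv' v ?_ rfl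
            rw [List.mem_iff_getElem?]
            exact ⟨0, by simpa using hu⟩
          have hva : v ≠ a := fun h => ha (h ▸ hvt)
          have hvb : v ≠ b := fun h => hb (h ▸ hvt)
          have hne : ∀ {x y : Fin m}, x ∈ T.children v → y ∈ T.children u → x ≠ y := by
            rintro x y hx hy rfl
            exact hvu (hx.2.symm.trans hy.2)
          rw [Function.update_of_ne (hv (hne hcc hbc)), Function.update_of_ne (hv (hne hcc hac)),
            Function.update_of_ne (hv hvb), Function.update_of_ne (hv hva),
            Function.update_of_ne (hv (hne hdc hbc)), Function.update_of_ne (hv (hne hdc hac))]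
          exact hinv v hv' c d hcd (by rw [h10]; exact h1) (by rw [h11]; exact h2)
        · have hc : c = a := Fin.ext (by rw [hL] at h1; omega)
          have hd : d = b := Fin.ext (by rw [hR] at h2; omega)
          subst hc hd
          rw [Function.update_of_ne (hv hab), Function.update_self, Function.update_of_ne (hv hub),
            Function.update_of_ne (hv hua), Function.update_self]
          exact ⟨rfl, rfl⟩
  · simp only [Expr.cost, Expr.lt]; omega
  · rintro t hf ⟨h15, hroot, hle, hinv⟩
    have h10 : t.arr 10 = s.arr 10 := by rw [hf.arr 10 rfl]; simp
    have h11 : t.arr 11 = s.arr 11 := by rw [hf.arr 11 rfl]; simp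
    refine ⟨hroot, fun u hu => leafCount_leaf hinj hleaf hu, fun u hu => ?_⟩
    rcases hch u with ⟨hl, -⟩ | ⟨a, b, hab, hch', hL, hR⟩
    · exact absurd hl hu
    · have := hinv u (by rw [List.take_of_length_le hq.length.le]; exact hq.mem u) a b hch'
        (by rw [h10, hL]) (by rw [h11, hR])
      exact ⟨a, b, hab, hch', this.1, this.2, leafCount_node hleaf hab hch'⟩

end

/-! ### The input and the linear order -/

/-- The state contains the representation of the model by the lists `LA` and `LB`, and all other
arrays are zero. -/
structure IsInput {n m : ℕ} (M : SignedTreeModel (Fin n) (Fin m)) (LA LB : List (Fin m × Fin m))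
    (s : State) : Prop where
  reg0 : s.reg 0 = m
  reg1 : s.reg 1 = n
  reg2 : s.reg 2 = LA.length
  reg4 : s.reg 4 = LB.length
  arr0 : ∀ v : Fin m, s.arr 0 v = M.tree.parent v
  arr1 : ∀ i : Fin n, s.arr 1 i = M.leaf i
  arr2 : Stores (s.arr 2) (fsts LA)
  arr3 : Stores (s.arr 3) (snds LA)
  arr4 : Stores (s.arr 4) (fsts LB)
  arr5 : Stores (s.arr 5) (snds LB)
  zero : ∀ k j, 6 ≤ k → s.arr k j = 0

theorem isInput_init {n m : ℕ} {M : SignedTreeModel (Fin n) (Fin m)} {X : List (List ℕ)}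
    (hX : M.IsCode X) : ∃ LA LB, ListsPairs LA M.neg ∧ ListsPairs LB M.pos ∧
      IsInput M LA LB (State.init X) := by
  obtain ⟨LA, LB, hA, hB, rfl⟩ := hX
  refine ⟨LA, LB, hA, hB, ?_⟩
  have hst : ∀ L : List ℕ, Stores (fun j => L.getD j 0) L := fun L j x h => by
    simp [h]
  refine ⟨by simp [State.init], by simp [State.init], by simp [State.init, fsts],
    by simp [State.init, fsts], fun v => by simp [State.init], fun v => by simp [State.init],
    hst _, hst _, hst _, hst _, fun k j hk => ?_⟩
  have : [List.ofFn fun v => (M.tree.parent v : ℕ), List.ofFn fun i => (M.leaf i : ℕ), fsts LA,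
      snds LA, fsts LB, snds LB].getD k [] = [] := List.getD_eq_default _ _ (by simpa using hk)
  simp only [State.init]
  rw [this]
  rfl

/-- Array 0 is reused: the parents are no longer needed, and it receives the vertex at each
position, the inverse of i ↦ `lo (leaf i)`. -/
def orderVertices : Prog := blk [
  .assign 15 0,
  .loop (.lt (ℛ 15) (ℛ 10)) (blk [
    .store 0 (𝒜 14 (𝒜 1 (ℛ 15))) (ℛ 15),
    .assign 15 (ℛ 15 + 1)])]

def labelTree : Prog := blk [
  .assign 10 (ℛ 1),
  .assign 11 (ℛ 0),
  .assign 12 (ℛ 2),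
  .assign 13 (ℛ 2 + ℛ 4),
  findChildren, traverse, countLeaves, findStarts, orderVertices]

theorem labelTree_runs {n m w : ℕ} {M : SignedTreeModel (Fin n) (Fin m)}
    {LA LB : List (Fin m × Fin m)} {s : State} (hs : IsInput M LA LB s) (hn : m + 1 = 2 * n)
    (hW : 8 * m + 8 < 2 ^ w) (hp : LA.length + LB.length < 2 ^ w) :
    Runs w labelTree s (400 * m + 200) fun s' =>
      ∃ lo sz : Fin m → ℕ, M.tree.Labelling lo sz ∧ (∀ u : Fin m, s'.arr 14 u = lo u) ∧
        (∀ u : Fin m, s'.arr 13 u = sz u) ∧ (∀ i : Fin n, s'.arr 0 (lo (M.leaf i)) = i) ∧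
        s'.reg 10 = n ∧ s'.reg 12 = LA.length ∧ s'.reg 13 = LA.length + LB.length := by
  have hw0 : w ≠ 0 := by rintro rfl; simp at hW
  have hW1 : 1 < 2 ^ w := by omega
  refine Runs.seq (T := 2) (T' := 400 * m + 198) (R := fun t => t.reg 10 = n)
    (.straight (by simp [hs.reg1]) rfl) ?_ (by omega)
  intro t1 f1 h1
  refine Runs.seq (T := 2) (T' := 400 * m + 196) (R := fun t => t.reg 11 = m)
    (.straight (by simp [f1.reg 0 rfl, hs.reg0]) rfl) ?_ (by omega)
  intro t2 f2 h2
  refine Runs.seq (T := 2) (T' := 400 * m + 194) (R := fun t => t.reg 12 = LA.length)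
    (.straight (by simp [f1.reg 2 rfl, f2.reg 2 rfl, hs.reg2]) rfl) ?_ (by omega)
  intro t3 f3 h3
  refine Runs.seq (T := 4) (T' := 400 * m + 190)
    (R := fun t => t.reg 13 = LA.length + LB.length)
    (.straight (by simp [f1.reg 2 rfl, f2.reg 2 rfl, f3.reg 2 rfl, f1.reg 4 rfl, f2.reg 4 rfl,
      f3.reg 4 rfl, hs.reg2, hs.reg4, hp]) rfl) ?_ (by omega)
  intro t4 f4 h4
  have harr : ∀ k, t4.arr k = s.arr k := fun k => by
    rw [f4.arr k rfl, f3.arr k rfl, f2.arr k rfl, f1.arr k rfl]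
  refine Runs.seq (T' := 340 * m + 170) (findChildren_runs M.full hW
    (by rw [f4.reg 11 rfl, f3.reg 11 rfl, h2]) (fun v => by rw [harr]; exact hs.arr0 v)
    fun j => by rw [harr]; exact hs.zero 10 j (by norm_num)) ?_ (by omega)
  rintro t5 f5 ⟨h5, h5'⟩
  refine Runs.seq (T' := 260 * m + 150) (traverse_runs hW h5 h5') ?_ (by omega)
  rintro t6 f6 ⟨q, hq, h6⟩
  have hch : ChildArrays M.tree (t6.arr 10) (t6.arr 11) := by
    rw [f6.arr 10 rfl, f6.arr 11 rfl]; exact h5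
  have h611 : t6.reg 11 = m := by
    rw [f6.reg 11 rfl, f5.reg 11 rfl, f4.reg 11 rfl, f3.reg 11 rfl, h2]
  refine Runs.seq (T' := 200 * m + 130) (countLeaves_runs M.leaf_injective M.range_leaf hW
    (by omega) h611 hch hq h6) ?_ (by omega)
  intro t7 f7 h7
  refine Runs.seq (T' := 120 * m + 110) (findStarts_runs M.leaf_injective M.range_leaf hW
    (by omega) (by rw [f7.reg 11 rfl, h611]) (by rw [f7.arr 10 rfl, f7.arr 11 rfl]; exact hch) hq
    (by rw [f7.arr 12 rfl]; exact h6) h7 fun j => by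
      rw [f7.arr 14 rfl, f6.arr 14 rfl, f5.arr 14 rfl, harr]; exact hs.zero 14 j (by norm_num))
    ?_ (by omega)
  intro t8 f8 h8
  have hleaf : ∀ i : Fin n, t8.arr 1 i = M.leaf i := fun i => by
    rw [f8.arr 1 rfl, f7.arr 1 rfl, f6.arr 1 rfl, f5.arr 1 rfl, harr]; exact hs.arr1 i
  refine Runs.seq (T := 2) (T' := 120 * m + 108)
    (R := fun t => t = t8.setReg 15 0) (.straight (by simp) rfl) ?_ (by omega)
  rintro _ - rfl
  have hreg : ∀ i, i = 10 ∨ i = 12 ∨ i = 13 → t8.reg i = t4.reg i := by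
    rintro i (rfl | rfl | rfl)
    · rw [f8.reg 10 rfl, f7.reg 10 rfl, f6.reg 10 rfl, f5.reg 10 rfl]
    · rw [f8.reg 12 rfl, f7.reg 12 rfl, f6.reg 12 rfl, f5.reg 12 rfl]
    · rw [f8.reg 13 rfl, f7.reg 13 rfl, f6.reg 13 rfl, f5.reg 13 rfl]
  have h10 : t8.reg 10 = n := by
    rw [hreg 10 (by simp), f4.reg 10 rfl, f3.reg 10 rfl, f2.reg 10 rfl, h1]
  have h12 : t8.reg 12 = LA.length := by rw [hreg 12 (by simp), f4.reg 12 rfl, h3]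
  have h13 : t8.reg 13 = LA.length + LB.length := by rw [hreg 13 (by simp), h4]
  refine Runs.forLoop (fun i t => t.reg 15 = i ∧
    ∀ j : Fin n, j.1 < i → t.arr 0 (t8.arr 14 (M.leaf j)) = j)
    70 0 n _ (Nat.zero_le _) ?_ ?_ ?_ ?_ ?_
  · simp
  · rintro i t hf ⟨h15, -⟩
    have := hf.reg 10 rfl
    simp [h10] at this
    simp [this, h15, hW1]
  · rintro i t - hi hf ⟨h15, hinv⟩
    have h14 : t.arr 14 = t8.arr 14 := by rw [hf.arr 14 rfl]; simp
    have ht1 : t.arr 1 i = M.leaf ⟨i, hi⟩ := by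
      rw [hf.arr 1 rfl]; simpa using hleaf ⟨i, hi⟩
    refine .straight ?_ rfl
    simp [h15, h14, ht1, hw0]
    refine ⟨by omega, fun j hj => ?_⟩
    rw [Function.update_apply]
    split_ifs with heq
    · have hr := (M.pos_iff h8 (a := j) (u := M.leaf j)).1 (.refl _ _)
      have hr' := (M.pos_iff h8 (a := ⟨i, hi⟩) (u := M.leaf ⟨i, hi⟩)).1 (.refl _ _)
      have ha := (M.pos_iff h8 (a := j) (u := M.leaf ⟨i, hi⟩)).2 (by omega)
      have hb := (M.pos_iff h8 (a := ⟨i, hi⟩) (u := M.leaf j)).2 (by omega)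
      rw [M.leaf_injective (ha.antisymm hb).symm]
    · refine hinv j ?_
      rcases Nat.lt_succ_iff_lt_or_eq.1 (Nat.lt_succ_of_le hj) with h | h
      · exact h
      · exact absurd (by rw [show j = ⟨i, hi⟩ from Fin.ext h]) heq
  · simp only [Expr.cost, Expr.lt]; omega
  · rintro t hf ⟨-, hinv⟩
    have h14 : t.arr 14 = t8.arr 14 := by rw [hf.arr 14 rfl]; simp
    have h13' : t.arr 13 = t8.arr 13 := by rw [hf.arr 13 rfl]; simp
    refine ⟨_, _, h8, fun u => by rw [h14], fun u => ?_, fun i => hinv i i.2, ?_, ?_, ?_⟩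
    · rw [h13', f8.arr 13 rfl]; exact h7 u
    · rw [hf.reg 10 rfl]; simpa using h10
    · rw [hf.reg 12 rfl]; simpa using h12
    · rw [hf.reg 13 rfl]; simpa using h13

/-! ### Writing down the rectangles

Registers: `10` number `n` of vertices, `13` number `p` of rectangles. Arrays: `20` – `24` the
rectangles and their colours, `25` priority queue, `26` the sorted rectangles. -/

/-- The family of rectangles is stored in the state. -/
structure HoldsRects (R : RectFamily) (s : State) : Prop where
  n : s.reg 10 = R.n
  p : s.reg 13 = R.p
  x1 : ∀ i < R.p, s.arr 20 i = R.x1 i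
  x2 : ∀ i < R.p, s.arr 21 i = R.x2 i
  y1 : ∀ i < R.p, s.arr 22 i = R.y1 i
  y2 : ∀ i < R.p, s.arr 23 i = R.y2 i
  col : ∀ i < R.p, s.arr 24 i = R.col i

theorem HoldsRects.congr {R : RectFamily} {s s' : State} (h : HoldsRects R s)
    (h10 : s'.reg 10 = s.reg 10) (h13 : s'.reg 13 = s.reg 13)
    (harr : ∀ k, k ∈ [20, 21, 22, 23, 24] → s'.arr k = s.arr k) : HoldsRects R s' := by
  simp only [List.mem_cons, List.not_mem_nil, or_false, forall_eq_or_imp, forall_eq] at harr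
  obtain ⟨h1, h2, h3, h4, h5⟩ := harr
  exact ⟨h10.trans h.n, h13.trans h.p, fun i hi => by rw [h1, h.x1 i hi],
    fun i hi => by rw [h2, h.x2 i hi], fun i hi => by rw [h3, h.y1 i hi],
    fun i hi => by rw [h4, h.y2 i hi], fun i hi => by rw [h5, h.col i hi]⟩

def makeRects : Prog := blk [
  .assign 15 0,
  .loop (.lt (ℛ 15) (ℛ 13)) (blk [
    .ite (.lt (ℛ 15) (ℛ 12))
      (blk [.assign 16 (𝒜 2 (ℛ 15)), .assign 17 (𝒜 3 (ℛ 15)), .store 24 (ℛ 15) 0])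
      (blk [.assign 16 (𝒜 4 (ℛ 15 - ℛ 12)), .assign 17 (𝒜 5 (ℛ 15 - ℛ 12)),
        .store 24 (ℛ 15) 1]),
    .ite (.lt (𝒜 14 (ℛ 17)) (𝒜 14 (ℛ 16)))
      (blk [.assign 18 (ℛ 16), .assign 16 (ℛ 17), .assign 17 (ℛ 18)]) .skip,
    .store 20 (ℛ 15) (𝒜 14 (ℛ 16)),
    .store 21 (ℛ 15) (𝒜 14 (ℛ 16) + 𝒜 13 (ℛ 16)),
    .store 22 (ℛ 15) (𝒜 14 (ℛ 17)),
    .store 23 (ℛ 15) (𝒜 14 (ℛ 17) + 𝒜 13 (ℛ 17)),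
    .assign 15 (ℛ 15 + 1)])]

theorem makeRects_runs {n m w : ℕ} {LA LB : List (Fin m × Fin m)} {lo sz : Fin m → ℕ}
    {s : State} (r : Fin m) (hlo : ∀ u : Fin m, s.arr 14 u = lo u)
    (hsz : ∀ u : Fin m, s.arr 13 u = sz u) (hle : ∀ u, lo u + sz u ≤ n) (h10 : s.reg 10 = n)
    (h12 : s.reg 12 = LA.length) (h13 : s.reg 13 = LA.length + LB.length)
    (h2 : Stores (s.arr 2) (fsts LA)) (h3 : Stores (s.arr 3) (snds LA))
    (h4 : Stores (s.arr 4) (fsts LB)) (h5 : Stores (s.arr 5) (snds LB))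
    (hn : n < 2 ^ w) (hp : LA.length + LB.length + 1 < 2 ^ w) :
    Runs w makeRects s (120 * (LA.length + LB.length) + 20) fun s' =>
      HoldsRects (pairRects n LA.length lo sz (LA ++ LB) r) s' := by
  have hW1 : 1 < 2 ^ w := by omega
  have hw0 : w ≠ 0 := by rintro rfl; simp at hW1
  set R := pairRects n LA.length lo sz (LA ++ LB) r with hR
  have hRp : R.p = LA.length + LB.length := by simp [hR, pairRects]
  refine Runs.seq (T := 2) (T' := 120 * (LA.length + LB.length) + 18)
    (R := fun t => t = s.setReg 15 0) (.straight (by simp) rfl) ?_ (by omega)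
  rintro _ - rfl
  refine Runs.forLoop (fun i t => t.reg 15 = i ∧ ∀ j < i, t.arr 20 j = R.x1 j ∧
    t.arr 21 j = R.x2 j ∧ t.arr 22 j = R.y1 j ∧ t.arr 23 j = R.y2 j ∧ t.arr 24 j = R.col j)
    110 0 (LA.length + LB.length) _ (Nat.zero_le _) ?_ ?_ ?_ ?_ ?_
  · simp
  · rintro i t hf ⟨h15, -⟩
    have := hf.reg 13 rfl
    simp [h13] at this
    simp [this, h15, hW1]
  · rintro i t - hi hf ⟨h15, hinv⟩
    have e12 : t.reg 12 = LA.length := by rw [hf.reg 12 rfl]; simpa using h12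
    have earr : ∀ k, k = 2 ∨ k = 3 ∨ k = 4 ∨ k = 5 ∨ k = 13 ∨ k = 14 → t.arr k = s.arr k := by
      rintro k (rfl | rfl | rfl | rfl | rfl | rfl) <;> rw [hf.arr _ rfl] <;> simp
    obtain ⟨q, hq⟩ : ∃ q, (LA ++ LB).getD i (r, r) = q := ⟨_, rfl⟩
    refine Runs.seq (T := 40) (T' := 65) (R := fun t' => t'.reg 15 = i ∧ t'.reg 16 = q.1 ∧
      t'.reg 17 = q.2 ∧ (∀ k, k ≠ 24 → t'.arr k = t.arr k) ∧
      t'.arr 24 = Function.update (t.arr 24) i (R.col i)) ?_ ?_ (by omega)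
    · by_cases hia : i < LA.length
      · have hq' : q = LA[i] := by
          rw [← hq, List.getD_eq_getElem _ _ (by simp; omega), List.getElem_append_left hia]
        have e2 : t.arr 2 i = q.1 := by
          rw [earr 2 (by simp)]; exact h2 _ _ (by simp [fsts, hia, hq'])
        have e3 : t.arr 3 i = q.2 := by
          rw [earr 3 (by simp)]; exact h3 _ _ (by simp [snds, hia, hq'])
        refine .straight ?_ rfl
        simp [h15, e12, hia, hW1, e2, e3, hR, pairRects]
        intro k hk
        rw [Function.update_of_ne hk]
      · have hq' : q = LB[i - LA.length] := by
          rw [← hq, List.getD_eq_getElem _ _ (by simp; omega),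
            List.getElem_append_right (not_lt.1 hia)]
        have hib : i - LA.length < LB.length := by omega
        have e2 : t.arr 4 (i - LA.length) = q.1 := by
          rw [earr 4 (by simp)]; exact h4 _ _ (by simp [fsts, hib, hq'])
        have e3 : t.arr 5 (i - LA.length) = q.2 := by
          rw [earr 5 (by simp)]; exact h5 _ _ (by simp [snds, hib, hq'])
        refine .straight ?_ rfl
        simp [h15, e12, hia, hW1, e2, e3, hR, pairRects]
        refine ⟨by omega, ?_⟩
        intro k hk
        rw [Function.update_of_ne hk]
    rintro t1 - ⟨g1, g2, g3, g4, g5⟩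
    have e14 : ∀ u : Fin m, t1.arr 14 u = lo u := fun u => by
      rw [g4 14 (by norm_num), earr 14 (by simp), hlo]
    have e13 : ∀ u : Fin m, t1.arr 13 u = sz u := fun u => by
      rw [g4 13 (by norm_num), earr 13 (by simp), hsz]
    refine Runs.seq (T := 20) (T' := 45) (R := fun t' => t'.reg 15 = i ∧
      t'.reg 16 = (orient lo q).1 ∧ t'.reg 17 = (orient lo q).2 ∧ t'.arr = t1.arr)
      ?_ ?_ (by omega)
    · refine .straight ?_ rfl
      simp [g2, g3, hW1, e14]
      unfold orient
      split_ifs with h h' h' <;> first | omega | simp [g1, g2, g3]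
    rintro t2 - ⟨k1, k2, k3, k4⟩
    have b1 := hle (orient lo q).1
    have b2 := hle (orient lo q).2
    refine .straight ?_ rfl
    simp [k1, k2, k3, k4, e14, e13, hw0]
    refine ⟨by omega, fun j hj => ?_⟩
    rw [g5, g4 20 (by norm_num), g4 21 (by norm_num), g4 22 (by norm_num), g4 23 (by norm_num)]
    by_cases hji : j = i
    · subst hji
      simp only [Function.update_self]
      simp only [hR, pairRects, hq]
      simp
    · simp only [Function.update_of_ne hji]
      exact hinv j (by omega)
  · simp only [Expr.cost, Expr.lt]; omega
  · rintro t hf ⟨-, hinv⟩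
    have e10 : t.reg 10 = n := by rw [hf.reg 10 rfl]; simpa using h10
    have e13 : t.reg 13 = R.p := by rw [hf.reg 13 rfl, hRp]; simpa using h13
    rw [← hRp] at hinv
    exact ⟨e10, e13, fun i hi => (hinv i hi).1, fun i hi => (hinv i hi).2.1,
      fun i hi => (hinv i hi).2.2.1, fun i hi => (hinv i hi).2.2.2.1,
      fun i hi => (hinv i hi).2.2.2.2⟩

/-! ### Sorting the rectangles -/

namespace RectFamily

variable {R : RectFamily}

variable (R) in
/-- Rectangles with greater keys come first. -/
def key (i : ℕ) : ℕ :=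
  (((R.n - R.x1 i) * (R.n + 1) + R.x2 i) * (R.n + 1) + (R.y2 i - R.y1 i)) * R.p + i

theorem lex_of_le {a b c d N : ℕ} (h : a * N + b ≤ c * N + d) (hd : d < N) :
    a < c ∨ (a = c ∧ b ≤ d) := by
  rcases lt_trichotomy a c with h1 | rfl | h1
  · exact Or.inl h1
  · exact Or.inr ⟨rfl, by omega⟩
  · have := Nat.mul_le_mul_right N h1
    rw [Nat.succ_mul] at this
    omega

/-- The key is a number with the digits n − x1, x2, height and index. The lowest digit recovers the
rectangle from its key, and it makes the keys distinct. -/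
theorem key_mod {i : ℕ} (hi : i < R.p) : R.key i % R.p = i := by
  unfold key
  rw [mul_comm, Nat.mul_add_mod, Nat.mod_eq_of_lt hi]

variable (L : R.Laminar)
include L

theorem Laminar.bounds {i : ℕ} (hi : i < R.p) :
    R.x1 i < R.n ∧ R.x2 i < R.n + 1 ∧ R.y2 i - R.y1 i < R.n + 1 ∧ 0 < R.x2 i := by
  have := L.x_lt i hi
  have := L.x_le_y i hi
  have := L.y_lt i hi
  have := L.y_le i hi
  omega

/-- Allows the value 0 to mark the empty leaves of the priority queue. -/
theorem Laminar.key_pos {i : ℕ} (hi : i < R.p) : 0 < R.key i := by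
  have := L.bounds hi
  unfold key
  have h : 0 < ((R.n - R.x1 i) * (R.n + 1) + R.x2 i) * (R.n + 1) + (R.y2 i - R.y1 i) := by
    have : 0 < ((R.n - R.x1 i) * (R.n + 1) + R.x2 i) * (R.n + 1) := by
      apply Nat.mul_pos <;> omega
    omega
  have := Nat.mul_pos h (show 0 < R.p by omega)
  omega

/-- Since x2 and the height are below the base n + 1 and the index is below p, comparing keys means
comparing digits lexicographically, which is the order `Before`. -/
theorem Laminar.before_of_key {i j : ℕ} (hi : i < R.p) (hj : j < R.p)
    (h : R.key j < R.key i) : R.Before i j := by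
  have h1 := L.bounds hi
  have h2 := L.bounds hj
  unfold key at h
  unfold Before
  have h3 : ((R.n - R.x1 j) * (R.n + 1) + R.x2 j) * (R.n + 1) + (R.y2 j - R.y1 j) ≤
      ((R.n - R.x1 i) * (R.n + 1) + R.x2 i) * (R.n + 1) + (R.y2 i - R.y1 i) := by
    rcases lex_of_le h.le hi with h | ⟨h, -⟩ <;> omega
  rcases lex_of_le h3 h1.2.2.1 with h | ⟨h, h'⟩
  · rcases lex_of_le h.le h1.2.1 with h4 | ⟨h4, h5⟩
    · omega
    · rw [h4] at h; omega
  · rcases lex_of_le h.le h1.2.1 with h4 | ⟨h4, h5⟩ <;> omega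

/-- Bounds the intermediate values too, since the program evaluates the key step by step and none of
them may overflow. -/
theorem Laminar.key_le {i : ℕ} (hi : i < R.p) :
    (R.n - R.x1 i) * (R.n + 1) ≤ (R.n + 1) ^ 3 * (R.p + 1) ∧
    (R.n - R.x1 i) * (R.n + 1) + R.x2 i ≤ (R.n + 1) ^ 3 * (R.p + 1) ∧
    ((R.n - R.x1 i) * (R.n + 1) + R.x2 i) * (R.n + 1) ≤ (R.n + 1) ^ 3 * (R.p + 1) ∧
    ((R.n - R.x1 i) * (R.n + 1) + R.x2 i) * (R.n + 1) + (R.y2 i - R.y1 i) ≤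
      (R.n + 1) ^ 3 * (R.p + 1) ∧
    (((R.n - R.x1 i) * (R.n + 1) + R.x2 i) * (R.n + 1) + (R.y2 i - R.y1 i)) * R.p ≤
      (R.n + 1) ^ 3 * (R.p + 1) ∧ R.key i ≤ (R.n + 1) ^ 3 * (R.p + 1) := by
  have h1 := L.bounds hi
  unfold key
  have hx1 : R.n - R.x1 i ≤ R.n := Nat.sub_le _ _
  generalize R.n - R.x1 i = A at *
  generalize R.y2 i - R.y1 i = D at *
  generalize R.x2 i = B at *
  generalize R.n = n at *
  generalize R.p = p at *
  have e1 : A * (n + 1) + B + 1 ≤ (n + 1) ^ 2 := by nlinarith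
  have e2 : (A * (n + 1) + B) * (n + 1) + D + 1 ≤ (n + 1) ^ 3 := by
    have := Nat.mul_le_mul_right (n + 1) e1
    have e : (n + 1) ^ 3 = (n + 1) ^ 2 * (n + 1) := by ring
    rw [Nat.succ_mul] at this
    omega
  have e3 : ((A * (n + 1) + B) * (n + 1) + D) * p + p ≤ (n + 1) ^ 3 * p := by
    have := Nat.mul_le_mul_right p e2
    rwa [Nat.succ_mul] at this
  have e4 : (n + 1) ^ 3 * (p + 1) = (n + 1) ^ 3 * p + (n + 1) ^ 3 := by ring
  have e5 : (n + 1) ^ 2 ≤ (n + 1) ^ 3 := Nat.pow_le_pow_right (by omega) (by norm_num)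
  have : (A * (n + 1) + B) ≤ (A * (n + 1) + B) * (n + 1) := Nat.le_mul_of_pos_right _ (by omega)
  generalize (A * (n + 1) + B) * (n + 1) = Y at *
  generalize (Y + D) * p = Z at *
  generalize A * (n + 1) = X at *
  generalize (n + 1) ^ 3 = n3 at *
  omega

end RectFamily

theorem below_one {x : ℕ} (hx : 1 ≤ x) : Below x 1 := by
  induction x using Nat.strong_induction_on with
  | h x ih =>
    by_cases h : x = 1
    · rw [h]; exact .refl 1
    · obtain ⟨j, hj⟩ := ih (x / 2) (by omega) (by omega)
      exact ⟨j + 1, by rw [pow_succ', ← Nat.div_div_eq_div_mul]; exact hj⟩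

def fillQueue : Prog := blk [
  .assign 50 (ℛ 13),
  .assign 15 0,
  .loop (.lt (ℛ 15) (ℛ 13)) (blk [
    .assign 51 (ℛ 15),
    .assign 52 ((((ℛ 10 - 𝒜 20 (ℛ 15)) * (ℛ 10 + 1) + 𝒜 21 (ℛ 15)) * (ℛ 10 + 1) +
      (𝒜 23 (ℛ 15) - 𝒜 22 (ℛ 15))) * ℛ 13 + ℛ 15),
    setLeaf 25,
    .assign 15 (ℛ 15 + 1)])]

theorem fillQueue_runs {w : ℕ} {R : RectFamily} (L : R.Laminar) {s : State}
    (h : HoldsRects R s) (h0 : ∀ j, s.arr 25 j = 0)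
    (hW : (R.n + 1) ^ 3 * (R.p + 1) + 4 * R.p + 8 < 2 ^ w) :
    Runs w fillQueue s (R.p * (60 * (Nat.log 2 R.p + 1) + 70) + 20) fun s' =>
      IsMaxTree R.p (s'.arr 25) ∧ (∀ j < R.p, s'.arr 25 (R.p + j) = R.key j) ∧
        s'.reg 50 = R.p := by
  have hW1 : 1 < 2 ^ w := by omega
  have hw0 : w ≠ 0 := by rintro rfl; simp at hW1
  refine Runs.seq (T := 2) (T' := R.p * (60 * (Nat.log 2 R.p + 1) + 70) + 18)
    (R := fun t => t = s.setReg 50 R.p) (.straight (by simp [h.p]) rfl) ?_ (by omega)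
  rintro _ - rfl
  refine Runs.seq (T := 2) (T' := R.p * (60 * (Nat.log 2 R.p + 1) + 70) + 16)
    (R := fun t => t = (s.setReg 50 R.p).setReg 15 0) (.straight (by simp) rfl) ?_ (by omega)
  rintro _ - rfl
  have hh : HoldsRects R ((s.setReg 50 R.p).setReg 15 0) :=
    h.congr (by simp) (by simp) fun k _ => by simp
  refine Runs.forLoop (fun i t => t.reg 15 = i ∧ IsMaxTree R.p (t.arr 25) ∧
    (∀ j < R.p, t.arr 25 (R.p + j) = if j < i then R.key j else 0) ∧ t.reg 50 = R.p)
    (60 * (Nat.log 2 R.p + 1) + 56) 0 R.p _ (Nat.zero_le _) ?_ ?_ ?_ ?_ ?_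
  · exact ⟨by simp, fun i _ _ => by simp [h0], by simp [h0], by simp⟩
  · rintro i t hf ⟨h15, -⟩
    have := hf.reg 13 rfl
    simp [h.p] at this
    simp [this, h15, hW1]
  · rintro i t - hi hf ⟨h15, hmax, hinv, h50⟩
    have ht : HoldsRects R t := hh.congr (hf.reg 10 rfl) (hf.reg 13 rfl) fun k hk => by
      simp only [List.mem_cons, List.not_mem_nil, or_false] at hk
      rcases hk with rfl | rfl | rfl | rfl | rfl <;> exact hf.arr _ rfl
    obtain ⟨b1, b2, b3, b4, b5, b6⟩ := L.key_le hi
    have b7 := L.bounds hi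
    have b8 := L.y_le i hi
    have b9 : R.n + 1 ≤ (R.n + 1) ^ 3 * (R.p + 1) := by
      rw [pow_succ', mul_assoc]
      exact Nat.le_mul_of_pos_right _ (by positivity)
    refine Runs.seq (T := 2) (T' := 60 * (Nat.log 2 R.p + 1) + 54)
      (R := fun t' => t' = t.setReg 51 i) (.straight (by simp [h15]) rfl) ?_ (by omega)
    rintro _ - rfl
    refine Runs.seq (T := 30) (T' := 60 * (Nat.log 2 R.p + 1) + 24)
      (R := fun t' => t' = (t.setReg 51 i).setReg 52 (R.key i))
      (.straight ?_ rfl) ?_ (by omega)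
    · simp [h15, ht.n, ht.p, ht.x1 i hi, ht.x2 i hi, ht.y1 i hi, ht.y2 i hi, hw0, RectFamily.key]
      unfold RectFamily.key at b6
      omega
    rintro _ - rfl
    refine Runs.seq (T' := 4) (setLeaf_runs (N := R.p) (by simpa using h50) (by simpa using hi)
      (by omega) (by simpa using hmax)) ?_ (by omega)
    rintro t1 f1 ⟨h1, h2⟩
    have e15 : t1.reg 15 = i := by rw [f1.reg 15 rfl]; simpa using h15
    have e50 : t1.reg 50 = R.p := by rw [f1.reg 50 rfl]; simpa using h50
    refine .straight ?_ rfl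
    simp [e15, hw0]
    refine ⟨by omega, h1, fun j hj => ?_, e50⟩
    rw [h2 j hj]
    simp
    by_cases hji : j = i
    · rw [if_pos hji, if_pos (by omega), hji]
    · rw [if_neg hji, hinv j hj]
      by_cases hlt : j < i
      · rw [if_pos hlt, if_pos (by omega)]
      · rw [if_neg hlt, if_neg (by omega)]
  · have := Nat.mul_le_mul_left R.p (show 60 * (Nat.log 2 R.p + 1) + 56 + (1 + 1 + 1) + 1 ≤
      60 * (Nat.log 2 R.p + 1) + 70 by omega)
    simp only [Expr.cost, Expr.lt, Nat.sub_zero]; omega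
  · rintro t hf ⟨-, h1, h2, h3⟩
    exact ⟨h1, fun j hj => by rw [h2 j hj, if_pos hj], h3⟩

def drainQueue : Prog := blk [
  .assign 15 0,
  .loop (.lt (ℛ 15) (ℛ 13)) (blk [
    .assign 51 (𝒜 25 1 % ℛ 13),
    .store 26 (ℛ 15) (ℛ 51),
    .assign 52 0,
    setLeaf 25,
    .assign 15 (ℛ 15 + 1)])]

theorem drainQueue_runs {w : ℕ} {R : RectFamily} (L : R.Laminar) {s : State}
    (hp : s.reg 13 = R.p) (hmax : IsMaxTree R.p (s.arr 25))
    (hkey : ∀ j < R.p, s.arr 25 (R.p + j) = R.key j) (h50 : s.reg 50 = R.p)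
    (hW : 4 * R.p + 8 < 2 ^ w) :
    Runs w drainQueue s (R.p * (60 * (Nat.log 2 R.p + 1) + 70) + 20) fun s' =>
      R.IsOrder (s'.arr 26) := by
  have hW1 : 1 < 2 ^ w := by omega
  have hw0 : w ≠ 0 := by rintro rfl; simp at hW1
  refine Runs.seq (T := 2) (T' := R.p * (60 * (Nat.log 2 R.p + 1) + 70) + 18)
    (R := fun t => t = s.setReg 15 0) (.straight (by simp) rfl) ?_ (by omega)
  rintro _ - rfl
  -- Leaves of extracted rectangles are 0 and all others hold their keys. The extracted keys
  -- decrease, and every key still in the queue is smaller than all of them.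
  refine Runs.forLoop (fun k t => t.reg 15 = k ∧ IsMaxTree R.p (t.arr 25) ∧ t.reg 50 = R.p ∧
    (∀ l < k, t.arr 26 l < R.p) ∧
    (∀ l < k, t.arr 25 (R.p + t.arr 26 l) = 0) ∧
    (∀ j < R.p, t.arr 25 (R.p + j) = R.key j ∨ ∃ l < k, t.arr 26 l = j) ∧
    (∀ l l', l < l' → l' < k → R.key (t.arr 26 l') < R.key (t.arr 26 l)) ∧
    ∀ l < k, ∀ j < R.p, t.arr 25 (R.p + j) ≠ 0 → R.key j < R.key (t.arr 26 l))
    (60 * (Nat.log 2 R.p + 1) + 56) 0 R.p _ (Nat.zero_le _) ?_ ?_ ?_ ?_ ?_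
  · exact ⟨by simp, by simpa using hmax, by simpa using h50, by simp, by simp,
      fun j hj => Or.inl (by simpa using hkey j hj), by simp, by simp⟩
  · rintro i t hf ⟨h15, -⟩
    have := hf.reg 13 rfl
    simp [hp] at this
    simp [this, h15, hW1]
  · rintro k t - hk hf ⟨h15, hmax, h50, hlt, hzero, hinv, hdec, hgt⟩
    have h13 : t.reg 13 = R.p := by rw [hf.reg 13 rfl]; simpa using hp
    -- Fewer than `p` rectangles have been extracted, so one is left; its key is positive, hence so
    -- is the value at the root.
    obtain ⟨j₁, hj₁, hnot⟩ : ∃ j < R.p, ∀ l < k, t.arr 26 l ≠ j := by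
      by_contra hcon
      push Not at hcon
      have : Finset.range R.p ⊆ (Finset.range k).image (t.arr 26) := by
        intro j hj
        obtain ⟨l, hl, hlj⟩ := hcon j (by simpa using hj)
        exact Finset.mem_image.2 ⟨l, by simpa using hl, hlj⟩
      have := (Finset.card_le_card this).trans Finset.card_image_le
      simp at this
      omega
    have hval : ∀ j < R.p, t.arr 25 (R.p + j) ≠ 0 → t.arr 25 (R.p + j) = R.key j := by
      intro j hj hne
      rcases hinv j hj with h | ⟨l, hl, rfl⟩
      · exact h
      · exact absurd (hzero l hl) hne
    have hj₁' : t.arr 25 (R.p + j₁) = R.key j₁ := by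
      rcases hinv j₁ hj₁ with h | ⟨l, hl, h⟩
      · exact h
      · exact absurd h (hnot l hl)
    have hroot : ∀ j < R.p, t.arr 25 (R.p + j) ≤ t.arr 25 1 := fun j hj =>
      hmax.le (by omega) le_rfl (below_one (by omega))
    obtain ⟨x, hx1, hx2, -, hx3⟩ := exists_leaf_below hmax 1 le_rfl (by omega)
    obtain ⟨j₀, rfl⟩ := Nat.exists_eq_add_of_le hx1
    have hj₀ : j₀ < R.p := by omega
    have hne : t.arr 25 (R.p + j₀) ≠ 0 := by
      have h1 := hroot j₁ hj₁
      have h2 := L.key_pos hj₁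
      omega
    have h1 : t.arr 25 1 = R.key j₀ := by rw [← hx3, hval j₀ hj₀ hne]
    refine Runs.seq (T := 8) (T' := 60 * (Nat.log 2 R.p + 1) + 42)
      (R := fun t' => t' = t.setReg 51 j₀)
      (.straight (by simp [h1, h13, RectFamily.key_mod hj₀, hw0]; omega) rfl) ?_ (by omega)
    rintro _ - rfl
    refine Runs.seq (T := 4) (T' := 60 * (Nat.log 2 R.p + 1) + 38)
      (R := fun t' => t' = (t.setReg 51 j₀).setArr 26 k j₀)
      (.straight (by simp [h15]) rfl) ?_ (by omega)
    rintro _ - rfl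
    refine Runs.seq (T := 2) (T' := 60 * (Nat.log 2 R.p + 1) + 36)
      (R := fun t' => t' = ((t.setReg 51 j₀).setArr 26 k j₀).setReg 52 0)
      (.straight (by simp) rfl) ?_ (by omega)
    rintro _ - rfl
    refine Runs.seq (T' := 4) (setLeaf_runs (N := R.p) (by simpa using h50) (by simpa using hj₀)
      (by omega) (by simpa using hmax)) ?_ (by omega)
    rintro t1 f1 ⟨g1, g2⟩
    have e15 : t1.reg 15 = k := by rw [f1.reg 15 rfl]; simpa using h15
    have e50 : t1.reg 50 = R.p := by rw [f1.reg 50 rfl]; simpa using h50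
    have e26 : t1.arr 26 = Function.update (t.arr 26) k j₀ := by rw [f1.arr 26 rfl]; simp
    have hold : ∀ l < k, t1.arr 26 l = t.arr 26 l := fun l hl => by
      rw [e26, Function.update_of_ne (by omega)]
    have hnew : t1.arr 26 k = j₀ := by rw [e26, Function.update_self]
    have g3 : ∀ j < R.p, t1.arr 25 (R.p + j) = if j = j₀ then 0 else t.arr 25 (R.p + j) := by
      intro j hj
      rw [g2 j hj]; simp
    have hcase : ∀ l, l < k + 1 → l < k ∨ l = k := fun l hl => by omega
    refine .straight ?_ rfl
    simp [e15, hw0]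
    refine ⟨by omega, g1, e50, fun l hl => ?_, fun l hl => ?_, fun j hj => ?_,
      fun l l' hll hl' => ?_, fun l hl j hj hj' => ?_⟩
    · rcases hcase l (by omega) with h | rfl
      · rw [hold l h]; exact hlt l h
      · rw [hnew]; exact hj₀
    · rcases hcase l (by omega) with h | rfl
      · rw [hold l h, g3 _ (hlt l h)]
        split_ifs
        · rfl
        · exact hzero l h
      · rw [hnew, g3 _ hj₀, if_pos rfl]
    · by_cases hjj : j = j₀
      · exact Or.inr ⟨k, by omega, by rw [hnew, hjj]⟩
      · rw [g3 j hj, if_neg hjj]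
        rcases hinv j hj with h | ⟨l, hl, h⟩
        · exact Or.inl h
        · exact Or.inr ⟨l, by omega, by rw [hold l hl, h]⟩
    · rcases hcase l' (by omega) with h | rfl
      · rw [hold l' h, hold l (by omega)]; exact hdec l l' hll h
      · rw [hnew, hold l hll]; exact hgt l hll j₀ hj₀ hne
    · rw [g3 j hj] at hj'
      split_ifs at hj' with hjj
      · exact absurd rfl hj'
      · rcases hcase l (by omega) with h | rfl
        · rw [hold l h]; exact hgt l h j hj hj'
        · rw [hnew]
          have h2 := hroot j hj
          rw [hval j hj hj', h1] at h2
          -- Equal keys have equal residues modulo p, that is, equal indices.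
          refine lt_of_le_of_ne h2 fun heq => hjj ?_
          rw [← RectFamily.key_mod hj, heq, RectFamily.key_mod hj₀]
  · have := Nat.mul_le_mul_left R.p (show 60 * (Nat.log 2 R.p + 1) + 56 + (1 + 1 + 1) + 1 ≤
      60 * (Nat.log 2 R.p + 1) + 70 by omega)
    simp only [Expr.cost, Expr.lt, Nat.sub_zero]; omega
  · rintro t hf ⟨-, -, -, hlt, -, -, hdec, -⟩
    refine ⟨hlt, fun k hk l hl hkl => ?_, fun k l hkl hl =>
      L.before_of_key (hlt k (by omega)) (hlt l hl) (hdec k l hkl hl)⟩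
    rcases lt_trichotomy k l with h | h | h
    · have := hdec k l h hl
      rw [hkl] at this; omega
    · exact h
    · have := hdec l k h hk
      rw [hkl] at this; omega

/-! ### Sweeping over the columns -/

/-- The list of tuples `E` is stored in the arrays `1, …, 4`, its length in register `20`. -/
structure HoldsOut (E : List (ℕ × ℕ × ℕ × ℕ)) (s : State) : Prop where
  len : s.reg 20 = E.length
  a : Stores (s.arr 1) (E.map fun q => q.1)
  b : Stores (s.arr 2) (E.map fun q => q.2.1)
  c : Stores (s.arr 3) (E.map fun q => q.2.2.1)
  d : Stores (s.arr 4) (E.map fun q => q.2.2.2)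

theorem HoldsOut.frame {E : List (ℕ × ℕ × ℕ × ℕ)} {P : Prog} {s s' : State} (h : HoldsOut E s)
    (hf : Frame P s s') (hr : P.writesReg 20 = false)
    (ha : ([1, 2, 3, 4].all fun k => !P.writesArr k) = true) : HoldsOut E s' := by
  simp at ha
  refine ⟨by rw [hf.reg 20 hr]; exact h.len, ?_, ?_, ?_, ?_⟩
  · rw [hf.arr 1 ha.1]; exact h.a
  · rw [hf.arr 2 ha.2.1]; exact h.b
  · rw [hf.arr 3 ha.2.2.1]; exact h.c
  · rw [hf.arr 4 ha.2.2.2]; exact h.d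

theorem HoldsRects.frame {R : RectFamily} {P : Prog} {s s' : State} (h : HoldsRects R s)
    (hf : Frame P s s') (hr : ([10, 13].all fun k => !P.writesReg k) = true)
    (ha : ([20, 21, 22, 23, 24].all fun k => !P.writesArr k) = true) : HoldsRects R s' := by
  simp at hr ha
  refine h.congr (hf.reg 10 hr.1) (hf.reg 13 hr.2) fun k hk => ?_
  simp only [List.mem_cons, List.not_mem_nil, or_false] at hk
  rcases hk with rfl | rfl | rfl | rfl | rfl <;> apply hf.arr <;> tauto

/-- The number of the first item of a stack, plus one. -/
def topCode : List ℕ → ℕ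
  | [] => 0
  | r :: _ => r + 1

/-- The arrays `27` and `28` hold the ends and the colours of the segments by their start, the
arrays `30, …, 33` hold the segment into which an item has been inserted and the item below it on
the stack, and the maximum tree `34` marks the starts of the segments. -/
structure HoldsStack (R : RectFamily) (S : List ℕ) (s : State) : Prop where
  rects : HoldsRects R s
  size : s.reg 50 = R.n
  top : s.reg 22 = topCode S
  -- What is saved for `r` refers to the stack below it, so it remains valid until `r` is removed
  -- and then suffices to restore the segment it had cut.
  frames : ∀ r S', (r :: S') <:+ S → s.arr 30 r = (R.seg S' (R.y1 r)).1 ∧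
    s.arr 31 r = (R.seg S' (R.y1 r)).2.1 ∧ s.arr 32 r = (R.seg S' (R.y1 r)).2.2 ∧
    s.arr 33 r = topCode S'
  segs : ∀ y < R.n, (R.seg S y).1 = y →
    s.arr 27 y = (R.seg S y).2.1 ∧ s.arr 28 y = (R.seg S y).2.2
  tree : IsMaxTree R.n (s.arr 34)
  -- Marking a start `y` by y + 1, and other positions by 0, turns the search for the preceding
  -- start into a prefix maximum.
  marks : ∀ y < R.n, s.arr 34 (R.n + y) = if (R.seg S y).1 = y then y + 1 else 0

theorem HoldsStack.frame {R : RectFamily} {S : List ℕ} {P : Prog} {s s' : State}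
    (h : HoldsStack R S s) (hf : Frame P s s')
    (hr : ([10, 13, 22, 50].all fun k => !P.writesReg k) = true)
    (ha : ([20, 21, 22, 23, 24, 27, 28, 30, 31, 32, 33, 34].all fun k => !P.writesArr k) = true) :
    HoldsStack R S s' := by
  simp at hr ha
  obtain ⟨a1, a2, a3, a4, a5, a6, a7, a8, a9, a10, a11, a12⟩ := ha
  refine ⟨h.rects.frame hf (by simp [hr]) (by simp [*]), ?_, ?_, ?_, ?_, ?_, ?_⟩
  · rw [hf.reg 50 hr.2.2.2]; exact h.size
  · rw [hf.reg 22 hr.2.2.1]; exact h.top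
  · rw [hf.arr 30 a8, hf.arr 31 a9, hf.arr 32 a10, hf.arr 33 a11]; exact h.frames
  · rw [hf.arr 27 a6, hf.arr 28 a7]; exact h.segs
  · rw [hf.arr 34 a12]; exact h.tree
  · rw [hf.arr 34 a12]; exact h.marks

/-- Write the rectangle of the segment with start `reg 40` up to the column `reg 41`. -/
def flushSegment : Prog := blk [
  .ite (𝒜 28 (ℛ 40)) (.ite (.lt (𝒜 29 (ℛ 40)) (ℛ 41)) (blk [
    .store 1 (ℛ 20) (𝒜 29 (ℛ 40)),
    .store 2 (ℛ 20) (ℛ 41 - 1),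
    .store 3 (ℛ 20) (ℛ 40),
    .store 4 (ℛ 20) (𝒜 27 (ℛ 40) - 1),
    .assign 20 (ℛ 20 + 1)]) .skip) .skip,
  .store 29 (ℛ 40) (ℛ 41)]

theorem flushSegment_runs {w : ℕ} {R : RectFamily} (L : R.Laminar) {Z : ℕ → ℕ} {k : ℕ}
    {S : List ℕ} {X : ℕ} {E : List (ℕ × ℕ × ℕ × ℕ)} {s : State} (hst : HoldsStack R S s)
    (ho : HoldsOut E s) (H : R.Sweep Z k S X (s.arr 29) E) {y : ℕ} (h40 : s.reg 40 = y)
    (h41 : s.reg 41 = X) (hy : y < R.n) (hyy : (R.seg S y).1 = y) (hn : R.n + 1 < 2 ^ w)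
    (hE : E.length + 1 < 2 ^ w) :
    Runs w flushSegment s 50 fun s' => s'.arr 29 = Function.update (s.arr 29) y X ∧
      ∃ E', HoldsOut E' s' ∧ R.Sweep Z k S X (s'.arr 29) E' ∧ E'.length ≤ E.length + 1 := by
  have hW1 : 1 < 2 ^ w := by omega
  have hw0 : w ≠ 0 := by rintro rfl; simp at hW1
  have hF := H.flush L hy hyy
  obtain ⟨h27, h28⟩ := hst.segs y hy hyy
  have hX := H.X_le
  have hle := L.finish_le H.stack hy
  have h20 := ho.len
  refine .straight ?_ rfl
  simp only [flushSegment, blk, Prog.sl, Prog.Safe, Expr.val_arr, Expr.val_reg, Expr.val_lt,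
    h40, h41, h28]
  by_cases hc : (R.seg S y).2.2 = 0
  · simp only [hc, ne_eq, not_true_eq_false, false_and, if_false] at hF
    simp [hc, hw0, h40, h41]
    exact ⟨E, ⟨ho.len, ho.a, ho.b, ho.c, ho.d⟩, hF, by omega⟩
  · by_cases hx : s.arr 29 y < X
    · rw [if_pos ⟨hc, hx⟩] at hF
      simp [hc, hx, hw0, h40, h41, h20, h27]
      refine ⟨by omega, _, ⟨?_, ?_, ?_, ?_, ?_⟩, hF, ?_⟩
      · simp
      · simpa using ho.a.append (s.arr 29 y)
      · simpa using ho.b.append (X - 1)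
      · simpa using ho.c.append y
      · simpa using ho.d.append ((R.seg S y).2.1 - 1)
      · simp
    · rw [if_neg (by tauto)] at hF
      simp [hc, hx, hw0, h40, h41]
      exact ⟨E, ⟨ho.len, ho.a, ho.b, ho.c, ho.d⟩, hF, by omega⟩

/-- Compute in register `42` the maximum of the leaves from number `reg 54` to number `reg 55 - 1`
of the maximum tree `34`. -/
def rangeMax : Prog := blk [
  decompose 35,
  .assign 42 0,
  .assign 43 0,
  .loop (.lt (ℛ 43) (ℛ 56)) (blk [
    .ite (.lt (ℛ 42) (𝒜 34 (𝒜 35 (ℛ 43)))) (.assign 42 (𝒜 34 (𝒜 35 (ℛ 43)))) .skip,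
    .assign 43 (ℛ 43 + 1)])]

/-- Each leaf of the range lies below a node of its decomposition, and each of these nodes attains
its value at a leaf of the range. So the maximum over O(log N) nodes is the maximum over the range.
-/
theorem rangeMax_runs {w N a b : ℕ} {s : State} (hN : s.reg 50 = N) (ha : s.reg 54 = a)
    (hb : s.reg 55 = b) (hab : a ≤ b) (hbN : b ≤ N) (hN0 : 0 < N) (hW : 4 * N + 8 < 2 ^ w)
    (hT : IsMaxTree N (s.arr 34)) :
    Runs w rangeMax s (190 * (Nat.log 2 N + 2)) fun s' =>
      (∀ j, a ≤ j → j < b → s.arr 34 (N + j) ≤ s'.reg 42) ∧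
      (s'.reg 42 = 0 ∨ ∃ j, a ≤ j ∧ j < b ∧ s.arr 34 (N + j) = s'.reg 42) := by
  have hW1 : 1 < 2 ^ w := by omega
  have hw0 : w ≠ 0 := by rintro rfl; simp at hW1
  have hlogN : Nat.log 2 N < N := Nat.log_lt_self 2 (by omega)
  refine Runs.seq (T' := 70 * (Nat.log 2 N + 2)) (decompose_runs hN ha hb hab hbN hN0 hW) ?_
    (by omega)
  rintro s1 f1 ⟨D, hD, h56, hst⟩
  have hDl := hD.length_le
  have h34 : s1.arr 34 = s.arr 34 := f1.arr 34 rfl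
  refine Runs.seq (T := 2) (T' := 70 * (Nat.log 2 N + 2) - 2)
    (R := fun t => t = s1.setReg 42 0) (.straight (by simp) rfl) ?_ (by omega)
  rintro _ - rfl
  refine Runs.seq (T := 2) (T' := 70 * (Nat.log 2 N + 2) - 4)
    (R := fun t => t = (s1.setReg 42 0).setReg 43 0) (.straight (by simp) rfl) ?_ (by omega)
  rintro _ - rfl
  refine Runs.forLoop (fun i t => t.reg 43 = i ∧
    (∀ j x, j < i → D[j]? = some x → s.arr 34 x ≤ t.reg 42) ∧
    (t.reg 42 = 0 ∨ ∃ x ∈ D, s.arr 34 x = t.reg 42)) 24 0 D.length _ (Nat.zero_le _) ?_ ?_ ?_ ?_ ?_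
  · simp
  · rintro i t hf ⟨h43, -⟩
    have := hf.reg 56 rfl
    simp [h56] at this
    simp [this, h43, hW1]
  · rintro i t - hi hf ⟨h43, h1, h2⟩
    have e34 : t.arr 34 = s.arr 34 := by rw [hf.arr 34 rfl]; simpa using h34
    have e35 : t.arr 35 i = D[i] := by
      rw [hf.arr 35 rfl]; simpa using hst.get i hi
    refine .straight ?_ rfl
    simp [h43, e34, e35, hw0]
    by_cases hlt : t.reg 42 < s.arr 34 D[i]
    · simp [not_le.2 hlt, h43]
      refine ⟨by omega, fun j x hj hx => ?_, Or.inr ⟨D[i], List.getElem_mem _, rfl⟩⟩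
      rcases Nat.lt_or_eq_of_le hj with h | rfl
      · exact (h1 j x h hx).trans hlt.le
      · rw [List.getElem?_eq_getElem hi] at hx
        cases hx; exact le_rfl
    · simp [not_lt.1 hlt, h43]
      refine ⟨by omega, fun j x hj hx => ?_, h2⟩
      rcases Nat.lt_or_eq_of_le hj with h | rfl
      · exact h1 j x h hx
      · rw [List.getElem?_eq_getElem hi] at hx
        cases hx; exact not_lt.1 hlt
  · have := Nat.mul_le_mul_right 28 hDl
    simp only [Expr.cost, Expr.lt, Nat.sub_zero]; omega
  · rintro t - ⟨-, h1, h2⟩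
    refine ⟨fun j hj hj' => ?_, h2.imp id ?_⟩
    · obtain ⟨y, hy, hyx⟩ := (hD.mem_iff (N + j) (by omega) (by omega)).1 ⟨by omega, by omega⟩
      obtain ⟨i, hi, rfl⟩ := List.getElem_of_mem hy
      exact (hT.le (by omega) (hD.pos _ hy) hyx).trans
        (h1 i _ hi (List.getElem?_eq_getElem hi))
    · rintro ⟨y, hy, hyt⟩
      obtain ⟨x, hx1, hx2, hx3, hx4⟩ := exists_leaf_below hT y (hD.pos y hy) (hD.lt y hy)
      obtain ⟨j, rfl⟩ := Nat.exists_eq_add_of_le hx1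
      have := (hD.mem_iff _ hx1 hx2).2 ⟨y, hy, hx3⟩
      exact ⟨j, by omega, by omega, by rw [hx4, hyt]⟩

/-- Compute in register `42` the start of the segment containing `reg 55 - 1`. -/
def findStart : Prog := blk [.assign 54 0, rangeMax, .assign 42 (ℛ 42 - 1)]

/-- By `Laminar.le_start`, the start of the segment of `y` is the greatest marked position up to
`y`. -/
theorem findStart_runs {w : ℕ} {R : RectFamily} (L : R.Laminar) {S : List ℕ} {s : State}
    (hS : R.IsStack S) (hst : HoldsStack R S s) {y : ℕ} (h55 : s.reg 55 = y + 1) (hy : y < R.n)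
    (hW : 4 * R.n + 8 < 2 ^ w) :
    Runs w findStart s (190 * (Nat.log 2 R.n + 2) + 10) fun s' =>
      s'.reg 42 = (R.seg S y).1 := by
  have hW1 : 1 < 2 ^ w := by omega
  have hw0 : w ≠ 0 := by rintro rfl; simp at hW1
  refine Runs.seq (T := 2) (T' := 190 * (Nat.log 2 R.n + 2) + 8)
    (R := fun t => t = s.setReg 54 0) (.straight (by simp) rfl) ?_ (by omega)
  rintro _ - rfl
  refine Runs.seq (T' := 8) (rangeMax_runs (N := R.n) (a := 0) (b := y + 1)
    (by simpa using hst.size) (by simp) (by simpa using h55) (by omega) (by omega) (by omega) hW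
    (by simpa using hst.tree)) ?_ (by omega)
  rintro s1 - ⟨h1, h2⟩
  have hle := L.start_le hS hy
  simp only [State.setReg_arr] at h1 h2
  have h3 := h1 _ (Nat.zero_le _) (Nat.lt_succ_of_le hle)
  rw [hst.marks _ (by omega), if_pos (by rw [L.seg_start hS hy])] at h3
  have h4 : s1.reg 42 ≤ (R.seg S y).1 + 1 := by
    rcases h2 with h2 | ⟨j, -, hj, h2⟩
    · omega
    · rw [hst.marks _ (by omega)] at h2
      split_ifs at h2 with hs
      · have := L.le_start hS hy (by omega) hs
        omega
      · omega
  refine .straight ?_ rfl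
  simp [hw0]
  omega

/-- Insert the item with number `reg 21` in the order `26`. -/
def pushItem : Prog := blk [
  blk [.assign 44 (𝒜 26 (ℛ 21)), .assign 41 (𝒜 20 (ℛ 44)), .assign 55 (𝒜 22 (ℛ 44) + 1)],
  findStart,
  blk [.store 30 (ℛ 44) (ℛ 42), .store 31 (ℛ 44) (𝒜 27 (ℛ 42)),
    .store 32 (ℛ 44) (𝒜 28 (ℛ 42)), .store 33 (ℛ 44) (ℛ 22), .assign 40 (ℛ 42)],
  flushSegment,
  -- The order of the stores matters: if the segment starts at `y1`, the left piece is empty and the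
  -- second store replaces the first. The right piece takes its end and colour from the saved
  -- copies.
  blk [.store 27 (ℛ 42) (𝒜 22 (ℛ 44)), .store 27 (𝒜 22 (ℛ 44)) (𝒜 23 (ℛ 44)),
    .store 28 (𝒜 22 (ℛ 44)) (𝒜 24 (ℛ 44)), .store 29 (𝒜 22 (ℛ 44)) (ℛ 41),
    .ite (.lt (𝒜 23 (ℛ 44)) (𝒜 31 (ℛ 44))) (blk [
      .store 27 (𝒜 23 (ℛ 44)) (𝒜 31 (ℛ 44)), .store 28 (𝒜 23 (ℛ 44)) (𝒜 32 (ℛ 44)),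
      .store 29 (𝒜 23 (ℛ 44)) (ℛ 41)]) .skip,
    .assign 51 (𝒜 22 (ℛ 44)), .assign 52 (ℛ 51 + 1)],
  setLeaf 34,
  .ite (.lt (𝒜 23 (ℛ 44)) (𝒜 31 (ℛ 44))) (blk [
    blk [.assign 51 (𝒜 23 (ℛ 44)), .assign 52 (ℛ 51 + 1)], setLeaf 34]) .skip,
  blk [.assign 22 (ℛ 44 + 1), .assign 21 (ℛ 21 + 1)]]

/-- An insertion flushes one segment, hence writes at most one tuple. The coefficient 310 comes from
one predecessor search (190) and at most two changes of marks (60 each). -/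
theorem pushItem_runs {w : ℕ} {R : RectFamily} (L : R.Laminar) {Z : ℕ → ℕ} {k : ℕ}
    {S : List ℕ} {X : ℕ} {E : List (ℕ × ℕ × ℕ × ℕ)} {s : State} (hst : HoldsStack R S s)
    (ho : HoldsOut E s) (hZ : R.IsOrder Z) (h26 : s.arr 26 = Z)
    (H : R.Sweep Z k S X (s.arr 29) E) (h21 : s.reg 21 = k) (hk : k < R.p)
    (hS : ∀ q ∈ S, R.x1 (Z k) < R.x2 q) (hW : 4 * R.n + 8 < 2 ^ w) (hp : R.p + 1 < 2 ^ w)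
    (hE : E.length + 1 < 2 ^ w) :
    Runs w pushItem s (310 * (Nat.log 2 R.n + 2) + 200) fun s' =>
      HoldsStack R (Z k :: S) s' ∧ s'.reg 21 = k + 1 ∧ ∃ E', HoldsOut E' s' ∧
        R.Sweep Z (k + 1) (Z k :: S) (R.x1 (Z k)) (s'.arr 29) E' ∧ E'.length ≤ E.length + 1 := by
  have hW1 : 1 < 2 ^ w := by omega
  have hw0 : w ≠ 0 := by rintro rfl; simp at hW1
  have hr := hZ.lt k hk
  have b1 := L.x_lt _ hr
  have b2 := L.x_le_y _ hr
  have b3 := L.y_lt _ hr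
  have b4 := L.y_le _ hr
  -- The sweep may move on to the next left side: the remaining rectangles start no earlier, as they
  -- are sorted, and those on the stack end later.
  have HX : R.Sweep Z k S (R.x1 (Z k)) (s.arr 29) E := by
    refine H.advance L hZ (H.new k le_rfl hk) (by omega) (fun q hq => (hS q hq).le)
      fun l hl hl' => ?_
    rcases hl.eq_or_lt with rfl | hl
    · exact le_rfl
    · have := hZ.before k l hl hl'
      unfold RectFamily.Before at this
      omega
  have hS' : R.IsStack (Z k :: S) := H.isStack_push L hZ hk hS
  obtain ⟨c1, c2, c3, c4⟩ := L.stack_bounds hS'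
  generalize hrr : Z k = r at *
  have hrS : r ∉ S := (List.nodup_cons.1 hS'.nodup).1
  generalize hsd : (R.seg S (R.y1 r)).1 = sg at *
  have hsgn : sg < R.n := by omega
  have hsgs : (R.seg S sg).1 = sg := by rw [← hsd, L.seg_start H.stack (by omega)]
  have hsgq : R.seg S sg = R.seg S (R.y1 r) := by rw [← hsd, L.seg_start H.stack (by omega)]
  refine Runs.seq (T := 20) (T' := 310 * (Nat.log 2 R.n + 2) + 180)
    (R := fun t => t.reg 44 = r ∧ t.reg 41 = R.x1 r ∧ t.reg 55 = R.y1 r + 1 ∧ t.reg 21 = k ∧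
      t.arr = s.arr) ?_ ?_ (by omega)
  · refine .straight ?_ rfl
    simp [h21, h26, hrr, hst.rects.x1 r hr, hst.rects.y1 r hr, hw0]
    omega
  rintro s1 f1 ⟨e44, e41, e55, e21, earr⟩
  have hst1 := hst.frame f1 rfl rfl
  have ho1 := ho.frame f1 rfl rfl
  refine Runs.seq (T' := 120 * (Nat.log 2 R.n + 2) + 170)
    (findStart_runs L H.stack hst1 e55 (by omega) hW) ?_ (by omega)
  rintro s2 f2 e42
  rw [hsd] at e42
  have hst2 := hst1.frame f2 rfl rfl
  have ho2 := ho1.frame f2 rfl rfl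
  have g44 : s2.reg 44 = r := by rw [f2.reg 44 rfl, e44]
  have g41 : s2.reg 41 = R.x1 r := by rw [f2.reg 41 rfl, e41]
  have g21 : s2.reg 21 = k := by rw [f2.reg 21 rfl, e21]
  have g29 : s2.arr 29 = s.arr 29 := by rw [f2.arr 29 rfl, earr]
  obtain ⟨g27, g28⟩ := hst2.segs sg hsgn hsgs
  rw [hsgq] at g27 g28
  refine Runs.seq (T := 25) (T' := 120 * (Nat.log 2 R.n + 2) + 145)
    (R := fun t => HoldsStack R S t ∧ t.arr 30 r = sg ∧ t.arr 31 r = (R.seg S (R.y1 r)).2.1 ∧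
      t.arr 32 r = (R.seg S (R.y1 r)).2.2 ∧ t.arr 33 r = topCode S ∧ t.reg 40 = sg) ?_ ?_
      (by omega)
  · refine .straight ?_ rfl
    simp [g44, e42, g27, g28, hst2.top]
    refine ⟨hst2.rects.congr (by simp) (by simp) ?_, by simpa using hst2.size,
      by simpa using hst2.top, ?_, by simpa using hst2.segs, by simpa using hst2.tree,
      by simpa using hst2.marks⟩
    · intro j hj
      simp only [List.mem_cons, List.not_mem_nil, or_false] at hj
      rcases hj with rfl | rfl | rfl | rfl | rfl <;> simp
    · intro r' S' hr'
      have : r' ≠ r := by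
        rintro rfl
        exact hrS (hr'.subset (by simp))
      simpa [this] using hst2.frames r' S' hr'
  rintro s3 f3 ⟨hst3, e30, e31, e32, e33, e40⟩
  have ho3 := ho2.frame f3 rfl rfl
  have i44 : s3.reg 44 = r := by rw [f3.reg 44 rfl, g44]
  have i41 : s3.reg 41 = R.x1 r := by rw [f3.reg 41 rfl, g41]
  have i42 : s3.reg 42 = sg := by rw [f3.reg 42 rfl, e42]
  have i21 : s3.reg 21 = k := by rw [f3.reg 21 rfl, g21]
  have i29 : s3.arr 29 = s.arr 29 := by rw [f3.arr 29 rfl, g29]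
  refine Runs.seq (T' := 120 * (Nat.log 2 R.n + 2) + 95)
    (flushSegment_runs L hst3 ho3 (by rwa [i29]) e40 i41 hsgn hsgs (by omega) hE)
    ?_ (by omega)
  rintro s4 f4 ⟨j29, E', ho4, H4, hE'⟩
  have hst4 := hst3.frame f4 rfl rfl
  have j44 : s4.reg 44 = r := by rw [f4.reg 44 rfl, i44]
  have j41 : s4.reg 41 = R.x1 r := by rw [f4.reg 41 rfl, i41]
  have j42 : s4.reg 42 = sg := by rw [f4.reg 42 rfl, i42]
  have j21 : s4.reg 21 = k := by rw [f4.reg 21 rfl, i21]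
  have j30 : s4.arr 30 r = sg := by rw [f4.arr 30 rfl, e30]
  have j31 : s4.arr 31 r = (R.seg S (R.y1 r)).2.1 := by rw [f4.arr 31 rfl, e31]
  have j32 : s4.arr 32 r = (R.seg S (R.y1 r)).2.2 := by rw [f4.arr 32 rfl, e32]
  have j33 : s4.arr 33 r = topCode S := by rw [f4.arr 33 rfl, e33]
  refine Runs.seq (T := 70) (T' := 120 * (Nat.log 2 R.n + 2) + 25)
    (R := fun t => (∀ y < R.n, (R.seg (r :: S) y).1 = y →
        t.arr 27 y = (R.seg (r :: S) y).2.1 ∧ t.arr 28 y = (R.seg (r :: S) y).2.2) ∧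
      R.Sweep Z (k + 1) (r :: S) (R.x1 r) (t.arr 29) E' ∧ t.reg 51 = R.y1 r ∧
      t.reg 52 = R.y1 r + 1) ?_ ?_ (by omega)
  · refine .straight ?_ rfl
    simp [j44, j42, j41, j31, j32, hst4.rects.y1 r hr, hst4.rects.y2 r hr, hst4.rects.col r hr, hw0]
    -- Stated for arbitrary arrays, so that it covers the cases with and without a right piece. Only
    -- entries at starts of segments matter; all others may be stale.
    have hseg : ∀ f27 f28 : ℕ → ℕ,
        (∀ y, y ≠ R.y1 r → y ≠ sg → ¬ (y = R.y2 r ∧ R.y2 r < (R.seg S (R.y1 r)).2.1) →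
          f27 y = s4.arr 27 y) →
        (∀ y, y ≠ R.y1 r → ¬ (y = R.y2 r ∧ R.y2 r < (R.seg S (R.y1 r)).2.1) →
          f28 y = s4.arr 28 y) →
        f27 (R.y1 r) = R.y2 r → f28 (R.y1 r) = R.col r → (sg < R.y1 r → f27 sg = R.y1 r) →
        (R.y2 r < (R.seg S (R.y1 r)).2.1 → f27 (R.y2 r) = (R.seg S (R.y1 r)).2.1 ∧
          f28 (R.y2 r) = (R.seg S (R.y1 r)).2.2) →
        ∀ y < R.n, (R.seg (r :: S) y).1 = y →
        f27 y = (R.seg (r :: S) y).2.1 ∧ f28 y = (R.seg (r :: S) y).2.2 := by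
      intro f27 f28 k1 k2 k3 k4 k5 k6 y hy hyy
      rcases L.start_cons hS' hy with ⟨l1, l2, l3, l4⟩ | ⟨l1, l2, l3⟩
      · rw [hsd] at l1 l4
        rw [l4] at hyy ⊢
        split_ifs at hyy ⊢ with l5 l6 <;> simp only at hyy ⊢ <;> subst hyy
        · refine ⟨k5 l5, ?_⟩
          rw [k2 _ (by omega) (by omega), ← hsgq]
          exact (hst4.segs _ hsgn hsgs).2
        · exact ⟨k3, k4⟩
        · exact k6 l2
      · rw [hsd] at l1 l3
        rw [l2] at hyy ⊢
        rw [hyy] at l3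
        rw [k1 _ (by omega) (by omega) (by omega), k2 _ (by omega) (by omega)]
        exact hst4.segs y hy hyy
    have hpush : ∀ f29 : ℕ → ℕ, f29 (R.y1 r) = R.x1 r →
        (R.y2 r < (R.seg S (R.y1 r)).2.1 → f29 (R.y2 r) = R.x1 r) →
        (∀ y, y ≠ R.y1 r → ¬ (y = R.y2 r ∧ R.y2 r < (R.seg S (R.y1 r)).2.1) →
          f29 y = s4.arr 29 y) → R.Sweep Z (k + 1) (r :: S) (R.x1 r) f29 E' := by
      intro f29 k1 k2 k3
      subst hrr
      exact H4.push L hZ hk hS (by rw [hsd, j29]; simp) hS' k1 k2 k3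
    by_cases hlt : R.y2 r < (R.seg S (R.y1 r)).2.1
    · simp [not_le.2 hlt, j44, hst4.rects.y1 r hr]
      refine ⟨by omega, hseg _ _ ?_ ?_ ?_ ?_ ?_ ?_, hpush _ ?_ ?_ ?_⟩
      · intro y k1 k2 k3
        simp only [hlt, and_true] at k3
        simp [k1, k2, k3]
      · intro y k1 k3
        simp only [hlt, and_true] at k3
        simp [k1, k3]
      · simp [b3.ne]
      · simp [b3.ne]
      · intro h
        simp [h.ne, (h.trans b3).ne]
      · simp
      · simp [b3.ne]
      · simp
      · intro y k1 k3
        simp only [hlt, and_true] at k3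
        simp [k1, k3]
    · simp [not_lt.1 hlt, j44, hst4.rects.y1 r hr]
      refine ⟨by omega, hseg _ _ ?_ ?_ ?_ ?_ ?_ ?_, hpush _ ?_ ?_ ?_⟩
      · intro y k1 k2 k3
        simp [k1, k2]
      · intro y k1 k3
        simp [k1]
      · simp
      · simp
      · intro h
        simp [h.ne]
      · simp [hlt]
      · simp
      · simp [hlt]
      · intro y k1 k3
        simp [k1]
  rintro s5 f5 ⟨hsegs, H5, e51, e52⟩
  have ho5 := ho4.frame f5 rfl rfl
  have hrc5 := hst4.rects.frame f5 rfl rfl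
  have m50 : s5.reg 50 = R.n := by rw [f5.reg 50 rfl]; exact hst4.size
  have m34 : s5.arr 34 = s4.arr 34 := f5.arr 34 rfl
  refine Runs.seq (T' := 60 * (Nat.log 2 R.n + 2) + 25)
    (setLeaf_runs (N := R.n) m50 (by omega) (by omega) (by rw [m34]; exact hst4.tree)) ?_
    (by omega)
  rintro s6 f6 ⟨ht6, hm6⟩
  have hrc6 := hrc5.frame f6 rfl rfl
  have ho6 := ho5.frame f6 rfl rfl
  have n44 : s6.reg 44 = r := by rw [f6.reg 44 rfl, f5.reg 44 rfl, j44]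
  have n31 : s6.arr 31 r = (R.seg S (R.y1 r)).2.1 := by rw [f6.arr 31 rfl, f5.arr 31 rfl, j31]
  have n50 : s6.reg 50 = R.n := by rw [f6.reg 50 rfl, m50]
  rw [e51, e52] at hm6
  refine Runs.seq (T := 60 * (Nat.log 2 R.n + 2) + 10) (T' := 10)
    (R := fun t => IsMaxTree R.n (t.arr 34) ∧ ∀ y < R.n, t.arr 34 (R.n + y) =
      if (R.seg (r :: S) y).1 = y then y + 1 else 0) ?_ ?_ (by omega)
  · refine Runs.ite (T := 60 * (Nat.log 2 R.n + 2)) (by simp [hw0]) ?_ ?_ (by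
      simp only [Expr.cost, Expr.lt]; omega)
    · intro hne
      have hlt : R.y2 r < (R.seg S (R.y1 r)).2.1 := by
        simpa [n44, n31, hrc6.y2 r hr] using hne
      refine Runs.seq (T := 10) (T' := 60 * (Nat.log 2 R.n + 1))
        (R := fun t => t.reg 51 = R.y2 r ∧ t.reg 52 = R.y2 r + 1 ∧ t.reg 50 = R.n ∧
          t.arr = s6.arr) ?_ ?_ (by omega)
      · refine .straight ?_ rfl
        simp [n44, hrc6.y2 r hr, hw0, n50]
        omega
      rintro t1 - ⟨o51, o52, o50, oarr⟩
      refine (setLeaf_runs (N := R.n) o50 (by omega) (by omega) (by rw [oarr]; exact ht6)).mono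
        le_rfl ?_
      rintro t2 - ⟨p1, p2⟩
      refine ⟨p1, fun y hy => ?_⟩
      rw [p2 y hy, o51, o52, oarr, hm6 y hy, m34, hst4.marks y hy]
      have := L.isStart_cons hS' hy
      split_ifs <;> omega
    · intro h0
      have hlt : ¬ R.y2 r < (R.seg S (R.y1 r)).2.1 := by
        simpa [n44, n31, hrc6.y2 r hr] using h0
      refine .straight ⟨trivial, ht6, fun y hy => ?_⟩ (Nat.ble_eq_true_of_le (by
        simp only [Prog.cost]; omega))
      simp only [Prog.sl]
      rw [hm6 y hy, m34, hst4.marks y hy]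
      have := L.isStart_cons hS' hy
      split_ifs <;> omega
  rintro s7 f7 ⟨ht7, hm7⟩
  have hrc7 := hrc6.frame f7 rfl rfl
  have ho7 := ho6.frame f7 rfl rfl
  have q44 : s7.reg 44 = r := by rw [f7.reg 44 rfl, n44]
  have q21 : s7.reg 21 = k := by rw [f7.reg 21 rfl, f6.reg 21 rfl, f5.reg 21 rfl, j21]
  have q50 : s7.reg 50 = R.n := by rw [f7.reg 50 rfl, n50]
  have qa : ∀ i, i ∈ [30, 31, 32, 33] → s7.arr i = s4.arr i := by
    intro i hi
    simp only [List.mem_cons, List.not_mem_nil, or_false] at hi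
    rcases hi with rfl | rfl | rfl | rfl <;> rw [f7.arr _ rfl, f6.arr _ rfl, f5.arr _ rfl]
  have qb : ∀ i, i ∈ [27, 28, 29] → s7.arr i = s5.arr i := by
    intro i hi
    simp only [List.mem_cons, List.not_mem_nil, or_false] at hi
    rcases hi with rfl | rfl | rfl <;> rw [f7.arr _ rfl, f6.arr _ rfl]
  refine .straight ?_ rfl
  simp [q44, q21, hw0]
  refine ⟨by omega, ⟨?_, ?_, ?_, ?_, ?_, ?_, ?_⟩, E', ⟨?_, ?_, ?_, ?_, ?_⟩, ?_, hE'⟩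
  · exact hrc7.congr (by simp) (by simp) (by simp)
  · simpa using q50
  · simp [topCode]
  · intro r' S' hr'
    simp only [State.setReg_arr]
    rw [qa 30 (by simp), qa 31 (by simp), qa 32 (by simp), qa 33 (by simp)]
    rcases List.suffix_cons_iff.1 hr' with h | h
    · cases h
      exact ⟨by rw [j30, hsd], j31, j32, j33⟩
    · exact hst4.frames r' S' h
  · simp only [State.setReg_arr]
    rw [qb 27 (by simp), qb 28 (by simp)]
    exact hsegs
  · exact ht7
  · exact hm7
  · simpa using ho7.len
  · exact ho7.a
  · exact ho7.b
  · exact ho7.c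
  · exact ho7.d
  · rw [qb 29 (by simp)]
    exact H5

/-- Remove the item on the top of the stack. -/
def popItem : Prog := blk [
  blk [.assign 44 (ℛ 22 - 1), .assign 41 (𝒜 21 (ℛ 44)), .assign 40 (𝒜 30 (ℛ 44))],
  flushSegment,
  .assign 40 (𝒜 22 (ℛ 44)),
  flushSegment,
  .ite (.lt (𝒜 23 (ℛ 44)) (𝒜 31 (ℛ 44)))
    (blk [.assign 40 (𝒜 23 (ℛ 44)), flushSegment]) .skip,
  blk [.store 27 (𝒜 30 (ℛ 44)) (𝒜 31 (ℛ 44)), .store 28 (𝒜 30 (ℛ 44)) (𝒜 32 (ℛ 44)),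
    .assign 52 0, .assign 51 (𝒜 22 (ℛ 44)),
    -- The mark at `y1` is deleted unless the glued segment starts there; then register 52 rewrites
    -- the same mark.
    .ite (.lt (𝒜 30 (ℛ 44)) (𝒜 22 (ℛ 44))) .skip (.assign 52 (ℛ 51 + 1))],
  setLeaf 34,
  .ite (.lt (𝒜 23 (ℛ 44)) (𝒜 31 (ℛ 44))) (blk [
    blk [.assign 51 (𝒜 23 (ℛ 44)), .assign 52 0], setLeaf 34]) .skip,
  .assign 22 (𝒜 33 (ℛ 44))]

/-- All pieces of the cut segment are flushed, at most three of them, before the saved end and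
colour are restored. This accounts for at most three tuples and two changes of marks. -/
theorem popItem_runs {w : ℕ} {R : RectFamily} (L : R.Laminar) {Z : ℕ → ℕ} {k r : ℕ}
    {S : List ℕ} {X : ℕ} {E : List (ℕ × ℕ × ℕ × ℕ)} {s : State} (hst : HoldsStack R (r :: S) s)
    (ho : HoldsOut E s) (hZ : R.IsOrder Z)
    (H : R.Sweep Z k (r :: S) X (s.arr 29) E)
    (hk : ∀ l, k ≤ l → l < R.p → R.x2 r ≤ R.x1 (Z l)) (hW : 4 * R.n + 8 < 2 ^ w)
    (hp : R.p + 1 < 2 ^ w) (hE : E.length + 3 < 2 ^ w) :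
    Runs w popItem s (120 * (Nat.log 2 R.n + 1) + 300) fun s' =>
      HoldsStack R S s' ∧ ∃ E', HoldsOut E' s' ∧
        R.Sweep Z k S (R.x2 r) (s'.arr 29) E' ∧ E'.length ≤ E.length + 3 := by
  have hW1 : 1 < 2 ^ w := by omega
  have hw0 : w ≠ 0 := by rintro rfl; simp at hW1
  have hS := H.stack
  have hr := hS.lt r (by simp)
  have hrS : r ∉ S := (List.nodup_cons.1 hS.nodup).1
  have b1 := L.x_lt _ hr
  have b2 := L.x_le_y _ hr
  have b3 := L.y_lt _ hr
  have b4 := L.y_le _ hr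
  obtain ⟨c1, c2, c3, c4⟩ := L.stack_bounds hS
  have HX : R.Sweep Z k (r :: S) (R.x2 r) (s.arr 29) E := by
    refine H.advance L hZ (H.mem r (by simp)).2.2 (by omega) (fun q hq => ?_) hk
    rcases List.mem_cons.1 hq with rfl | hq
    · exact le_rfl
    · exact ((List.pairwise_cons.1 hS.nested).1 q hq).2.1
  obtain ⟨d1, d2, d3, d4⟩ := hst.frames r S (List.suffix_refl _)
  have hsegt := L.seg_start hS.tail (y := R.y1 r) (by omega)
  generalize hsd : (R.seg S (R.y1 r)).1 = sg at *
  have hstart := fun y (hy : y < R.n) => L.isStart_cons hS hy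
  have hs1 : (R.seg (r :: S) sg).1 = sg := (hstart sg (by omega)).2 (by right; right; rw [hsegt, hsd])
  have hs2 : (R.seg (r :: S) (R.y1 r)).1 = R.y1 r := (hstart _ (by omega)).2 (Or.inl rfl)
  refine Runs.seq (T := 20) (T' := 120 * (Nat.log 2 R.n + 1) + 280)
    (R := fun t => t.reg 44 = r ∧ t.reg 41 = R.x2 r ∧ t.reg 40 = sg ∧ t.arr = s.arr) ?_ ?_
      (by omega)
  · refine .straight ?_ rfl
    simp [hst.top, topCode, hst.rects.x2 r hr, d1, hw0]
    omega
  rintro s1 f1 ⟨e44, e41, e40, earr⟩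
  have hst1 := hst.frame f1 rfl rfl
  have ho1 := ho.frame f1 rfl rfl
  refine Runs.seq (T' := 120 * (Nat.log 2 R.n + 1) + 230)
    (flushSegment_runs L hst1 ho1 (by rwa [earr]) e40 e41 (by omega) hs1 (by omega) (by omega))
    ?_ (by omega)
  rintro s2 f2 ⟨e29, E1, ho2, H2, hE1⟩
  have hst2 := hst1.frame f2 rfl rfl
  refine Runs.seq (T := 3) (T' := 120 * (Nat.log 2 R.n + 1) + 227)
    (R := fun t => t = s2.setReg 40 (R.y1 r)) ?_ ?_ (by omega)
  · refine .straight ?_ rfl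
    simp [f2.reg 44 rfl, e44, hst2.rects.y1 r hr]
  rintro s3 f3 hs3
  have hst3 := hst2.frame f3 rfl rfl
  have ho3 := ho2.frame f3 rfl rfl
  have g44 : s3.reg 44 = r := by rw [f3.reg 44 rfl, f2.reg 44 rfl, e44]
  have g41 : s3.reg 41 = R.x2 r := by rw [f3.reg 41 rfl, f2.reg 41 rfl, e41]
  refine Runs.seq (T' := 120 * (Nat.log 2 R.n + 1) + 177)
    (flushSegment_runs L hst3 ho3 (by rw [hs3]; exact H2) (by rw [hs3]; simp) g41 (by omega) hs2
      (by omega) (by omega)) ?_ (by omega)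
  rintro s4 f4 ⟨g29, E2, ho4, H4, hE2⟩
  have hst4 := hst3.frame f4 rfl rfl
  have h44 : s4.reg 44 = r := by rw [f4.reg 44 rfl, g44]
  have h41 : s4.reg 41 = R.x2 r := by rw [f4.reg 41 rfl, g41]
  have hx1 : s4.arr 29 sg = R.x2 r := by
    rw [g29, f3.arr 29 rfl, e29, Function.update_apply, Function.update_self]; simp
  have hx2 : s4.arr 29 (R.y1 r) = R.x2 r := by rw [g29]; simp
  have i31 := (hst4.frames r S (List.suffix_refl _)).2.1
  refine Runs.seq (T := 80) (T' := 120 * (Nat.log 2 R.n + 1) + 97)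
    (R := fun t => t.arr 29 sg = R.x2 r ∧ t.arr 29 (R.y1 r) = R.x2 r ∧
      (R.y2 r < (R.seg S (R.y1 r)).2.1 → t.arr 29 (R.y2 r) = R.x2 r) ∧
      ∃ E', HoldsOut E' t ∧ R.Sweep Z k (r :: S) (R.x2 r) (t.arr 29) E' ∧
        E'.length ≤ E.length + 3) ?_ ?_ (by omega)
  · refine Runs.ite (T := 60) (by simp [hw0]) ?_ ?_ (by simp only [Expr.cost, Expr.lt]; omega)
    · intro hne
      have hlt : R.y2 r < (R.seg S (R.y1 r)).2.1 := by
        simpa [h44, i31, hst4.rects.y2 r hr] using hne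
      have hs3' : (R.seg (r :: S) (R.y2 r)).1 = R.y2 r :=
        (hstart _ (by omega)).2 (Or.inr (Or.inl ⟨rfl, hlt⟩))
      refine Runs.seq (T := 3) (T' := 57) (R := fun t => t = s4.setReg 40 (R.y2 r)) ?_ ?_ (by omega)
      · refine .straight ?_ rfl
        simp [h44, hst4.rects.y2 r hr]
      rintro t1 k1 hs5
      refine (flushSegment_runs L (hst4.frame k1 rfl rfl) (ho4.frame k1 rfl rfl)
        (by rw [hs5]; exact H4) (by rw [hs5]; simp) (by rw [k1.reg 41 rfl, h41]) (by omega) hs3'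
        (by omega) (by omega)).mono (by omega) ?_
      rintro t2 - ⟨l29, E3, ho5, H5, hE3⟩
      rw [k1.arr 29 rfl] at l29
      refine ⟨?_, ?_, fun _ => ?_, E3, ho5, H5, by omega⟩ <;> rw [l29, Function.update_apply] <;>
        simp [hx1, hx2]
    · intro h0
      have hlt : ¬ R.y2 r < (R.seg S (R.y1 r)).2.1 := by
        simpa [h44, i31, hst4.rects.y2 r hr] using h0
      exact .straight ⟨trivial, hx1, hx2, fun h => absurd h hlt, E2, ho4, H4, by omega⟩ rfl
  rintro s5 f5 ⟨x1, x2, x3, E', ho5, H5, hE'⟩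
  have hst5 := hst4.frame f5 rfl rfl
  have k44 : s5.reg 44 = r := by rw [f5.reg 44 rfl, h44]
  -- Every piece is one of the at most three flushed ones, starting at `sg`, `y1 r` or `y2 r`.
  have H5' : R.Sweep Z k S (R.x2 r) (s5.arr 29) E' := by
    refine H5.pop L (fun y hy hy' => ?_) (by rwa [hsd])
    rcases L.start_cons hS (y := y) (by omega) with ⟨l1, l2, l3, l4⟩ | ⟨l1, -, -⟩
    · rw [l4, hsd]
      split_ifs with l5 l6
      · exact x1
      · exact x2
      · exact x3 (by omega)
    · omega
  obtain ⟨k30, k31, k32, k33⟩ := hst5.frames r S (List.suffix_refl _)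
  rw [hsd] at k30
  refine Runs.seq (T := 40) (T' := 120 * (Nat.log 2 R.n + 1) + 57)
    (R := fun t => (∀ y < R.n, (R.seg S y).1 = y →
        t.arr 27 y = (R.seg S y).2.1 ∧ t.arr 28 y = (R.seg S y).2.2) ∧
      t.reg 51 = R.y1 r ∧ t.reg 52 = if (R.seg S (R.y1 r)).1 = R.y1 r then R.y1 r + 1 else 0)
    ?_ ?_ (by omega)
  · refine .straight ?_ rfl
    have hseg : ∀ y < R.n, (R.seg S y).1 = y →
        Function.update (s5.arr 27) sg (R.seg S (R.y1 r)).2.1 y = (R.seg S y).2.1 ∧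
        Function.update (s5.arr 28) sg (R.seg S (R.y1 r)).2.2 y = (R.seg S y).2.2 := by
      intro y hy hyy
      by_cases hys : y = sg
      · rw [hys, hsegt]; simp
      · rw [Function.update_of_ne hys, Function.update_of_ne hys]
        rcases L.start_cons hS hy with ⟨l1, l2, l3, l4⟩ | ⟨l1, l2, l3⟩
        · rw [l3, hsd] at hyy; omega
        · rw [← l2]
          exact hst5.segs y hy (by rw [l2, hyy])
    simp [k44, k30, k31, k32, hst5.rects.y1 r hr, hw0]
    by_cases hlt : sg < R.y1 r
    · simp [not_le.2 hlt, hsd, hlt.ne]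
      exact hseg
    · have : sg = R.y1 r := by omega
      simp [hsd, this]
      rw [this] at hseg
      exact ⟨by omega, hseg⟩
  rintro s6 f6 ⟨hsegs, e51, e52⟩
  have ho6 := ho5.frame f6 rfl rfl
  have hrc6 := hst5.rects.frame f6 rfl rfl
  have m50 : s6.reg 50 = R.n := by rw [f6.reg 50 rfl]; exact hst5.size
  have m34 : s6.arr 34 = s5.arr 34 := f6.arr 34 rfl
  refine Runs.seq (T' := 60 * (Nat.log 2 R.n + 1) + 57)
    (setLeaf_runs (N := R.n) m50 (by omega) (by omega) (by rw [m34]; exact hst5.tree)) ?_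
    (by omega)
  rintro s7 f7 ⟨ht7, hm7⟩
  have hrc7 := hrc6.frame f7 rfl rfl
  have ho7 := ho6.frame f7 rfl rfl
  have n44 : s7.reg 44 = r := by rw [f7.reg 44 rfl, f6.reg 44 rfl, k44]
  have n31 : s7.arr 31 r = (R.seg S (R.y1 r)).2.1 := by rw [f7.arr 31 rfl, f6.arr 31 rfl, k31]
  have n50 : s7.reg 50 = R.n := by rw [f7.reg 50 rfl, m50]
  rw [e51, e52] at hm7
  refine Runs.seq (T := 60 * (Nat.log 2 R.n + 1) + 30) (T' := 10)
    (R := fun t => IsMaxTree R.n (t.arr 34) ∧ ∀ y < R.n, t.arr 34 (R.n + y) =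
      if (R.seg S y).1 = y then y + 1 else 0) ?_ ?_ (by omega)
  · refine Runs.ite (T := 60 * (Nat.log 2 R.n + 1) + 10) (by simp [hw0]) ?_ ?_ (by
      simp only [Expr.cost, Expr.lt]; omega)
    · intro hne
      have hlt : R.y2 r < (R.seg S (R.y1 r)).2.1 := by
        simpa [n44, n31, hrc7.y2 r hr] using hne
      -- After gluing, `y2 r` lies strictly inside the segment starting at `sg`.
      have hnot : (R.seg S (R.y2 r)).1 ≠ R.y2 r := by
        rw [L.seg_eq hS.tail (z := R.y1 r) (by omega) (by omega) hlt, hsd]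
        omega
      refine Runs.seq (T := 10) (T' := 60 * (Nat.log 2 R.n + 1))
        (R := fun t => t.reg 51 = R.y2 r ∧ t.reg 52 = 0 ∧ t.reg 50 = R.n ∧
          t.arr = s7.arr) ?_ ?_ (by omega)
      · refine .straight ?_ rfl
        simp [n44, hrc7.y2 r hr, n50]
      rintro t1 - ⟨o51, o52, o50, oarr⟩
      refine (setLeaf_runs (N := R.n) o50 (by omega) (by omega) (by rw [oarr]; exact ht7)).mono
        le_rfl ?_
      rintro t2 - ⟨p1, p2⟩
      refine ⟨p1, fun y hy => ?_⟩
      rw [p2 y hy, o51, o52, oarr, hm7 y hy, m34, hst5.marks y hy]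
      have := hstart y hy
      by_cases q1 : y = R.y2 r
      · rw [if_pos q1, if_neg (by rw [q1]; exact hnot)]
      · rw [if_neg q1]
        by_cases q2 : y = R.y1 r
        · rw [if_pos q2, q2]
        · rw [if_neg q2]
          split_ifs <;> omega
    · intro h0
      have hlt : ¬ R.y2 r < (R.seg S (R.y1 r)).2.1 := by
        simpa [n44, n31, hrc7.y2 r hr] using h0
      refine .straight ⟨trivial, ht7, fun y hy => ?_⟩ (Nat.ble_eq_true_of_le (by
        simp only [Prog.cost]; omega))
      simp only [Prog.sl]
      rw [hm7 y hy, m34, hst5.marks y hy]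
      have := hstart y hy
      by_cases q2 : y = R.y1 r
      · rw [if_pos q2, q2]
      · rw [if_neg q2]
        split_ifs <;> omega
  rintro s8 f8 ⟨ht8, hm8⟩
  have hrc8 := hrc7.frame f8 rfl rfl
  have ho8 := ho7.frame f8 rfl rfl
  have q44 : s8.reg 44 = r := by rw [f8.reg 44 rfl, n44]
  have q50 : s8.reg 50 = R.n := by rw [f8.reg 50 rfl, n50]
  have qa : ∀ i, i ∈ [30, 31, 32, 33, 29] → s8.arr i = s5.arr i := by
    intro i hi
    simp only [List.mem_cons, List.not_mem_nil, or_false] at hi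
    rcases hi with rfl | rfl | rfl | rfl | rfl <;> rw [f8.arr _ rfl, f7.arr _ rfl, f6.arr _ rfl]
  have qb : ∀ i, i ∈ [27, 28] → s8.arr i = s6.arr i := by
    intro i hi
    simp only [List.mem_cons, List.not_mem_nil, or_false] at hi
    rcases hi with rfl | rfl <;> rw [f8.arr _ rfl, f7.arr _ rfl]
  refine .straight ?_ rfl
  simp [q44, qa 33 (by simp), k33]
  refine ⟨⟨?_, ?_, ?_, ?_, ?_, ?_, ?_⟩, E', ⟨?_, ?_, ?_, ?_, ?_⟩, ?_, hE'⟩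
  · exact hrc8.congr (by simp) (by simp) (by simp)
  · simpa using q50
  · simp
  · intro r' S' hr'
    simp only [State.setReg_arr]
    rw [qa 30 (by simp), qa 31 (by simp), qa 32 (by simp), qa 33 (by simp)]
    exact hst5.frames r' S' (hr'.trans (List.suffix_cons _ _))
  · simp only [State.setReg_arr]
    rw [qb 27 (by simp), qb 28 (by simp)]
    exact hsegs
  · exact ht8
  · exact hm8
  · simpa using ho8.len
  · exact ho8.a
  · exact ho8.b
  · exact ho8.c
  · exact ho8.d
  · rw [qa 29 (by simp)]
    exact H5'

/-- Write to the arrays `1, …, 4` tuples which partition the positive points. -/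
def sweepColumns : Prog := blk [
  blk [.assign 50 (ℛ 10), .assign 21 0, .assign 22 0, .assign 20 0, .store 27 0 (ℛ 10),
    .assign 51 0, .assign 52 1],
  setLeaf 34,
  -- The guard vanishes when all items are inserted and the stack is empty. If the next item begins
  -- where the top one ends, the removal comes first, so x-intervals that only touch are never
  -- stacked.
  .loop ((ℛ 13 - ℛ 21) + ℛ 22) (.ite (ℛ 22)
    (.ite (.lt (ℛ 21) (ℛ 13))
      (.ite (.lt (𝒜 20 (𝒜 26 (ℛ 21))) (𝒜 21 (ℛ 22 - 1))) pushItem popItem) popItem)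
    pushItem)]

theorem sweepColumns_runs {w : ℕ} {R : RectFamily} (L : R.Laminar) {s : State}
    (hrc : HoldsRects R s) (hZ : R.IsOrder (s.arr 26)) (h28 : s.arr 28 0 = 0)
    (h29 : s.arr 29 0 = 0) (h34 : ∀ j, s.arr 34 j = 0) (hn : 0 < R.n)
    (hW : 4 * R.n + 8 < 2 ^ w) (hp : 4 * R.p + 8 < 2 ^ w) :
    Runs w sweepColumns s (R.p * (620 * (Nat.log 2 R.n + 2) + 800) + 60 * (Nat.log 2 R.n + 2) + 60)
      fun s' => ∃ E X, HoldsOut E s' ∧ R.Sweep (s.arr 26) R.p [] X (s'.arr 29) E ∧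
        E.length ≤ 4 * R.p := by
  have hW1 : 1 < 2 ^ w := by omega
  have hw0 : w ≠ 0 := by rintro rfl; simp at hW1
  refine Runs.seq (T := 40)
    (T' := R.p * (620 * (Nat.log 2 R.n + 2) + 800) + 60 * (Nat.log 2 R.n + 2) + 20)
    (R := fun t => t.reg 50 = R.n ∧ t.reg 21 = 0 ∧ t.reg 22 = 0 ∧ t.reg 20 = 0 ∧
      t.arr 27 0 = R.n ∧ t.reg 51 = 0 ∧ t.reg 52 = 1) ?_ ?_ (by omega)
  · exact .straight (by simp [hrc.n, hw0]) rfl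
  rintro s1 f1 ⟨e50, e21, e22, e20, e27, e51, e52⟩
  refine Runs.seq (T' := R.p * (620 * (Nat.log 2 R.n + 2) + 800) + 20)
    (setLeaf_runs (N := R.n) e50 (by omega) (by omega) (by
      rw [f1.arr 34 rfl]; exact fun i _ _ => by simp [h34])) ?_ (by omega)
  rintro s2 f2 ⟨ht, hm⟩
  rw [e51, e52, f1.arr 34 rfl] at hm
  -- Both an insertion and a removal lower 2(p − k) + |S| by one, which gives 2p rounds. An inserted
  -- item pays for four tuples: one now, and three kept in reserve for its removal.
  refine Runs.loop (fun i t => ∃ k S X E, k ≤ R.p ∧ t.reg 21 = k ∧ HoldsStack R S t ∧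
      HoldsOut E t ∧ R.Sweep (s.arr 26) k S X (t.arr 29) E ∧ E.length + 3 * S.length ≤ 4 * k ∧
      i = 2 * (R.p - k) + S.length)
    (310 * (Nat.log 2 R.n + 2) + 330) (2 * R.p) s2 ?_ ?_ ?_ ?_ ?_
  · refine ⟨0, [], 0, [], Nat.zero_le _, by rw [f2.reg 21 rfl, e21], ⟨?_, ?_, ?_, ?_, ?_, ht, ?_⟩,
      ⟨by rw [f2.reg 20 rfl, e20]; rfl, .nil _, .nil _, .nil _, .nil _⟩, .init _ _ ?_, by simp,
      by simp⟩
    · exact (hrc.frame f1 rfl rfl).frame f2 rfl rfl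
    · rw [f2.reg 50 rfl, e50]
    · rw [f2.reg 22 rfl, e22]; rfl
    · intro r S' h
      have := h.length_le
      simp at this
    · intro y hy hyy
      obtain rfl : 0 = y := hyy
      rw [f2.arr 27 rfl, f2.arr 28 rfl, f1.arr 28 rfl]
      exact ⟨e27, h28⟩
    · intro y hy
      rw [hm y hy, h34]
      by_cases hy0 : y = 0
      · simp [hy0, RectFamily.seg]
      · simp [hy0, RectFamily.seg, Ne.symm hy0]
    · rw [f2.arr 29 rfl, f1.arr 29 rfl, h29]
  · rintro i t hf ⟨k, S, X, E, hk, h21, hst, -, hsw, -⟩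
    have h22 : t.reg 22 ≤ R.p := by
      rw [hst.top]
      rcases S with _ | ⟨r, S⟩
      · exact Nat.zero_le _
      · exact hsw.stack.lt r (by simp)
    simp [h21, hst.rects.p]
    omega
  · rintro i t hf ⟨k, S, X, E, hk, h21, hst, ho, hsw, hcount, rfl⟩ hne
    have h26 : t.arr 26 = s.arr 26 := by rw [hf.arr 26 rfl, f2.arr 26 rfl, f1.arr 26 rfl]
    have h22 := hst.top
    simp only [Expr.val_add, Expr.val_sub, Expr.val_reg, h21, h22, hst.rects.p] at hne
    have hpush : k < R.p → (∀ q ∈ S, R.x1 (s.arr 26 k) < R.x2 q) →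
        ∃ k', 2 * (R.p - k) + S.length = k' + 1 ∧
          Runs w pushItem t (310 * (Nat.log 2 R.n + 2) + 300) fun t => ∃ k S X E, k ≤ R.p ∧
            t.reg 21 = k ∧ HoldsStack R S t ∧ HoldsOut E t ∧
            R.Sweep (s.arr 26) k S X (t.arr 29) E ∧ E.length + 3 * S.length ≤ 4 * k ∧
            k' = 2 * (R.p - k) + S.length := by
      intro hk hS
      refine ⟨2 * (R.p - (k + 1)) + (S.length + 1), by omega,
        (pushItem_runs L hst ho hZ h26 hsw h21 hk hS hW (by omega) (by omega)).mono (by omega) ?_⟩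
      rintro t' - ⟨h1, h2, E', h3, h4, h5⟩
      exact ⟨k + 1, _, _, E', hk, h2, h1, h3, h4, by simp only [List.length_cons]; omega,
        by simp⟩
    have hpop : ∀ r S₁, S = r :: S₁ → (∀ l, k ≤ l → l < R.p → R.x2 r ≤ R.x1 (s.arr 26 l)) →
        ∃ k', 2 * (R.p - k) + S.length = k' + 1 ∧
          Runs w popItem t (310 * (Nat.log 2 R.n + 2) + 300) fun t => ∃ k S X E, k ≤ R.p ∧
            t.reg 21 = k ∧ HoldsStack R S t ∧ HoldsOut E t ∧
            R.Sweep (s.arr 26) k S X (t.arr 29) E ∧ E.length + 3 * S.length ≤ 4 * k ∧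
            k' = 2 * (R.p - k) + S.length := by
      rintro r S₁ rfl hr
      simp only [List.length_cons] at hcount ⊢
      refine ⟨2 * (R.p - k) + S₁.length, by omega,
        (popItem_runs L hst ho hZ hsw hr hW (by omega) (by omega)).mono (by omega) ?_⟩
      rintro t' hf' ⟨h1, E', h3, h4, h5⟩
      exact ⟨k, _, _, E', hk, by rw [hf'.reg 21 rfl, h21], h1, h3, h4, by omega, rfl⟩
    have hlift : ∀ {P : Prog} {Q : ℕ → State → Prop},
        (∃ k', 2 * (R.p - k) + S.length = k' + 1 ∧
          Runs w P t (310 * (Nat.log 2 R.n + 2) + 300) (Q k')) →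
        Runs w P t (310 * (Nat.log 2 R.n + 2) + 300) (Q (2 * (R.p - k) + S.length - 1)) := by
      rintro P Q ⟨k', hk', h⟩
      rwa [hk', Nat.add_sub_cancel]
    refine ⟨2 * (R.p - k) + S.length - 1, ?_, ?_⟩
    · rcases S with _ | ⟨r, S⟩
      · simp [topCode] at hne ⊢; omega
      · rw [List.length_cons]; omega
    refine Runs.ite (T := 310 * (Nat.log 2 R.n + 2) + 320) trivial ?_ ?_ (by
      simp only [Expr.cost]; omega)
    · intro h0
      rcases S with _ | ⟨r, S⟩
      · simp [h22, topCode] at h0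
      have hr := hsw.stack.lt r (by simp)
      refine Runs.ite (T := 310 * (Nat.log 2 R.n + 2) + 315) (by simp [hw0]) ?_ ?_ (by
        simp only [Expr.cost, Expr.lt]; omega)
      · intro h1
        have hk' : k < R.p := by simpa [h21, hst.rects.p] using h1
        refine Runs.ite (T := 310 * (Nat.log 2 R.n + 2) + 300)
          (by simp [hw0, h22, topCode]; omega) ?_ ?_ (by
          simp only [Expr.cost, Expr.lt, HSub.hSub, Sub.sub]; omega)
        · intro h2
          have h3 : R.x1 (s.arr 26 k) < R.x2 r := by
            simpa [h21, h22, topCode, h26, hst.rects.x1 _ (hZ.lt k hk'), hst.rects.x2 r hr]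
              using h2
          refine hlift (hpush hk' fun q hq => ?_)
          rcases List.mem_cons.1 hq with rfl | hq
          · exact h3
          · exact h3.trans_le ((List.pairwise_cons.1 hsw.stack.nested).1 q hq).2.1
        · intro h2
          have h3 : ¬ R.x1 (s.arr 26 k) < R.x2 r := by
            simpa [h21, h22, topCode, h26, hst.rects.x1 _ (hZ.lt k hk'), hst.rects.x2 r hr]
              using h2
          refine hlift (hpop r S rfl fun l hl hl' => ?_)
          rcases hl.eq_or_lt with rfl | hl
          · omega
          · have := hZ.before k l hl hl'
            unfold RectFamily.Before at this
            omega
      · intro h1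
        have hk' : R.p ≤ k := by simpa [h21, hst.rects.p] using h1
        exact (hlift (hpop r S rfl fun l hl hl' => by omega)).mono (by omega) fun _ _ h => h
    · intro h0
      rcases S with _ | ⟨r, S⟩
      · exact (hlift (hpush (by simp [topCode] at hne; omega) (by simp))).mono (by omega)
          fun _ _ h => h
      · simp [h22, topCode] at h0
  · have aux : ∀ p g : ℕ, 2 * p * (310 * (g + 2) + 330 + 5 + 1) + 5 + 1 ≤
        p * (620 * (g + 2) + 800) + 20 := by intro p g; nlinarith
    exact aux R.p (Nat.log 2 R.n)
  · rintro i t hf ⟨k, S, X, E, hk, h21, hst, ho, hsw, hcount, rfl⟩ h0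
    have h22 := hst.top
    simp only [Expr.val_add, Expr.val_sub, Expr.val_reg, h21, h22, hst.rects.p] at h0
    rcases S with _ | ⟨r, S⟩
    · obtain rfl : k = R.p := by omega
      exact ⟨E, X, ho, hsw, by simpa using hcount⟩
    · simp [topCode] at h0

/-! ### Interval biclique partitions -/

section bounds

variable {n m : ℕ}

theorem SignedTreeModel.card_nodes (M : SignedTreeModel (Fin n) (Fin m)) :
    m + 1 = 2 * n :=
  ParentTree.card_nodes M.full M.leaf_injective M.range_leaf

theorem SignedTreeModel.pos_card (M : SignedTreeModel (Fin n) (Fin m)) :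
    0 < n := by
  have := M.card_nodes
  omega

/-- The sets consist of distinct unordered pairs of the 2n − 1 nodes. A polynomial bound makes log p
of order log n and lets words of O(log n) bits hold the keys. -/
theorem SignedTreeModel.numPairs_le (M : SignedTreeModel (Fin n) (Fin m)) :
    M.numPairs ≤ 4 * n ^ 2 := by
  have h : M.numPairs = (M.neg ∪ M.pos).card := (Finset.card_union_of_disjoint M.disj).symm
  have h1 := Finset.card_le_univ (M.neg ∪ M.pos)
  rw [Sym2.card, Fintype.card_fin, Nat.choose_two_right] at h1
  have h2 := M.card_nodes
  have h3 : (m + 1) * m / 2 ≤ (m + 1) * m := Nat.div_le_self _ _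
  rw [h]
  simp only [Nat.add_sub_cancel] at h1
  nlinarith

/-- A one-node tree has no transversal pair. So p > 0 implies log n ≥ 1, and linear terms in p are
absorbed by p log n. -/
theorem SignedTreeModel.two_le (M : SignedTreeModel (Fin n) (Fin m)) (h : 0 < M.numPairs) : 2 ≤ n := by
  by_contra hn
  have h2 := M.card_nodes
  obtain rfl : m = 1 := by omega
  obtain ⟨e, he⟩ : ∃ e, e ∈ M.neg ∨ e ∈ M.pos := by
    unfold numPairs at h
    rcases Finset.eq_empty_or_nonempty M.neg with h3 | ⟨e, he⟩
    · rcases Finset.eq_empty_or_nonempty M.pos with h4 | ⟨e, he⟩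
      · simp [h3, h4] at h
      · exact ⟨e, Or.inr he⟩
    · exact ⟨e, Or.inl he⟩
  obtain ⟨u, v, -, h3, -⟩ := M.transversal e he
  exact h3 ⟨0, Subsingleton.elim _ _⟩

/-- Words are long enough for the numbers used by the algorithms. -/
theorem SignedTreeModel.word_bound (M : SignedTreeModel (Fin n) (Fin m)) {W : ℕ}
    (hW : (n + 1) ^ 20 ≤ W) :
    1000 * ((n + 1) ^ 3 * (M.numPairs + 1)) < W := by
  have hn := M.pos_card
  have h1 := M.numPairs_le
  have h2 : M.numPairs + 1 ≤ (n + 1) ^ 4 := by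
    have : 4 ≤ (n + 1) ^ 2 := by nlinarith
    have e : (n + 1) ^ 4 = (n + 1) ^ 2 * (n + 1) ^ 2 := by ring
    nlinarith
  -- As n ≥ 1, this holds because 2^10 > 1000. Together with p + 1 ≤ (n + 1)^4 the total exponent is
  -- 10 + 3 + 4 = 17 < 20.
  have h3 : 1000 ≤ (n + 1) ^ 10 :=
    le_trans (by norm_num) (Nat.pow_le_pow_left (show 2 ≤ n + 1 by omega) 10)
  calc 1000 * ((n + 1) ^ 3 * (M.numPairs + 1)) ≤ (n + 1) ^ 10 * ((n + 1) ^ 3 * (n + 1) ^ 4) := by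
        gcongr
    _ = (n + 1) ^ 17 := by ring
    _ < (n + 1) ^ 20 := Nat.pow_lt_pow_right (by omega) (by norm_num)
    _ ≤ W := hW

/-- Turns the cost O(p log p) of sorting into O(p log n). -/
theorem SignedTreeModel.log_numPairs_le (M : SignedTreeModel (Fin n) (Fin m)) :
    Nat.log 2 M.numPairs ≤ 2 * Nat.log 2 n + 3 := by
  have h := M.numPairs_le
  have h1 : n < 2 ^ (Nat.log 2 n + 1) := Nat.lt_pow_succ_log_self (by norm_num) n
  refine Nat.le_of_lt_succ (Nat.log_lt_of_lt_pow' (by omega) ?_)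
  calc M.numPairs ≤ 4 * n ^ 2 := h
    _ < 4 * (2 ^ (Nat.log 2 n + 1)) ^ 2 := by
      have := Nat.pow_lt_pow_left h1 (two_ne_zero)
      omega
    _ = 2 ^ (2 * Nat.log 2 n + 3 + 1) := by ring

end bounds

def partitionProg : Prog := blk [labelTree, makeRects, fillQueue, drainQueue, sweepColumns,
  blk [.assign 0 (ℛ 10), .assign 1 (ℛ 20), .assign 2 (ℛ 20), .assign 3 (ℛ 20),
    .assign 4 (ℛ 20)]]

theorem partitionProg_runs {n m w : ℕ} {M : SignedTreeModel (Fin n) (Fin m)} {X : List (List ℕ)}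
    (hX : M.IsCode X) (hW : 1000 * ((n + 1) ^ 3 * (M.numPairs + 1)) < 2 ^ w) :
    Runs w partitionProg (State.init X) (4000 * (n + M.numPairs * Nat.log 2 n)) fun s =>
      ∃ (I : IntervalBicliquePartition (n := n) M.graph) (Y : List (List ℕ)), I.IsCode Y ∧
        s.Holds Y ∧ I.bicliques.length ≤ 4 * M.numPairs := by
  classical
  obtain ⟨LA, LB, hA, hB, hin⟩ := isInput_init hX
  have hp : LA.length + LB.length = M.numPairs := by
    rw [hA.length_eq, hB.length_eq]; rfl
  have hm := M.card_nodes
  have hn := M.pos_card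
  set p := M.numPairs with hpd
  set l := Nat.log 2 n with hl
  have hb1 : n + 1 ≤ (n + 1) ^ 3 * (p + 1) := by
    calc n + 1 = (n + 1) ^ 1 * 1 := by ring
      _ ≤ (n + 1) ^ 3 * (p + 1) :=
        Nat.mul_le_mul (Nat.pow_le_pow_right (by omega) (by norm_num)) (by omega)
  have hb2 : p + 1 ≤ (n + 1) ^ 3 * (p + 1) := Nat.le_mul_of_pos_left _ (by positivity)
  have hlp : Nat.log 2 p ≤ 2 * l + 3 := M.log_numPairs_le
  have hln : l ≤ n := Nat.log_le_self 2 n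
  have hlog : p ≤ p * l := by
    rcases Nat.eq_zero_or_pos p with h | h
    · simp [h]
    · exact Nat.le_mul_of_pos_right _ (Nat.log_pos (by norm_num) (M.two_le h))
  have e1 : p * (60 * (Nat.log 2 p + 1) + 70) ≤ 120 * (p * l) + 310 * p := by
    calc p * (60 * (Nat.log 2 p + 1) + 70) ≤ p * (60 * (2 * l + 3 + 1) + 70) := by gcongr
      _ = 120 * (p * l) + 310 * p := by ring
  have e2 : p * (620 * (l + 2) + 800) = 620 * (p * l) + 2040 * p := by ring
  generalize hpl : p * l = pl at *
  have hw0 : w ≠ 0 := by rintro rfl; simp at hW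
  refine Runs.seq (T' := 3000 * n + 4000 * pl) (labelTree_runs hin hm (by omega) (by omega)) ?_
    (by omega)
  rintro s1 f1 ⟨lo, sz, H, h14, h13, h0, r10, r12, r13⟩
  have hroot := M.sz_root H
  have hle : ∀ u, lo u + sz u ≤ n := fun u => by rw [← hroot]; exact H.le_root u
  have hlt : ∀ i, lo (M.leaf i) < n := fun i => by
    have := hle (M.leaf i)
    have := H.pos (M.leaf i)
    omega
  have L := pairRects_laminar hA hB H M.tree.root
  have hpos := fun a b => pairRects_positive hA hB H M.tree.root (a := a) (b := b)
  refine Runs.seq (T' := 2950 * n + 3880 * pl) (makeRects_runs (n := n) M.tree.root h14 h13 hle r10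
    r12 r13 (by rw [f1.arr 2 rfl]; exact hin.arr2) (by rw [f1.arr 3 rfl]; exact hin.arr3)
    (by rw [f1.arr 4 rfl]; exact hin.arr4) (by rw [f1.arr 5 rfl]; exact hin.arr5) (by omega)
    (by omega)) ?_ (by omega)
  rintro s2 f2 hrc
  have hRn : (pairRects n LA.length lo sz (LA ++ LB) M.tree.root).n = n := rfl
  have hRp : (pairRects n LA.length lo sz (LA ++ LB) M.tree.root).p = p := by
    rw [← hp]; exact List.length_append
  generalize pairRects n LA.length lo sz (LA ++ LB) M.tree.root = R at *
  -- Arrays from number 6 on are zero in the input and still untouched where this is applied; so the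
  -- queue, the marks and the initial segment start out clear.
  have hz2 : ∀ k j, s1.arr k j = (State.init X).arr k j → s2.arr k j = s1.arr k j →
    6 ≤ k → s2.arr k j = 0 := fun k j h1 h2 h3 => by rw [h2, h1, hin.zero k j h3]
  refine Runs.seq (T' := 2900 * n + 3440 * pl) (fillQueue_runs L hrc (fun j => hz2 25 j
    (by rw [f1.arr 25 rfl]) (by rw [f2.arr 25 rfl]) (by norm_num)) (by rw [hRn, hRp]; omega)) ?_
    (by rw [hRp]; omega)
  rintro s3 f3 ⟨hmax, hkey, h50⟩
  have hrc3 := hrc.frame f3 rfl rfl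
  refine Runs.seq (T' := 2850 * n + 3000 * pl) (drainQueue_runs L hrc3.p hmax hkey h50
    (by rw [hRp]; omega)) ?_ (by rw [hRp]; omega)
  rintro s4 f4 hZ
  have hrc4 := hrc3.frame f4 rfl rfl
  refine Runs.seq (T' := 40) (sweepColumns_runs L hrc4 hZ ?_ ?_ (fun j => ?_) (by rw [hRn]; omega)
    (by rw [hRn]; omega) (by rw [hRp]; omega)) ?_ (by rw [hRp, hRn, ← hl, e2]; omega)
  · rw [f4.arr 28 rfl, f3.arr 28 rfl]
    exact hz2 28 0 (by rw [f1.arr 28 rfl]) (by rw [f2.arr 28 rfl]) (by norm_num)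
  · rw [f4.arr 29 rfl, f3.arr 29 rfl]
    exact hz2 29 0 (by rw [f1.arr 29 rfl]) (by rw [f2.arr 29 rfl]) (by norm_num)
  · rw [f4.arr 34 rfl, f3.arr 34 rfl]
    exact hz2 34 j (by rw [f1.arr 34 rfl]) (by rw [f2.arr 34 rfl]) (by norm_num)
  rintro s5 f5 ⟨E, X', ho, hsw, hE⟩
  have hinj : Function.Injective fun i => (⟨lo (M.leaf i), hlt i⟩ : Fin n) := by
    intro i j hij
    have hij' : lo (M.leaf i) = lo (M.leaf j) := by simpa using hij
    have h1 := h0 i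
    rw [hij', h0 j] at h1
    exact (Fin.ext h1).symm
  -- The map from vertices to positions; it is injective because array 0 holds a left inverse.
  let pos : Fin n ≃ Fin n := Equiv.ofBijective _ (Finite.injective_iff_bijective.1 hinj)
  have hpv : ∀ i : Fin n, lo (M.leaf (pos.symm i)) = i := fun i =>
    congrArg Fin.val (pos.apply_symm_apply i)
  have hfin := fun x y (hy : y < n) => RectFamily.Sweep.final hZ hsw x y (by rwa [hRn])
  -- Covered points are positive, hence lie in some rectangle of the family, and these lie above the
  -- diagonal.
  have hlt' : ∀ q ∈ E, ∀ x y, RectFamily.Covers q x y → x < y := by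
    intro q hq x y hxy
    have hy : y < n := by
      have := hsw.wf q hq
      unfold RectFamily.Covers at hxy
      omega
    obtain ⟨i, hi, -, hm', -⟩ := (hfin x y hy).1 ⟨q, hq, hxy⟩
    have := L.x_le_y i hi
    unfold RectFamily.Mem at hm'
    omega
  have hcov : ∀ i j : Fin n, i < j → ((∃ q ∈ E, RectFamily.Covers q i j) ↔
      M.graph.Adj (pos.symm i) (pos.symm j)) := by
    intro i j hij
    rw [hfin i j j.2, ← hpos _ _ (by rw [hpv, hpv]; exact hij), hpv, hpv]
  obtain ⟨I, hI, hIl⟩ := exists_partition hn (G := M.graph) pos.symm (E := E)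
    (fun q hq => by have := hsw.wf q hq; rwa [hRn] at this) hsw.disj hlt' hcov
  refine .straight ?_ rfl
  simp [ho.len]
  refine ⟨I, _, hI, ?_, by rw [hIl, ← hRp]; exact hE⟩
  have hget : ∀ (k : ℕ) (L : List ℕ) (s : State), s.reg k = L.length → Stores (s.arr k) L →
      s.reg k = L.length ∧ ∀ j (hj : j < L.length), s.arr k j = L[j] :=
    fun k L s h1 h2 => ⟨h1, fun j hj => h2.get j hj⟩
  intro k hk
  simp only [List.length_cons, List.length_nil] at hk
  interval_cases k
  · refine ⟨by simp [hrc4.n, hRn, f5.reg 10 rfl], fun j hj => ?_⟩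
    simp only [List.length_ofFn, List.getElem_cons_zero] at hj
    have := h0 (pos.symm ⟨j, hj⟩)
    rw [hpv] at this
    simp [f5.arr 0 rfl, f4.arr 0 rfl, f3.arr 0 rfl, f2.arr 0 rfl]
    exact this
  · exact hget 1 _ _ (by simp) ho.a
  · exact hget 2 _ _ (by simp) ho.b
  · exact hget 3 _ _ (by simp) ho.c
  · exact hget 4 _ _ (by simp) ho.d

/-! ### DAG compressions from interval biclique partitions -/

/-- A constant array is a maximum tree, so the descent of `exists_leaf_below` applies. -/
theorem exists_leaf_Below {N y : ℕ} (hy : 1 ≤ y) (hy' : y < 2 * N) :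
    ∃ x, N ≤ x ∧ x < 2 * N ∧ Below x y := by
  obtain ⟨x, h1, h2, h3, -⟩ := exists_leaf_below (N := N) (T := fun _ => 0)
    (fun _ _ _ => by simp) y hy hy'
  exact ⟨x, h1, h2, h3⟩

namespace IntervalBicliquePartition

variable {n : ℕ} {G : SimpleGraph (Fin n)} (I : IntervalBicliquePartition (n := n) G)

/-- The sides of the bicliques are decomposed into subtrees. -/
def Decomposed (D : ℕ → List ℕ × List ℕ) (r : ℕ) : Prop :=
  ∀ j (hj : j < I.bicliques.length), j < r →
    IsDecomposition n I.bicliques[j].a (I.bicliques[j].b + 1) (D j).1 ∧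
    IsDecomposition n I.bicliques[j].c (I.bicliques[j].d + 1) (D j).2

theorem adj_iff_exists (u v : Fin n) : G.Adj u v ↔ ∃ j, ∃ hj : j < I.bicliques.length,
    (I.ord.symm u ∈ Set.Icc I.bicliques[j].a I.bicliques[j].b ∧
      I.ord.symm v ∈ Set.Icc I.bicliques[j].c I.bicliques[j].d) ∨
    (I.ord.symm v ∈ Set.Icc I.bicliques[j].a I.bicliques[j].b ∧
      I.ord.symm u ∈ Set.Icc I.bicliques[j].c I.bicliques[j].d) := by
  rw [← SimpleGraph.mem_edgeSet, ← I.edge_cover]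
  constructor
  · rintro ⟨q, hq, i, hi, j, hj, h⟩
    obtain ⟨l, hl, rfl⟩ := List.getElem_of_mem hq
    refine ⟨l, hl, ?_⟩
    rcases Sym2.eq_iff.1 h with ⟨rfl, rfl⟩ | ⟨rfl, rfl⟩
    · left; simpa using ⟨hi, hj⟩
    · right; simpa using ⟨hi, hj⟩
  · rintro ⟨l, hl, ⟨h1, h2⟩ | ⟨h1, h2⟩⟩
    · exact ⟨_, List.getElem_mem hl, _, h1, _, h2, by simp⟩
    · exact ⟨_, List.getElem_mem hl, _, h1, _, h2, by simp [Sym2.eq_swap]⟩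

variable {I} in
theorem Decomposed.below_iff {D : ℕ → List ℕ × List ℕ} {r j : ℕ} (hD : I.Decomposed D r)
    (hj : j < I.bicliques.length) (hjr : j < r) (i : Fin n) :
    (i ∈ Set.Icc I.bicliques[j].a I.bicliques[j].b ↔ ∃ y ∈ (D j).1, Below (n + i) y) ∧
    (i ∈ Set.Icc I.bicliques[j].c I.bicliques[j].d ↔ ∃ y ∈ (D j).2, Below (n + i) y) := by
  obtain ⟨h1, h2⟩ := hD j hj hjr
  have hi := i.2
  rw [← h1.mem_iff (n + i) (by omega) (by omega), ← h2.mem_iff (n + i) (by omega) (by omega)]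
  simp only [Set.mem_Icc, Fin.le_def]
  omega

end IntervalBicliquePartition

/-- The arcs of the complete binary tree, and arcs from the nodes `2 * n + 2 * j` and
`2 * n + 2 * j + 1` to the nodes in the lists `D j`, for `j < r`. -/
def dagArcs (n : ℕ) (D : ℕ → List ℕ × List ℕ) (r : ℕ) : List (ℕ × ℕ) :=
  -- For i = 0 this is the arc from 0 to 1. The number 0 is not a node of the heap; the arc only
  -- keeps it from being a superfluous sink.
  ((List.range (2 * n - 1)).map fun i => ((i + 1) / 2, i + 1)) ++
    (List.range r).flatMap fun j => (D j).1.map (fun y => (2 * (n + j), y)) ++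
      (D j).2.map fun y => (2 * (n + j) + 1, y)

theorem mem_dagArcs {n r : ℕ} {D : ℕ → List ℕ × List ℕ} {x y : ℕ} : (x, y) ∈ dagArcs n D r ↔
    (x = y / 2 ∧ 1 ≤ y ∧ y < 2 * n) ∨
      ∃ j < r, (x = 2 * (n + j) ∧ y ∈ (D j).1) ∨ (x = 2 * (n + j) + 1 ∧ y ∈ (D j).2) := by
  simp only [dagArcs, List.mem_append, List.mem_map, List.mem_range, List.mem_flatMap,
    Prod.mk.injEq]
  refine or_congr ⟨?_, ?_⟩ ⟨?_, ?_⟩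
  · rintro ⟨i, hi, rfl, rfl⟩; omega
  · rintro ⟨rfl, h1, h2⟩; exact ⟨y - 1, by omega, by congr 1; omega, by omega⟩
  · rintro ⟨j, hj, ⟨z, hz, rfl, rfl⟩ | ⟨z, hz, rfl, rfl⟩⟩
    · exact ⟨j, hj, Or.inl ⟨rfl, hz⟩⟩
    · exact ⟨j, hj, Or.inr ⟨rfl, hz⟩⟩
  · rintro ⟨j, hj, ⟨rfl, hz⟩ | ⟨rfl, hz⟩⟩
    · exact ⟨j, hj, Or.inl ⟨y, hz, rfl, rfl⟩⟩
    · exact ⟨j, hj, Or.inr ⟨y, hz, rfl, rfl⟩⟩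

theorem nodup_dagArcs {n r : ℕ} {D : ℕ → List ℕ × List ℕ}
    (hD : ∀ j < r, (D j).1.Nodup ∧ (D j).2.Nodup ∧
      (∀ y ∈ (D j).1, y < 2 * n) ∧ ∀ y ∈ (D j).2, y < 2 * n) : (dagArcs n D r).Nodup := by
  refine List.nodup_append.2 ⟨?_, ?_, ?_⟩
  · exact List.nodup_range.map fun i j h => by simpa using (Prod.mk.inj h).2
  · rw [List.nodup_flatMap]
    refine ⟨fun j hj => List.nodup_append.2 ⟨?_, ?_, ?_⟩, ?_⟩
    · exact (hD j (by simpa using hj)).1.map fun y z h => (Prod.mk.inj h).2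
    · exact (hD j (by simpa using hj)).2.1.map fun y z h => (Prod.mk.inj h).2
    · simp only [List.mem_map]
      rintro _ ⟨y, -, rfl⟩ _ ⟨z, -, rfl⟩ h
      have := (Prod.mk.inj h).1
      omega
    · refine List.nodup_range.imp fun {i j} hij => ?_
      rw [Function.onFun, List.disjoint_left]
      simp only [List.mem_append, List.mem_map]
      rintro _ (⟨y, -, rfl⟩ | ⟨y, -, rfl⟩) (⟨z, -, h⟩ | ⟨z, -, h⟩) <;>
        · have := (Prod.mk.inj h).1
          omega
  · simp only [List.mem_map, List.mem_flatMap, List.mem_append, List.mem_range]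
    rintro _ ⟨i, hi, rfl⟩ _ ⟨j, -, ⟨z, -, rfl⟩ | ⟨z, -, rfl⟩⟩ h <;>
      · have := (Prod.mk.inj h).1
        omega

theorem length_dagArcs_le {n r l : ℕ} {D : ℕ → List ℕ × List ℕ}
    (hD : ∀ j < r, (D j).1.length ≤ l ∧ (D j).2.length ≤ l) :
    (dagArcs n D r).length ≤ 2 * n + 2 * (r * l) := by
  have : ((List.range r).flatMap fun j => (D j).1.map (fun y => (2 * (n + j), y)) ++
      (D j).2.map fun y => (2 * (n + j) + 1, y)).length ≤ 2 * (r * l) := by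
    induction r with
    | zero => simp
    | succ r ih =>
      have h1 := ih fun j hj => hD j (by omega)
      have h2 := hD r (by omega)
      rw [List.range_succ, List.flatMap_append]
      simp only [List.length_append, List.flatMap_cons, List.flatMap_nil, List.append_nil,
        List.length_map]
      have e : (r + 1) * l = r * l + l := Nat.succ_mul r l
      omega
  simp only [dagArcs, List.length_append, List.length_map, List.length_range]
  omega

/-- The element of `Fin k` with value `x`, if `x < k`. -/
def toFin {k : ℕ} (hk : 0 < k) (x : ℕ) : Fin k := ⟨x % k, Nat.mod_lt _ hk⟩

theorem val_toFin {k : ℕ} (hk : 0 < k) {x : ℕ} (hx : x < k) : (toFin hk x : ℕ) = x :=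
  Nat.mod_eq_of_lt hx

/-- A list of pairs of numbers less than `k` as a list of pairs of elements of `Fin k`. -/
def toFinPairs {k : ℕ} (hk : 0 < k) (L : List (ℕ × ℕ)) : List (Fin k × Fin k) :=
  L.map fun q => (toFin hk q.1, toFin hk q.2)

section

variable {k : ℕ} (hk : 0 < k) {L : List (ℕ × ℕ)} (hL : ∀ q ∈ L, q.1 < k ∧ q.2 < k)
include hL

theorem fsts_toFinPairs : fsts (toFinPairs hk L) = L.map Prod.fst := by
  simp only [fsts, toFinPairs, List.map_map]
  exact List.map_congr_left fun q hq => val_toFin hk (hL q hq).1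

theorem snds_toFinPairs : snds (toFinPairs hk L) = L.map Prod.snd := by
  simp only [snds, toFinPairs, List.map_map]
  exact List.map_congr_left fun q hq => val_toFin hk (hL q hq).2

theorem mem_toFinPairs {x y : Fin k} : (x, y) ∈ toFinPairs hk L ↔ ((x : ℕ), (y : ℕ)) ∈ L := by
  simp only [toFinPairs, List.mem_map, Prod.mk.injEq]
  constructor
  · rintro ⟨q, hq, rfl, rfl⟩
    rw [val_toFin hk (hL q hq).1, val_toFin hk (hL q hq).2]
    exact hq
  · intro h
    exact ⟨_, h, Fin.ext (val_toFin hk x.2), Fin.ext (val_toFin hk y.2)⟩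

theorem nodup_toFinPairs (h : L.Nodup) : (toFinPairs hk L).Nodup := by
  refine List.Nodup.map_on (fun q hq q' hq' h => ?_) h
  have h1 := congrArg Fin.val (Prod.mk.inj h).1
  have h2 := congrArg Fin.val (Prod.mk.inj h).2
  rw [val_toFin hk (hL q hq).1, val_toFin hk (hL q' hq').1] at h1
  rw [val_toFin hk (hL q hq).2, val_toFin hk (hL q' hq').2] at h2
  exact Prod.ext h1 h2

end

/-- The DAG consisting of the complete binary tree and of two nodes for each biclique. -/
theorem exists_dagCompression {n : ℕ} (hn : 0 < n) {G : SimpleGraph (Fin n)}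
    (I : IntervalBicliquePartition (n := n) G) {D : ℕ → List ℕ × List ℕ} {q : ℕ}
    (hq : I.bicliques.length = q) (hD : I.Decomposed D q) :
    ∃ C : DAGCompression G (Fin (2 * (n + q))), C.IsCode [[2 * (n + q)],
      List.ofFn fun v => n + (I.ord.symm v : ℕ), (dagArcs n D q).map Prod.fst,
      (dagArcs n D q).map Prod.snd, (List.range q).map fun j => 2 * (n + j),
      (List.range q).map fun j => 2 * (n + j) + 1] ∧
      C.size = 2 * (n + q) + (dagArcs n D q).length + q := by
  classical
  subst hq
  set q := I.bicliques.length
  set A := dagArcs n D q with hA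
  have hk : 0 < 2 * (n + q) := by omega
  have hlt : ∀ j < q, (∀ y ∈ (D j).1, 1 ≤ y ∧ y < 2 * n) ∧ ∀ y ∈ (D j).2, 1 ≤ y ∧ y < 2 * n :=
    fun j hj => ⟨fun y hy => ⟨(hD j hj hj).1.pos y hy, (hD j hj hj).1.lt y hy⟩,
      fun y hy => ⟨(hD j hj hj).2.pos y hy, (hD j hj hj).2.lt y hy⟩⟩
  have harc : ∀ x y, (x, y) ∈ A → x < 2 * (n + q) ∧ y < 2 * n ∧ (x < 2 * n → x = y / 2 ∧ 1 ≤ y) ∧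
      (2 * n ≤ x ∨ x < n) := by
    intro x y h
    rcases mem_dagArcs.1 h with ⟨rfl, h1, h2⟩ | ⟨j, hj, ⟨rfl, hy⟩ | ⟨rfl, hy⟩⟩
    · omega
    · have := (hlt j hj).1 y hy; omega
    · have := (hlt j hj).2 y hy; omega
  have hAk : ∀ r ∈ A, r.1 < 2 * (n + q) ∧ r.2 < 2 * (n + q) := fun r hr => by
    have := harc r.1 r.2 hr; omega
  let B : List (ℕ × ℕ) := (List.range q).map fun j => (2 * (n + j), 2 * (n + j) + 1)
  have hBm : ∀ x y, (x, y) ∈ B ↔ ∃ j < q, x = 2 * (n + j) ∧ y = 2 * (n + j) + 1 := by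
    intro x y
    simp only [B, List.mem_map, List.mem_range, Prod.mk.injEq]
    exact ⟨fun ⟨j, hj, h1, h2⟩ => ⟨j, hj, h1.symm, h2.symm⟩,
      fun ⟨j, hj, h1, h2⟩ => ⟨j, hj, h1.symm, h2.symm⟩⟩
  have hBk : ∀ r ∈ B, r.1 < 2 * (n + q) ∧ r.2 < 2 * (n + q) := by
    rintro ⟨x, y⟩ hr
    obtain ⟨j, hj, h1, h2⟩ := (hBm x y).1 hr
    simp only
    omega
  have hmemA := fun x y => mem_toFinPairs hk hAk (x := x) (y := y)
  have hmemB := fun x y => mem_toFinPairs hk hBk (x := x) (y := y)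
  let LB := toFinPairs hk B
  have hnodB : (LB.map fun r => s(r.1, r.2)).Nodup := by
    refine List.Nodup.map_on ?_ (nodup_toFinPairs hk hBk ?_)
    · rintro ⟨x, y⟩ hr ⟨x', y'⟩ hr' h
      obtain ⟨j, -, h1, h2⟩ := (hBm _ _).1 ((hmemB x y).1 hr)
      obtain ⟨j', -, h3, h4⟩ := (hBm _ _).1 ((hmemB x' y').1 hr')
      rcases Sym2.eq_iff.1 h with ⟨h5, h6⟩ | ⟨h5, h6⟩
      · exact Prod.ext h5 h6
      · have h5 : x = y' := h5
        rw [h5] at h1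
        omega
    · exact List.nodup_range.map fun i j h => by have := (Prod.mk.inj h).1; omega
  let arcs : Finset (Fin (2 * (n + q)) × Fin (2 * (n + q))) := (toFinPairs hk A).toFinset
  have harcs : ∀ x y, (x, y) ∈ arcs ↔ ((x : ℕ), (y : ℕ)) ∈ A := fun x y => by
    rw [List.mem_toFinset, hmemA]
  have hreach : ∀ x y : Fin (2 * (n + q)), 1 ≤ (x : ℕ) → (x : ℕ) < 2 * n → (y : ℕ) < 2 * n →
      (Relation.ReflTransGen (fun x y => (x, y) ∈ arcs) x y ↔ Below y x) := by
    intro x y hx1 hx2 hy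
    constructor
    · intro h
      have : Below y x ∧ (y : ℕ) < 2 * n := by
        clear hy
        induction h with
        | refl => exact ⟨.refl _, hx2⟩
        | tail _ h ih =>
          obtain ⟨⟨j, hj⟩, h2⟩ := ih
          have h3 := harc _ _ ((harcs _ _).1 h)
          exact ⟨⟨j + 1, by rw [pow_succ', ← Nat.div_div_eq_div_mul, ← (h3.2.2.1 h2).1, hj]⟩,
            h3.2.1⟩
      exact this.1
    · rintro ⟨j, hj⟩
      induction j generalizing y with
      | zero =>
        have : y = x := Fin.ext (by simpa using hj)
        rw [this]
      | succ j ih =>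
        rw [pow_succ', ← Nat.div_div_eq_div_mul] at hj
        have hy0 : (y : ℕ) ≠ 0 := by
          intro h0
          rw [h0] at hj
          simp at hj
          omega
        exact (ih ⟨y / 2, by omega⟩ (by simp only; omega) hj).tail
          ((harcs _ _).2 (mem_dagArcs.2 (Or.inl ⟨rfl, by omega, hy⟩)))
  -- All arcs end in tree nodes, so a path from a biclique node takes one arc to a node of the
  -- decomposition and then descends in the tree.
  have hbic : ∀ (x y : Fin (2 * (n + q))) (E : List ℕ), 2 * n ≤ (x : ℕ) → (y : ℕ) < 2 * n →
      (∀ z, ((x : ℕ), z) ∈ A ↔ z ∈ E) →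
      (Relation.ReflTransGen (fun x y => (x, y) ∈ arcs) x y ↔ ∃ z ∈ E, Below y z) := by
    intro x y E hx hy hE
    constructor
    · intro h
      rcases h.cases_head with rfl | ⟨z, hz, hzy⟩
      · omega
      · have h1 := (harcs _ _).1 hz
        have h2 : 1 ≤ (z : ℕ) ∧ (z : ℕ) < 2 * n := by
          rcases mem_dagArcs.1 h1 with ⟨-, h1, h2⟩ | ⟨j, hj, ⟨-, hy⟩ | ⟨-, hy⟩⟩
          · exact ⟨h1, h2⟩
          · exact (hlt j hj).1 z hy
          · exact (hlt j hj).2 z hy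
        exact ⟨z, (hE _).1 h1, (hreach z y h2.1 h2.2 hy).1 hzy⟩
    · rintro ⟨z, hz, hzy⟩
      have h1 := (hE z).2 hz
      have h2 : 1 ≤ z ∧ z < 2 * n := by
        rcases mem_dagArcs.1 h1 with ⟨-, h1, h2⟩ | ⟨j, hj, ⟨-, hy⟩ | ⟨-, hy⟩⟩
        · exact ⟨h1, h2⟩
        · exact (hlt j hj).1 z hy
        · exact (hlt j hj).2 z hy
      exact .head ((harcs x ⟨z, by omega⟩).2 h1) ((hreach ⟨z, by omega⟩ y h2.1 h2.2 hy).2 hzy)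
  let sink : Fin n → Fin (2 * (n + q)) := fun v => ⟨n + I.ord.symm v, by omega⟩
  have hfst : ∀ (j : ℕ) (hj : j < q) (u : Fin n),
      Relation.ReflTransGen (fun x y => (x, y) ∈ arcs) ⟨2 * (n + j), by omega⟩ (sink u) ↔
        I.ord.symm u ∈ Set.Icc I.bicliques[j].a I.bicliques[j].b := by
    intro j hj u
    rw [(hD.below_iff hj hj _).1]
    refine hbic _ _ _ (by simp only; omega) (by simp only [sink]; omega) fun z => ?_
    rw [mem_dagArcs]
    constructor
    · rintro (⟨h1, h2, h3⟩ | ⟨j', hj', ⟨h1, h2⟩ | ⟨h1, h2⟩⟩)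
      · simp only at h1; omega
      · simp only at h1
        rwa [show j = j' by omega]
      · simp only at h1; omega
    · exact fun h => Or.inr ⟨j, hj, Or.inl ⟨rfl, h⟩⟩
  have hsnd : ∀ (j : ℕ) (hj : j < q) (u : Fin n),
      Relation.ReflTransGen (fun x y => (x, y) ∈ arcs) ⟨2 * (n + j) + 1, by omega⟩ (sink u) ↔
        I.ord.symm u ∈ Set.Icc I.bicliques[j].c I.bicliques[j].d := by
    intro j hj u
    rw [(hD.below_iff hj hj _).2]
    refine hbic _ _ _ (by simp only; omega) (by simp only [sink]; omega) fun z => ?_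
    rw [mem_dagArcs]
    constructor
    · rintro (⟨h1, h2, h3⟩ | ⟨j', hj', ⟨h1, h2⟩ | ⟨h1, h2⟩⟩)
      · simp only at h1; omega
      · simp only at h1; omega
      · simp only at h1
        rwa [show j = j' by omega]
    · exact fun h => Or.inr ⟨j, hj, Or.inr ⟨rfl, h⟩⟩
  refine ⟨⟨arcs, ?_, sink, ?_, ?_, (LB.map fun r => s(r.1, r.2)).toFinset, ?_⟩, ?_, ?_⟩
  -- Every arc ends below 2n, and arcs starting below 2n increase the number; so no path returns to
  -- its start.
  · have hmono : ∀ x y, Relation.TransGen (fun x y => (x, y) ∈ arcs) x y →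
        (y : ℕ) < 2 * n ∧ ((x : ℕ) < 2 * n → (x : ℕ) < y) := by
      intro x y h
      have hstep : ∀ x y, (x, y) ∈ arcs → (y : ℕ) < 2 * n ∧ ((x : ℕ) < 2 * n → (x : ℕ) < y) := by
        intro x y h
        have := harc _ _ ((harcs _ _).1 h)
        omega
      induction h with
      | single h => exact hstep _ _ h
      | tail _ h ih => have := hstep _ _ h; omega
    intro x h
    have := hmono x x h
    omega
  · intro u v h
    have := congrArg Fin.val h
    simp only [sink] at this
    exact I.ord.symm.injective (Fin.ext (by omega))
  · ext x
    simp only [Set.mem_range, Set.mem_ofPred_eq, harcs]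
    constructor
    · rintro ⟨v, rfl⟩ y h
      have := harc _ _ h
      simp only [sink] at this
      omega
    · intro h
      by_cases h1 : (x : ℕ) < n
      · exfalso
        by_cases h0 : (x : ℕ) = 0
        · exact h ⟨1, by omega⟩ (mem_dagArcs.2 (Or.inl ⟨by simp [h0], le_rfl, by simp only; omega⟩))
        · exact h ⟨2 * x, by omega⟩ (mem_dagArcs.2 (Or.inl ⟨by simp only; omega, by simp only; omega,
            by simp only; omega⟩))
      · by_cases h2 : (x : ℕ) < 2 * n
        · exact ⟨I.ord ⟨x - n, by omega⟩, Fin.ext (by simp [sink]; omega)⟩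
        · exfalso
          obtain ⟨j, hj, hx⟩ : ∃ j < q, (x : ℕ) = 2 * (n + j) ∨ (x : ℕ) = 2 * (n + j) + 1 :=
            ⟨(x - 2 * n) / 2, by omega, by omega⟩
          -- Sides are nonempty, so their decompositions are too, and the biclique nodes are not
          -- sinks.
          have hne := I.nonempty _ (List.getElem_mem hj)
          rcases hx with hx | hx
          · obtain ⟨y, hy, -⟩ := ((hD.below_iff hj hj _).1).1 (Set.left_mem_Icc.2 hne.1)
            have := (hlt j hj).1 y hy
            exact h ⟨y, by omega⟩ (mem_dagArcs.2 (Or.inr ⟨j, hj, Or.inl ⟨hx, hy⟩⟩))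
          · obtain ⟨y, hy, -⟩ := ((hD.below_iff hj hj _).2).1 (Set.left_mem_Icc.2 hne.2)
            have := (hlt j hj).2 y hy
            exact h ⟨y, by omega⟩ (mem_dagArcs.2 (Or.inr ⟨j, hj, Or.inr ⟨hx, hy⟩⟩))
  · intro u v
    rw [I.adj_iff_exists]
    constructor
    · rintro ⟨j, hj, ⟨h1, h2⟩ | ⟨h1, h2⟩⟩
      · refine ⟨⟨2 * (n + j), by omega⟩, ⟨2 * (n + j) + 1, by omega⟩, ?_, (hfst j hj u).2 h1,
          (hsnd j hj v).2 h2⟩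
        rw [List.mem_toFinset, List.mem_map]
        exact ⟨(_, _), (hmemB _ _).2 ((hBm _ _).2 ⟨j, hj, rfl, rfl⟩), rfl⟩
      · refine ⟨⟨2 * (n + j) + 1, by omega⟩, ⟨2 * (n + j), by omega⟩, ?_, (hsnd j hj u).2 h2,
          (hfst j hj v).2 h1⟩
        rw [List.mem_toFinset, List.mem_map]
        exact ⟨(_, _), (hmemB _ _).2 ((hBm _ _).2 ⟨j, hj, rfl, rfl⟩), Sym2.eq_swap⟩
    · rintro ⟨x, y, h, hx, hy⟩
      rw [List.mem_toFinset, List.mem_map] at h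
      obtain ⟨⟨x', y'⟩, hr, h⟩ := h
      obtain ⟨j, hj, h1, h2⟩ := (hBm _ _).1 ((hmemB x' y').1 hr)
      rw [show x' = ⟨2 * (n + j), by omega⟩ from Fin.ext h1,
        show y' = ⟨2 * (n + j) + 1, by omega⟩ from Fin.ext h2] at h
      rcases Sym2.eq_iff.1 h with ⟨rfl, rfl⟩ | ⟨rfl, rfl⟩
      · exact ⟨j, hj, Or.inl ⟨(hfst j hj u).1 hx, (hsnd j hj v).1 hy⟩⟩
      · exact ⟨j, hj, Or.inr ⟨(hfst j hj v).1 hy, (hsnd j hj u).1 hx⟩⟩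
  · refine ⟨toFinPairs hk A, LB, ⟨nodup_toFinPairs hk hAk ?_, fun a => List.mem_toFinset.symm⟩,
      ⟨hnodB, fun e => List.mem_toFinset.symm⟩, ?_⟩
    · exact nodup_dagArcs fun j hj => ⟨(hD j hj hj).1.nodup, (hD j hj hj).2.nodup,
        (hD j hj hj).1.lt, (hD j hj hj).2.lt⟩
    · rw [fsts_toFinPairs hk hAk, snds_toFinPairs hk hAk, fsts_toFinPairs hk hBk,
        snds_toFinPairs hk hBk]
      simp [B, sink, Function.comp_def]
  · simp only [DAGCompression.size, arcs]
    rw [List.toFinset_card_of_nodup hnodB, List.toFinset_card_of_nodup (nodup_toFinPairs hk hAk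
      (nodup_dagArcs fun j hj => ⟨(hD j hj hj).1.nodup, (hD j hj hj).2.nodup,
        (hD j hj hj).1.lt, (hD j hj hj).2.lt⟩))]
    simp [LB, toFinPairs, B]

/-! ### Positive tree models from interval biclique partitions -/

theorem Below.trans {x y z : ℕ} (h : Below x y) (h' : Below y z) : Below x z := by
  obtain ⟨i, rfl⟩ := h
  obtain ⟨j, rfl⟩ := h'
  exact ⟨i + j, by rw [pow_add, Nat.div_div_eq_div_mul]⟩

theorem Below.le {x y : ℕ} (h : Below x y) : y ≤ x := by
  obtain ⟨i, rfl⟩ := h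
  exact Nat.div_le_self _ _

/-- The complete binary tree with `n` leaves. -/
def heapTree (n : ℕ) (hn : 0 < n) : ParentTree (Fin (2 * n - 1)) where
  root := ⟨0, by omega⟩
  parent v := ⟨(v - 1) / 2, by omega⟩
  parent_root := by simp
  reach := by
    rintro ⟨v, hv⟩
    induction v using Nat.strong_induction_on with
    | h v ih =>
      by_cases h : v = 0
      · exact ⟨0, by simp [h]⟩
      · obtain ⟨k, hk⟩ := ih ((v - 1) / 2) (by omega) (by omega)
        exact ⟨k + 1, hk⟩

section

variable {n : ℕ} {hn : 0 < n}

/-- Node `v` has heap number v + 1. Iterated parents stop at the root whereas iterated halving goes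
on to 0, hence the maximum with 1 in `key`. -/
theorem heapTree_anc {u v : Fin (2 * n - 1)} :
    (heapTree n hn).Anc u v ↔ Below (v + 1) (u + 1) := by
  have key : ∀ k, (((heapTree n hn).parent^[k] v : Fin (2 * n - 1)) : ℕ) + 1 =
      max 1 (((v : ℕ) + 1) / 2 ^ k) := by
    intro k
    induction k with
    | zero => simp
    | succ k ih =>
      rw [Function.iterate_succ_apply', pow_succ, ← Nat.div_div_eq_div_mul]
      generalize (heapTree n hn).parent^[k] v = x at *
      generalize ((v : ℕ) + 1) / 2 ^ k = y at *
      simp only [heapTree]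
      omega
  constructor
  · rintro ⟨k, rfl⟩
    rw [key]
    by_cases h : 1 ≤ ((v : ℕ) + 1) / 2 ^ k
    · rw [max_eq_right h]
      exact ⟨k, rfl⟩
    · rw [max_eq_left (by omega)]
      exact below_one (by omega)
  · rintro ⟨k, hk⟩
    refine ⟨k, Fin.ext ?_⟩
    have := key k
    rw [hk, max_eq_right (by omega)] at this
    omega

theorem heapTree_children {u : Fin (2 * n - 1)} {v : Fin (2 * n - 1)} :
    v ∈ (heapTree n hn).children u ↔ (v : ℕ) = 2 * u + 1 ∨ (v : ℕ) = 2 * u + 2 := by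
  simp only [ParentTree.children, heapTree, Set.mem_ofPred_eq, Fin.ext_iff, ne_eq]
  omega

theorem heapTree_isLeaf {u : Fin (2 * n - 1)} : (heapTree n hn).IsLeaf u ↔ n ≤ u + 1 := by
  unfold ParentTree.IsLeaf
  constructor
  · intro h
    by_contra hu
    have : (⟨2 * u + 1, by omega⟩ : Fin (2 * n - 1)) ∈ (heapTree n hn).children u :=
      heapTree_children.2 (Or.inl rfl)
    rw [h] at this
    exact this
  · intro h
    refine Set.eq_empty_of_forall_notMem fun v hv => ?_
    have := heapTree_children.1 hv
    omega

theorem heapTree_isFullBinary : (heapTree n hn).IsFullBinary := by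
  intro u
  by_cases h : n ≤ (u : ℕ) + 1
  · exact Or.inl (heapTree_isLeaf.2 h)
  · refine Or.inr ⟨⟨2 * u + 1, by omega⟩, ⟨2 * u + 2, by omega⟩, by simp, ?_⟩
    ext v
    rw [heapTree_children]
    simp [Fin.ext_iff]

end

/-- The pairs of nodes from the two lists in `D j`, for `j < r`, numbered from `0`. -/
def treePairs (D : ℕ → List ℕ × List ℕ) (r : ℕ) : List (ℕ × ℕ) :=
  (List.range r).flatMap fun j => (D j).1.flatMap fun y => (D j).2.map fun z => (y - 1, z - 1)

theorem mem_treePairs {D : ℕ → List ℕ × List ℕ} {r : ℕ}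
    (hD : ∀ j < r, (∀ y ∈ (D j).1, 1 ≤ y) ∧ ∀ y ∈ (D j).2, 1 ≤ y) {x y : ℕ} :
    (x, y) ∈ treePairs D r ↔ ∃ j < r, x + 1 ∈ (D j).1 ∧ y + 1 ∈ (D j).2 := by
  simp only [treePairs, List.mem_flatMap, List.mem_map, List.mem_range, Prod.mk.injEq]
  constructor
  · rintro ⟨j, hj, u, hu, v, hv, rfl, rfl⟩
    have h1 := (hD j hj).1 u hu
    have h2 := (hD j hj).2 v hv
    rw [Nat.sub_add_cancel h1, Nat.sub_add_cancel h2]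
    exact ⟨j, hj, hu, hv⟩
  · rintro ⟨j, hj, hu, hv⟩
    exact ⟨j, hj, _, hu, _, hv, rfl, rfl⟩

theorem nodup_treePairs {D : ℕ → List ℕ × List ℕ} {r : ℕ}
    (hD : ∀ j < r, (∀ y ∈ (D j).1, 1 ≤ y) ∧ ∀ y ∈ (D j).2, 1 ≤ y)
    (hnd : ∀ j < r, (D j).1.Nodup ∧ (D j).2.Nodup)
    (hdis : ∀ i < r, ∀ j < r, ∀ y ∈ (D i).1, y ∈ (D j).1 → ∀ z ∈ (D i).2, z ∈ (D j).2 → i = j) :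
    (treePairs D r).Nodup := by
  rw [treePairs, List.nodup_flatMap]
  have hinj : ∀ a b, 1 ≤ a → 1 ≤ b → a - 1 = b - 1 → a = b := by omega
  constructor
  · intro j hj
    have hj : j < r := by simpa using hj
    rw [List.nodup_flatMap]
    refine ⟨fun y hy => (hnd j hj).2.map_on fun z hz z' hz' h => ?_, ?_⟩
    · exact hinj _ _ ((hD j hj).2 z hz) ((hD j hj).2 z' hz') (Prod.mk.inj h).2
    · refine List.Pairwise.imp_of_mem (fun {y y'} hy hy' hne => ?_) (hnd j hj).1
      rw [Function.onFun, List.disjoint_left]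
      simp only [List.mem_map]
      rintro _ ⟨z, -, rfl⟩ ⟨z', -, h⟩
      exact hne (hinj _ _ ((hD j hj).1 y hy) ((hD j hj).1 y' hy') (Prod.mk.inj h).1.symm)
  · refine List.Pairwise.imp_of_mem (fun {i j} hi hj hne => ?_) List.nodup_range
    have hi : i < r := by simpa using hi
    have hj : j < r := by simpa using hj
    rw [Function.onFun, List.disjoint_left]
    simp only [List.mem_map, List.mem_flatMap]
    rintro _ ⟨y, hy, z, hz, rfl⟩ ⟨y', hy', z', hz', h⟩
    have h1 := hinj _ _ ((hD j hj).1 y' hy') ((hD i hi).1 y hy) (Prod.mk.inj h).1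
    have h2 := hinj _ _ ((hD j hj).2 z' hz') ((hD i hi).2 z hz) (Prod.mk.inj h).2
    exact hne (hdis i hi j hj y hy (h1 ▸ hy') z hz (h2 ▸ hz'))

theorem length_treePairs_le {D : ℕ → List ℕ × List ℕ} {r l : ℕ}
    (hD : ∀ j < r, (D j).1.length ≤ l ∧ (D j).2.length ≤ l) :
    (treePairs D r).length ≤ r * l ^ 2 := by
  induction r with
  | zero => simp [treePairs]
  | succ r ih =>
    have h1 := ih fun j hj => hD j (by omega)
    have h2 := hD r (by omega)
    unfold treePairs at h1 ⊢
    rw [List.range_succ, List.flatMap_append, List.length_append]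
    simp only [List.flatMap_cons, List.flatMap_nil, List.append_nil]
    have h3 : ((D r).1.flatMap fun y => (D r).2.map fun z => (y - 1, z - 1)).length =
        (D r).1.length * (D r).2.length := by simp
    have h4 := Nat.mul_le_mul h2.1 h2.2
    rw [h3]
    have e : (r + 1) * l ^ 2 = r * l ^ 2 + l * l := by ring
    omega

namespace IntervalBicliquePartition

variable {n : ℕ} {G : SimpleGraph (Fin n)} {I : IntervalBicliquePartition (n := n) G}

theorem eq_of_mem {i j : ℕ} (hi : i < I.bicliques.length) (hj : j < I.bicliques.length)
    {e : Sym2 (Fin n)} (h : e ∈ I.bicliques[i].edges I.ord) (h' : e ∈ I.bicliques[j].edges I.ord) :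
    i = j := by
  have := List.pairwise_iff_getElem.1 I.edge_disj
  rcases lt_trichotomy i j with hij | hij | hij
  · exact (Set.disjoint_left.1 (this i j hi hj hij) h h').elim
  · exact hij
  · exact (Set.disjoint_left.1 (this j i hj hi hij) h' h).elim

variable {D : ℕ → List ℕ × List ℕ} (hD : I.Decomposed D I.bicliques.length)
include hD

/-- The edge formed by `x` and `x'` lies in both bicliques, so they coincide because the bicliques
partition the edges; then a leaf lies below only one node of each decomposition. -/
theorem Decomposed.unique {j j' : ℕ} (hj : j < I.bicliques.length) (hj' : j' < I.bicliques.length)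
    {y y' z z' : ℕ} (hy : y ∈ (D j).1) (hz : z ∈ (D j).2) (hy' : y' ∈ (D j').1)
    (hz' : z' ∈ (D j').2) {x x' : Fin n} (h1 : Below (n + x) y) (h2 : Below (n + x) y')
    (h3 : Below (n + x') z) (h4 : Below (n + x') z') : j = j' ∧ y = y' ∧ z = z' := by
  have m1 := ((hD.below_iff hj hj x).1).2 ⟨y, hy, h1⟩
  have m2 := ((hD.below_iff hj' hj' x).1).2 ⟨y', hy', h2⟩
  have m3 := ((hD.below_iff hj hj x').2).2 ⟨z, hz, h3⟩
  have m4 := ((hD.below_iff hj' hj' x').2).2 ⟨z', hz', h4⟩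
  obtain rfl := eq_of_mem hj hj' ⟨x, m1, x', m3, rfl⟩ ⟨x, m2, x', m4, rfl⟩
  have hx := x.2
  have hx' := x'.2
  exact ⟨rfl, (hD j hj hj).1.unique _ (by omega) (by omega) _ hy _ hy' h1 h2,
    (hD j hj hj).2.unique _ (by omega) (by omega) _ hz _ hz' h3 h4⟩

theorem Decomposed.not_both {j : ℕ} (hj : j < I.bicliques.length) {y z : ℕ} (hy : y ∈ (D j).1)
    (hz : z ∈ (D j).2) {x : Fin n} (h1 : Below (n + x) y) (h2 : Below (n + x) z) : False :=
  Set.disjoint_left.1 (I.disj _ (List.getElem_mem hj))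
    (((hD.below_iff hj hj x).1).2 ⟨y, hy, h1⟩) (((hD.below_iff hj hj x).2).2 ⟨z, hz, h2⟩)

/-- As before the two bicliques are equal, but then `x` would lie on both of its sides. -/
theorem Decomposed.not_swapped {j j' : ℕ} (hj : j < I.bicliques.length)
    (hj' : j' < I.bicliques.length)
    {y y' z z' : ℕ} (hy : y ∈ (D j).1) (hz : z ∈ (D j).2) (hy' : y' ∈ (D j').1)
    (hz' : z' ∈ (D j').2) {x x' : Fin n} (h1 : Below (n + x) y) (h2 : Below (n + x) z')
    (h3 : Below (n + x') z) (h4 : Below (n + x') y') : False := by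
  have m1 := ((hD.below_iff hj hj x).1).2 ⟨y, hy, h1⟩
  have m2 := ((hD.below_iff hj' hj' x).2).2 ⟨z', hz', h2⟩
  have m3 := ((hD.below_iff hj hj x').2).2 ⟨z, hz, h3⟩
  have m4 := ((hD.below_iff hj' hj' x').1).2 ⟨y', hy', h4⟩
  obtain rfl := eq_of_mem hj hj' ⟨x, m1, x', m3, rfl⟩ ⟨x', m4, x, m2, Sym2.eq_swap⟩
  exact hD.not_both hj hy hz' h1 h2

end IntervalBicliquePartition

-- In the complete binary tree every edge lies below exactly one chosen pair, so the condition in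
-- `Covers` that no other pair lies in between holds automatically and anti-edges are not needed.
-- Noncrossing follows as well: crossing pairs would have a common edge below them.
open IntervalBicliquePartition in
theorem exists_positiveTreeModel {n : ℕ} (hn : 0 < n) {G : SimpleGraph (Fin n)}
    (I : IntervalBicliquePartition (n := n) G) {D : ℕ → List ℕ × List ℕ} {q : ℕ}
    (hq : I.bicliques.length = q) (hD : I.Decomposed D q) :
    ∃ M : SignedTreeModel (Fin n) (Fin (2 * n - 1)), M.IsPositive ∧ M.graph = G ∧
      M.IsCode [(List.range (2 * n - 1)).map fun i => (i - 1) / 2,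
        List.ofFn fun v => n + (I.ord.symm v : ℕ) - 1, [], [], (treePairs D q).map Prod.fst,
        (treePairs D q).map Prod.snd] ∧ M.pos.card = (treePairs D q).length := by
  classical
  subst hq
  set q := I.bicliques.length with hqd
  have hk : 0 < 2 * n - 1 := by omega
  have hle : ∀ j < q, (∀ y ∈ (D j).1, 1 ≤ y) ∧ ∀ y ∈ (D j).2, 1 ≤ y :=
    fun j hj => ⟨(hD j hj hj).1.pos, (hD j hj hj).2.pos⟩
  have hlt : ∀ j < q, (∀ y ∈ (D j).1, y < 2 * n) ∧ ∀ y ∈ (D j).2, y < 2 * n :=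
    fun j hj => ⟨(hD j hj hj).1.lt, (hD j hj hj).2.lt⟩
  have hleaf : ∀ y, 1 ≤ y → y < 2 * n → ∃ x : Fin n, Below (n + x) y := by
    intro y h1 h2
    obtain ⟨x, h3, h4, h5⟩ := exists_leaf_Below h1 h2
    obtain ⟨i, rfl⟩ := Nat.exists_eq_add_of_le h3
    exact ⟨⟨i, by omega⟩, h5⟩
  have hleaf' : ∀ u : Fin (2 * n - 1), ∃ x : Fin n, Below (n + x) (u + 1) :=
    fun u => hleaf _ (by omega) (by omega)
  set A := treePairs D q with hA
  have hAm : ∀ {x y}, (x, y) ∈ A ↔ ∃ j < q, x + 1 ∈ (D j).1 ∧ y + 1 ∈ (D j).2 := mem_treePairs hle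
  have hAk : ∀ r ∈ A, r.1 < 2 * n - 1 ∧ r.2 < 2 * n - 1 := by
    rintro ⟨x, y⟩ hr
    obtain ⟨j, hj, h1, h2⟩ := hAm.1 hr
    have := (hlt j hj).1 _ h1
    have := (hlt j hj).2 _ h2
    simp only
    omega
  have hAn : A.Nodup := by
    refine nodup_treePairs hle (fun j hj => ⟨(hD j hj hj).1.nodup, (hD j hj hj).2.nodup⟩) ?_
    intro i hi j hj y hy hy' z hz hz'
    obtain ⟨x, hx⟩ := hleaf y ((hle i hi).1 y hy) ((hlt i hi).1 y hy)
    obtain ⟨x', hx'⟩ := hleaf z ((hle i hi).2 z hz) ((hlt i hi).2 z hz)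
    exact (hD.unique hi hj hy hz hy' hz' hx hx hx' hx').1
  let LB := toFinPairs hk A
  have hLB : ∀ {x y : Fin (2 * n - 1)}, (x, y) ∈ LB ↔
      ∃ j < q, (x : ℕ) + 1 ∈ (D j).1 ∧ (y : ℕ) + 1 ∈ (D j).2 :=
    fun {x y} => (mem_toFinPairs hk hAk).trans hAm
  have hpair : ∀ {u v u' v' : Fin (2 * n - 1)}, (u, v) ∈ LB → (u', v') ∈ LB →
      ∀ {x x' : Fin n}, Below (n + x) (u + 1) → Below (n + x) (u' + 1) → Below (n + x') (v + 1) →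
      Below (n + x') (v' + 1) → u = u' ∧ v = v' := by
    intro u v u' v' h h' x x' h1 h2 h3 h4
    obtain ⟨j, hj, k1, k2⟩ := hLB.1 h
    obtain ⟨j', hj', k3, k4⟩ := hLB.1 h'
    have := hD.unique hj hj' k1 k2 k3 k4 h1 h2 h3 h4
    exact ⟨Fin.ext (by omega), Fin.ext (by omega)⟩
  have hswap : ∀ {u v u' v' : Fin (2 * n - 1)}, (u, v) ∈ LB → (u', v') ∈ LB →
      ∀ {x x' : Fin n}, Below (n + x) (u + 1) → Below (n + x) (v' + 1) → Below (n + x') (v + 1) →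
      Below (n + x') (u' + 1) → False := by
    intro u v u' v' h h' x x' h1 h2 h3 h4
    obtain ⟨j, hj, k1, k2⟩ := hLB.1 h
    obtain ⟨j', hj', k3, k4⟩ := hLB.1 h'
    exact hD.not_swapped hj hj' k1 k2 k3 k4 h1 h2 h3 h4
  let pos : Finset (Sym2 (Fin (2 * n - 1))) := (LB.map fun r => s(r.1, r.2)).toFinset
  have hpos : ∀ {u v : Fin (2 * n - 1)}, s(u, v) ∈ pos ↔ (u, v) ∈ LB ∨ (v, u) ∈ LB := by
    intro u v
    simp only [pos, List.mem_toFinset, List.mem_map]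
    constructor
    · rintro ⟨⟨u', v'⟩, h, h'⟩
      rcases Sym2.eq_iff.1 h' with ⟨rfl, rfl⟩ | ⟨rfl, rfl⟩
      · exact Or.inl h
      · exact Or.inr h
    · rintro (h | h)
      · exact ⟨_, h, rfl⟩
      · exact ⟨_, h, Sym2.eq_swap⟩
  have huniq : ∀ {u v u' v' : Fin (2 * n - 1)}, s(u, v) ∈ pos → s(u', v') ∈ pos →
      ∀ {x x' : Fin n}, Below (n + x) (u + 1) → Below (n + x) (u' + 1) → Below (n + x') (v + 1) →
      Below (n + x') (v' + 1) → u = u' ∧ v = v' := by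
    intro u v u' v' h h' x x' h1 h2 h3 h4
    rcases hpos.1 h with h | h <;> rcases hpos.1 h' with h' | h'
    · exact hpair h h' h1 h2 h3 h4
    · exact (hswap h h' h1 h2 h3 h4).elim
    · exact (hswap h h' h3 h4 h1 h2).elim
    · exact (hpair h h' h3 h4 h1 h2).symm
  have hnot : ∀ {u v : Fin (2 * n - 1)}, s(u, v) ∈ pos → ¬ (heapTree n hn).Anc u v := by
    intro u v h huv
    rw [heapTree_anc] at huv
    obtain ⟨x, hx⟩ := hleaf' v
    have hx' := hx.trans huv
    rcases hpos.1 h with h | h <;> obtain ⟨j, hj, k1, k2⟩ := hLB.1 h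
    · exact hD.not_both hj k1 k2 hx' hx
    · exact hD.not_both hj k1 k2 hx hx'
  have hnodB : (LB.map fun r => s(r.1, r.2)).Nodup := by
    refine List.Nodup.map_on ?_ (nodup_toFinPairs hk hAk hAn)
    rintro ⟨x, y⟩ hr ⟨x', y'⟩ hr' h
    rcases Sym2.eq_iff.1 h with ⟨h5, h6⟩ | ⟨h5, h6⟩
    · exact Prod.ext h5 h6
    · simp only at h5 h6
      subst h5 h6
      obtain ⟨i, hi⟩ := hleaf' x
      obtain ⟨i', hi'⟩ := hleaf' y
      exact (hswap hr hr' hi hi hi' hi').elim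
  let leaf : Fin n → Fin (2 * n - 1) := fun v => ⟨n + I.ord.symm v - 1, by omega⟩
  have hanc : ∀ u v, (heapTree n hn).Anc u (leaf v) ↔ Below (n + I.ord.symm v) (u + 1) := by
    intro u v
    rw [heapTree_anc]
    simp only [leaf]
    rw [Nat.sub_add_cancel (by omega)]
  have hcross : ∀ e f, e ∈ pos → f ∈ pos → ¬ (heapTree n hn).Cross e f := by
    rintro e f he hf ⟨⟨a, ha, b, hb, hab, hab'⟩, b', hb', a', ha', hba, hba'⟩
    -- If both comparisons used the same end of `e`, the ends of `f` would be comparable, against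
    -- transversality. Hence e = {a, a'}, and likewise f = {b, b'}.
    have haa : a' ≠ a := by
      rintro rfl
      have h1 : (heapTree n hn).Anc b' b := by
        rw [heapTree_anc] at *
        exact hab.trans hba
      have hbb : b ≠ b' := by
        rintro rfl
        rw [heapTree_anc] at hab hba
        have := hab.le
        have := hba.le
        exact hab' (Fin.ext (by omega))
      have := (Sym2.mem_and_mem_iff hbb.symm).1 ⟨hb', hb⟩
      rw [this] at hf
      exact hnot hf h1
    have hea := (Sym2.mem_and_mem_iff haa.symm).1 ⟨ha, ha'⟩
    rw [hea] at he
    have hbb : b ≠ b' := by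
      rintro rfl
      refine hnot he ?_
      rw [heapTree_anc] at *
      exact hba.trans hab
    rw [(Sym2.mem_and_mem_iff hbb).1 ⟨hb, hb'⟩] at hf
    rw [heapTree_anc] at hab hba
    obtain ⟨x, hx⟩ := hleaf' b
    obtain ⟨x', hx'⟩ := hleaf' a'
    -- Leaves below `b` and below `a'` form an edge that lies below both pairs, so the pairs are
    -- equal.
    exact hab' (huniq he hf (hx.trans hab) hx hx' (hx'.trans hba)).1
  let M : SignedTreeModel (Fin n) (Fin (2 * n - 1)) :=
    { tree := heapTree n hn
      full := heapTree_isFullBinary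
      leaf := leaf
      leaf_injective := by
        intro u v h
        have := congrArg Fin.val h
        simp only [leaf] at this
        exact I.ord.symm.injective (Fin.ext (by omega))
      range_leaf := by
        ext u
        rw [Set.mem_ofPred_eq, heapTree_isLeaf, Set.mem_range]
        constructor
        · rintro ⟨v, rfl⟩
          simp only [leaf]
          omega
        · intro h
          exact ⟨I.ord ⟨u + 1 - n, by omega⟩, Fin.ext (by simp [leaf]; omega)⟩
      neg := ∅
      pos := pos
      disj := Finset.disjoint_empty_left _
      transversal := by
        intro e he
        induction e with
        | h u v =>
          have he : s(u, v) ∈ pos := by simpa using he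
          exact ⟨u, v, rfl, hnot he, hnot (Sym2.eq_swap ▸ he)⟩
      noncrossing := by
        intro e f he hf
        exact hcross e f (by simpa using he) (by simpa using hf) }
  refine ⟨M, rfl, ?_, ⟨[], LB, ⟨by simp, by simp [M]⟩, ⟨hnodB, fun e => List.mem_toFinset.symm⟩, ?_⟩,
    ?_⟩
  · ext u v
    rw [I.adj_iff_exists]
    constructor
    · rintro ⟨e, he, u', v', rfl, hu, hv, -⟩
      rw [hanc] at hu hv
      rcases hpos.1 he with h | h <;> obtain ⟨j, hj, k1, k2⟩ := hLB.1 h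
      · exact ⟨j, hj, Or.inl ⟨((hD.below_iff hj hj _).1).2 ⟨_, k1, hu⟩,
          ((hD.below_iff hj hj _).2).2 ⟨_, k2, hv⟩⟩⟩
      · exact ⟨j, hj, Or.inr ⟨((hD.below_iff hj hj _).1).2 ⟨_, k1, hv⟩,
          ((hD.below_iff hj hj _).2).2 ⟨_, k2, hu⟩⟩⟩
    · have main : ∀ u v : Fin n, ∀ j, ∀ hj : j < I.bicliques.length,
          I.ord.symm u ∈ Set.Icc I.bicliques[j].a I.bicliques[j].b →
          I.ord.symm v ∈ Set.Icc I.bicliques[j].c I.bicliques[j].d → M.graph.Adj u v := by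
        intro u v j hj h1 h2
        obtain ⟨y, hy, hyu⟩ := ((hD.below_iff hj hj _).1).1 h1
        obtain ⟨z, hz, hzv⟩ := ((hD.below_iff hj hj _).2).1 h2
        have := (hle j hj).1 y hy
        have := (hle j hj).2 z hz
        have := (hlt j hj).1 y hy
        have := (hlt j hj).2 z hz
        obtain ⟨y', rfl⟩ : ∃ y', y = y' + 1 := ⟨y - 1, by omega⟩
        obtain ⟨z', rfl⟩ : ∃ z', z = z' + 1 := ⟨z - 1, by omega⟩
        have he : s((⟨y', by omega⟩ : Fin (2 * n - 1)), (⟨z', by omega⟩ : Fin (2 * n - 1))) ∈ pos :=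
          hpos.2 (Or.inl (hLB.2 ⟨j, hj, hy, hz⟩))
        refine ⟨_, he, _, _, rfl, (hanc _ _).2 hyu, (hanc _ _).2 hzv, ?_⟩
        rintro ⟨u'', v'', hf, hne, -, h3, -, h4⟩
        have hf : s(u'', v'') ∈ pos := by simpa [M] using hf
        -- Another pair above both leaves would have the same edge below it.
        obtain ⟨rfl, rfl⟩ := huniq he hf hyu ((hanc _ _).1 h3) hzv ((hanc _ _).1 h4)
        exact hne rfl
      rintro ⟨j, hj, ⟨h1, h2⟩ | ⟨h1, h2⟩⟩
      · exact main u v j hj h1 h2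
      · exact (main v u j hj h1 h2).symm
  · rw [fsts_toFinPairs hk hAk, snds_toFinPairs hk hAk]
    simp only [M, leaf, heapTree, fsts, snds, List.map_nil, List.cons.injEq, and_true]
    refine List.ext_getElem (by simp) fun i h1 h2 => by simp
  · simp only [M, pos]
    rw [List.toFinset_card_of_nodup hnodB]
    simp [LB, toFinPairs]

/-! ### Computing DAG compressions -/

section

variable {n w : ℕ} {G : SimpleGraph (Fin n)}

/-- The sides of the bicliques are stored in the arrays `71, …, 74`. -/
structure HoldsSides (I : IntervalBicliquePartition (n := n) G) (s : State) : Prop where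
  n : s.reg 68 = n
  q : s.reg 69 = I.bicliques.length
  a : ∀ j (hj : j < I.bicliques.length), s.arr 71 j = I.bicliques[j].a
  b : ∀ j (hj : j < I.bicliques.length), s.arr 72 j = I.bicliques[j].b
  c : ∀ j (hj : j < I.bicliques.length), s.arr 73 j = I.bicliques[j].c
  d : ∀ j (hj : j < I.bicliques.length), s.arr 74 j = I.bicliques[j].d

theorem HoldsSides.frame {I : IntervalBicliquePartition (n := n) G} {P : Prog} {s s' : State}
    (h : HoldsSides I s) (hf : Frame P s s') (hr : ([68, 69].all fun k => !P.writesReg k) = true)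
    (ha : ([71, 72, 73, 74].all fun k => !P.writesArr k) = true) : HoldsSides I s' := by
  simp at hr ha
  refine ⟨by rw [hf.reg 68 hr.1, h.n], by rw [hf.reg 69 hr.2, h.q], ?_, ?_, ?_, ?_⟩
  · rw [hf.arr 71 ha.1]; exact h.a
  · rw [hf.arr 72 ha.2.1]; exact h.b
  · rw [hf.arr 73 ha.2.2.1]; exact h.c
  · rw [hf.arr 74 ha.2.2.2]; exact h.d

/-- Save the sides of the bicliques, and write to array `1` the number `n + i - reg 67` for the
`i`-th vertex. -/
def unpack : Prog := blk [
  blk [.assign 68 (ℛ 0), .assign 69 (ℛ 1), .assign 60 0],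
  .loop (.lt (ℛ 60) (ℛ 69)) (blk [
    .store 71 (ℛ 60) (𝒜 1 (ℛ 60)), .store 72 (ℛ 60) (𝒜 2 (ℛ 60)),
    .store 73 (ℛ 60) (𝒜 3 (ℛ 60)), .store 74 (ℛ 60) (𝒜 4 (ℛ 60)),
    .assign 60 (ℛ 60 + 1)]),
  .assign 60 0,
  .loop (.lt (ℛ 60) (ℛ 68)) (blk [
    .store 1 (𝒜 0 (ℛ 60)) (ℛ 68 + ℛ 60 - ℛ 67),
    .assign 60 (ℛ 60 + 1)])]

theorem unpack_runs {I : IntervalBicliquePartition (n := n) G} {Y : List (List ℕ)}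
    (hI : I.IsCode Y) {s : State} (hs : s.Holds Y) {o : ℕ} (h67 : s.reg 67 = o)
    (hW : 2 * n + I.bicliques.length + 2 < 2 ^ w) :
    Runs w unpack s (40 * (n + I.bicliques.length) + 30) fun s' => HoldsSides I s' ∧
      ∀ v : Fin n, s'.arr 1 v = n + (I.ord.symm v : ℕ) - o := by
  have hW1 : 1 < 2 ^ w := by omega
  have hw0 : w ≠ 0 := by rintro rfl; simp at hW1
  have hI' : Y = _ := hI
  subst hI'
  set q := I.bicliques.length with hq
  have h0 := hs 0 (by simp)
  have h1 := hs 1 (by simp)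
  have h2 := hs 2 (by simp)
  have h3 := hs 3 (by simp)
  have h4 := hs 4 (by simp)
  simp at h0 h1 h2 h3 h4
  refine Runs.seq (T := 10) (T' := 40 * (n + q) + 20) (R := fun t => t.reg 68 = n ∧ t.reg 69 = q ∧
    t.reg 60 = 0 ∧ t.arr = s.arr) (.straight (by simp [h0.1, h1.1]; rfl) rfl) ?_ (by omega)
  rintro s1 f1 ⟨e68, e69, e60, earr⟩
  refine Runs.seq (T := 40 * q + 5) (T' := 40 * n + 15)
    (R := fun t => HoldsSides I t) ?_ ?_ (by omega)
  · refine Runs.forLoop (fun i t => t.reg 60 = i ∧ ∀ j (hj : j < I.bicliques.length), j < i →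
      t.arr 71 j = I.bicliques[j].a ∧ t.arr 72 j = I.bicliques[j].b ∧
      t.arr 73 j = I.bicliques[j].c ∧ t.arr 74 j = I.bicliques[j].d) 30 0 q _ (Nat.zero_le _)
      ⟨e60, fun j hj h => by omega⟩ ?_ ?_ ?_ ?_
    · rintro i t hf ⟨h60, -⟩
      have := hf.reg 69 rfl
      simp [e69] at this
      simp [this, h60, hW1]
    · rintro i t - hi hf ⟨h60, hinv⟩
      have ha : ∀ k, k ∈ [1, 2, 3, 4] → t.arr k = s.arr k := by
        intro k hk
        simp only [List.mem_cons, List.not_mem_nil, or_false] at hk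
        rcases hk with rfl | rfl | rfl | rfl <;> rw [hf.arr _ rfl, earr]
      refine .straight ?_ rfl
      simp [h60, ha, hw0, h1.2 i hi, h2.2 i hi, h3.2 i hi, h4.2 i hi]
      refine ⟨by omega, fun j hj hj' => ?_⟩
      rcases Nat.lt_or_eq_of_le hj' with h | rfl
      · simp only [Function.update_of_ne h.ne]
        exact hinv j hj h
      · simp
    · simp only [Expr.cost, Expr.lt]; omega
    · rintro t hf ⟨-, hinv⟩
      exact ⟨by rw [hf.reg 68 rfl, e68], by rw [hf.reg 69 rfl, e69],
        fun j hj => (hinv j hj hj).1, fun j hj => (hinv j hj hj).2.1,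
        fun j hj => (hinv j hj hj).2.2.1, fun j hj => (hinv j hj hj).2.2.2⟩
  rintro s2 f2 hs2
  refine Runs.seq (T := 2) (T' := 40 * n + 10) (R := fun t => t = s2.setReg 60 0)
    (.straight (by simp) rfl) ?_ (by omega)
  rintro s3 f3 hs3
  have hsd := hs2.frame f3 rfl rfl
  have e60 : s3.reg 60 = 0 := by rw [hs3]; simp
  refine Runs.forLoop (fun i t => t.reg 60 = i ∧ ∀ j : Fin n, j < i →
      t.arr 1 (I.ord j) = n + (j : ℕ) - o) 30 0 n _ (Nat.zero_le _)
      ⟨e60, fun j h => by omega⟩ ?_ ?_ ?_ ?_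
  · rintro i t hf ⟨h60, -⟩
    have := hf.reg 68 rfl
    simp [hsd.n] at this
    simp [this, h60, hW1]
  · rintro i t - hi hf ⟨h60, hinv⟩
    have g68 : t.reg 68 = n := by rw [hf.reg 68 rfl, hsd.n]
    have g67 : t.reg 67 = o := by
      rw [hf.reg 67 rfl, f3.reg 67 rfl, f2.reg 67 rfl, f1.reg 67 rfl, h67]
    have g0 : t.arr 0 i = I.ord ⟨i, hi⟩ := by
      rw [hf.arr 0 rfl, f3.arr 0 rfl, f2.arr 0 rfl, earr]
      exact h0.2 i hi
    refine .straight ?_ rfl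
    simp [h60, g68, g67, g0, hw0]
    refine ⟨by omega, fun j hj => ?_⟩
    rcases Nat.lt_or_eq_of_le hj with h | rfl
    · rw [Function.update_of_ne]
      · exact hinv j h
      · intro h'
        have := congrArg Fin.val (I.ord.injective (Fin.ext h'))
        simp only at this
        omega
    · simp
  · simp only [Expr.cost, Expr.lt]; omega
  · rintro t hf ⟨-, hinv⟩
    refine ⟨hsd.frame hf rfl rfl, fun v => ?_⟩
    have := hinv (I.ord.symm v) (I.ord.symm v).2
    rwa [Equiv.apply_symm_apply] at this

end

/-- The list of pairs `L` is stored in the arrays `a` and `b`, its length in register `61`. -/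
structure HoldsPairs (a b : ℕ) (L : List (ℕ × ℕ)) (s : State) : Prop where
  len : s.reg 61 = L.length
  fst : Stores (s.arr a) (L.map Prod.fst)
  snd : Stores (s.arr b) (L.map Prod.snd)

theorem HoldsPairs.frame {a b : ℕ} {L : List (ℕ × ℕ)} {P : Prog} {s s' : State}
    (h : HoldsPairs a b L s) (hf : Frame P s s') (hr : P.writesReg 61 = false)
    (ha : P.writesArr a = false) (hb : P.writesArr b = false) : HoldsPairs a b L s' :=
  ⟨by rw [hf.reg 61 hr, h.len], by rw [hf.arr a ha]; exact h.fst,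
    by rw [hf.arr b hb]; exact h.snd⟩

/-- Append to the list in the arrays `a` and `b` the pairs of `reg 62` and the entries of the
array `36` minus `reg 67`. -/
def emitPairs (a b : ℕ) : Prog := blk [
  .assign 63 0,
  .loop (.lt (ℛ 63) (ℛ 56)) (blk [
    .store a (ℛ 61) (ℛ 62), .store b (ℛ 61) (𝒜 36 (ℛ 63) - ℛ 67),
    .assign 61 (ℛ 61 + 1), .assign 63 (ℛ 63 + 1)])]

theorem emitPairs_runs {w a b x o : ℕ} {L : List (ℕ × ℕ)} {D : List ℕ} {s : State} (hab : a ≠ b)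
    (ha : a ≠ 36) (hb : b ≠ 36) (h : HoldsPairs a b L s) (h62 : s.reg 62 = x) (h67 : s.reg 67 = o)
    (h56 : s.reg 56 = D.length) (hD : Stores (s.arr 36) D) (hlt : ∀ y ∈ D, y < 2 ^ w)
    (hW : L.length + D.length + 2 < 2 ^ w) :
    Runs w (emitPairs a b) s (D.length * 24 + 10) fun s' =>
      HoldsPairs a b (L ++ D.map fun y => (x, y - o)) s' := by
  have hW1 : 1 < 2 ^ w := by omega
  have hw0 : w ≠ 0 := by rintro rfl; simp at hW1
  refine Runs.seq (T := 2) (T' := D.length * 24 + 8) (R := fun t => t = s.setReg 63 0)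
    (.straight (by simp) rfl) ?_ (by omega)
  rintro _ - rfl
  refine Runs.forLoop (fun i t => t.reg 63 = i ∧
    HoldsPairs a b (L ++ (D.take i).map fun y => (x, y - o)) t) 20 0 D.length _ (Nat.zero_le _)
    ⟨by simp, by simpa using h.len, by simpa using h.fst, by simpa using h.snd⟩ ?_ ?_ ?_ ?_
  · rintro i t hf ⟨h63, -⟩
    have := hf.reg 56 rfl
    simp [h56] at this
    simp [this, h63, hW1]
  · rintro i t - hi hf ⟨h63, hp⟩
    have e62 : t.reg 62 = x := by rw [hf.reg 62 rfl]; simpa using h62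
    have e67 : t.reg 67 = o := by rw [hf.reg 67 rfl]; simpa using h67
    have e36 : t.arr 36 i = D[i] := by
      rw [hf.arr 36 (by simp [blk, Prog.writesArr, ha, hb])]
      simpa using hD.get i hi
    have hlen := hp.len
    have hl := hlt D[i] (List.getElem_mem _)
    have htake : D.take (i + 1) = D.take i ++ [D[i]] := by simp
    rw [htake, List.map_append, ← List.append_assoc]
    generalize hL' : L ++ (D.take i).map (fun y => (x, y - o)) = L' at *
    have hLl : L'.length ≤ L.length + D.length := by
      rw [← hL']; simp
    refine .straight ?_ rfl
    simp [h63, e62, e67, e36, hlen, hw0, ha.symm]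
    refine ⟨by omega, by simp, ?_, ?_⟩
    · have := hp.fst.append x
      simpa [hab] using this
    · have := hp.snd.append (D[i] - o)
      simpa [hab.symm] using this
  · simp only [Expr.cost, Expr.lt]; omega
  · rintro t - ⟨-, hp⟩
    simpa using hp

/-- Decompose the interval from entry `reg 60` of array `x` to that of array `y`. -/
def decomposeSide (k x y : ℕ) : Prog := blk [
  blk [.assign 54 (𝒜 x (ℛ 60)), .assign 55 (𝒜 y (ℛ 60) + 1)], decompose k]

theorem decomposeSide_runs {w k x y r n a b : ℕ} {s : State} (h60 : s.reg 60 = r)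
    (hx : s.arr x r = a) (hy : s.arr y r = b) (hab : a ≤ b) (hb : b < n) (h50 : s.reg 50 = n)
    (hW : 4 * n + 8 < 2 ^ w) :
    Runs w (decomposeSide k x y) s (120 * (Nat.log 2 n + 2) + 10) fun s' =>
      ∃ D, IsDecomposition n a (b + 1) D ∧ s'.reg 56 = D.length ∧ Stores (s'.arr k) D := by
  have hW1 : 1 < 2 ^ w := by omega
  have hw0 : w ≠ 0 := by rintro rfl; simp at hW1
  refine Runs.seq (T := 10) (T' := 120 * (Nat.log 2 n + 2)) (R := fun t => t.reg 50 = n ∧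
    t.reg 54 = a ∧ t.reg 55 = b + 1) (.straight (by simp [h60, hx, hy, h50, hw0]; omega) rfl) ?_
    (by omega)
  rintro s1 - ⟨e50, e54, e55⟩
  exact decompose_runs e50 e54 e55 (by omega) (by omega) (by omega) hW

/-- Treating one more biclique only appends to the list, which is what the program does. The
decompositions enter through `Function.update` because each is known only once its round has run. -/
theorem dagArcs_succ {n r : ℕ} {D : ℕ → List ℕ × List ℕ} (D₁ D₂ : List ℕ) :
    dagArcs n (Function.update D r (D₁, D₂)) (r + 1) = dagArcs n D r ++
      (D₁.map fun y => (2 * (n + r), y)) ++ D₂.map fun y => (2 * (n + r) + 1, y) := by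
  have : ((List.range r).flatMap fun j =>
      (Function.update D r (D₁, D₂) j).1.map (fun y => (2 * (n + j), y)) ++
      (Function.update D r (D₁, D₂) j).2.map fun y => (2 * (n + j) + 1, y)) =
    (List.range r).flatMap fun j => (D j).1.map (fun y => (2 * (n + j), y)) ++
      (D j).2.map fun y => (2 * (n + j) + 1, y) := by
    refine List.flatMap_congr fun j hj => ?_
    have : j ≠ r := by have := List.mem_range.1 hj; omega
    rw [Function.update_of_ne this]
  simp only [dagArcs, List.range_succ, List.flatMap_append, List.flatMap_cons, List.flatMap_nil,
    Function.update_self, this, List.append_nil, List.append_assoc]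

theorem treePairs_succ {r : ℕ} {D : ℕ → List ℕ × List ℕ} (D₁ D₂ : List ℕ) :
    treePairs (Function.update D r (D₁, D₂)) (r + 1) = treePairs D r ++
      D₁.flatMap fun y => D₂.map fun z => (y - 1, z - 1) := by
  have : ((List.range r).flatMap fun j => (Function.update D r (D₁, D₂) j).1.flatMap fun y =>
      (Function.update D r (D₁, D₂) j).2.map fun z => (y - 1, z - 1)) =
    (List.range r).flatMap fun j => (D j).1.flatMap fun y =>
      (D j).2.map fun z => (y - 1, z - 1) := by
    refine List.flatMap_congr fun j hj => ?_
    have : j ≠ r := by have := List.mem_range.1 hj; omega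
    rw [Function.update_of_ne this]
  simp only [treePairs, List.range_succ, List.flatMap_append, List.flatMap_cons, List.flatMap_nil,
    Function.update_self, this, List.append_nil]

theorem IntervalBicliquePartition.Decomposed.succ {n : ℕ} {G : SimpleGraph (Fin n)}
    {I : IntervalBicliquePartition (n := n) G} {D : ℕ → List ℕ × List ℕ} {r : ℕ}
    (h : I.Decomposed D r) (hr : r < I.bicliques.length) {D₁ D₂ : List ℕ}
    (h₁ : IsDecomposition n I.bicliques[r].a (I.bicliques[r].b + 1) D₁)
    (h₂ : IsDecomposition n I.bicliques[r].c (I.bicliques[r].d + 1) D₂) :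
    I.Decomposed (Function.update D r (D₁, D₂)) (r + 1) := by
  intro j hj hjr
  rcases Nat.lt_succ_iff_lt_or_eq.1 hjr with h' | rfl
  · rw [Function.update_of_ne h'.ne]
    exact h j hj h'
  · rw [Function.update_self]
    exact ⟨h₁, h₂⟩

theorem IntervalBicliquePartition.Decomposed.length_le {n : ℕ} {G : SimpleGraph (Fin n)}
    {I : IntervalBicliquePartition (n := n) G} {D : ℕ → List ℕ × List ℕ} {r : ℕ}
    (h : I.Decomposed D r) (hr : r ≤ I.bicliques.length) :
    ∀ j < r, (D j).1.length ≤ 2 * (Nat.log 2 n + 2) ∧ (D j).2.length ≤ 2 * (Nat.log 2 n + 2) :=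
  fun j hj => ⟨(h j (by omega) hj).1.length_le, (h j (by omega) hj).2.length_le⟩

def dagProg : Prog := blk [
  -- Offset 0: the nodes of the DAG are the heap numbers themselves.
  .assign 67 0,
  unpack,
  blk [.assign 61 0, .assign 66 1],
  .loop (.lt (ℛ 66) (2 * ℛ 68)) (blk [
    .store 2 (ℛ 61) (ℛ 66 / 2), .store 3 (ℛ 61) (ℛ 66), .assign 61 (ℛ 61 + 1),
    .assign 66 (ℛ 66 + 1)]),
  blk [.assign 50 (ℛ 68), .assign 60 0],
  .loop (.lt (ℛ 60) (ℛ 69)) (blk [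
    decomposeSide 36 71 72,
    .assign 62 (2 * (ℛ 68 + ℛ 60)),
    emitPairs 2 3,
    decomposeSide 36 73 74,
    .assign 62 (2 * (ℛ 68 + ℛ 60) + 1),
    emitPairs 2 3,
    blk [.store 4 (ℛ 60) (2 * (ℛ 68 + ℛ 60)), .store 5 (ℛ 60) (2 * (ℛ 68 + ℛ 60) + 1),
      .assign 60 (ℛ 60 + 1)]]),
  blk [.store 0 0 (2 * (ℛ 68 + ℛ 69)), .assign 0 1, .assign 1 (ℛ 68), .assign 2 (ℛ 61),
    .assign 3 (ℛ 61), .assign 4 (ℛ 69), .assign 5 (ℛ 69)]]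

theorem dagProg_runs {n w : ℕ} {G : SimpleGraph (Fin n)} (hn : 0 < n)
    {I : IntervalBicliquePartition (n := n) G} {Y : List (List ℕ)} (hI : I.IsCode Y) {s : State}
    (hs : s.Holds Y) {q : ℕ} (hq : I.bicliques.length = q)
    (hW : 200 * ((n + 1) ^ 2 * (q + 1)) < 2 ^ w) :
    Runs w dagProg s (200 * n + q * (340 * (Nat.log 2 n + 2) + 300) + 200) fun s' =>
      ∃ D, I.Decomposed D q ∧ s'.Holds [[2 * (n + q)],
        List.ofFn fun v => n + (I.ord.symm v : ℕ), (dagArcs n D q).map Prod.fst,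
        (dagArcs n D q).map Prod.snd, (List.range q).map fun j => 2 * (n + j),
        (List.range q).map fun j => 2 * (n + j) + 1] := by
  have hlog : Nat.log 2 n < n := Nat.log_lt_self 2 (by omega)
  have hb1 : n + 1 ≤ (n + 1) ^ 2 * (q + 1) := by nlinarith
  have hb2 : q + 1 ≤ (n + 1) ^ 2 * (q + 1) := Nat.le_mul_of_pos_left _ (by positivity)
  have hb3 : q * (2 * (Nat.log 2 n + 2)) ≤ 2 * ((n + 1) ^ 2 * (q + 1)) := by
    have h1 : q * (2 * (Nat.log 2 n + 2)) ≤ q * (2 * (n + 1)) :=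
      Nat.mul_le_mul_left _ (by omega)
    nlinarith
  have hW1 : 1 < 2 ^ w := by omega
  have hw0 : w ≠ 0 := by rintro rfl; simp at hW1
  refine Runs.seq (T := 2) (T' := 200 * n + q * (340 * (Nat.log 2 n + 2) + 300) + 198)
    (R := fun t => t = s.setReg 67 0) (.straight (by simp) rfl) ?_ (by omega)
  rintro s0 f0 hs0
  have hs0' : s0.Holds Y := by
    intro k hk
    have hk5 : k < 5 := by rw [show Y = _ from hI] at hk; simpa using hk
    have := hs k hk
    rw [hs0]
    simpa [Function.update_of_ne (show k ≠ 67 by omega)] using this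
  obtain ⟨F, hF⟩ : ∃ F, F = q * (340 * (Nat.log 2 n + 2) + 200) := ⟨_, rfl⟩
  have e : F + q * 100 = q * (340 * (Nat.log 2 n + 2) + 300) := by rw [hF]; ring
  generalize q * (340 * (Nat.log 2 n + 2) + 300) = F' at e ⊢
  refine Runs.seq (T' := 160 * n + F + 168)
    (unpack_runs hI hs0' (o := 0) (by rw [hs0]; simp) (by omega)) ?_ (by omega)
  rintro s1 f1 ⟨hsd, hsink⟩
  refine Runs.seq (T := 4) (T' := 160 * n + F + 164)
    (R := fun t => t = (s1.setReg 61 0).setReg 66 1) (.straight (by simp [hw0]) rfl) ?_ (by omega)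
  rintro s2 f2 hs2
  have hsd2 := hsd.frame f2 rfl rfl
  refine Runs.seq (T := 60 * n + 10) (T' := 100 * n + F + 154)
    (R := fun t => HoldsPairs 2 3 ((List.range (2 * n - 1)).map fun i => ((i + 1) / 2, i + 1)) t)
    ?_ ?_ (by omega)
  · refine Runs.forLoop (fun i t => t.reg 66 = i ∧ 1 ≤ i ∧
      HoldsPairs 2 3 ((List.range (i - 1)).map fun i => ((i + 1) / 2, i + 1)) t) 20 1 (2 * n) _
      (by omega) ⟨by rw [hs2]; simp, le_rfl, by rw [hs2]; simp, by simpa using Stores.nil _,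
        by simpa using Stores.nil _⟩ ?_ ?_ ?_ ?_
    · rintro i t hf ⟨h66, -⟩
      have := hf.reg 68 rfl
      rw [hsd2.n] at this
      simp [this, h66, hw0]
      omega
    · rintro i t hi hi' hf ⟨h66, -, hp⟩
      obtain ⟨i, rfl⟩ : ∃ j, i = j + 1 := ⟨i - 1, by omega⟩
      have hlen := hp.len
      simp at hlen
      have h1 := hp.fst.append ((i + 1) / 2)
      have h2 := hp.snd.append (i + 1)
      simp at h1 h2
      refine .straight ?_ rfl
      simp [h66, hlen, hw0]
      refine ⟨by omega, ?_, ?_, ?_⟩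
      · simp
      · simpa [List.range_succ] using h1
      · simpa [List.range_succ] using h2
    · change (2 * n - 1) * (20 + 5 + 1) + 5 + 1 ≤ 60 * n + 10
      omega
    · rintro t - ⟨-, -, hp⟩
      exact hp
  rintro s3 f3 hp3
  have hsd3 := hsd2.frame f3 rfl rfl
  refine Runs.seq (T := 4) (T' := 100 * n + F + 150)
    (R := fun t => t = (s3.setReg 50 n).setReg 60 0) (.straight (by simp [hsd3.n]) rfl) ?_
    (by omega)
  rintro s4 f4 hs4
  have hsd4 := hsd3.frame f4 rfl rfl
  have hp4 := hp3.frame f4 rfl rfl rfl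
  refine Runs.seq (T := F + 10) (T' := 100)
    (R := fun t => ∃ D, I.Decomposed D q ∧ HoldsPairs 2 3 (dagArcs n D q) t ∧
      ∀ j < q, t.arr 4 j = 2 * (n + j) ∧ t.arr 5 j = 2 * (n + j) + 1) ?_ ?_ (by omega)
  -- The 340 covers two decompositions (120 each) and two lists of at most 2(log n + 2) arcs at 24
  -- steps per arc.
  · refine Runs.forLoop (fun r t => t.reg 60 = r ∧ ∃ D, I.Decomposed D r ∧
      HoldsPairs 2 3 (dagArcs n D r) t ∧
      ∀ j < r, t.arr 4 j = 2 * (n + j) ∧ t.arr 5 j = 2 * (n + j) + 1)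
      (340 * (Nat.log 2 n + 2) + 190) 0 q _ (Nat.zero_le _) ⟨by rw [hs4]; simp,
        fun _ => ([], []), fun j hj h => by omega, by simpa [dagArcs] using hp4,
        fun j h => by omega⟩ ?_ ?_ ?_ ?_
    · rintro i t hf ⟨h60, -⟩
      have := hf.reg 69 rfl
      rw [hsd4.q, hq] at this
      simp [this, h60, hW1]
    · rintro r t - hr hf ⟨h60, D, hD, hp, h45⟩
      have hrl : r < I.bicliques.length := by omega
      have hne := I.nonempty _ (List.getElem_mem hrl)
      have hsd5 := hsd4.frame hf rfl rfl
      have h50 : t.reg 50 = n := by rw [hf.reg 50 rfl, hs4]; simp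
      have h67 : t.reg 67 = 0 := by
        rw [hf.reg 67 rfl, f4.reg 67 rfl, f3.reg 67 rfl, f2.reg 67 rfl, f1.reg 67 rfl, hs0]; simp
      have hAl : (dagArcs n D r).length ≤ 2 * n + 4 * ((n + 1) ^ 2 * (q + 1)) := by
        have h1 := length_dagArcs_le (n := n) (hD.length_le hrl.le)
        have h2 : r * (2 * (Nat.log 2 n + 2)) ≤ q * (2 * (Nat.log 2 n + 2)) := by gcongr
        omega
      refine Runs.seq (T' := 220 * (Nat.log 2 n + 2) + 180) (decomposeSide_runs h60
        (hsd5.a r hrl) (hsd5.b r hrl) (Fin.le_def.1 hne.1) (Fin.is_lt _) h50 (by omega)) ?_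
        (by omega)
      rintro t1 k1 ⟨D₁, hD₁, e56, hst₁⟩
      have hsd6 := hsd5.frame k1 rfl rfl
      have hD₁l := hD₁.length_le
      have i60 : t1.reg 60 = r := by rw [k1.reg 60 rfl, h60]
      refine Runs.seq (T := 10) (T' := 220 * (Nat.log 2 n + 2) + 170)
        (R := fun u => u = t1.setReg 62 (2 * (n + r)))
        (.straight (by simp [hsd6.n, i60]; omega) rfl) ?_ (by omega)
      rintro t2 k2 ht2
      have i67 : t2.reg 67 = 0 := by rw [k2.reg 67 rfl, k1.reg 67 rfl, h67]
      refine Runs.seq (T' := 172 * (Nat.log 2 n + 2) + 160) (emitPairs_runs (by norm_num)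
        (by norm_num) (by norm_num) ((hp.frame k1 rfl rfl rfl).frame k2 rfl rfl rfl)
        (x := 2 * (n + r)) (by rw [ht2]; simp) i67 (by rw [k2.reg 56 rfl, e56])
        (by rw [k2.arr 36 rfl]; exact hst₁) (fun y hy => by have := hD₁.lt y hy; omega)
        (by omega)) ?_ (by omega)
      rintro t3 k3 hp3
      have hsd7 := (hsd6.frame k2 rfl rfl).frame k3 rfl rfl
      have j60 : t3.reg 60 = r := by rw [k3.reg 60 rfl, k2.reg 60 rfl, i60]
      have j50 : t3.reg 50 = n := by rw [k3.reg 50 rfl, k2.reg 50 rfl, k1.reg 50 rfl, h50]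
      refine Runs.seq (T' := 52 * (Nat.log 2 n + 2) + 150) (decomposeSide_runs j60
        (hsd7.c r hrl) (hsd7.d r hrl) (Fin.le_def.1 hne.2) (Fin.is_lt _) j50 (by omega)) ?_
        (by omega)
      rintro t4 k4 ⟨D₂, hD₂, g56, hst₂⟩
      have hsd8 := hsd7.frame k4 rfl rfl
      have hD₂l := hD₂.length_le
      have l60 : t4.reg 60 = r := by rw [k4.reg 60 rfl, j60]
      refine Runs.seq (T := 10) (T' := 52 * (Nat.log 2 n + 2) + 140)
        (R := fun u => u = t4.setReg 62 (2 * (n + r) + 1))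
        (.straight (by simp [hsd8.n, l60]; omega) rfl) ?_ (by omega)
      rintro t5 k5 ht5
      have l67 : t5.reg 67 = 0 := by
        rw [k5.reg 67 rfl, k4.reg 67 rfl, k3.reg 67 rfl, i67]
      refine Runs.seq (T' := 30) (emitPairs_runs (by norm_num)
        (by norm_num) (by norm_num) ((hp3.frame k4 rfl rfl rfl).frame k5 rfl rfl rfl)
        (x := 2 * (n + r) + 1) (by rw [ht5]; simp) l67 (by rw [k5.reg 56 rfl, g56])
        (by rw [k5.arr 36 rfl]; exact hst₂) (fun y hy => by have := hD₂.lt y hy; omega)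
        (by simp; omega)) ?_ (by omega)
      rintro t6 k6 hp6
      have hsd9 := (hsd8.frame k5 rfl rfl).frame k6 rfl rfl
      have m60 : t6.reg 60 = r := by rw [k6.reg 60 rfl, k5.reg 60 rfl, l60]
      have m4 : t6.arr 4 = t.arr 4 := by
        rw [k6.arr 4 rfl, k5.arr 4 rfl, k4.arr 4 rfl, k3.arr 4 rfl, k2.arr 4 rfl, k1.arr 4 rfl]
      have m5 : t6.arr 5 = t.arr 5 := by
        rw [k6.arr 5 rfl, k5.arr 5 rfl, k4.arr 5 rfl, k3.arr 5 rfl, k2.arr 5 rfl, k1.arr 5 rfl]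
      simp only [Nat.sub_zero] at hp6
      rw [← dagArcs_succ] at hp6
      have hD' := hD.succ hrl hD₁ hD₂
      refine .straight ?_ rfl
      simp [hsd9.n, m60, hw0]
      refine ⟨by omega, _, hD', ⟨by simpa using hp6.len, by simpa using hp6.fst,
        by simpa using hp6.snd⟩, fun j hj => ?_⟩
      rw [m4, m5]
      rcases Nat.lt_or_eq_of_le hj with h | rfl
      · rw [Function.update_of_ne h.ne, Function.update_of_ne h.ne]
        exact h45 j h
      · simp
    · have aux : ∀ g, q * (340 * g + 190 + 3 + 1) + 3 + 1 ≤ q * (340 * g + 200) + 10 := by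
        intro g; nlinarith
      rw [hF]
      exact aux _
    · rintro t - ⟨-, h⟩
      exact h
  rintro s5 f5 ⟨D, hD, hp5, h45⟩
  have hsd5 := hsd4.frame f5 rfl rfl
  have h1 : s5.arr 1 = s1.arr 1 := by rw [f5.arr 1 rfl, f4.arr 1 rfl, f3.arr 1 rfl, f2.arr 1 rfl]
  refine .straight ?_ (Nat.ble_eq_true_of_le (show _ ≤ 100 from Nat.le_of_ble_eq_true rfl))
  have hlen := hp5.len
  simp [hsd5.n, hsd5.q, hq, hlen, hw0]
  refine ⟨by omega, D, hD, ?_⟩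
  intro k hk
  simp only [List.length_cons, List.length_nil] at hk
  interval_cases k
  · simp
  · refine ⟨by simp, fun j hj => ?_⟩
    have hj : j < n := by simpa using hj
    have := hsink ⟨j, hj⟩
    simp [h1]
    simpa using this
  · exact ⟨by simp, fun j hj => hp5.fst.get j hj⟩
  · exact ⟨by simp, fun j hj => hp5.snd.get j hj⟩
  · refine ⟨by simp, fun j hj => ?_⟩
    have hj : j < q := by simpa using hj
    simpa using (h45 j hj).1
  · refine ⟨by simp, fun j hj => ?_⟩
    have hj : j < q := by simpa using hj
    simpa using (h45 j hj).2

/-! ### Computing positive tree models -/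

/-- Append to the list in the arrays `4` and `5` the pairs of an entry of the array `35` and one
of the array `36`, both decreased by one. -/
def emitProducts : Prog := blk [
  .assign 65 0,
  .loop (.lt (ℛ 65) (ℛ 64)) (blk [
    .assign 62 (𝒜 35 (ℛ 65) - 1),
    emitPairs 4 5,
    .assign 65 (ℛ 65 + 1)])]

theorem emitProducts_runs {w l : ℕ} {A : List (ℕ × ℕ)} {D₁ D₂ : List ℕ} {s : State}
    (h : HoldsPairs 4 5 A s) (h67 : s.reg 67 = 1) (h64 : s.reg 64 = D₁.length)
    (h35 : Stores (s.arr 35) D₁) (h56 : s.reg 56 = D₂.length) (h36 : Stores (s.arr 36) D₂)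
    (hl₁ : D₁.length ≤ 2 * l) (hl₂ : D₂.length ≤ 2 * l) (hlt₁ : ∀ y ∈ D₁, y < 2 ^ w)
    (hlt₂ : ∀ y ∈ D₂, y < 2 ^ w) (hW : A.length + (2 * l) ^ 2 + 2 * l + 2 < 2 ^ w) :
    Runs w emitProducts s (2 * l * (48 * l + 30) + 20) fun s' =>
      HoldsPairs 4 5 (A ++ D₁.flatMap fun y => D₂.map fun z => (y - 1, z - 1)) s' := by
  have hW1 : 1 < 2 ^ w := by omega
  have hw0 : w ≠ 0 := by rintro rfl; simp at hW1
  refine Runs.seq (T := 2) (T' := 2 * l * (48 * l + 30) + 18)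
    (R := fun u => u = s.setReg 65 0) (.straight (by simp) rfl) ?_ (by omega)
  rintro _ - rfl
  have hprod : ∀ i, i < D₁.length →
      ((D₁.take i).flatMap fun y => D₂.map fun z => (y - 1, z - 1)).length + D₂.length ≤
        (2 * l) ^ 2 := by
    intro i hi
    have h1 : ((D₁.take i).flatMap fun y => D₂.map fun z => (y - 1, z - 1)).length =
        i * D₂.length := by
      simp [Nat.min_eq_left hi.le]
    have h2 : (i + 1) * D₂.length ≤ 2 * l * (2 * l) := Nat.mul_le_mul (by omega) hl₂
    rw [h1, sq, ← Nat.succ_mul]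
    exact h2
  refine Runs.forLoop (fun i u => u.reg 65 = i ∧ HoldsPairs 4 5
    (A ++ (D₁.take i).flatMap fun y => D₂.map fun z => (y - 1, z - 1)) u)
    (48 * l + 22) 0 D₁.length _ (Nat.zero_le _)
    ⟨by simp, by simpa using h.len, by simpa using h.fst, by simpa using h.snd⟩ ?_ ?_ ?_ ?_
  · rintro i u hf ⟨h65, -⟩
    have := hf.reg 64 rfl
    simp [h64] at this
    simp [this, h65, hW1]
  · rintro i u - hi hf ⟨h65, hpu⟩
    have hprod' := hprod i hi
    have m35 : u.arr 35 i = D₁[i] := by rw [hf.arr 35 rfl]; exact h35.get i hi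
    have hlt := hlt₁ D₁[i] (List.getElem_mem _)
    have htake : D₁.take (i + 1) = D₁.take i ++ [D₁[i]] := by simp
    rw [htake, List.flatMap_append, List.flatMap_singleton, ← List.append_assoc]
    generalize hL' : A ++ (D₁.take i).flatMap (fun y => D₂.map fun z => (y - 1, z - 1)) = L' at *
    have hLl : L'.length + D₂.length ≤ A.length + (2 * l) ^ 2 := by
      rw [← hL', List.length_append]; omega
    clear hprod' hprod
    refine Runs.seq (T := 6) (T' := 48 * l + 16) (R := fun v => v = u.setReg 62 (D₁[i] - 1))
      (.straight (by simp [h65, m35, hw0]; omega) rfl) ?_ (by omega)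
    rintro u1 n1 hu1
    refine Runs.seq (T' := 4) (emitPairs_runs (by norm_num) (by norm_num) (by norm_num)
      (hpu.frame n1 rfl rfl rfl) (x := D₁[i] - 1) (o := 1) (by rw [hu1]; simp)
      (by rw [n1.reg 67 rfl, hf.reg 67 rfl]; simpa using h67)
      (by rw [n1.reg 56 rfl, hf.reg 56 rfl]; simpa using h56)
      (by rw [n1.arr 36 rfl, hf.arr 36 rfl]; simpa using h36)
      hlt₂ (by omega)) ?_ (by omega)
    rintro u2 n2 hp2
    have o65 : u2.reg 65 = i := by rw [n2.reg 65 rfl, n1.reg 65 rfl, h65]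
    refine .straight ?_ rfl
    simp [o65, hw0]
    exact ⟨by omega, by simpa using hp2.len, by simpa using hp2.fst, by simpa using hp2.snd⟩
  · change (D₁.length - 0) * (48 * l + 22 + 3 + 1) + 3 + 1 ≤ _
    have h1 : (D₁.length - 0) * (48 * l + 22 + 3 + 1) ≤ 2 * l * (48 * l + 30) :=
      Nat.mul_le_mul (by omega) (by omega)
    exact (Nat.add_le_add_right h1 4).trans (by omega)
  · rintro u - ⟨-, hpu⟩
    simpa using hpu

def treeProg : Prog := blk [
  -- Offset 1: tree nodes are numbered from 0, one less than their heap numbers.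
  .assign 67 1,
  unpack,
  blk [.assign 61 0, .assign 66 0],
  .loop (.lt (ℛ 66 + 1) (2 * ℛ 68)) (blk [
    -- Truncated subtraction makes the root 0 its own parent, as required.
    .store 0 (ℛ 66) ((ℛ 66 - 1) / 2), .assign 66 (ℛ 66 + 1)]),
  blk [.assign 50 (ℛ 68), .assign 60 0],
  .loop (.lt (ℛ 60) (ℛ 69)) (blk [
    decomposeSide 35 71 72,
    .assign 64 (ℛ 56),
    decomposeSide 36 73 74,
    emitProducts,
    .assign 60 (ℛ 60 + 1)]),
  blk [.assign 0 (2 * ℛ 68 - 1), .assign 1 (ℛ 68), .assign 2 0, .assign 3 0, .assign 4 (ℛ 61),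
    .assign 5 (ℛ 61)]]

theorem treeProg_runs {n w : ℕ} {G : SimpleGraph (Fin n)} (hn : 0 < n)
    {I : IntervalBicliquePartition (n := n) G} {Y : List (List ℕ)} (hI : I.IsCode Y) {s : State}
    (hs : s.Holds Y) {q : ℕ} (hq : I.bicliques.length = q)
    (hW : 200 * ((n + 1) ^ 2 * (q + 1)) < 2 ^ w) :
    Runs w treeProg s (200 * n + q * (300 * (Nat.log 2 n + 2) ^ 2 + 200) + 200) fun s' =>
      ∃ D, I.Decomposed D q ∧ s'.Holds [(List.range (2 * n - 1)).map fun i => (i - 1) / 2,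
        List.ofFn fun v => n + (I.ord.symm v : ℕ) - 1, [], [], (treePairs D q).map Prod.fst,
        (treePairs D q).map Prod.snd] := by
  have hlog : Nat.log 2 n < n := Nat.log_lt_self 2 (by omega)
  have hb1 : n + 1 ≤ (n + 1) ^ 2 * (q + 1) := by nlinarith
  have hb2 : q + 1 ≤ (n + 1) ^ 2 * (q + 1) := Nat.le_mul_of_pos_left _ (by positivity)
  obtain ⟨l, hl⟩ : ∃ l, l = Nat.log 2 n + 2 := ⟨_, rfl⟩
  have hl2 : 2 ≤ l := by omega
  rw [← hl]
  have hb3 : (q + 1) * (2 * l) ^ 2 ≤ 4 * ((n + 1) ^ 2 * (q + 1)) := by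
    have h1 : (2 * l) ^ 2 ≤ (2 * (n + 1)) ^ 2 := Nat.pow_le_pow_left (by omega) 2
    calc (q + 1) * (2 * l) ^ 2 ≤ (q + 1) * (2 * (n + 1)) ^ 2 := Nat.mul_le_mul_left _ h1
      _ = 4 * ((n + 1) ^ 2 * (q + 1)) := by ring
  have hb4 : q * (2 * l) ^ 2 + (2 * l) ^ 2 = (q + 1) * (2 * l) ^ 2 := by ring
  have hll : 2 * l ≤ (2 * l) ^ 2 := Nat.le_self_pow two_ne_zero _
  have hW1 : 1 < 2 ^ w := by omega
  have hw0 : w ≠ 0 := by rintro rfl; simp at hW1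
  obtain ⟨F, hF⟩ : ∃ F, F = q * (300 * l ^ 2 + 100) := ⟨_, rfl⟩
  have e : F + q * 100 = q * (300 * l ^ 2 + 200) := by rw [hF]; ring
  generalize q * (300 * l ^ 2 + 200) = F' at e ⊢
  refine Runs.seq (T := 2) (T' := 200 * n + F' + 198)
    (R := fun t => t = s.setReg 67 1) (.straight (by simp [hw0]) rfl) ?_ (by omega)
  rintro s0 f0 hs0
  have hs0' : s0.Holds Y := by
    intro k hk
    have hk5 : k < 5 := by rw [show Y = _ from hI] at hk; simpa using hk
    have := hs k hk
    rw [hs0]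
    simpa [Function.update_of_ne (show k ≠ 67 by omega)] using this
  refine Runs.seq (T' := 160 * n + F + 168)
    (unpack_runs hI hs0' (o := 1) (by rw [hs0]; simp) (by omega)) ?_ (by omega)
  rintro s1 f1 ⟨hsd, hsink⟩
  refine Runs.seq (T := 4) (T' := 160 * n + F + 164)
    (R := fun t => t = (s1.setReg 61 0).setReg 66 0) (.straight (by simp) rfl) ?_ (by omega)
  rintro s2 f2 hs2
  have hsd2 := hsd.frame f2 rfl rfl
  refine Runs.seq (T := 60 * n + 10) (T' := 100 * n + F + 154)
    (R := fun t => ∀ j < 2 * n - 1, t.arr 0 j = (j - 1) / 2) ?_ ?_ (by omega)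
  · refine Runs.forLoop (fun i t => t.reg 66 = i ∧ i ≤ 2 * n - 1 ∧ ∀ j < i, t.arr 0 j = (j - 1) / 2) 14 0
      (2 * n - 1) _ (by omega) ⟨by rw [hs2]; simp, Nat.zero_le _, fun j h => by omega⟩ ?_ ?_ ?_ ?_
    · rintro i t hf ⟨h66, hile, -⟩
      have := hf.reg 68 rfl
      rw [hsd2.n] at this
      simp [this, h66, hw0]
      omega
    · rintro i t hi hi' hf ⟨h66, -, hp⟩
      refine .straight ?_ rfl
      simp [h66, hw0]
      refine ⟨by omega, by omega, fun j hj => ?_⟩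
      rcases Nat.lt_or_eq_of_le hj with h | rfl
      · rw [Function.update_of_ne h.ne]
        exact hp j h
      · simp
    · change (2 * n - 1 - 0) * (14 + 7 + 1) + 7 + 1 ≤ 60 * n + 10
      omega
    · rintro t - ⟨-, -, hp⟩
      exact hp
  rintro s3 f3 hpar
  have hsd3 := hsd2.frame f3 rfl rfl
  refine Runs.seq (T := 4) (T' := 100 * n + F + 150)
    (R := fun t => t = (s3.setReg 50 n).setReg 60 0) (.straight (by simp [hsd3.n]) rfl) ?_
    (by omega)
  rintro s4 f4 hs4
  have hsd4 := hsd3.frame f4 rfl rfl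
  refine Runs.seq (T := F + 10) (T' := 100)
    (R := fun t => ∃ D, I.Decomposed D q ∧ HoldsPairs 4 5 (treePairs D q) t) ?_ ?_ (by omega)
  · refine Runs.forLoop (fun r t => t.reg 60 = r ∧ ∃ D, I.Decomposed D r ∧
      HoldsPairs 4 5 (treePairs D r) t) (300 * l ^ 2 + 90) 0 q _ (Nat.zero_le _)
      ⟨by rw [hs4]; simp, fun _ => ([], []), fun j hj h => by omega, ⟨?_, .nil _, .nil _⟩⟩
      ?_ ?_ ?_ ?_
    · rw [f4.reg 61 rfl, f3.reg 61 rfl, hs2]; simp [treePairs]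
    · rintro i t hf ⟨h60, -⟩
      have := hf.reg 69 rfl
      rw [hsd4.q, hq] at this
      simp [this, h60, hW1]
    · rintro r t - hr hf ⟨h60, D, hD, hp⟩
      have hrl : r < I.bicliques.length := by omega
      have hne := I.nonempty _ (List.getElem_mem hrl)
      have hsd5 := hsd4.frame hf rfl rfl
      have h50 : t.reg 50 = n := by rw [hf.reg 50 rfl, hs4]; simp
      have h67 : t.reg 67 = 1 := by
        rw [hf.reg 67 rfl, f4.reg 67 rfl, f3.reg 67 rfl, f2.reg 67 rfl, f1.reg 67 rfl, hs0]; simp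
      have hAl : (treePairs D r).length ≤ q * (2 * l) ^ 2 := by
        have h1 := length_treePairs_le (hD.length_le hrl.le)
        rw [← hl] at h1
        exact h1.trans (Nat.mul_le_mul_right _ hr.le)
      obtain ⟨A, hA⟩ : ∃ A, A = treePairs D r := ⟨_, rfl⟩
      rw [← hA] at hp hAl
      -- Two decompositions and at most 2l emissions of at most 2l pairs each; since l ≥ 2, the term
      -- 300 l² absorbs the lower ones.
      have hs1 : 240 * l + 2 * l * (48 * l + 30) + 120 ≤ 300 * l ^ 2 + 90 := by nlinarith
      refine Runs.seq (T' := 120 * l + 2 * l * (48 * l + 30) + 110) (decomposeSide_runs h60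
        (hsd5.a r hrl) (hsd5.b r hrl) (Fin.le_def.1 hne.1) (Fin.is_lt _) h50 (by omega)) ?_
        (by rw [← hl]; omega)
      rintro t1 k1 ⟨D₁, hD₁, e56, hst₁⟩
      have hsd6 := hsd5.frame k1 rfl rfl
      have hD₁l := hD₁.length_le
      rw [← hl] at hD₁l
      have i60 : t1.reg 60 = r := by rw [k1.reg 60 rfl, h60]
      refine Runs.seq (T := 2) (T' := 120 * l + 2 * l * (48 * l + 30) + 108)
        (R := fun u => u = t1.setReg 64 D₁.length) (.straight (by simp [e56]) rfl) ?_ (by omega)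
      rintro t2 k2 ht2
      have hsd7 := hsd6.frame k2 rfl rfl
      have j60 : t2.reg 60 = r := by rw [k2.reg 60 rfl, i60]
      have j50 : t2.reg 50 = n := by rw [k2.reg 50 rfl, k1.reg 50 rfl, h50]
      refine Runs.seq (T' := 2 * l * (48 * l + 30) + 60) (decomposeSide_runs j60
        (hsd7.c r hrl) (hsd7.d r hrl) (Fin.le_def.1 hne.2) (Fin.is_lt _) j50 (by omega)) ?_
        (by rw [← hl]; omega)
      rintro t3 k3 ⟨D₂, hD₂, g56, hst₂⟩
      have hD₂l := hD₂.length_le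
      rw [← hl] at hD₂l
      refine Runs.seq (T' := 10) (emitProducts_runs (l := l) (((hp.frame k1 rfl rfl rfl).frame k2
        rfl rfl rfl).frame k3 rfl rfl rfl)
        (by rw [k3.reg 67 rfl, k2.reg 67 rfl, k1.reg 67 rfl, h67])
        (by rw [k3.reg 64 rfl, ht2]; simp)
        (by rw [k3.arr 35 rfl, k2.arr 35 rfl]; exact hst₁) g56 hst₂ hD₁l hD₂l
        (fun y hy => by have := hD₁.lt y hy; omega) (fun y hy => by have := hD₂.lt y hy; omega)
        (by omega)) ?_ (by omega)
      rintro t5 k5 hp5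
      rw [hA, ← treePairs_succ] at hp5
      have m60 : t5.reg 60 = r := by rw [k5.reg 60 rfl, k3.reg 60 rfl, j60]
      refine .straight ?_ rfl
      simp [m60, hw0]
      exact ⟨by omega, _, hD.succ hrl hD₁ hD₂, by simpa using hp5.len, hp5.fst, hp5.snd⟩
    · have aux : ∀ g, q * (300 * g + 90 + 3 + 1) + 3 + 1 ≤ q * (300 * g + 100) + 10 := by
        intro g; nlinarith
      rw [hF]
      exact aux _
    · rintro t - ⟨-, h⟩
      exact h
  rintro s5 f5 ⟨D, hD, hp5⟩
  have hsd5 := hsd4.frame f5 rfl rfl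
  have h1 : s5.arr 1 = s1.arr 1 := by rw [f5.arr 1 rfl, f4.arr 1 rfl, f3.arr 1 rfl, f2.arr 1 rfl]
  have h0 : s5.arr 0 = s3.arr 0 := by rw [f5.arr 0 rfl, f4.arr 0 rfl]
  refine .straight ?_ (Nat.ble_eq_true_of_le (show _ ≤ 100 from Nat.le_of_ble_eq_true rfl))
  have hlen := hp5.len
  simp [hsd5.n, hlen, hw0]
  refine ⟨by omega, D, hD, ?_⟩
  intro k hk
  simp only [List.length_cons, List.length_nil] at hk
  interval_cases k
  · refine ⟨by simp, fun j hj => ?_⟩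
    have hj : j < 2 * n - 1 := by simpa using hj
    simpa [h0] using hpar j hj
  · refine ⟨by simp, fun j hj => ?_⟩
    have hj : j < n := by simpa using hj
    have := hsink ⟨j, hj⟩
    simp [h1]
    simpa using this
  · exact ⟨by simp, fun j hj => by simp at hj⟩
  · exact ⟨by simp, fun j hj => by simp at hj⟩
  · exact ⟨by simp, fun j hj => hp5.fst.get j hj⟩
  · exact ⟨by simp, fun j hj => hp5.snd.get j hj⟩

/-! ### Composition of the programs and final bounds. -/

theorem Runs.outputs {w T : ℕ} {P : Prog} {X : List (List ℕ)} {Q : List (List ℕ) → Prop}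
    (h : Runs w P (State.init X) T fun s => ∃ Y, s.Holds Y ∧ Q Y) :
    ∃ Y t, P.Outputs w X Y t ∧ t ≤ T ∧ Q Y := by
  obtain ⟨s, t, he, ht, Y, hY, hQ⟩ := h
  exact ⟨Y, t, ⟨s, he, hY⟩, ht, hQ⟩

section

variable {n m w : ℕ} (M : SignedTreeModel (Fin n) (Fin m))

theorem SignedTreeModel.numPairs_le_mul_log : M.numPairs ≤ M.numPairs * Nat.log 2 n := by
  rcases Nat.eq_zero_or_pos M.numPairs with h | h
  · simp [h]
  · exact Nat.le_mul_of_pos_right _ (Nat.log_pos (by norm_num) (M.two_le h))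

theorem SignedTreeModel.numPairs_mul_log_le :
    M.numPairs * Nat.log 2 n ≤ M.numPairs * Nat.log 2 n ^ 2 :=
  Nat.mul_le_mul_left _ (Nat.le_self_pow two_ne_zero _)

/-- Costs are counted with the integer part of the logarithm, which is at most the real one. -/
theorem cast_numPairs_mul_log_le (p : ℕ) : (↑(p * Nat.log 2 n) : ℝ) ≤ p * Real.logb 2 n := by
  push_cast
  gcongr
  exact Real.natLog_le_logb n 2

theorem cast_numPairs_mul_log_sq_le (p : ℕ) :
    (↑(p * Nat.log 2 n ^ 2) : ℝ) ≤ p * Real.logb 2 n ^ 2 := by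
  push_cast
  gcongr
  exact Real.natLog_le_logb n 2

theorem exists_intervalBicliquePartition_outputs {X : List (List ℕ)} (hX : M.IsCode X)
    (hW : (n + 1) ^ 20 ≤ 2 ^ w) :
    ∃ Y t, partitionProg.Outputs w X Y t ∧ t ≤ 4000 * (n + M.numPairs * Nat.log 2 n) ∧
      ∃ I : IntervalBicliquePartition (n := n) M.graph, I.IsCode Y ∧
        I.bicliques.length ≤ 4 * M.numPairs :=
  Runs.outputs ((partitionProg_runs hX (M.word_bound hW)).mono le_rfl
    fun _ _ ⟨I, Y, hI, hs, hq⟩ => ⟨Y, hs, I, hI, hq⟩)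

theorem word_bound_of_length_le {q : ℕ} (hq : q ≤ 4 * M.numPairs)
    (hW : (n + 1) ^ 20 ≤ 2 ^ w) : 200 * ((n + 1) ^ 2 * (q + 1)) < 2 ^ w := by
  refine lt_of_le_of_lt ?_ (M.word_bound hW)
  have h : (n + 1) ^ 2 * (q + 1) ≤ (n + 1) ^ 3 * (5 * (M.numPairs + 1)) :=
    Nat.mul_le_mul (Nat.pow_le_pow_right (by omega) (by norm_num)) (by omega)
  linarith

theorem exists_dagCompression_outputs {X : List (List ℕ)} (hX : M.IsCode X)
    (hW : (n + 1) ^ 20 ≤ 2 ^ w) :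
    ∃ Y t, (Prog.seq partitionProg dagProg).Outputs w X Y t ∧
      t ≤ 10000 * (n + M.numPairs * Nat.log 2 n) ∧
      ∃ (k : ℕ) (D : DAGCompression M.graph (Fin k)), D.IsCode Y ∧
        D.size ≤ 10000 * (n + M.numPairs * Nat.log 2 n) := by
  have hn := M.pos_card
  have h1 := M.numPairs_le_mul_log
  refine Runs.outputs (Runs.seq (T' := 200 * n + 4 * M.numPairs * (340 * (Nat.log 2 n + 2) + 300)
    + 200) (partitionProg_runs hX (M.word_bound hW)) ?_ ?_)
  · rintro s - ⟨I, Y, hI, hs, hq⟩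
    refine (dagProg_runs hn hI hs rfl (word_bound_of_length_le M hq hW)).mono
      (by have := Nat.mul_le_mul_right (340 * (Nat.log 2 n + 2) + 300) hq; omega) ?_
    rintro s' - ⟨D, hD, hs'⟩
    obtain ⟨C, hC, hsize⟩ := exists_dagCompression hn I rfl hD
    refine ⟨_, hs', _, C, hC, ?_⟩
    have h2 := length_dagArcs_le (n := n) (hD.length_le le_rfl)
    have h3 : I.bicliques.length * (2 * (Nat.log 2 n + 2)) ≤
        4 * M.numPairs * (2 * (Nat.log 2 n + 2)) := by gcongr
    have h4 : 4 * M.numPairs * (2 * (Nat.log 2 n + 2)) =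
        8 * (M.numPairs * Nat.log 2 n) + 16 * M.numPairs := by ring
    omega
  -- The coefficients 4000, 1360 and 3920 of p log n add up to less than 10000; the last one uses p
  -- ≤ p log n.
  · have h4 : 4 * M.numPairs * (340 * (Nat.log 2 n + 2) + 300) =
        1360 * (M.numPairs * Nat.log 2 n) + 3920 * M.numPairs := by ring
    omega

theorem exists_positiveTreeModel_outputs {X : List (List ℕ)} (hX : M.IsCode X)
    (hW : (n + 1) ^ 20 ≤ 2 ^ w) :
    ∃ Y t, (Prog.seq partitionProg treeProg).Outputs w X Y t ∧
      t ≤ 20000 * (n + M.numPairs * Nat.log 2 n + M.numPairs * Nat.log 2 n ^ 2) ∧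
      ∃ (k : ℕ) (M' : SignedTreeModel (Fin n) (Fin k)), M'.IsPositive ∧ M'.graph = M.graph ∧
        M'.IsCode Y ∧ M'.pos.card ≤ 20000 * (M.numPairs * Nat.log 2 n ^ 2) := by
  have hn := M.pos_card
  have h1 := M.numPairs_le_mul_log
  have h1' := M.numPairs_mul_log_le
  refine Runs.outputs (Runs.seq (T' := 200 * n + 4 * M.numPairs * (300 * (Nat.log 2 n + 2) ^ 2
    + 200) + 200) (partitionProg_runs hX (M.word_bound hW)) ?_ ?_)
  · rintro s - ⟨I, Y, hI, hs, hq⟩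
    refine (treeProg_runs hn hI hs rfl (word_bound_of_length_le M hq hW)).mono
      (by have := Nat.mul_le_mul_right (300 * (Nat.log 2 n + 2) ^ 2 + 200) hq; omega) ?_
    rintro s' - ⟨D, hD, hs'⟩
    obtain ⟨M', hp, hG, hC, hcard⟩ := exists_positiveTreeModel hn I rfl hD
    refine ⟨_, hs', _, M', hp, hG, hC, ?_⟩
    have h2 := length_treePairs_le (hD.length_le le_rfl)
    have h3 : I.bicliques.length * (2 * (Nat.log 2 n + 2)) ^ 2 ≤
        4 * M.numPairs * (2 * (Nat.log 2 n + 2)) ^ 2 := by gcongr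
    -- The lower terms are absorbed by p ≤ p log n ≤ p log² n, which also holds for n = 1 because
    -- then p = 0.
    have h4 : 4 * M.numPairs * (2 * (Nat.log 2 n + 2)) ^ 2 =
        16 * (M.numPairs * Nat.log 2 n ^ 2) + 64 * (M.numPairs * Nat.log 2 n) +
          64 * M.numPairs := by ring
    omega
  · have h4 : 4 * M.numPairs * (300 * (Nat.log 2 n + 2) ^ 2 + 200) =
        1200 * (M.numPairs * Nat.log 2 n ^ 2) + 4800 * (M.numPairs * Nat.log 2 n) +
          5600 * M.numPairs := by ring
    omega

end

end TreeModels

theorem theorem1 :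
    -- interval biclique partition
    (∃ (P : TreeModels.Prog) (c C : ℕ),
      ∀ (n m : ℕ) (M : TreeModels.SignedTreeModel (Fin n) (Fin m)) (X : List (List ℕ)) (w : ℕ),
        M.IsCode X → (n + 1) ^ c ≤ 2 ^ w →
        ∃ (Y : List (List ℕ)) (t : ℕ), P.Outputs w X Y t ∧
          (t : ℝ) ≤ C * (n + M.numPairs * Real.logb 2 n) ∧
          ∃ I : TreeModels.IntervalBicliquePartition (n := n) M.graph,
            I.IsCode Y ∧ I.bicliques.length ≤ C * M.numPairs) ∧
    -- DAG compression
    (∃ (P : TreeModels.Prog) (c C : ℕ),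
      ∀ (n m : ℕ) (M : TreeModels.SignedTreeModel (Fin n) (Fin m)) (X : List (List ℕ)) (w : ℕ),
        M.IsCode X → (n + 1) ^ c ≤ 2 ^ w →
        ∃ (Y : List (List ℕ)) (t : ℕ), P.Outputs w X Y t ∧
          (t : ℝ) ≤ C * (n + M.numPairs * Real.logb 2 n) ∧
          ∃ (k : ℕ) (D : TreeModels.DAGCompression M.graph (Fin k)),
            D.IsCode Y ∧ (D.size : ℝ) ≤ C * (n + M.numPairs * Real.logb 2 n)) ∧
    -- positive tree model
    (∃ (P : TreeModels.Prog) (c C : ℕ),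
      ∀ (n m : ℕ) (M : TreeModels.SignedTreeModel (Fin n) (Fin m)) (X : List (List ℕ)) (w : ℕ),
        M.IsCode X → (n + 1) ^ c ≤ 2 ^ w →
        ∃ (Y : List (List ℕ)) (t : ℕ), P.Outputs w X Y t ∧
          (t : ℝ) ≤ C * (n + M.numPairs * Real.logb 2 n + M.numPairs * Real.logb 2 n ^ 2) ∧
          ∃ (k : ℕ) (M' : TreeModels.SignedTreeModel (Fin n) (Fin k)),
            M'.IsPositive ∧ M'.graph = M.graph ∧ M'.IsCode Y ∧
            (M'.pos.card : ℝ) ≤ C * (M.numPairs * Real.logb 2 n ^ 2)) := by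
  refine ⟨⟨TreeModels.partitionProg, 20, 4000, fun n m M X w hX hW => ?_⟩,
    ⟨.seq TreeModels.partitionProg TreeModels.dagProg, 20, 10000, fun n m M X w hX hW => ?_⟩,
    ⟨.seq TreeModels.partitionProg TreeModels.treeProg, 20, 20000, fun n m M X w hX hW => ?_⟩⟩
  · obtain ⟨Y, t, hY, ht, I, hI, hq⟩ :=
      TreeModels.exists_intervalBicliquePartition_outputs M hX hW
    refine ⟨Y, t, hY, ?_, I, hI, by omega⟩
    calc (t : ℝ) ≤ (4000 : ℕ) * (n + ↑(M.numPairs * Nat.log 2 n)) := by exact_mod_cast ht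
      _ ≤ _ := by gcongr; exact TreeModels.cast_numPairs_mul_log_le _
  · obtain ⟨Y, t, hY, ht, k, D, hD, hs⟩ := TreeModels.exists_dagCompression_outputs M hX hW
    refine ⟨Y, t, hY, ?_, k, D, hD, ?_⟩
    · calc (t : ℝ) ≤ (10000 : ℕ) * (n + ↑(M.numPairs * Nat.log 2 n)) := by exact_mod_cast ht
        _ ≤ _ := by gcongr; exact TreeModels.cast_numPairs_mul_log_le _
    · calc (D.size : ℝ) ≤ (10000 : ℕ) * (n + ↑(M.numPairs * Nat.log 2 n)) := by exact_mod_cast hs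
        _ ≤ _ := by gcongr; exact TreeModels.cast_numPairs_mul_log_le _
  · obtain ⟨Y, t, hY, ht, k, M', hp, hG, hC, hs⟩ :=
      TreeModels.exists_positiveTreeModel_outputs M hX hW
    refine ⟨Y, t, hY, ?_, k, M', hp, hG, hC, ?_⟩
    · calc (t : ℝ) ≤ (20000 : ℕ) * (n + ↑(M.numPairs * Nat.log 2 n) +
            ↑(M.numPairs * Nat.log 2 n ^ 2)) := by exact_mod_cast ht
        _ ≤ _ := by
          gcongr
          · exact TreeModels.cast_numPairs_mul_log_le _
          · exact TreeModels.cast_numPairs_mul_log_sq_le _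
    · calc (M'.pos.card : ℝ) ≤ (20000 : ℕ) * ↑(M.numPairs * Nat.log 2 n ^ 2) := by
            exact_mod_cast hs
        _ ≤ _ := by gcongr; exact TreeModels.cast_numPairs_mul_log_sq_le _
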